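/- **Setting.** Let $d\ge 1$, $J\ge 0$. The *linear part* consists of matrices $L(k)$ on $\mathbb C^{2J}$ ($k\in\mathbb R^d$), real functions $\omega_{n,\zeta}(k)$ and vectors $g_{n,\zeta}(k)\in\mathbb C^{2J}$ ($n=1,\dots,J$, $\zeta=\pm$); write $\omega_n=\omega_{n,+}$. The band-crossing set $\sigma_{bc}$ is the set of $k$ at which $\omega_{n+1,\zeta}(k)=\omega_{n,\zeta}(k)$ for some $n,\zeta$, or $\omega_{1,\zeta}(k)=0$ for some $\zeta$, or $L$ is not continuous. Assume: every $L(k)$ is Hermitian; for $k\notin\sigma_{bc}$, $L(k)g_{n,\zeta}(k)=\omega_{n,\zeta}(k)g_{n,\zeta}(k)$, $|g_{n,\zeta}(k)|=1$, $\omega_{J,-}\le\dots\le\omega_{1,-}\le 0\le\omega_{1,+}\le\dots\le\omega_{J,+}$ at $k$, and $\omega_{n,-\zeta}(-k)=-\omega_{n,\zeta}(k)$; $\omega_{n,\zeta}$ is continuous and $L$ is $C^\infty$ off $\sigma_{bc}$; $\sigma_{bc}$ is closed, nowhere dense and of Lebesgue measure $0$; and $\|L(k)\|\le c(1+|k|^p)$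 for some $c,p>0$. Let $\Pi_{n,\zeta}(k)$ be the orthogonal projection onto $\mathbb C g_{n,\zeta}(k)$. The *nonlinearity* is $$\hat F(U)(k)=\sum_{m\in\mathfrak M}(2\pi)^{-(m-1)d}\int_{k'+\dots+k^{(m)}=k}\chi^{(m)}(k,k',\dots,k^{(m)})\bigl(U(k'),\dots,U(k^{(m)})\bigr)\,dk'\cdots dk^{(m-1)},$$ with $\mathfrak M\subset\{2,3,\dots\}$ finite and $\chi^{(m)}$ an $m$-linear-map-valued function, smooth and bounded when none of $k,k',\dots,k^{(m)}$ lies in $\sigma_{bc}$. For $\varrho>0$ a *solution* on $[0,T]$ with data $\hat h$ is a $\hat u\in C([0,T];L^1(\mathbb R^d;\mathbb C^{2J}))$ with $$\hat u(\tau)=\hat h+\int_0^\tau e^{\frac{i\tau'}{\varrho}L}\hat F\bigl(e^{-\frac{i\tau'}{\varrho}L}\hat u(\tau')\bigr)d\tau',$$ and the corresponding solution of the original modal equation $\partial_\tau\hat U=-\frac{i}{\varrho}L\hat U+\hat F(\hat U)$ is $\hat U(\tau,k)=e^{-\frac{i\tau}{\varrho}L(k)}\hat u(\tau,k)$. **Spectra.**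 An *nk-spectrum* is a family $S=\{(n_l,k_{*l})\}_{l=1}^N$ of distinct pairs, with $\pm k_{*l}\notin\sigma_{bc}$, such that no point $\varkappa_m(\lambda)=\sum_j\zeta^{(j)}k_{*l_j}$, where $m\in\mathfrak M$ and $\lambda=((\zeta^{(j)},l_j))_{j=1}^m$, $\zeta^{(j)}=\pm1$, lies in $\sigma_{bc}$. A tuple $(m,\zeta,n,\lambda)$ with $m\in\mathfrak M$ is *resonant* if $-\zeta\omega_n(\zeta\varkappa_m(\lambda))+\sum_j\zeta^{(j)}\omega_{n_{l_j}}(k_{*l_j})=0$. A resonant tuple is *internal* if $(n,\zeta\varkappa_m(\lambda))\in S$, and *universal* if, with $\delta_l=\sum_{j:\,l_j=l}\zeta^{(j)}$, there is an index $I$ with $\delta_I=\zeta$, $\delta_l=0$ for $l\ne I$, and $n=n_I$. $S$ is *universally resonance invariant* if $(n,\zeta\varkappa_m(\lambda))\in S$ for every resonant tuple, and the internal resonant tuples are exactly the universal ones. **Wavepackets.** Fix a smooth cutoff $\Psi\ge0$ on $\mathbb R^d$, equal to $1$ for $|\eta|\le\frac12$ and to $0$ for $|\eta|\ge1$, and put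 $\Psi(b,k_*;k)=\Psi(b^{-1}(k-k_*))$. Families below depend on $\beta$ and on a parameter $\vec r=(r_{*1},\dots,r_{*N})\in(\mathbb R^d)^N$; all constants, including $\beta_0$, are independent of $\beta$ and $\vec r$. A family $\hat h(\beta,\vec r;\cdot)\in L^1$ is a *particle-like wavepacket* with nk-pair $(n,k_*)$, regularity $s$, parameter $\epsilon$ and position $r(\beta,\vec r)$ if for some $\beta_0>0$ and all $0<\beta<\beta_0$: $\|\hat h\|_{L^1}\le C$; $\hat h=\hat h_-+\hat h_++D$ with $\|D\|_{L^1}\le C'\beta^s$ and $\hat h_\zeta\in L^1$, $\hat h_\zeta=\Psi(\tfrac12\beta^{1-\epsilon},\zeta k_*;\cdot)\,\Pi_{n,\zeta}\hat h_\zeta$ a.e.; and $e^{i r\cdot k}\hat h_\zeta(k)$ has a weak gradient in $L^1$ with $\|\nabla_k(e^{ir\cdot k}\hat h_\zeta)\|_{L^1}\le C_1\beta^{-1-\epsilon}$, $\zeta=\pm$. A *multi-particle wavepacket* with nk-spectrum $S$ and positions $r_l$ is, for small $\beta$, a sum over $l=1,\dots,N$ of particle-like wavepackets with nk-pairs $(n_l,k_{*l})$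 and positions $r_l$. **Statement.** For every system as above, every $N$ and every $R>0$ there is $T>0$, depending only on the system, $N$ and $R$, such that the following holds. Let $S=\{(n_l,k_{*l})\}_{l=1}^N$ be a universally resonance invariant nk-spectrum, $0<\epsilon<1$, $s,s_0>0$, and let $\varrho=\varrho(\beta)$ satisfy $$0<\varrho\le\tfrac12,\qquad \varrho\le C_0\beta^{s_0},\qquad \frac{\beta^2}{\varrho}\le C\qquad(0<\beta\le\tfrac12).$$ Let $\hat h=\hat h(\beta,\vec r;k)$ be a multi-particle wavepacket with nk-spectrum $S$, regularity $s$, parameter $\epsilon$ and positions $r_{*1},\dots,r_{*N}$, with $\|\hat h\|_{L^1}\le R$ for all small $\beta$ and all $\vec r$. Then for all small $\beta$ (uniformly in $\vec r$) the solution $\hat u$ on $[0,T]$ with data $\hat h(\beta,\vec r;\cdot)$ exists and is unique, and for every $\tau\in[0,T]$ and every $\epsilon'\in(\epsilon,1)$, $$\hat U(\tau,k)=e^{-\frac{i\tau}{\varrho}L(k)}\hat u(\tau,k)$$ is a multi-particle wavepacket with the same nk-spectrum $S$, regularity $s_1=\min(s,s_0)$, parameter $\epsilon'$ and positions $$r_{*l}+\frac{\tau}{\varrho}\nabla\omega_{n_l}(k_{*l}),\qquad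 l=1,\dots,N .$$ -/

import Mathlib

open MeasureTheory Set

open scoped ContDiff

namespace Wavepacket

/-- The space `ℝ^d` of wavevectors (and of positions). -/
abbrev Wave (d : ℕ) := EuclideanSpace ℝ (Fin d)

/-- The space `ℂ^{2J}` of amplitudes. -/
abbrev Amp (J : ℕ) := EuclideanSpace ℂ (Fin (2 * J))

/-- The sign `ζ = ±1` as a real number. -/
def sgn (ζ : ℤˣ) : ℝ := ((ζ : ℤ) : ℝ)

/-! ### Linear part -/

/-- The symbol `L(k)`, the dispersion relations `ω_{n,ζ}(k)` and the eigenvectors `g_{n,ζ}(k)`.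
The band number `n ∈ {1, …, J}` is represented by `n - 1 : Fin J`. -/
structure LinearPart (d J : ℕ) where
  L : Wave d → Amp J →L[ℂ] Amp J
  freq : Fin J → ℤˣ → Wave d → ℝ
  vec : Fin J → ℤˣ → Wave d → Amp J

namespace LinearPart

variable {d J : ℕ} (A : LinearPart d J)

/-- The set `σ_bc` of band-crossing points. -/
def bandCrossing : Set (Wave d) :=
  {k | (∃ ζ : ℤˣ, ∃ n n' : Fin J, (n' : ℕ) = n + 1 ∧ A.freq n' ζ k = A.freq n ζ k) ∨
    ¬ ContinuousAt A.L k ∨ ∃ ζ : ℤˣ, ∃ n : Fin J, (n : ℕ) = 0 ∧ A.freq n ζ k = 0}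

/-- The orthogonal projection `Π_{n,ζ}(k)` onto the complex line spanned by the unit vector
`g_{n,ζ}(k)`. -/
noncomputable def proj (n : Fin J) (ζ : ℤˣ) (k : Wave d) (v : Amp J) : Amp J :=
  (inner ℂ (A.vec n ζ k) v) • A.vec n ζ k

/-- The standing conditions on the linear part. -/
structure Admissible : Prop where
  hermitian : ∀ k, IsSelfAdjoint (A.L k)
  eigen : ∀ k ∉ A.bandCrossing, ∀ n ζ, A.L k (A.vec n ζ k) = (A.freq n ζ k : ℂ) • A.vec n ζ k
  unit : ∀ k ∉ A.bandCrossing, ∀ n ζ, ‖A.vec n ζ k‖ = 1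
  omega_pos : ∀ k ∉ A.bandCrossing, ∀ n, 0 ≤ A.freq n 1 k
  omega_neg : ∀ k ∉ A.bandCrossing, ∀ n, A.freq n (-1) k ≤ 0
  order_pos : ∀ k ∉ A.bandCrossing, ∀ n n', n ≤ n' → A.freq n 1 k ≤ A.freq n' 1 k
  order_neg : ∀ k ∉ A.bandCrossing, ∀ n n', n ≤ n' → A.freq n' (-1) k ≤ A.freq n (-1) k
  continuous_omega : ∀ n ζ, ContinuousOn (A.freq n ζ) A.bandCrossingᶜ
  symm : ∀ k ∉ A.bandCrossing, ∀ n ζ, A.freq n (-ζ) (-k) = -A.freq n ζ k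
  closed : IsClosed A.bandCrossing
  nowhereDense : IsNowhereDense A.bandCrossing
  null : volume A.bandCrossing = 0
  smooth : ContDiffOn ℝ ∞ A.L A.bandCrossingᶜ
  polyBound : ∃ C > (0 : ℝ), ∃ p > (0 : ℝ), ∀ k, ‖A.L k‖ ≤ C * (1 + ‖k‖ ^ p)

/-- The unitary factor `exp(-i t L(k))`. -/
noncomputable def propagator (t : ℝ) (k : Wave d) : Amp J →L[ℂ] Amp J :=
  NormedSpace.exp ((-(Complex.I * (t : ℂ))) • A.L k)

end LinearPart

/-! ### Nonlinear part -/

/-- A polynomial nonlinearity: the finite set `𝔐_F` of its degrees and the susceptibilities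
`χ^{(m)}(k, k', …, k^{(m)})`, which are `m`-linear maps from `(ℂ^{2J})^m` to `ℂ^{2J}`. -/
structure Nonlinearity (d J : ℕ) where
  M : Finset ℕ
  χ : (m : ℕ) → Wave d → (Fin m → Wave d) →
    ContinuousMultilinearMap ℂ (fun _ : Fin m => Amp J) (Amp J)

namespace Nonlinearity

variable {d J : ℕ} (B : Nonlinearity d J)

/-- The standing conditions on the nonlinearity: degrees at least two, susceptibilities smooth and
bounded away from the band-crossing points. -/
structure Admissible (A : LinearPart d J) : Prop where
  two_le : ∀ m ∈ B.M, 2 ≤ m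
  smooth : ∀ m ∈ B.M, ContDiffOn ℝ ∞
    (fun q : Wave d × (Fin m → Wave d) => B.χ m q.1 q.2)
    {q | q.1 ∉ A.bandCrossing ∧ ∀ j, q.2 j ∉ A.bandCrossing}
  bounded : ∃ C : ℝ, ∀ m ∈ B.M, ∀ (k : Wave d) (q : Fin m → Wave d),
    k ∉ A.bandCrossing → (∀ j, q j ∉ A.bandCrossing) → ‖B.χ m k q‖ ≤ C

/-- The vector `(k', …, k^{(m)})` with prescribed first `m - 1` entries and with
`k^{(m)} = k - k' - … - k^{(m-1)}`. -/
def convVec (m : ℕ) (k : Wave d) (q : Fin (m - 1) → Wave d) : Fin m → Wave d :=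
  fun j => if hj : (j : ℕ) < m - 1 then q ⟨j, hj⟩ else k - ∑ i, q i

/-- The operator `U ↦ F̂(U)` in Fourier form, a finite sum of convolution type integrals. -/
noncomputable def fourierOp (U : Wave d → Amp J) (k : Wave d) : Amp J :=
  ∑ m ∈ B.M, (((2 * Real.pi) ^ ((m - 1) * d))⁻¹ : ℝ) •
    ∫ q : Fin (m - 1) → Wave d, B.χ m k (convVec m k q) (fun j => U (convVec m k q j))

end Nonlinearity

/-! ### The modal evolution equation in the slow variable -/

section Evolution

variable {d J : ℕ}

/-- The integrand `exp(iτL/ϱ) F̂(exp(-iτL/ϱ) u)` of the integrated evolution equation. -/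
noncomputable def slowForce (A : LinearPart d J) (B : Nonlinearity d J) (ϱ τ : ℝ)
    (u : Wave d → Amp J) (k : Wave d) : Amp J :=
  A.propagator (-(τ / ϱ)) k (B.fourierOp (fun k' => A.propagator (τ / ϱ) k' (u k')) k)

/-- `u ∈ C([0,T], L¹)` solves `u(τ) = h + ∫₀^τ exp(iτ'L/ϱ) F̂(exp(-iτ'L/ϱ) u(τ')) dτ'` on `[0,T]`,
as an equation in `L¹`. The function `f` is the integrand viewed as an `L¹`-valued function. -/
def IsSolution (A : LinearPart d J) (B : Nonlinearity d J) (ϱ T : ℝ) (h : Wave d → Amp J)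
    (u : ℝ → (Wave d →₁[volume] Amp J)) : Prop :=
  ContinuousOn u (Icc 0 T) ∧ u 0 =ᵐ[volume] h ∧
    ∃ f : ℝ → (Wave d →₁[volume] Amp J),
      (∀ τ ∈ Icc 0 T, f τ =ᵐ[volume] slowForce A B ϱ τ (u τ)) ∧
      IntervalIntegrable f volume 0 T ∧
      ∀ τ ∈ Icc 0 T, u τ = u 0 + ∫ τ' in (0 : ℝ)..τ, f τ'

end Evolution

/-! ### Resonances -/

section Resonance

variable {d J N : ℕ}

/-- `ϰ_m(λ) = ∑_j ζ^{(j)} k_{*l_j}` for `λ = ((ζ^{(j)}, l_j))_j`. -/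
noncomputable def kappa (S : Fin N → Fin J × Wave d) {m : ℕ} (lam : Fin m → ℤˣ × Fin N) : Wave d :=
  ∑ j, sgn (lam j).1 • (S (lam j).2).2

/-- The output `k`-spectrum. -/
def outputK (M : Finset ℕ) (S : Fin N → Fin J × Wave d) : Set (Wave d) :=
  {k | ∃ m ∈ M, ∃ lam : Fin m → ℤˣ × Fin N, k = kappa S lam}

/-- The resonance equation for `(m, ζ, n, λ)`:
`-ζ ω_n(ζ ϰ_m(λ)) + ∑_j ζ^{(j)} ω_{n_{l_j}}(k_{*l_j}) = 0`. -/
def IsResonant (A : LinearPart d J) (S : Fin N → Fin J × Wave d) {m : ℕ} (ζ : ℤˣ) (n : Fin J)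
    (lam : Fin m → ℤˣ × Fin N) : Prop :=
  -(sgn ζ * A.freq n 1 (sgn ζ • kappa S lam)) +
    ∑ j, sgn (lam j).1 * A.freq (S (lam j).2).1 1 (S (lam j).2).2 = 0

/-- The solution `(m, ζ, n, λ)` of the resonance equation is `S`-internal. -/
def IsInternal (A : LinearPart d J) (S : Fin N → Fin J × Wave d) {m : ℕ} (ζ : ℤˣ) (n : Fin J)
    (lam : Fin m → ℤˣ × Fin N) : Prop :=
  IsResonant A S ζ n lam ∧ (n, sgn ζ • kappa S lam) ∈ range S

/-- The coefficient `δ_l`, the sum of the signs `ζ^{(j)}` over all `j` with `l_j = l`. -/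
def delta {m : ℕ} (lam : Fin m → ℤˣ × Fin N) (l : Fin N) : ℤ :=
  ∑ j, if (lam j).2 = l then ((lam j).1 : ℤ) else 0

/-- The solution `(m, ζ, n, λ)` of the resonance equation is universal. -/
def IsUniversal (A : LinearPart d J) (S : Fin N → Fin J × Wave d) {m : ℕ} (ζ : ℤˣ) (n : Fin J)
    (lam : Fin m → ℤˣ × Fin N) : Prop :=
  IsResonant A S ζ n lam ∧
    ∃ I₀ : Fin N, (delta lam I₀ = 1 ∨ delta lam I₀ = -1) ∧ (∀ l, l ≠ I₀ → delta lam l = 0) ∧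
      n = (S I₀).1 ∧ (ζ : ℤ) = delta lam I₀

/-- The resonant output spectrum of `S`. -/
def resonantOutput (A : LinearPart d J) (M : Finset ℕ) (S : Fin N → Fin J × Wave d) :
    Set (Fin J × Wave d) :=
  {p | p.2 ∈ outputK M S ∧ ∃ m ∈ M, ∃ (ζ : ℤˣ) (lam : Fin m → ℤˣ × Fin N),
    p.2 = sgn ζ • kappa S lam ∧ IsResonant A S ζ p.1 lam}

/-- The `nk`-spectrum `S` is universally resonance invariant: `R(S) = S` and the universal
solutions of the resonance equation are exactly the internal ones. -/
def UniversallyResonanceInvariant (A : LinearPart d J) (M : Finset ℕ)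
    (S : Fin N → Fin J × Wave d) : Prop :=
  range S ∪ resonantOutput A M S = range S ∧
    ∀ m ∈ M, ∀ (ζ : ℤˣ) (n : Fin J) (lam : Fin m → ℤˣ × Fin N),
      IsUniversal A S ζ n lam ↔ IsInternal A S ζ n lam

/-- An `nk`-spectrum: pairwise different pairs `(n_l, k_{*l})` such that neither the points
`±k_{*l}` nor the output `k`-spectrum meet the band-crossing set. -/
structure IsNKSpectrum (A : LinearPart d J) (M : Finset ℕ) (S : Fin N → Fin J × Wave d) :
    Prop where
  injective : Function.Injective S
  regular : ∀ l, (S l).2 ∉ A.bandCrossing ∧ -(S l).2 ∉ A.bandCrossing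
  output : outputK M S ∩ A.bandCrossing = ∅

end Resonance

/-! ### Wavepackets -/

section Wavepackets

variable {d J : ℕ}

/-- Cutoff functions: smooth, nonnegative, equal to `1` on `|η| ≤ 1/2` and to `0` on `|η| ≥ 1`. -/
structure IsCutoff (Ψ : Wave d → ℝ) : Prop where
  smooth : ContDiff ℝ ∞ Ψ
  nonneg : ∀ η, 0 ≤ Ψ η
  eq_one : ∀ η, ‖η‖ ≤ 1 / 2 → Ψ η = 1
  eq_zero : ∀ η, 1 ≤ ‖η‖ → Ψ η = 0

/-- The shifted and rescaled cutoff `Ψ(b, k_*; k) = Ψ(b⁻¹ (k - k_*))`. -/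
noncomputable def cutoff (Ψ : Wave d → ℝ) (b : ℝ) (kstar k : Wave d) : ℝ :=
  Ψ (b⁻¹ • (k - kstar))

/-- `G` is the weak gradient of `f`, both being integrable. -/
def HasWeakGradient (f : Wave d → Amp J) (G : Wave d → Wave d →L[ℝ] Amp J) : Prop :=
  Integrable f ∧ Integrable G ∧
    ∀ φ : Wave d → ℝ, ContDiff ℝ ∞ φ → HasCompactSupport φ → ∀ e : Wave d,
      ∫ k, φ k • G k e = -∫ k, (fderiv ℝ φ k e) • f k

/-- A particle-like wavepacket with `nk`-pair `(n, k_*)`, degree of regularity `s` and parameter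
`ε`. It is a family `h(β, p; k)`, where `p` runs through a parameter set `P`; the position
`r(β, p)` may depend on `p` and on `β`. All constants are uniform in `p`. -/
def IsParticleWavepacket {P : Type} (A : LinearPart d J) (Ψ : Wave d → ℝ) (ε s : ℝ)
    (nk : Fin J × Wave d) (pos : ℝ → P → Wave d) (h : ℝ → P → Wave d → Amp J) : Prop :=
  ∃ β₀ > (0 : ℝ), ∃ C C' C₁ : ℝ,
    ∃ (hc : ℤˣ → ℝ → P → Wave d → Amp J) (D : ℝ → P → Wave d → Amp J),
    ∀ β ∈ Ioo 0 β₀, ∀ p : P,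
      -- uniform boundedness in `L¹`
      Integrable (h β p) ∧ ∫ k, ‖h β p k‖ ≤ C ∧
      -- decomposition into two band components and a small remainder
      (∀ᵐ k, h β p k = hc (-1) β p k + hc 1 β p k + D β p k) ∧
      (∀ ζ : ℤˣ, Integrable (hc ζ β p) ∧
        ∀ᵐ k, hc ζ β p k =
          cutoff Ψ (β ^ (1 - ε) / 2) (sgn ζ • nk.2) k • A.proj nk.1 ζ k (hc ζ β p k)) ∧
      Integrable (D β p) ∧ ∫ k, ‖D β p k‖ ≤ C' * β ^ s ∧
      -- localization about the position
      ∀ ζ : ℤˣ, ∃ G : Wave d → Wave d →L[ℝ] Amp J,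
        HasWeakGradient
          (fun k => Complex.exp (Complex.I * (inner ℝ (pos β p) k : ℝ)) • hc ζ β p k) G ∧
        ∫ k, ‖G k‖ ≤ C₁ * β ^ (-1 - ε)

/-- A multi-particle wavepacket with `nk`-spectrum `S`: the sum of particle-like wavepackets with
`nk`-pairs `S l` and positions `pos l`. -/
def IsMultiParticleWavepacket {N : ℕ} {P : Type} (A : LinearPart d J) (Ψ : Wave d → ℝ) (ε s : ℝ)
    (S : Fin N → Fin J × Wave d) (pos : Fin N → ℝ → P → Wave d)
    (h : ℝ → P → Wave d → Amp J) : Prop :=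
  ∃ hl : Fin N → ℝ → P → Wave d → Amp J,
    (∀ l, IsParticleWavepacket A Ψ ε s (S l) (pos l) (hl l)) ∧
    ∃ β₀ > (0 : ℝ), ∀ β ∈ Ioo 0 β₀, ∀ p : P, ∀ᵐ k, h β p k = ∑ l, hl l β p k

end Wavepackets

end Wavepacket

set_option linter.unusedSectionVars false

noncomputable section

namespace Wavepacket

/-! ### Bounded operators between `L¹` spaces -/

section LiftL1

variable {α β E F : Type*} [MeasurableSpace α] [MeasurableSpace β] {μ : Measure α} {ν : Measure β}
  [NormedAddCommGroup E] [NormedSpace ℝ E] [NormedAddCommGroup F] [NormedSpace ℝ F]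

/-! The theorem is proved by time averaging, with the position of a packet encoded through
translations in k. Put b = β^(1-ε). The datum is, up to O(β^s), a sum of 2N components indexed by θ
= (ζ, l), each polarized in the band (n_l, ζ) and supported within b/2 of the centre ζ k_{*l}. For
the slow unknown û, an m-fold interaction of components λ projected onto a band (n, ζ) carries the
factor exp(i(τ/ϱ)φ), where φ = ω_{n,ζ}(∑k^{(j)}) − ∑ω_{n_j,ζ_j}(k^{(j)}). At the centres φ vanishes
exactly for resonant tuples (`phase_ctr`). A nonresonant term has |φ| bounded below near the
centres, so integration by parts in time makes it O(ϱ), hence O(β^{s₀}) (`norm_integral_oscSym_le`).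
By resonance invariance a resonant term produces a wave near one of the given centres and in its
band. Keeping only the resonant terms gives the averaged system `avgForce`, whose solution w has a
sum that stays close to û (`IsAveragedSolution.norm_sub_le`).

On a time interval independent of β, Picard iteration for the averaged system preserves three
properties of every component (`exists_averagedSolution`). The weighted norm with weight
exp(|k−c|/b), saturated far away, stays bounded, because this weight is submultiplicative along
convolutions (`norm_weightOp_avgForce_le`). The polarization is exact, because the kept symbols take
values in the band. Finally ‖exp(i r_l·y) w_θ(·+y) − w_θ‖ ≤ V|y| for |y| ≤ b, an L¹ form of a
gradient bound on exp(i r_l·k) w_θ that is closed under limits and needs only Lipschitz symbols.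

The third property is where universality enters. A universal resonance feeding the component θ has
an input j from the same packet l (`Feeds.exists_index`). A translation of the output can be charged
to that single input (`twistOp_symOp`), so the positions of the other packets never appear. Output
and input j have the same group velocity ∇ω_{n_l}(k_{*l}), whatever their signs, so the linear
change of φ cancels and only a change O(|y|(∑|x_j−c_j|+|y|)) remains (`phase_shift_le`). Multiplied
by τ/ϱ = O(β^{-2}), and with distances of order b paid for by the weight, it contributes
O(β^{-1-ε})|y|, which is the size allowed for a particle-like packet.

Returning to Û multiplies w_θ by exp(−i(τ/ϱ)ω). Subtracting the linear part (τ/ϱ)∇ω(k_*)·k of this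
phase moves the position by (τ/ϱ)∇ω(k_*), and the remaining phase has gradient O(a/ϱ) = O(β^{-1-ε'})
on the scale a = β^(1-ε')/8. Cutting off at scale a costs exp(−a/b), where a/b is a negative power
of β because ε' > ε. Mollification turns the translation bound into a weak gradient
(`exists_packet`). The lifetime depends only on bounds for χ, the degrees, N and R; the localization
radius δ, which depends on S, enters only the error constants. -/

/-- A map of functions which induces a bounded linear operator between `L¹` spaces. -/
structure IsL1Bounded (μ : Measure α) (ν : Measure β) (Φ : (α → E) → β → F) (C : ℝ) : Prop where
  congr : ∀ f g, f =ᵐ[μ] g → Φ f =ᵐ[ν] Φ g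
  integrable : ∀ f, Integrable f μ → Integrable (Φ f) ν
  add : ∀ f g, Integrable f μ → Integrable g μ → Φ (f + g) =ᵐ[ν] Φ f + Φ g
  smul : ∀ (c : ℝ) f, Integrable f μ → Φ (c • f) =ᵐ[ν] c • Φ f
  bound : ∀ f, Integrable f μ → ∫ x, ‖Φ f x‖ ∂ν ≤ C * ∫ x, ‖f x‖ ∂μ

theorem norm_toL1_eq_integral {f : α → E} (hf : Integrable f μ) :
    ‖hf.toL1 f‖ = ∫ x, ‖f x‖ ∂μ := by
  rw [L1.norm_eq_integral_norm]
  exact integral_congr_ae (hf.coeFn_toL1.mono fun x hx => congrArg norm hx)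

/-- The bounded operator on `L¹` induced by a map of functions. -/
noncomputable def liftL1 {Φ : (α → E) → β → F} {C : ℝ} (h : IsL1Bounded μ ν Φ C) :
    (α →₁[μ] E) →L[ℝ] (β →₁[ν] F) :=
  LinearMap.mkContinuous
    { toFun := fun f => (h.integrable f (L1.integrable_coeFn f)).toL1 (Φ f)
      map_add' := fun f g => by
        rw [← Integrable.toL1_add, Integrable.toL1_eq_toL1_iff]
        exact (h.congr _ _ (Lp.coeFn_add f g)).trans
          (h.add _ _ (L1.integrable_coeFn f) (L1.integrable_coeFn g))
      map_smul' := fun c f => by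
        simp only [RingHom.id_apply]
        rw [← Integrable.toL1_smul', Integrable.toL1_eq_toL1_iff]
        exact (h.congr _ _ (Lp.coeFn_smul c f)).trans (h.smul c _ (L1.integrable_coeFn f)) }
    C (fun f => by
      simp only [LinearMap.coe_mk, AddHom.coe_mk]
      rw [norm_toL1_eq_integral, L1.norm_eq_integral_norm]
      exact h.bound _ (L1.integrable_coeFn f))

theorem liftL1_coe {Φ : (α → E) → β → F} {C : ℝ} (h : IsL1Bounded μ ν Φ C) (f : α →₁[μ] E) :
    liftL1 h f =ᵐ[ν] Φ f :=
  Integrable.coeFn_toL1 (h.integrable f (L1.integrable_coeFn f))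

theorem norm_liftL1_le {Φ : (α → E) → β → F} {C : ℝ} (h : IsL1Bounded μ ν Φ C)
    (f : α →₁[μ] E) : ‖liftL1 h f‖ ≤ C * ‖f‖ := by
  rw [L1.norm_eq_integral_norm, L1.norm_eq_integral_norm,
    integral_congr_ae ((liftL1_coe h f).mono fun x hx => congrArg norm hx)]
  exact h.bound _ (L1.integrable_coeFn f)

end LiftL1

/-! ### Fibre integrals -/

section Fiber

variable {d : ℕ} {m : ℕ} {E : Type*} [NormedAddCommGroup E] [NormedSpace ℝ E]

namespace Nonlinearity

theorem convVec_succ (n : ℕ) (k : Wave d) (q : Fin n → Wave d) :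
    convVec (n + 1) k q = Fin.insertNth (α := fun _ => Wave d) (Fin.last n) (k - ∑ i, q i) q := by
  funext j
  refine Fin.lastCases ?_ (fun i => ?_) j
  · simp [convVec]
  · simp [convVec]

theorem sum_convVec (hm : 1 ≤ m) (k : Wave d) (q : Fin (m - 1) → Wave d) :
    ∑ j, convVec m k q j = k := by
  obtain ⟨n, rfl⟩ : ∃ n, m = n + 1 := ⟨m - 1, by omega⟩
  rw [convVec_succ, Fin.sum_univ_castSucc]
  simp

/-- The map is a shear, (k, q) ↦ (q, k − ∑q), followed by a permutation of coordinates, and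
translations preserve Lebesgue measure. With Fubini this reduces every convolution to an integral
over all of (ℝ^d)^m. -/
theorem measurePreserving_convVec (hm : 1 ≤ m) :
    MeasurePreserving (fun p : Wave d × (Fin (m - 1) → Wave d) => convVec m p.1 p.2)
      (volume.prod volume) volume := by
  obtain ⟨n, rfl⟩ : ∃ n, m = n + 1 := ⟨m - 1, by omega⟩
  have h1 : MeasurePreserving (fun p : (Fin n → Wave d) × Wave d => (p.1, p.2 - ∑ i, p.1 i))
      (volume.prod volume) (volume.prod volume) := by
    refine MeasurePreserving.skew_product (g := fun (q : Fin n → Wave d) (x : Wave d) => x - ∑ i, q i)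
      (MeasurePreserving.id volume) (by fun_prop) ?_
    exact Filter.Eventually.of_forall fun q =>
      (measurePreserving_sub_right volume (∑ i, q i)).map_eq
  have h2 := (Measure.measurePreserving_swap (μ := (volume : Measure (Fin n → Wave d)))
    (ν := (volume : Measure (Wave d)))).comp
    (h1.comp (Measure.measurePreserving_swap (μ := (volume : Measure (Wave d)))
      (ν := (volume : Measure (Fin n → Wave d)))))
  have h3 := ((volume_preserving_piFinSuccAbove (fun _ : Fin (n + 1) => Wave d)
    (Fin.last n)).symm).comp h2
  have heq : (fun p : Wave d × (Fin (n + 1 - 1) → Wave d) => convVec (n + 1) p.1 p.2) =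
      (MeasurableEquiv.piFinSuccAbove (fun _ => Wave d) (Fin.last n)).symm ∘
        (Prod.swap ∘ (fun p : (Fin n → Wave d) × Wave d => (p.1, p.2 - ∑ i, p.1 i)) ∘
          Prod.swap) := by
    funext p
    rw [convVec_succ]
    rfl
  rw [heq]
  exact h3

/-- A shift of the output can be charged to any one argument. The last argument k − ∑q absorbs it
directly; for another slot the free variable moves together with k, so the last argument is
unchanged. This freedom of choice is what universality exploits later. -/
theorem convVec_add_single (hm : 1 ≤ m) (j : Fin m) (y : Wave d) :
    (∀ k q, convVec m (k + y) q = convVec m k q + Pi.single j y) ∨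
      ∃ i : Fin (m - 1), ∀ k q, convVec m (k + y) (q + Pi.single i y) =
        convVec m k q + Pi.single j y := by
  obtain ⟨n, rfl⟩ : ∃ n, m = n + 1 := ⟨m - 1, by omega⟩
  refine Fin.lastCases ?_ (fun i => ?_) j
  · left
    intro k q
    funext l
    refine Fin.lastCases ?_ (fun i => ?_) l
    · simp [convVec, add_sub_right_comm]
    · simp [convVec, Fin.ext_iff, i.2.ne]
  · right
    refine ⟨i, fun k (q : Fin n → Wave d) => ?_⟩
    change convVec (n + 1) (k + y) (q + Pi.single i y : Fin n → Wave d) = _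
    funext l
    refine Fin.lastCases ?_ (fun l => ?_) l
    · have : ∑ x, (q + Pi.single i y : Fin n → Wave d) x = (∑ x, q x) + y := by
        simp [Finset.sum_add_distrib]
      have h2 : (Fin.last n) ≠ i.castSucc := (Fin.castSucc_lt_last i).ne'
      simp only [convVec, Fin.val_last, Nat.add_sub_cancel, lt_irrefl, dite_false, Pi.add_apply,
        Pi.single_eq_of_ne h2, add_zero]
      refine (congrArg (k + y - ·) this).trans ?_
      change k + y - (∑ x, q x + y) = k - ∑ x, q x
      abel
    · by_cases h : l = i
      · subst h; simp [convVec]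
      · have h2 : l.castSucc ≠ i.castSucc := fun hh => h (Fin.castSucc_injective _ hh)
        simp only [convVec, Fin.val_castSucc, Nat.add_sub_cancel, l.2, dite_true, Pi.add_apply,
          Pi.single_eq_of_ne h2, add_zero]
        exact (by simp [Pi.single_eq_of_ne h] :
          (q + Pi.single i y : Fin n → Wave d) l = q l)

end Nonlinearity

open Nonlinearity

/-- The integral of `G` over the fibre `k' + … + k^{(m)} = k`. -/
noncomputable def fiberIntegral (G : (Fin m → Wave d) → E) (k : Wave d) : E :=
  ∫ q, G (convVec m k q)

theorem fiberIntegral_congr (hm : 1 ≤ m) {G G' : (Fin m → Wave d) → E} (h : G =ᵐ[volume] G') :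
    fiberIntegral G =ᵐ[volume] fiberIntegral G' := by
  have h1 := (measurePreserving_convVec (d := d) hm).quasiMeasurePreserving.ae h
  exact (Measure.ae_ae_of_ae_prod h1).mono fun k hk => integral_congr_ae hk

theorem fiberIntegral_add_right (hm : 1 ≤ m) (G : (Fin m → Wave d) → E) (j : Fin m)
    (k y : Wave d) :
    fiberIntegral G (k + y) = fiberIntegral (fun x => G (x + Pi.single j y)) k := by
  unfold fiberIntegral
  rcases convVec_add_single hm j y with h | ⟨i, h⟩
  · simp_rw [h]
  -- When the shifted slot is a free variable, translation invariance of the measure in q removes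
  -- the shift of q.
  · simp_rw [← h]
    exact (integral_add_right_eq_self (fun q => G (convVec m (k + y) q)) (Pi.single i y)).symm

theorem integrable_comp_convVec (hm : 1 ≤ m) {G : (Fin m → Wave d) → E} (hG : Integrable G) :
    Integrable (fun p : Wave d × (Fin (m - 1) → Wave d) => G (convVec m p.1 p.2))
      (volume.prod volume) :=
  (measurePreserving_convVec hm).integrable_comp_of_integrable hG

theorem isL1Bounded_fiberIntegral (hm : 1 ≤ m) :
    IsL1Bounded volume volume (fiberIntegral (E := E) (d := d) (m := m)) 1 where
  congr f g h := fiberIntegral_congr hm h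
  integrable f hf := (integrable_comp_convVec hm hf).integral_prod_left
  add f g hf hg := by
    filter_upwards [(integrable_comp_convVec hm hf).prod_right_ae,
      (integrable_comp_convVec hm hg).prod_right_ae] with k hk hk'
    exact integral_add hk hk'
  smul c f _ := Filter.Eventually.of_forall fun k => integral_smul c _
  bound f hf := by
    have h1 := (integrable_comp_convVec hm hf)
    rw [one_mul]
    calc ∫ k, ‖fiberIntegral f k‖ ≤ ∫ k, ∫ q, ‖f (convVec m k q)‖ :=
          integral_mono h1.integral_prod_left.norm h1.norm.integral_prod_left
            fun k => norm_integral_le_integral_norm _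
      _ = ∫ p : Wave d × (Fin (m - 1) → Wave d), ‖f (convVec m p.1 p.2)‖
            ∂(volume.prod volume) := (integral_prod _ h1.norm).symm
      _ = ∫ x, ‖f x‖ := by
          have := (measurePreserving_convVec (d := d) hm)
          rw [← this.map_eq, integral_map this.measurable.aemeasurable]
          rw [this.map_eq]
          exact hf.norm.aestronglyMeasurable

end Fiber
end Wavepacket

namespace Wavepacket

open Nonlinearity

/-- The space `L¹(ℝ^d; ℂ^{2J})`. -/
abbrev AmpL1 (d J : ℕ) := Wave d →₁[volume] Amp J

/-- Multilinear-map-valued functions of `(k', …, k^{(m)})`. -/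
abbrev MSymbol (d J m : ℕ) :=
  (Fin m → Wave d) → ContinuousMultilinearMap ℂ (fun _ : Fin m => Amp J) (Amp J)

/-! ### Multipliers and twisted translations on L¹ -/

section Mul

variable {d J : ℕ}

/-- A bounded measurable multiplier. -/
structure IsMultiplier (p : Wave d → Amp J →L[ℂ] Amp J) (C : ℝ) : Prop where
  meas : AEStronglyMeasurable p volume
  bound : ∀ᵐ k, ‖p k‖ ≤ C

theorem IsMultiplier.isL1Bounded {p : Wave d → Amp J →L[ℂ] Amp J} {C : ℝ}
    (h : IsMultiplier p C) :
    IsL1Bounded volume volume (fun (f : Wave d → Amp J) k => p k (f k)) C := by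
  have hb : ∀ f : Wave d → Amp J, ∀ᵐ k, ‖p k (f k)‖ ≤ C * ‖f k‖ := fun f =>
    h.bound.mono fun k hk => (p k).le_of_opNorm_le hk _
  have hi : ∀ f : Wave d → Amp J, Integrable f → Integrable (fun k => p k (f k)) := by
    intro f hf
    refine (hf.norm.const_mul C).mono' ?_ (hb f)
    exact isBoundedBilinearMap_apply.continuous.comp_aestronglyMeasurable₂
      (g := fun a b => a b) h.meas hf.1
  refine ⟨fun f g hfg => hfg.mono fun k hk => by simp only [hk], hi,
    fun f g _ _ => .of_forall fun k => by simp, fun c f _ => .of_forall fun k => by simp,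
    fun f hf => ?_⟩
  rw [← integral_const_mul]
  exact integral_mono_ae (hi f hf).norm (hf.norm.const_mul C) (hb f)

open Classical in
/-- The operator of multiplication by `p`. -/
def mulOp (p : Wave d → Amp J →L[ℂ] Amp J) : AmpL1 d J →L[ℝ] AmpL1 d J :=
  if h : ∃ C, IsMultiplier p C then liftL1 h.choose_spec.isL1Bounded else 0

theorem mulOp_coe {p : Wave d → Amp J →L[ℂ] Amp J} {C : ℝ} (h : IsMultiplier p C)
    (f : AmpL1 d J) : mulOp p f =ᵐ[volume] fun k => p k (f k) := by
  have h' : ∃ C, IsMultiplier p C := ⟨C, h⟩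
  rw [mulOp, dif_pos h']
  exact liftL1_coe _ _

theorem norm_mulOp_eq {p : Wave d → Amp J →L[ℂ] Amp J} {C : ℝ} (h : IsMultiplier p C)
    (f : AmpL1 d J) : ‖mulOp p f‖ = ∫ k, ‖p k (f k)‖ := by
  rw [L1.norm_eq_integral_norm]
  exact integral_congr_ae ((mulOp_coe h f).mono fun x hx => congrArg norm hx)

/-- Multiplication by a scalar function, as a multiplier. -/
def scal (f : Wave d → ℂ) : Wave d → Amp J →L[ℂ] Amp J :=
  fun k => f k • ContinuousLinearMap.id ℂ (Amp J)

theorem scal_apply (f : Wave d → ℂ) (k : Wave d) (v : Amp J) : scal f k v = f k • v := by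
  simp [scal]

theorem isMultiplier_scal {f : Wave d → ℂ} {C : ℝ} (hf : AEStronglyMeasurable f volume)
    (hb : ∀ᵐ k, ‖f k‖ ≤ C) : IsMultiplier (scal (J := J) f) C := by
  refine ⟨hf.smul_const _, hb.mono fun k hk => ?_⟩
  refine ContinuousLinearMap.opNorm_le_bound _ ((norm_nonneg _).trans hk) fun v => ?_
  rw [scal_apply, norm_smul]
  gcongr

/-- The twisted translation `f ↦ exp(i r·y) f(· + y)`. -/
def twist (r y : Wave d) (f : Wave d → Amp J) (k : Wave d) : Amp J :=
  Complex.exp (Complex.I * (inner ℝ r y : ℝ)) • f (k + y)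

theorem norm_exp_I_mul_ofReal (x : ℝ) : ‖Complex.exp (Complex.I * (x : ℂ))‖ = 1 := by
  rw [mul_comm, Complex.norm_exp_ofReal_mul_I]

theorem norm_twist (r y : Wave d) (f : Wave d → Amp J) (k : Wave d) :
    ‖twist r y f k‖ = ‖f (k + y)‖ := by
  rw [twist, norm_smul, norm_exp_I_mul_ofReal, one_mul]

theorem ae_comp_add_right {p : Wave d → Prop} (h : ∀ᵐ k, p k) (y : Wave d) :
    ∀ᵐ k, p (k + y) :=
  (measurePreserving_add_right volume y).quasiMeasurePreserving.ae h

theorem isL1Bounded_twist (r y : Wave d) :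
    IsL1Bounded volume volume (twist (J := J) r y) 1 := by
  refine ⟨fun f g h => ?_, fun f hf => ?_, fun f g _ _ => ?_, fun c f _ => ?_, fun f hf => ?_⟩
  · exact (ae_comp_add_right h y).mono fun k hk => by simp only [twist, hk]
  · exact (hf.comp_add_right y).smul (Complex.exp (Complex.I * (inner ℝ r y : ℝ)))
  · exact .of_forall fun k => by simp [twist]
  · exact .of_forall fun k => by simp only [twist, Pi.smul_apply]; rw [smul_comm]
  · simp_rw [norm_twist, one_mul]
    exact (integral_add_right_eq_self (fun k => ‖f k‖) y).le

/-- The twisted translation as an operator on `L¹`. -/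
def twistOp (r y : Wave d) : AmpL1 d J →L[ℝ] AmpL1 d J :=
  liftL1 (isL1Bounded_twist r y)

theorem twistOp_coe (r y : Wave d) (f : AmpL1 d J) : twistOp r y f =ᵐ[volume] twist r y f :=
  liftL1_coe _ _

end Mul

/-! ### Multilinear convolution operators and their symbols -/

section SymbolCalculus

variable {d J m : ℕ}

/-- The integrand `a(k', …, k^{(m)})(w₁(k'), …, w_m(k^{(m)}))`. -/
def tens (a : MSymbol d J m) (w : Fin m → Wave d → Amp J) (x : Fin m → Wave d) : Amp J :=
  a x (fun j => w j (x j))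

/-- Bounded measurable symbols. -/
structure IsSymbol (a : MSymbol d J m) (C : ℝ) : Prop where
  meas : AEStronglyMeasurable a volume
  nonneg : 0 ≤ C
  bound : ∀ᵐ x, ‖a x‖ ≤ C

theorem ae_eval {p : Wave d → Prop} (h : ∀ᵐ k, p k) (j : Fin m) :
    ∀ᵐ x : Fin m → Wave d, p (x j) :=
  (Measure.quasiMeasurePreserving_eval (fun _ : Fin m => (volume : Measure (Wave d))) j).ae h

/-- The preimage of a null set under the sum corresponds, through `convVec`, to a cylinder over that
null set. Hence conditions valid for almost every output k, such as k ∉ σ_bc, hold almost everywhere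
in (k', …, k^{(m)}). -/
theorem quasiMeasurePreserving_sum (hm : 1 ≤ m) :
    Measure.QuasiMeasurePreserving (fun x : Fin m → Wave d => ∑ j, x j) volume volume := by
  refine ⟨by fun_prop, Measure.AbsolutelyContinuous.mk fun s hs h0 => ?_⟩
  rw [Measure.map_apply (by fun_prop) hs, ← (measurePreserving_convVec (d := d) hm).map_eq,
    Measure.map_apply (measurePreserving_convVec hm).measurable
      ((by fun_prop : Measurable fun x : Fin m → Wave d => ∑ j, x j) hs)]
  have : (fun p : Wave d × (Fin (m - 1) → Wave d) => convVec m p.1 p.2) ⁻¹'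
      ((fun x : Fin m → Wave d => ∑ j, x j) ⁻¹' s) = s ×ˢ univ := by
    ext p
    simp [sum_convVec hm]
  rw [this, Measure.prod_prod, h0, zero_mul]

theorem ae_sum (hm : 1 ≤ m) {p : Wave d → Prop} (h : ∀ᵐ k, p k) :
    ∀ᵐ x : Fin m → Wave d, p (∑ j, x j) :=
  (quasiMeasurePreserving_sum hm).ae h

theorem aestronglyMeasurable_tens {a : MSymbol d J m} {w : Fin m → Wave d → Amp J}
    (ha : AEStronglyMeasurable a volume) (hw : ∀ j, AEStronglyMeasurable (w j) volume) :
    AEStronglyMeasurable (tens a w) volume := by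
  have h1 : AEStronglyMeasurable (fun x : Fin m → Wave d => fun j => w j (x j)) volume := by
    refine (aemeasurable_pi_lambda _ fun j => ?_).aestronglyMeasurable
    exact ((hw j).comp_quasiMeasurePreserving
      (Measure.quasiMeasurePreserving_eval (fun _ => volume) j)).aemeasurable
  have hc : Continuous fun p : ContinuousMultilinearMap ℂ (fun _ : Fin m => Amp J) (Amp J) ×
      (Fin m → Amp J) => p.1 p.2 := by fun_prop
  exact hc.comp_aestronglyMeasurable (ha.prodMk h1)

theorem norm_tens_le {a : MSymbol d J m} (w : Fin m → Wave d → Amp J) (x : Fin m → Wave d) :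
    ‖tens a w x‖ ≤ ‖a x‖ * ∏ j, ‖w j (x j)‖ := (a x).le_opNorm _

theorem integrable_prod_comp {f : Fin m → Wave d → ℝ} (hf : ∀ j, Integrable (f j)) :
    Integrable (fun x : Fin m → Wave d => ∏ j, f j (x j)) :=
  Integrable.fintype_prod hf

theorem integrable_tens {a : MSymbol d J m} {C : ℝ} (ha : IsSymbol a C)
    {w : Fin m → Wave d → Amp J} (hw : ∀ j, Integrable (w j)) : Integrable (tens a w) := by
  refine ((integrable_prod_comp fun j => (hw j).norm).const_mul C).mono'
    (aestronglyMeasurable_tens ha.meas fun j => (hw j).1) ?_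
  filter_upwards [ha.bound] with x hx
  exact (norm_tens_le w x).trans (by gcongr)

theorem update_coe_eval (w : Fin m → AmpL1 d J) (i : Fin m) (v : AmpL1 d J)
    (x : Fin m → Wave d) :
    (fun j => Function.update w i v j (x j)) =
      Function.update (fun j => w j (x j)) i (v (x i)) := by
  funext j
  by_cases h : j = i
  · subst h; simp
  · simp [h]

theorem tens_congr {a : MSymbol d J m} {w w' : Fin m → Wave d → Amp J}
    (h : ∀ j, w j =ᵐ[volume] w' j) : tens a w =ᵐ[volume] tens a w' := by
  have : ∀ᵐ x : Fin m → Wave d, ∀ j, w j (x j) = w' j (x j) :=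
    ae_all_iff.2 fun j => ae_eval (h j) j
  filter_upwards [this] with x hx
  simp only [tens, hx]

open Classical in
/-- The convolution operator with symbol `a`. -/
def symOp (a : MSymbol d J m) :
    ContinuousMultilinearMap ℝ (fun _ : Fin m => AmpL1 d J) (AmpL1 d J) :=
  if h : 1 ≤ m ∧ ∃ C, IsSymbol a C then
    MultilinearMap.mkContinuous
      { toFun := fun w => liftL1 (isL1Bounded_fiberIntegral h.1)
          ((integrable_tens h.2.choose_spec fun j => L1.integrable_coeFn (w j)).toL1 _)
        map_update_add' := fun {inst} w i v v' => by
          -- The multilinearity fields quantify over every decidability instance; all of them are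
          -- equal.
          have : inst = instDecidableEqFin m := Subsingleton.elim _ _
          subst this
          rw [← map_add, ← Integrable.toL1_add]
          congr 1
          rw [Integrable.toL1_eq_toL1_iff]
          filter_upwards [ae_eval (Lp.coeFn_add v v') i] with x hx
          simp only [tens, Pi.add_apply, update_coe_eval, hx, Pi.add_apply,
            ContinuousMultilinearMap.map_update_add]
        map_update_smul' := fun {inst} w i c v => by
          have : inst = instDecidableEqFin m := Subsingleton.elim _ _
          subst this
          rw [← map_smul, ← Integrable.toL1_smul']
          congr 1
          rw [Integrable.toL1_eq_toL1_iff]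
          filter_upwards [ae_eval (Lp.coeFn_smul c v) i] with x hx
          simp only [tens, Pi.smul_apply, update_coe_eval, hx]
          rw [← Complex.coe_smul, ← Complex.coe_smul, ContinuousMultilinearMap.map_update_smul] }
      h.2.choose (fun w => by
        have ha := h.2.choose_spec
        refine (norm_liftL1_le _ _).trans ?_
        rw [one_mul, norm_toL1_eq_integral]
        simp_rw [L1.norm_eq_integral_norm]
        rw [← integral_fintype_prod_volume_eq_prod, ← integral_const_mul]
        refine integral_mono_ae (integrable_tens ha fun j => L1.integrable_coeFn (w j)).norm
          ((integrable_prod_comp fun j => (L1.integrable_coeFn (w j)).norm).const_mul _) ?_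
        filter_upwards [ha.bound] with x hx
        exact (norm_tens_le _ x).trans (by gcongr))
  else 0

theorem symOp_eq (hm : 1 ≤ m) {a : MSymbol d J m} {C : ℝ} (ha : IsSymbol a C)
    (w : Fin m → AmpL1 d J) :
    symOp a w = liftL1 (isL1Bounded_fiberIntegral hm)
      ((integrable_tens ha fun j => L1.integrable_coeFn (w j)).toL1 _) := by
  have h : 1 ≤ m ∧ ∃ C, IsSymbol a C := ⟨hm, C, ha⟩
  rw [symOp, dif_pos h]
  rfl

theorem symOp_coe (hm : 1 ≤ m) {a : MSymbol d J m} {C : ℝ} (ha : IsSymbol a C)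
    (w : Fin m → AmpL1 d J) :
    symOp a w =ᵐ[volume] fiberIntegral (tens a fun j => (w j : Wave d → Amp J)) := by
  rw [symOp_eq hm ha]
  exact (liftL1_coe _ _).trans (fiberIntegral_congr hm (Integrable.coeFn_toL1 _))

/-- Bound of a convolution operator in terms of a product majorant. -/
theorem norm_symOp_apply_le (hm : 1 ≤ m) {a : MSymbol d J m} {C C' : ℝ} (ha : IsSymbol a C)
    (w : Fin m → AmpL1 d J) {f : Fin m → Wave d → ℝ} (hf : ∀ j, Integrable (f j))
    (h : ∀ᵐ x : Fin m → Wave d,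
      ‖tens a (fun j => (w j : Wave d → Amp J)) x‖ ≤ C' * ∏ j, f j (x j)) :
    ‖symOp a w‖ ≤ C' * ∏ j, ∫ k, f j k := by
  rw [symOp_eq hm ha]
  refine (norm_liftL1_le _ _).trans ?_
  rw [one_mul, norm_toL1_eq_integral, ← integral_fintype_prod_volume_eq_prod,
    ← integral_const_mul]
  exact integral_mono_ae (integrable_tens ha fun j => L1.integrable_coeFn (w j)).norm
    ((integrable_prod_comp hf).const_mul _) h

theorem norm_symOp_apply_le_prod (hm : 1 ≤ m) {a : MSymbol d J m} {C : ℝ} (ha : IsSymbol a C)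
    (w : Fin m → AmpL1 d J) : ‖symOp a w‖ ≤ C * ∏ j, ‖w j‖ := by
  have := norm_symOp_apply_le (C' := C) hm ha w (fun j => (L1.integrable_coeFn (w j)).norm) ?_
  · simpa only [← L1.norm_eq_integral_norm] using this
  filter_upwards [ha.bound] with x hx
  exact (norm_tens_le _ x).trans (by gcongr)

theorem norm_symOp_le (hm : 1 ≤ m) {a : MSymbol d J m} {C : ℝ} (ha : IsSymbol a C) :
    ‖symOp a‖ ≤ C :=
  ContinuousMultilinearMap.opNorm_le_bound ha.nonneg (norm_symOp_apply_le_prod hm ha)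

theorem symOp_eq_sum (hm : 1 ≤ m) {a : MSymbol d J m} {C : ℝ} (ha : IsSymbol a C)
    (w : Fin m → AmpL1 d J) {ι : Type*} (s : Finset ι) (b : ι → MSymbol d J m) {C' : ι → ℝ}
    (hb : ∀ i ∈ s, IsSymbol (b i) (C' i)) (w' : ι → Fin m → AmpL1 d J)
    (h : ∀ᵐ x : Fin m → Wave d, tens a (fun j => (w j : Wave d → Amp J)) x =
      ∑ i ∈ s, tens (b i) (fun j => (w' i j : Wave d → Amp J)) x) :
    symOp a w = ∑ i ∈ s, symOp (b i) (w' i) := by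
  classical
  have key : ∀ i (hi : i ∈ s), symOp (b i) (w' i) = liftL1 (isL1Bounded_fiberIntegral hm)
      ((integrable_tens (hb i hi) fun j => L1.integrable_coeFn (w' i j)).toL1 _) :=
    fun i hi => symOp_eq hm (hb i hi) _
  rw [← Finset.sum_attach, Finset.sum_congr rfl fun i (_ : i ∈ s.attach) => key i.1 i.2,
    ← map_sum, symOp_eq hm ha]
  congr 1
  apply Lp.ext
  refine (Integrable.coeFn_toL1 _).trans ?_
  have h2 : ∀ᵐ x : Fin m → Wave d, ∀ i : s, (integrable_tens (hb i i.2) fun j =>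
      L1.integrable_coeFn (w' i j)).toL1 _ x =
        tens (b i) (fun j => (w' i j : Wave d → Amp J)) x :=
    ae_all_iff.2 fun i => Integrable.coeFn_toL1 _
  filter_upwards [h, h2, Lp.coeFn_finsetSum s.attach fun i : s => (integrable_tens (hb i i.2)
    fun j => L1.integrable_coeFn (w' i j)).toL1 _] with x hx hx2 hx3
  rw [hx3, hx, ← Finset.sum_attach, Finset.sum_apply]
  exact Finset.sum_congr rfl fun i _ => (hx2 i).symm

theorem IsSymbol.sub {a b : MSymbol d J m} {C C' : ℝ} (ha : IsSymbol a C) (hb : IsSymbol b C') :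
    IsSymbol (fun x => a x - b x) (C + C') where
  meas := ha.meas.sub hb.meas
  nonneg := add_nonneg ha.nonneg hb.nonneg
  bound := by
    filter_upwards [ha.bound, hb.bound] with x hx hx'
    exact (norm_sub_le _ _).trans (add_le_add hx hx')

theorem IsSymbol.mono {a : MSymbol d J m} {C C' : ℝ} (ha : IsSymbol a C)
    (h : ∀ᵐ x, ‖a x‖ ≤ C') (h0 : 0 ≤ C') : IsSymbol a C' := ⟨ha.meas, h0, h⟩

theorem symOp_sub (hm : 1 ≤ m) {a b : MSymbol d J m} {C C' : ℝ} (ha : IsSymbol a C)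
    (hb : IsSymbol b C') : symOp (fun x => a x - b x) = symOp a - symOp b := by
  ext1 w
  have := symOp_eq_sum hm ha w (Finset.univ : Finset Bool)
    (fun i => if i then (fun x => a x - b x) else b) (C' := fun i => if i then C + C' else C')
    (fun i _ => by cases i; exacts [hb, ha.sub hb])
    (fun _ => w) (.of_forall fun x => by simp [tens])
  simp only [Fintype.sum_bool, if_true] at this
  rw [sub_apply, this]
  simp

theorem IsSymbol.smul {a : MSymbol d J m} {C C' : ℝ} (ha : IsSymbol a C)
    {f : (Fin m → Wave d) → ℂ} (hf : AEStronglyMeasurable f volume)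
    (hb : ∀ᵐ x, ‖f x • a x‖ ≤ C') (h0 : 0 ≤ C') : IsSymbol (fun x => f x • a x) C' :=
  ⟨hf.smul ha.meas, h0, hb⟩

theorem IsSymbol.comp_left (hm : 1 ≤ m) {a : MSymbol d J m} {C C' : ℝ} (ha : IsSymbol a C)
    {p : Wave d → Amp J →L[ℂ] Amp J} (hp : IsMultiplier p C') (h0 : 0 ≤ C') :
    IsSymbol (fun x => (p (∑ j, x j)).compContinuousMultilinearMap (a x)) (C' * C) where
  meas := by
    have hc : Continuous fun q : (Amp J →L[ℂ] Amp J) ×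
        ContinuousMultilinearMap ℂ (fun _ : Fin m => Amp J) (Amp J) =>
        q.1.compContinuousMultilinearMap q.2 :=
      (ContinuousLinearMap.compContinuousMultilinearMapL ℂ (fun _ : Fin m => Amp J)
        (Amp J) (Amp J)).isBoundedBilinearMap.continuous
    exact hc.comp_aestronglyMeasurable
      ((hp.meas.comp_quasiMeasurePreserving (quasiMeasurePreserving_sum hm)).prodMk ha.meas)
  nonneg := mul_nonneg h0 ha.nonneg
  bound := by
    filter_upwards [ha.bound, ae_sum hm hp.bound] with x hx hx'
    refine (ContinuousLinearMap.norm_compContinuousMultilinearMap_le _ _).trans ?_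
    gcongr

/-- On the fibre over k the sum of the arguments is k, so p(k) passes under the integral as p(∑x_j).
-/
theorem mulOp_symOp (hm : 1 ≤ m) {a : MSymbol d J m} {C C' : ℝ} (ha : IsSymbol a C)
    {p : Wave d → Amp J →L[ℂ] Amp J} (hp : IsMultiplier p C') (h0 : 0 ≤ C')
    (w : Fin m → AmpL1 d J) :
    mulOp p (symOp a w) =
      symOp (fun x => (p (∑ j, x j)).compContinuousMultilinearMap (a x)) w := by
  apply Lp.ext
  refine (mulOp_coe hp _).trans (.trans ?_ (symOp_coe hm (ha.comp_left hm hp h0) w).symm)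
  have hi := integrable_comp_convVec hm
    (integrable_tens ha fun j => L1.integrable_coeFn (w j))
  filter_upwards [symOp_coe hm ha w, hi.prod_right_ae] with k hk hk2
  rw [hk, fiberIntegral, ← ContinuousLinearMap.integral_comp_comm _ hk2, fiberIntegral]
  refine integral_congr_ae (.of_forall fun q => ?_)
  simp [tens, sum_convVec hm]

/-- The symbol `a` with its `j`-th argument shifted by `y`. -/
def shiftSym (a : MSymbol d J m) (j : Fin m) (y : Wave d) : MSymbol d J m :=
  fun x => a (x + Pi.single j y)

theorem ae_shift {p : (Fin m → Wave d) → Prop} (h : ∀ᵐ x, p x) (y : Fin m → Wave d) :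
    ∀ᵐ x, p (x + y) :=
  (measurePreserving_add_right volume y).quasiMeasurePreserving.ae h

theorem IsSymbol.shift {a : MSymbol d J m} {C : ℝ} (ha : IsSymbol a C) (j : Fin m) (y : Wave d) :
    IsSymbol (shiftSym a j y) C where
  meas := ha.meas.comp_quasiMeasurePreserving
    (measurePreserving_add_right volume
      (Pi.single j y : Fin m → Wave d)).quasiMeasurePreserving
  nonneg := ha.nonneg
  bound := ae_shift ha.bound _

/-- The translation by y is placed on slot j and the scalar exp(i r·y) enters the same slot by
linearity. Only one input is twisted, with the same r as the output; the price is a shifted symbol.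
-/
theorem twistOp_symOp (hm : 1 ≤ m) {a : MSymbol d J m} {C : ℝ} (ha : IsSymbol a C)
    (r y : Wave d) (j : Fin m) (w : Fin m → AmpL1 d J) :
    twistOp r y (symOp a w) =
      symOp (shiftSym a j y) (Function.update w j (twistOp r y (w j))) := by
  apply Lp.ext
  refine (twistOp_coe r y _).trans (.trans ?_ (symOp_coe hm (ha.shift j y) _).symm)
  have h1 : twist r y (symOp a w) =ᵐ[volume]
      fiberIntegral (fun x => Complex.exp (Complex.I * (inner ℝ r y : ℝ)) •
        tens a (fun j => (w j : Wave d → Amp J)) (x + Pi.single j y)) := by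
    filter_upwards [ae_comp_add_right (symOp_coe hm ha w) y] with k hk
    rw [twist, hk, fiberIntegral_add_right hm _ j, fiberIntegral, fiberIntegral, integral_smul]
  refine h1.trans (fiberIntegral_congr hm ?_)
  filter_upwards [ae_eval (twistOp_coe r y (w j)) j] with x hx
  simp only [tens, update_coe_eval, shiftSym, hx, twist]
  rw [ContinuousMultilinearMap.map_update_smul]
  congr 2
  funext i
  by_cases h : i = j
  · subst h; simp
  · simp [h]

end SymbolCalculus

end Wavepacket

namespace Wavepacket

/-! ### Spectral theory of L off the band-crossing set -/

namespace LinearPart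

variable {d J : ℕ} {A : LinearPart d J}

theorem Admissible.freq_pos (hA : A.Admissible) {k : Wave d} (hk : k ∉ A.bandCrossing) (n : Fin J) :
    0 < A.freq n 1 k := by
  have hJ : 0 < J := n.pos
  have h0 : A.freq ⟨0, hJ⟩ 1 k ≠ 0 := fun h => hk (Or.inr (Or.inr ⟨1, ⟨0, hJ⟩, rfl, h⟩))
  have h1 := (hA.omega_pos k hk ⟨0, hJ⟩).lt_of_ne' h0
  exact h1.trans_le (hA.order_pos k hk _ _ (Fin.mk_le_of_le_val (Nat.zero_le _)))

theorem Admissible.freq_neg (hA : A.Admissible) {k : Wave d} (hk : k ∉ A.bandCrossing) (n : Fin J) :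
    A.freq n (-1) k < 0 := by
  have hJ : 0 < J := n.pos
  have h0 : A.freq ⟨0, hJ⟩ (-1) k ≠ 0 := fun h => hk (Or.inr (Or.inr ⟨-1, ⟨0, hJ⟩, rfl, h⟩))
  have h1 := (hA.omega_neg k hk ⟨0, hJ⟩).lt_of_ne h0
  exact (hA.order_neg k hk _ _ (Fin.mk_le_of_le_val (Nat.zero_le _))).trans_lt h1

/-- Band crossing forbids only coincidences of neighbouring bands; the ordering of the ω_n spreads
strictness to all pairs of the same sign. -/
theorem Admissible.freq_ne_of_lt (hA : A.Admissible) {k : Wave d} (hk : k ∉ A.bandCrossing)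
    {n n' : Fin J} (h : n < n') (ζ : ℤˣ) : A.freq n ζ k ≠ A.freq n' ζ k := by
  have hlt : (n : ℕ) + 1 < J + 0 := by have := n'.2; have : (n : ℕ) < n' := h; omega
  have hne : A.freq ⟨n + 1, hlt⟩ ζ k ≠ A.freq n ζ k := fun hh =>
    hk (Or.inl ⟨ζ, n, ⟨n + 1, hlt⟩, rfl, hh⟩)
  have hle : (⟨n + 1, hlt⟩ : Fin J) ≤ n' := Fin.mk_le_of_le_val h
  have hle' : n ≤ (⟨n + 1, hlt⟩ : Fin J) := Fin.le_def.2 (Nat.le_succ _)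
  rcases Int.units_eq_one_or ζ with rfl | rfl
  · exact (((hA.order_pos k hk _ _ hle').lt_of_ne hne.symm).trans_le
      (hA.order_pos k hk _ _ hle)).ne
  · exact ((hA.order_neg k hk _ _ hle).trans_lt
      ((hA.order_neg k hk _ _ hle').lt_of_ne hne)).ne'

theorem Admissible.freq_injective (hA : A.Admissible) {k : Wave d} (hk : k ∉ A.bandCrossing) :
    Function.Injective (fun i : Fin J × ℤˣ => A.freq i.1 i.2 k) := by
  have key : ∀ (n n' : Fin J) (ζ : ℤˣ), A.freq n ζ k = A.freq n' ζ k → n = n' := by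
    intro n n' ζ h
    by_contra hne
    rcases lt_or_gt_of_ne hne with hlt | hlt
    · exact hA.freq_ne_of_lt hk hlt ζ h
    · exact hA.freq_ne_of_lt hk hlt ζ h.symm
  rintro ⟨n, ζ⟩ ⟨n', ζ'⟩ h
  simp only at h
  rcases Int.units_eq_one_or ζ with rfl | rfl <;> rcases Int.units_eq_one_or ζ' with rfl | rfl
  · rw [key _ _ _ h]
  · exact absurd h (((hA.freq_neg hk n').trans (hA.freq_pos hk n)).ne')
  · exact absurd h (((hA.freq_neg hk n).trans (hA.freq_pos hk n')).ne)
  · rw [key _ _ _ h]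

/-- Eigenvectors of a Hermitian operator for distinct eigenvalues are orthogonal. There are 2J of
them, so they form a basis. -/
theorem Admissible.orthonormal (hA : A.Admissible) {k : Wave d} (hk : k ∉ A.bandCrossing) :
    Orthonormal ℂ (fun i : Fin J × ℤˣ => A.vec i.1 i.2 k) := by
  refine ⟨fun i => hA.unit k hk _ _, fun i j hij => ?_⟩
  have hsym := (hA.hermitian k).isSymmetric (A.vec i.1 i.2 k) (A.vec j.1 j.2 k)
  simp only [ContinuousLinearMap.coe_coe, hA.eigen k hk, inner_smul_left, inner_smul_right,
    Complex.conj_ofReal] at hsym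
  have hne : (A.freq i.1 i.2 k : ℂ) - A.freq j.1 j.2 k ≠ 0 := by
    rw [sub_ne_zero]
    exact_mod_cast (hA.freq_injective hk).ne hij
  have : ((A.freq i.1 i.2 k : ℂ) - A.freq j.1 j.2 k) *
      inner ℂ (A.vec i.1 i.2 k) (A.vec j.1 j.2 k) = 0 := by rw [sub_mul, hsym, sub_self]
  exact (mul_eq_zero.1 this).resolve_left hne

/-- The orthonormal basis of eigenvectors off the band-crossing set. -/
def Admissible.onb (hA : A.Admissible) {k : Wave d} (hk : k ∉ A.bandCrossing) :
    OrthonormalBasis (Fin J × ℤˣ) ℂ (Amp J) :=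
  OrthonormalBasis.mk (hA.orthonormal hk) (by
    refine ((hA.orthonormal hk).linearIndependent.span_eq_top_of_card_eq_finrank' ?_).ge
    simp [mul_comm])

theorem Admissible.onb_apply (hA : A.Admissible) {k : Wave d} (hk : k ∉ A.bandCrossing)
    (i : Fin J × ℤˣ) : hA.onb hk i = A.vec i.1 i.2 k := by
  simp [Admissible.onb]

theorem Admissible.sum_proj (hA : A.Admissible) {k : Wave d} (hk : k ∉ A.bandCrossing)
    (v : Amp J) : ∑ i : Fin J × ℤˣ, A.proj i.1 i.2 k v = v := by
  have := (hA.onb hk).sum_repr' v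
  simpa [hA.onb_apply hk, LinearPart.proj] using this

variable (A) in
/-- The projection `Π_{n,ζ}(k)` as a bounded operator. -/
def projL (n : Fin J) (ζ : ℤˣ) (k : Wave d) : Amp J →L[ℂ] Amp J :=
  (innerSL ℂ (A.vec n ζ k)).smulRight (A.vec n ζ k)

theorem projL_apply (n : Fin J) (ζ : ℤˣ) (k : Wave d) (v : Amp J) :
    A.projL n ζ k v = A.proj n ζ k v := by
  simp [projL, proj]

theorem Admissible.norm_projL_le (hA : A.Admissible) {k : Wave d} (hk : k ∉ A.bandCrossing)
    (n : Fin J) (ζ : ℤˣ) : ‖A.projL n ζ k‖ ≤ 1 := by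
  rw [projL, ContinuousLinearMap.norm_smulRight_apply, innerSL_apply_norm, hA.unit k hk, one_mul]

theorem Admissible.projL_projL (hA : A.Admissible) {k : Wave d} (hk : k ∉ A.bandCrossing)
    (i j : Fin J × ℤˣ) (v : Amp J) :
    A.projL i.1 i.2 k (A.projL j.1 j.2 k v) = if i = j then A.projL j.1 j.2 k v else 0 := by
  simp only [projL_apply, proj, inner_smul_right]
  split_ifs with h
  · subst h
    rw [inner_self_eq_norm_sq_to_K, hA.unit k hk]; simp
  · rw [(hA.orthonormal hk).2 h]; simp

theorem exp_apply_of_eigen (T : Amp J →L[ℂ] Amp J) {v : Amp J} {μ : ℂ} (h : T v = μ • v) :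
    NormedSpace.exp T v = Complex.exp μ • v := by
  have h1 := NormedSpace.exp_series_hasSum_exp' (𝕂 := ℂ) T
  have h2 := (ContinuousLinearMap.apply ℂ (Amp J) v).hasSum h1
  have h3 := (NormedSpace.exp_series_hasSum_exp' (𝕂 := ℂ) μ).smul_const v
  rw [← Complex.exp_eq_exp_ℂ] at h3
  have hp : ∀ n : ℕ, (T ^ n) v = μ ^ n • v := by
    intro n
    induction n with
    | zero => simp
    | succ n ih => rw [pow_succ', mul_apply_eq_comp, ih, map_smul, h, smul_smul,
        pow_succ]
  refine h2.unique (h3.congr_fun fun n => ?_)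
  simp [hp, smul_smul]

theorem Admissible.propagator_proj (hA : A.Admissible) {k : Wave d} (hk : k ∉ A.bandCrossing)
    (t : ℝ) (n : Fin J) (ζ : ℤˣ) (v : Amp J) :
    A.propagator t k (A.proj n ζ k v) =
      Complex.exp (Complex.I * ((-(t * A.freq n ζ k) : ℝ) : ℂ)) • A.proj n ζ k v := by
  apply exp_apply_of_eigen
  simp only [proj, map_smul, smul_apply, hA.eigen k hk, smul_smul]
  congr 1
  push_cast
  ring

theorem Admissible.propagator_apply (hA : A.Admissible) {k : Wave d} (hk : k ∉ A.bandCrossing)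
    (t : ℝ) (v : Amp J) :
    A.propagator t k v = ∑ i : Fin J × ℤˣ,
      Complex.exp (Complex.I * ((-(t * A.freq i.1 i.2 k) : ℝ) : ℂ)) • A.proj i.1 i.2 k v := by
  conv_lhs => rw [← hA.sum_proj hk v, map_sum]
  exact Finset.sum_congr rfl fun i _ => hA.propagator_proj hk t _ _ v

theorem norm_exp_I_smul_apply {T : Amp J →L[ℂ] Amp J} (hT : IsSelfAdjoint T) (v : Amp J) :
    ‖NormedSpace.exp (Complex.I • T) v‖ = ‖v‖ :=
  ContinuousLinearMap.norm_map_of_mem_unitary (selfAdjoint.expUnitary ⟨T, selfAdjoint.mem_iff.2 hT⟩).2 v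

theorem Admissible.norm_propagator_apply (hA : A.Admissible) (t : ℝ) (k : Wave d) (v : Amp J) :
    ‖A.propagator t k v‖ = ‖v‖ := by
  have hsa : IsSelfAdjoint (((-t : ℝ) : ℂ) • A.L k) :=
    IsSelfAdjoint.smul (Complex.conj_ofReal _) (hA.hermitian k)
  rw [← norm_exp_I_smul_apply hsa v, propagator, smul_smul]
  congr 4
  push_cast
  ring

theorem continuous_exp_clm : Continuous fun x : Amp J →L[ℂ] Amp J => NormedSpace.exp x := by
  let _ : NormedAlgebra ℚ (Amp J →L[ℂ] Amp J) := NormedAlgebra.restrictScalars ℚ ℂ _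
  exact NormedSpace.exp_continuous

theorem continuous_propagator (k : Wave d) : Continuous fun t => A.propagator t k := by
  unfold propagator
  exact continuous_exp_clm.comp (by fun_prop)

theorem Admissible.isOpen (hA : A.Admissible) : IsOpen A.bandCrossingᶜ := hA.closed.isOpen_compl

theorem Admissible.ae_notMem (hA : A.Admissible) : ∀ᵐ k, k ∉ A.bandCrossing :=
  measure_eq_zero_iff_ae_notMem.1 hA.null

theorem Admissible.aestronglyMeasurable (hA : A.Admissible) {F : Type*} [TopologicalSpace F]
    [TopologicalSpace.PseudoMetrizableSpace F] {f : Wave d → F}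
    (hf : ContinuousOn f A.bandCrossingᶜ) :
    AEStronglyMeasurable f volume := by
  have := hf.aestronglyMeasurable (μ := volume) hA.isOpen.measurableSet
  rwa [Measure.restrict_eq_self_of_ae_mem (s := A.bandCrossingᶜ) hA.ae_notMem] at this

theorem Admissible.continuousOn_propagator (hA : A.Admissible) (t : ℝ) :
    ContinuousOn (A.propagator t) A.bandCrossingᶜ := by
  exact continuous_exp_clm.comp_continuousOn (hA.smooth.continuousOn.const_smul (-(Complex.I * (t : ℂ))))

theorem Admissible.isMultiplier_propagator (hA : A.Admissible) (t : ℝ) :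
    IsMultiplier (A.propagator t) 1 where
  meas := hA.aestronglyMeasurable (hA.continuousOn_propagator t)
  bound := .of_forall fun k => ContinuousLinearMap.opNorm_le_bound _ zero_le_one fun v => by
    rw [hA.norm_propagator_apply, one_mul]

/-! ### Smoothness of simple eigenvalues and of their projections -/

variable (A) in
/-- The characteristic function `det (L(k) - μ)`. -/
def charFun (p : Wave d × ℝ) : ℂ :=
  LinearMap.det ((A.L p.1 - (p.2 : ℂ) • ContinuousLinearMap.id ℂ (Amp J) :
    Amp J →L[ℂ] Amp J) : Amp J →ₗ[ℂ] Amp J)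

theorem Admissible.charFun_eq (hA : A.Admissible) {k : Wave d} (hk : k ∉ A.bandCrossing) (μ : ℝ) :
    A.charFun (k, μ) = ((∏ i : Fin J × ℤˣ, (A.freq i.1 i.2 k - μ) : ℝ) : ℂ) := by
  rw [charFun, ← LinearMap.det_toMatrix (hA.onb hk).toBasis]
  have : LinearMap.toMatrix (hA.onb hk).toBasis (hA.onb hk).toBasis
      ((A.L k - (μ : ℂ) • ContinuousLinearMap.id ℂ (Amp J) : Amp J →L[ℂ] Amp J) :
        Amp J →ₗ[ℂ] Amp J) =
      Matrix.diagonal fun i : Fin J × ℤˣ => ((A.freq i.1 i.2 k - μ : ℝ) : ℂ) := by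
    ext i j
    rw [LinearMap.toMatrix_apply]
    simp only [OrthonormalBasis.coe_toBasis, ContinuousLinearMap.coe_coe,
      OrthonormalBasis.coe_toBasis_repr_apply, hA.onb_apply hk]
    rw [sub_apply, hA.eigen k hk, smul_apply, ContinuousLinearMap.id_apply, ← sub_smul,
      OrthonormalBasis.repr_apply_apply, hA.onb_apply hk, inner_smul_right,
      orthonormal_iff_ite.1 (hA.orthonormal hk) i j, Matrix.diagonal_apply]
    split_ifs with h
    · subst h; simp
    · simp
  rw [this, Matrix.det_diagonal]
  push_cast
  rfl

/-- The determinant is expanded in the fixed standard basis; no regularity in k is known for the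
eigenvectors. -/
theorem Admissible.contDiffOn_charFun (hA : A.Admissible) :
    ContDiffOn ℝ ∞ A.charFun (A.bandCrossingᶜ ×ˢ univ) := by
  have h1 : ContDiffOn ℝ ∞ (fun p : Wave d × ℝ =>
      A.L p.1 - (p.2 : ℂ) • ContinuousLinearMap.id ℂ (Amp J)) (A.bandCrossingᶜ ×ˢ univ) := by
    refine (hA.smooth.comp contDiff_fst.contDiffOn fun p hp => hp.1).sub ?_
    exact ((Complex.ofRealCLM.contDiff.comp contDiff_snd).smul contDiff_const).contDiffOn
  let b := (EuclideanSpace.basisFun (Fin (2 * J)) ℂ).toBasis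
  have h2 : A.charFun = fun p => ∑ σ : Equiv.Perm (Fin (2 * J)), Equiv.Perm.sign σ •
      ∏ i, b.repr ((A.L p.1 - (p.2 : ℂ) • ContinuousLinearMap.id ℂ (Amp J)) (b i)) (σ i) := by
    funext p
    rw [charFun, ← LinearMap.det_toMatrix b, Matrix.det_apply]
    simp [LinearMap.toMatrix_apply]
  rw [h2]
  refine ContDiffOn.sum fun σ _ => ?_
  have h3 : ContDiffOn ℝ ∞ (fun p : Wave d × ℝ => ∏ i,
      b.repr ((A.L p.1 - (p.2 : ℂ) • ContinuousLinearMap.id ℂ (Amp J)) (b i)) (σ i))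
      (A.bandCrossingᶜ ×ˢ univ) := by
    refine contDiffOn_prod fun i _ => ?_
    let ℓ : (Amp J →L[ℂ] Amp J) →L[ℂ] ℂ :=
      (EuclideanSpace.proj (𝕜 := ℂ) (σ i)).comp (ContinuousLinearMap.apply ℂ (Amp J) (b i))
    exact (ℓ.restrictScalars ℝ).contDiff.comp_contDiffOn h1
  rcases Int.units_eq_one_or (Equiv.Perm.sign σ) with h | h
  · simpa [h] using h3
  · simpa [h] using h3.neg

end LinearPart
end Wavepacket

namespace Wavepacket

/-- `sgn` takes the values `±1`. -/
theorem sgn_eq (ζ : ℤˣ) : sgn ζ = 1 ∨ sgn ζ = -1 := by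
  rcases Int.units_eq_one_or ζ with rfl | rfl <;> simp [sgn]

namespace LinearPart

open Filter Topology

variable {d J : ℕ} {A : LinearPart d J}

theorem isInvertible_of_apply_one_ne_zero {f : ℝ →L[ℝ] ℝ} (h : f 1 ≠ 0) : f.IsInvertible := by
  refine ⟨ContinuousLinearEquiv.unitsEquivAut ℝ (Units.mk0 _ h), ?_⟩
  ext
  simp

/-- A simple root of the characteristic function depends smoothly on k by the implicit function
theorem. The assumed continuity of ω_{n,ζ} identifies it with the local root branch. -/
theorem Admissible.contDiffAt_freq (hA : A.Admissible) {k : Wave d} (hk : k ∉ A.bandCrossing)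
    (n : Fin J) (ζ : ℤˣ) : ContDiffAt ℝ ∞ (A.freq n ζ) k := by
  set f : Wave d × ℝ → ℝ := fun p => (A.charFun p).re with hf
  set u : Wave d × ℝ := (k, A.freq n ζ k) with hu
  have hfe : ∀ k' ∉ A.bandCrossing, ∀ μ, f (k', μ) = ∏ i : Fin J × ℤˣ, (A.freq i.1 i.2 k' - μ) :=
    fun k' hk' μ => by rw [hf]; simp only; rw [hA.charFun_eq hk', Complex.ofReal_re]
  have hf0 : ∀ k' ∉ A.bandCrossing, f (k', A.freq n ζ k') = 0 := fun k' hk' => by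
    rw [hfe k' hk']
    exact Finset.prod_eq_zero (Finset.mem_univ (n, ζ)) (sub_self _)
  have cdf : ContDiffAt ℝ ∞ f u := by
    have h1 : ContDiffAt ℝ ∞ A.charFun u := hA.contDiffOn_charFun.contDiffAt
      ((hA.isOpen.prod isOpen_univ).mem_nhds ⟨hk, mem_univ _⟩)
    exact Complex.reCLM.contDiff.contDiffAt.comp u h1
  have hder : HasDerivAt (fun μ => f (k, μ))
      (-(∏ i ∈ Finset.univ.erase ((n, ζ) : Fin J × ℤˣ), (A.freq i.1 i.2 k - A.freq n ζ k)))
      (A.freq n ζ k) := by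
    have h1 : HasDerivAt (fun μ => A.freq n ζ k - μ) (-1) (A.freq n ζ k) := by
      simpa using (hasDerivAt_id (A.freq n ζ k)).const_sub (A.freq n ζ k)
    have h2 : DifferentiableAt ℝ (fun μ => ∏ i ∈ Finset.univ.erase ((n, ζ) : Fin J × ℤˣ),
        (A.freq i.1 i.2 k - μ)) (A.freq n ζ k) := by fun_prop
    have h3 := h1.mul h2.hasDerivAt
    have h4 : (fun μ => f (k, μ)) = (fun μ => A.freq n ζ k - μ) *
        fun μ => ∏ i ∈ Finset.univ.erase ((n, ζ) : Fin J × ℤˣ), (A.freq i.1 i.2 k - μ) := by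
      funext μ
      rw [hfe k hk, Pi.mul_apply, ← Finset.mul_prod_erase _ _ (Finset.mem_univ (n, ζ))]
    rw [h4]
    refine h3.congr_deriv ?_
    simp
  have hinv : (fderiv ℝ f u ∘L .inr ℝ (Wave d) ℝ).IsInvertible := by
    apply isInvertible_of_apply_one_ne_zero
    have h1 : HasDerivAt (fun μ : ℝ => f (k, μ)) (fderiv ℝ f u (0, 1)) (A.freq n ζ k) := by
      have := (cdf.differentiableAt (by simp)).hasFDerivAt
      exact this.comp_hasDerivAt (A.freq n ζ k)
        ((hasDerivAt_const _ k).prodMk (hasDerivAt_id (A.freq n ζ k)))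
    simp only [ContinuousLinearMap.comp_apply, ContinuousLinearMap.inr_apply]
    -- The μ-derivative at the root is minus the product of its differences with the other
    -- eigenvalues, none of which vanishes.
    rw [h1.unique hder, neg_ne_zero, Finset.prod_ne_zero_iff]
    intro i hi
    rw [sub_ne_zero]
    exact (hA.freq_injective hk).ne (Finset.ne_of_mem_erase hi)
  have hev := cdf.eventually_apply_eq_iff_implicitFunction (by simp) hinv
  have hcont : ContinuousAt (fun k' => (k', A.freq n ζ k')) k :=
    continuousAt_id.prodMk ((hA.continuous_omega n ζ).continuousAt (hA.isOpen.mem_nhds hk))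
  have hev2 : ∀ᶠ k' in 𝓝 k, cdf.implicitFunction (by simp) hinv k' = A.freq n ζ k' := by
    filter_upwards [hcont.eventually hev, hA.isOpen.mem_nhds hk] with k' h1 h2
    exact h1.1 (by rw [hf0 k' h2, hu, hf0 k hk])
  exact (cdf.contDiffAt_implicitFunction (by simp) hinv).congr_of_eventuallyEq
    (hev2.mono fun _ h => h.symm)

theorem Admissible.contDiffOn_freq (hA : A.Admissible) (n : Fin J) (ζ : ℤˣ) :
    ContDiffOn ℝ ∞ (A.freq n ζ) A.bandCrossingᶜ :=
  fun _ hk => (hA.contDiffAt_freq hk n ζ).contDiffWithinAt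

/-- Lagrange interpolation: the product of (L − ω_a)/(ω_i − ω_a) over a in the list acts on each
eigenvector by the displayed scalar and is smooth in k because L and the ω's are. Over all a ≠ i it
is the spectral projection, so the projection is smooth although g_{n,ζ} itself may jump in phase.
-/
theorem Admissible.exists_lagrange (hA : A.Admissible) (i : Fin J × ℤˣ)
    (l : List (Fin J × ℤˣ)) (hl : i ∉ l) :
    ∃ P : Wave d → Amp J →L[ℂ] Amp J, ContDiffOn ℝ ∞ P A.bandCrossingᶜ ∧
      ∀ k ∉ A.bandCrossing, ∀ j : Fin J × ℤˣ, P k (A.vec j.1 j.2 k) =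
        (l.map fun a => (((A.freq i.1 i.2 k - A.freq a.1 a.2 k)⁻¹ *
          (A.freq j.1 j.2 k - A.freq a.1 a.2 k) : ℝ) : ℂ)).prod • A.vec j.1 j.2 k := by
  induction l with
  | nil => exact ⟨fun _ => ContinuousLinearMap.id ℂ _, contDiffOn_const, fun k _ j => by simp⟩
  | cons a l ih =>
    rw [List.mem_cons, not_or] at hl
    obtain ⟨P, hP, hPv⟩ := ih hl.2
    refine ⟨fun k => (((A.freq i.1 i.2 k - A.freq a.1 a.2 k)⁻¹ : ℝ) : ℂ) •
      ((A.L k - (A.freq a.1 a.2 k : ℂ) • ContinuousLinearMap.id ℂ (Amp J)) ∘L P k), ?_, ?_⟩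
    · have h1 : ContDiffOn ℝ ∞
          (fun k => (((A.freq i.1 i.2 k - A.freq a.1 a.2 k)⁻¹ : ℝ) : ℂ)) A.bandCrossingᶜ :=
        Complex.ofRealCLM.contDiff.comp_contDiffOn
          (((hA.contDiffOn_freq _ _).sub (hA.contDiffOn_freq _ _)).inv fun k hk =>
            sub_ne_zero.2 ((hA.freq_injective hk).ne hl.1))
      have h2 : ContDiffOn ℝ ∞ (fun k => A.L k -
          (A.freq a.1 a.2 k : ℂ) • ContinuousLinearMap.id ℂ (Amp J)) A.bandCrossingᶜ :=
        hA.smooth.sub ((Complex.ofRealCLM.contDiff.comp_contDiffOn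
          (hA.contDiffOn_freq _ _)).smul contDiffOn_const)
      exact h1.smul (((ContinuousLinearMap.compL ℂ (Amp J) (Amp J)
        (Amp J)).isBoundedBilinearMap.contDiff.restrict_scalars ℝ).comp_contDiffOn (h2.prodMk hP))
    · intro k hk j
      simp only [smul_apply, ContinuousLinearMap.comp_apply, hPv k hk j, map_smul, sub_apply,
        hA.eigen k hk, ContinuousLinearMap.id_apply, List.map_cons, List.prod_cons,
        smul_smul, ← sub_smul]
      congr 1
      push_cast
      ring

theorem Admissible.contDiffOn_projL (hA : A.Admissible) (n : Fin J) (ζ : ℤˣ) :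
    ContDiffOn ℝ ∞ (A.projL n ζ) A.bandCrossingᶜ := by
  obtain ⟨P, hP, hPv⟩ := hA.exists_lagrange (n, ζ)
    (Finset.univ.erase ((n, ζ) : Fin J × ℤˣ)).toList (by simp)
  refine hP.congr fun k hk => ?_
  have : ((A.projL n ζ k : Amp J →L[ℂ] Amp J) : Amp J →ₗ[ℂ] Amp J) = (P k : Amp J →ₗ[ℂ] Amp J) := by
    refine (hA.onb hk).toBasis.ext fun j => ?_
    simp only [OrthonormalBasis.coe_toBasis, hA.onb_apply, ContinuousLinearMap.coe_coe]
    rw [hPv k hk j, projL_apply, proj, orthonormal_iff_ite.1 (hA.orthonormal hk) (n, ζ) j,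
      Finset.prod_map_toList]
    split_ifs with h
    · subst h
      congr 1
      symm
      refine Finset.prod_eq_one fun a ha => ?_
      rw [inv_mul_cancel₀]
      · simp
      · exact sub_ne_zero.2 ((hA.freq_injective hk).ne (Finset.ne_of_mem_erase ha).symm)
    · rw [zero_smul]
      symm
      refine smul_eq_zero_of_left ?_ _
      refine Finset.prod_eq_zero (Finset.mem_erase.2 ⟨Ne.symm h, Finset.mem_univ j⟩) ?_
      simp
  exact ContinuousLinearMap.coe_injective this

/-- The mean value inequality on a ball of radius ‖k−k₀‖+‖y‖, on which the locally Lipschitz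
derivative differs from its value at k₀ by a multiple of that radius. The derivative is frozen at
k₀, since one velocity per packet must serve all nearby k. -/
theorem exists_second_order_bound {f : Wave d → ℝ} {k₀ : Wave d} (hf : ContDiffAt ℝ ∞ f k₀) :
    ∃ δ > 0, ∃ C ≥ 0, ∀ k y : Wave d, ‖k - k₀‖ ≤ δ → ‖y‖ ≤ δ →
      |f (k + y) - f k - fderiv ℝ f k₀ y| ≤ C * ‖y‖ * (‖k - k₀‖ + ‖y‖) := by
  have h1 : ContDiffAt ℝ 1 (fderiv ℝ f) k₀ := (hf.of_le (m := 2) (WithTop.coe_le_coe.2 le_top)).fderiv_right (by norm_num)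
  obtain ⟨K, t, ht, hK⟩ := h1.exists_lipschitzOnWith
  have h2 : ∀ᶠ k in 𝓝 k₀, DifferentiableAt ℝ f k := by
    have := (hf.of_le (m := 1) (by simp)).eventually (by simp)
    exact this.mono fun k hk => hk.differentiableAt (by simp)
  obtain ⟨r, hr, hball⟩ := Metric.mem_nhds_iff.1 (inter_mem ht h2)
  refine ⟨r / 4, by positivity, K, K.2, fun k y hk hy => ?_⟩
  set ρ := ‖k - k₀‖ + ‖y‖ with hρ
  have hsub : Metric.closedBall k₀ ρ ⊆ Metric.ball k₀ r :=
    Metric.closedBall_subset_ball (by rw [hρ]; linarith)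
  have hconv := (convex_closedBall k₀ ρ).norm_image_sub_le_of_norm_hasFDerivWithin_le'
    (f := f) (f' := fderiv ℝ f) (φ := fderiv ℝ f k₀) (C := K * ρ) (x := k) (y := k + y)
    (fun z hz => (hball (hsub hz)).2.hasFDerivAt.hasFDerivWithinAt)
    (fun z hz => by
      have := hK.dist_le_mul z (hball (hsub hz)).1 k₀ (mem_of_mem_nhds ht)
      rw [dist_eq_norm] at this
      exact this.trans (mul_le_mul_of_nonneg_left hz K.2))
    (by rw [Metric.mem_closedBall, dist_eq_norm, hρ]; linarith [norm_nonneg y])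
    (by
      rw [Metric.mem_closedBall, dist_eq_norm, hρ, add_sub_right_comm]
      exact norm_add_le _ _)
  rw [add_sub_cancel_left, Real.norm_eq_abs] at hconv
  linarith

/-- By ω_{n,−}(−k) = −ω_{n,+}(k), the gradient of ω_{n,ζ} at ζk₀ does not depend on ζ. Both halves
of a packet therefore move with the same velocity. -/
theorem Admissible.exists_freq_second_order (hA : A.Admissible) {k₀ : Wave d}
    (hk : k₀ ∉ A.bandCrossing) (n : Fin J) (ζ : ℤˣ) :
    ∃ δ > 0, ∃ C ≥ 0, ∀ k y : Wave d, ‖k - sgn ζ • k₀‖ ≤ δ → ‖y‖ ≤ δ →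
      |A.freq n ζ (k + y) - A.freq n ζ k - inner ℝ (gradient (A.freq n 1) k₀) y| ≤
        C * ‖y‖ * (‖k - sgn ζ • k₀‖ + ‖y‖) := by
  obtain ⟨δ, hδ, C, hC, h⟩ := exists_second_order_bound (hA.contDiffAt_freq hk n 1)
  have hg : ∀ y, inner ℝ (gradient (A.freq n 1) k₀) y = fderiv ℝ (A.freq n 1) k₀ y := fun y => by
    simp [gradient]
  rcases Int.units_eq_one_or ζ with rfl | rfl
  · refine ⟨δ, hδ, C, hC, fun k y hk hy => ?_⟩
    rw [hg]
    simpa [sgn] using h k y (by simpa [sgn] using hk) hy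
  · obtain ⟨r, hr, hball⟩ := Metric.isOpen_iff.1 hA.isOpen k₀ hk
    -- The radius r/3 keeps both −k and −(k + y) in the ball around k₀ that avoids the band
    -- crossing, where the symmetry is available.
    refine ⟨min δ (r / 3), by positivity, C, hC, fun k y hk hy => ?_⟩
    have hs : sgn (-1) = -1 := by simp [sgn]
    have hn : ‖-k - k₀‖ = ‖k - sgn (-1) • k₀‖ := by
      rw [hs, ← norm_neg]
      congr 1
      module
    have hsym : ∀ z : Wave d, ‖z - sgn (-1) • k₀‖ < r → A.freq n (-1) z = -A.freq n 1 (-z) := by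
      intro z hz
      have hz' : -z ∉ A.bandCrossing := by
        apply hball
        rw [Metric.mem_ball, dist_eq_norm]
        convert hz using 1
        rw [hs, ← norm_neg]
        congr 1
        module
      have := hA.symm (-z) hz' n 1
      rwa [neg_neg] at this
    have h1 := h (-k) (-y) (by rw [hn]; exact hk.trans (min_le_left _ _))
      (by rw [norm_neg]; exact hy.trans (min_le_left _ _))
    have hk3 := hk.trans (min_le_right _ _)
    have hy3 := hy.trans (min_le_right _ _)
    rw [hsym k (by linarith), hsym (k + y) (by
      rw [add_sub_right_comm]
      exact (norm_add_le _ _).trans_lt (by linarith)), hg, neg_add]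
    rw [hn, norm_neg, map_neg, ← abs_neg] at h1
    convert h1 using 2
    ring

end LinearPart
end Wavepacket

namespace Wavepacket

open Filter Topology

/-! ### Integral equations in Banach spaces -/

/-- Gronwall by an exponentially weighted maximum: if M is the maximum of D(s)exp(−2Ks), the
integral term contributes at most half of M exp(2Kσ) at the maximizer σ, whence M ≤ 2E. -/
theorem le_of_integral_inequality {D : ℝ → ℝ} {T K E : ℝ} (hK : 0 < K)
    (hE : 0 ≤ E) (hD : ContinuousOn D (Icc 0 T))
    (h : ∀ τ ∈ Icc 0 T, D τ ≤ E + K * ∫ s in (0 : ℝ)..τ, D s) :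
    ∀ τ ∈ Icc 0 T, D τ ≤ 2 * E * Real.exp (2 * K * T) := by
  intro τ hτ
  have hne : (Icc 0 T).Nonempty := ⟨τ, hτ⟩
  have hc : ContinuousOn (fun s => D s * Real.exp (-(2 * K * s))) (Icc 0 T) :=
    hD.mul (by fun_prop)
  obtain ⟨σ, hσ, hmax⟩ := isCompact_Icc.exists_isMaxOn hne hc
  set M := D σ * Real.exp (-(2 * K * σ)) with hM
  have hbd : ∀ s ∈ Icc 0 T, D s ≤ M * Real.exp (2 * K * s) := fun s hs => by
    have h1 : D s * Real.exp (-(2 * K * s)) ≤ M := hmax hs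
    calc D s = D s * Real.exp (-(2 * K * s)) * Real.exp (2 * K * s) := by
          rw [mul_assoc, ← Real.exp_add]; simp
      _ ≤ _ := by gcongr
  have hME : M ≤ 2 * E := by
    rcases le_or_gt M 0 with hM0 | hM0
    · linarith
    have h1 : ∫ s in (0 : ℝ)..σ, D s ≤ ∫ s in (0 : ℝ)..σ, M * Real.exp (2 * K * s) := by
      refine intervalIntegral.integral_mono_on hσ.1 ?_ ?_ fun s hs => hbd s ⟨hs.1, hs.2.trans hσ.2⟩
      · exact (hD.mono (by rw [uIcc_of_le hσ.1]; exact Icc_subset_Icc_right hσ.2)).intervalIntegrable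
      · exact Continuous.intervalIntegrable (by fun_prop) _ _
    have h2 : ∫ s in (0 : ℝ)..σ, M * Real.exp (2 * K * s) =
        M * ((2 * K)⁻¹ * (Real.exp (2 * K * σ) - 1)) := by
      rw [intervalIntegral.integral_const_mul, intervalIntegral.integral_comp_mul_left
        (fun x => Real.exp x) (by positivity), integral_exp]
      simp
    have h3 := h σ hσ
    have h4 : D σ = M * Real.exp (2 * K * σ) := by
      rw [hM, mul_assoc, ← Real.exp_add]; simp
    have h5 : D σ ≤ E + M / 2 * (Real.exp (2 * K * σ) - 1) := by
      refine h3.trans ?_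
      have : K * ∫ s in (0 : ℝ)..σ, D s ≤ K * (M * ((2 * K)⁻¹ * (Real.exp (2 * K * σ) - 1))) := by
        rw [← h2]; gcongr
      have h6 : K * (M * ((2 * K)⁻¹ * (Real.exp (2 * K * σ) - 1))) =
          M / 2 * (Real.exp (2 * K * σ) - 1) := by field_simp
      linarith
    have h7 : 1 ≤ Real.exp (2 * K * σ) := Real.one_le_exp (by have := hσ.1; positivity)
    rw [h4] at h5
    nlinarith
  calc D τ ≤ M * Real.exp (2 * K * τ) := hbd τ hτ
    _ ≤ 2 * E * Real.exp (2 * K * T) := by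
      have := hτ.2
      gcongr

/-! ### Picard iteration under linear constraints -/

section Picard

variable {X Y : Type*} [NormedAddCommGroup X] [NormedSpace ℝ X] [CompleteSpace X]
  [NormedAddCommGroup Y] [NormedSpace ℝ Y] [CompleteSpace Y]

theorem norm_apply_add_integral_le {T : ℝ} {g : ℝ → X} {τ : ℝ} (hτ : τ ∈ Icc 0 T)
    (hg : IntervalIntegrable g volume 0 τ) (A : X →L[ℝ] Y) (x₀ : X) {c b : ℝ}
    (hb : ∀ s ∈ Icc 0 T, ‖A (g s)‖ ≤ b) (h : ‖A x₀‖ + T * b ≤ c) :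
    ‖A (x₀ + ∫ s in (0 : ℝ)..τ, g s)‖ ≤ c := by
  rw [map_add, ← A.intervalIntegral_comp_comm hg]
  have hb0 : 0 ≤ b := (norm_nonneg _).trans (hb 0 ⟨le_rfl, hτ.1.trans hτ.2⟩)
  have h1 : ‖∫ s in (0 : ℝ)..τ, A (g s)‖ ≤ b * |τ - 0| := by
    refine intervalIntegral.norm_integral_le_of_norm_le_const fun s hs => hb s ?_
    rw [uIoc_of_le hτ.1] at hs
    exact ⟨hs.1.le, hs.2.trans hτ.2⟩
  rw [sub_zero, abs_of_nonneg hτ.1] at h1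
  have h2 : b * τ ≤ T * b := by rw [mul_comm]; gcongr; exact hτ.2
  exact (norm_add_le _ _).trans (by linarith)

/-- Picard iteration in a closed set cut out by bounds on continuous linear maps. -/
theorem exists_solution_of_invariant {T K : ℝ} (hT : 0 ≤ T) (hK : 0 ≤ K) (hKT : T * K ≤ 1 / 2)
    (f : ℝ → X → X) (x₀ : X) {ι : Type*} (A : ι → X →L[ℝ] Y) (c : ι → ℝ)
    (hx₀ : ∀ i, ‖A i x₀‖ ≤ c i)
    (hinv : ∀ i, ∃ b, ‖A i x₀‖ + T * b ≤ c i ∧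
      ∀ s ∈ Icc 0 T, ∀ x, (∀ i, ‖A i x‖ ≤ c i) → ‖A i (f s x)‖ ≤ b)
    (hlip : ∀ s ∈ Icc 0 T, ∀ x y, (∀ i, ‖A i x‖ ≤ c i) → (∀ i, ‖A i y‖ ≤ c i) →
      ‖f s x - f s y‖ ≤ K * ‖x - y‖)
    (hcont : ∀ w : ℝ → X, ContinuousOn w (Icc 0 T) →
      ContinuousOn (fun s => f s (w s)) (Icc 0 T)) :
    ∃ w : ℝ → X, ContinuousOn w (Icc 0 T) ∧ (∀ s ∈ Icc 0 T, ∀ i, ‖A i (w s)‖ ≤ c i) ∧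
      ∀ τ ∈ Icc 0 T, w τ = x₀ + ∫ s in (0 : ℝ)..τ, f s (w s) := by
  let ext : C(Icc (0 : ℝ) T, X) → ℝ → X := fun w => IccExtend hT w
  have hext : ∀ w, Continuous (ext w) := fun w => w.continuous.Icc_extend'
  have hfc : ∀ w, ContinuousOn (fun s => f s (ext w s)) (Icc 0 T) :=
    fun w => hcont _ (hext w).continuousOn
  have hint : ∀ w, ∀ τ ∈ Icc 0 T,
      IntervalIntegrable (fun s => f s (ext w s)) volume 0 τ := fun w τ hτ =>
    ((hfc w).mono (by rw [uIcc_of_le hτ.1]; exact Icc_subset_Icc_right hτ.2)).intervalIntegrable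
  have hprim : ∀ w, ContinuousOn (fun τ => ∫ s in (0 : ℝ)..τ, f s (ext w s)) (Icc 0 T) := by
    intro w
    have := intervalIntegral.continuousOn_primitive_interval (a := (0 : ℝ)) (b := T)
      (μ := volume) (f := fun s => f s (ext w s))
      (by rw [uIcc_of_le hT]; exact (hfc w).integrableOn_Icc)
    rwa [uIcc_of_le hT] at this
  let Φ : C(Icc (0 : ℝ) T, X) → C(Icc (0 : ℝ) T, X) := fun w =>
    ⟨fun τ => x₀ + ∫ s in (0 : ℝ)..τ, f s (ext w s),
      continuous_const.add (continuousOn_iff_continuous_domRestrict.1 (hprim w))⟩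
  -- Bounds on continuous linear images are closed conditions and survive integration in time, so
  -- invariance of S needs only pointwise bounds on A i (f s x). Infinitely many constraints are
  -- allowed.
  let S : Set C(Icc (0 : ℝ) T, X) := {w | ∀ τ i, ‖A i (w τ)‖ ≤ c i}
  have hSclosed : IsClosed S := by
    simp only [S, ofPred_forall]
    refine isClosed_iInter fun τ => isClosed_iInter fun i => ?_
    exact isClosed_le (((A i).continuous.comp (continuous_eval_const τ)).norm) continuous_const
  have hextS : ∀ w ∈ S, ∀ s i, ‖A i (ext w s)‖ ≤ c i := fun w hw s i => hw _ i
  have hmaps : MapsTo Φ S S := by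
    intro w hw τ i
    obtain ⟨b, hb, hb'⟩ := hinv i
    exact norm_apply_add_integral_le τ.2 (hint w _ τ.2) (A i) x₀
      (fun s hs => hb' s hs _ (hextS w hw s)) hb
  -- Φ is Lipschitz on S with constant T·K ≤ 1/2.
  have hcontr : ContractingWith (1 / 2) (hmaps.restrict Φ S S) := by
    refine ⟨by norm_num, LipschitzWith.of_dist_le_mul fun w w' => ?_⟩
    rw [Subtype.dist_eq, Subtype.dist_eq, ContinuousMap.dist_le (by positivity)]
    intro τ
    change dist (x₀ + ∫ s in (0 : ℝ)..τ, f s (ext w s))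
      (x₀ + ∫ s in (0 : ℝ)..τ, f s (ext w' s)) ≤ _
    rw [dist_add_left, dist_eq_norm, ← intervalIntegral.integral_sub (hint _ _ τ.2)
      (hint _ _ τ.2)]
    have h1 : ‖∫ s in (0 : ℝ)..τ, (f s (ext w s) - f s (ext w' s))‖ ≤
        K * dist (w : C(Icc (0 : ℝ) T, X)) w' * |(τ : ℝ) - 0| := by
      refine intervalIntegral.norm_integral_le_of_norm_le_const fun s hs => ?_
      rw [uIoc_of_le τ.2.1] at hs
      refine (hlip s ⟨hs.1.le, hs.2.trans τ.2.2⟩ _ _ (hextS _ w.2 s) (hextS _ w'.2 s)).trans ?_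
      gcongr
      rw [← dist_eq_norm]
      exact ContinuousMap.dist_apply_le_dist _
    refine h1.trans ?_
    rw [sub_zero, abs_of_nonneg τ.2.1]
    have h2 : K * τ ≤ 1 / 2 := by
      refine le_trans ?_ hKT
      rw [mul_comm]
      exact mul_le_mul_of_nonneg_right τ.2.2 hK
    have h3 := dist_nonneg (x := (w : C(Icc (0 : ℝ) T, X))) (y := w')
    have : ((1 / 2 : NNReal) : ℝ) = 1 / 2 := by norm_num
    rw [this]
    nlinarith
  have hconst : ContinuousMap.const _ x₀ ∈ S := fun τ i => hx₀ i
  obtain ⟨w, hwS, hw, -⟩ := hcontr.exists_fixedPoint' hSclosed.isComplete hmaps hconst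
    (edist_ne_top _ _)
  refine ⟨ext w, (hext w).continuousOn, fun s _ i => hextS w hwS s i, fun τ hτ => ?_⟩
  have h1 : ext w τ = w ⟨τ, hτ⟩ := IccExtend_of_mem hT w hτ
  rw [h1]
  conv_lhs => rw [← hw]
  rfl

end Picard

/-! ### Averaging of oscillating multilinear operators -/

section Oscillation

variable {m : ℕ} {X : Type*} [NormedAddCommGroup X] [NormedSpace ℝ X] [CompleteSpace X]

/-- Summing over n + 1 equal subintervals, the quadratic terms add up to O(1/n). It replaces
differentiation of Γ, which is only Lipschitz. -/
theorem norm_sub_le_of_quadratic {Γ : ℝ → X} {T a c : ℝ}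
    (h : ∀ s ∈ Icc 0 T, ∀ t ∈ Icc 0 T, s ≤ t → ‖Γ t - Γ s‖ ≤ a * (t - s) + c * (t - s) ^ 2)
    {τ : ℝ} (hτ : τ ∈ Icc 0 T) : ‖Γ τ - Γ 0‖ ≤ a * τ := by
  have key : ∀ n : ℕ, ‖Γ τ - Γ 0‖ ≤ a * τ + c * τ ^ 2 / (n + 1) := by
    intro n
    have hn : (0 : ℝ) < n + 1 := by positivity
    have h1 : ∀ i : ℕ, i ≤ n + 1 → ‖Γ (i * (τ / (n + 1))) - Γ 0‖ ≤
        i * (a * (τ / (n + 1)) + c * (τ / (n + 1)) ^ 2) := by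
      intro i
      have hmem : ∀ i : ℕ, i ≤ n + 1 → (i : ℝ) * (τ / (n + 1)) ∈ Icc 0 T := by
        intro i hi
        refine ⟨by have := hτ.1; positivity, le_trans ?_ hτ.2⟩
        rw [mul_div_assoc', div_le_iff₀ hn, mul_comm]
        gcongr
        · exact hτ.1
        · exact_mod_cast hi
      induction i with
      | zero => intro _; simp
      | succ i ih =>
        intro hi
        have h2 := h _ (hmem i (by omega)) _ (hmem (i + 1) hi) (by
          push_cast
          have : 0 ≤ τ / (n + 1) := by have := hτ.1; positivity
          nlinarith)
        have h3 : ((i + 1 : ℕ) : ℝ) * (τ / (n + 1)) - i * (τ / (n + 1)) = τ / (n + 1) := by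
          push_cast; ring
        rw [h3] at h2
        calc ‖Γ (((i + 1 : ℕ) : ℝ) * (τ / (n + 1))) - Γ 0‖
            ≤ ‖Γ (((i + 1 : ℕ) : ℝ) * (τ / (n + 1))) - Γ (i * (τ / (n + 1)))‖ +
              ‖Γ (i * (τ / (n + 1))) - Γ 0‖ := norm_sub_le_norm_sub_add_norm_sub _ _ _
          _ ≤ _ := by
              have := ih (by omega)
              push_cast at *
              linarith
    have h2 := h1 (n + 1) le_rfl
    have h3 : ((n + 1 : ℕ) : ℝ) * (τ / (n + 1)) = τ := by push_cast; field_simp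
    rw [h3] at h2
    refine h2.trans (le_of_eq ?_)
    push_cast
    field_simp
  have hlim : Tendsto (fun n : ℕ => a * τ + c * τ ^ 2 / ((n : ℝ) + 1)) atTop (𝓝 (a * τ + 0)) := by
    refine tendsto_const_nhds.add ?_
    have := (tendsto_one_div_add_atTop_nhds_zero_nat (𝕜 := ℝ)).const_mul (c * τ ^ 2)
    simpa [div_eq_mul_inv] using this
  rw [add_zero] at hlim
  exact ge_of_tendsto' hlim key

theorem norm_multilinear_sub_le {q : ContinuousMultilinearMap ℝ (fun _ : Fin m => X) X} {C B : ℝ}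
    (hq : ‖q‖ ≤ C) {x y : Fin m → X} (hx : ‖x‖ ≤ B) (hy : ‖y‖ ≤ B) :
    ‖q x - q y‖ ≤ C * m * B ^ (m - 1) * ‖x - y‖ := by
  refine (q.norm_image_sub_le x y).trans ?_
  rw [Fintype.card_fin]
  have h0 : 0 ≤ C := (norm_nonneg _).trans hq
  have h1 : max ‖x‖ ‖y‖ ≤ B := max_le hx hy
  gcongr

theorem norm_multilinear_le {q : ContinuousMultilinearMap ℝ (fun _ : Fin m => X) X} {C B : ℝ}
    (hq : ‖q‖ ≤ C) {x : Fin m → X} (hx : ‖x‖ ≤ B) : ‖q x‖ ≤ C * B ^ m := by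
  refine (q.le_opNorm x).trans ?_
  have h0 : 0 ≤ C := (norm_nonneg _).trans hq
  calc ‖q‖ * ∏ i, ‖x i‖ ≤ C * ∏ i : Fin m, B := by
        gcongr with i
        exact (norm_le_pi_norm x i).trans hx
    _ = _ := by simp

/-- Integration by parts for an oscillating multilinear operator `M = N'`. -/
theorem norm_integral_oscillating_le
    {M N : ℝ → ContinuousMultilinearMap ℝ (fun _ : Fin m => X) X} {w : ℝ → Fin m → X}
    {T ν B L C₂ C₃ C₄ : ℝ} (hL0 : 0 ≤ L) (hC₃ : 0 ≤ C₃)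
    (hw : ∀ s ∈ Icc 0 T, ‖w s‖ ≤ B)
    (hL : ∀ s ∈ Icc 0 T, ∀ t ∈ Icc 0 T, ‖w t - w s‖ ≤ L * |t - s|)
    (hN : ∀ s, ‖N s‖ ≤ ν) (hNM : ∀ s h, 0 ≤ h → ‖N (s + h) - N s - h • M s‖ ≤ C₂ * h ^ 2)
    (hM : ∀ s t, ‖M t - M s‖ ≤ C₃ * |t - s|) (hMb : ∀ s, ‖M s‖ ≤ C₄)
    {τ : ℝ} (hτ : τ ∈ Icc 0 T) :
    ‖∫ s in (0 : ℝ)..τ, M s (w s)‖ ≤ 2 * (ν * B ^ m) + ν * m * B ^ (m - 1) * L * τ := by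
  have hB : 0 ≤ B := (norm_nonneg _).trans (hw τ hτ)
  have hC₄ : 0 ≤ C₄ := (norm_nonneg _).trans (hMb 0)
  set Q := C₃ * B ^ m + C₄ * m * B ^ (m - 1) * L with hQ
  have hQ0 : 0 ≤ Q := by positivity
  have hg : ∀ s ∈ Icc 0 T, ∀ t ∈ Icc 0 T, ‖M t (w t) - M s (w s)‖ ≤ Q * |t - s| := by
    intro s hs t ht
    have h1 : M t (w t) - M s (w s) = (M t - M s) (w t) + (M s (w t) - M s (w s)) := by
      rw [sub_apply]; abel
    rw [h1]
    refine (norm_add_le _ _).trans ?_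
    have h2 := norm_multilinear_le (hM s t) (hw t ht)
    have h3 := norm_multilinear_sub_le (hMb s) (hw t ht) (hw s hs)
    have h4 := mul_le_mul_of_nonneg_left (hL s hs t ht)
      (by positivity : 0 ≤ C₄ * m * B ^ (m - 1))
    rw [hQ]
    nlinarith
  have hcont : ContinuousOn (fun s => M s (w s)) (Icc 0 T) := by
    refine (LipschitzOnWith.of_dist_le_mul (K := ⟨Q, hQ0⟩) fun t ht s hs => ?_).continuousOn
    rw [dist_eq_norm, Real.dist_eq]
    exact hg s hs t ht
  have hint : ∀ s ∈ Icc 0 T, ∀ t ∈ Icc 0 T, IntervalIntegrable (fun s => M s (w s)) volume s t :=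
    fun s hs t ht => (hcont.mono (uIcc_subset_Icc hs ht)).intervalIntegrable
  have h0 : (0 : ℝ) ∈ Icc 0 T := ⟨le_rfl, hτ.1.trans hτ.2⟩
  -- Γ is the boundary term minus the integral. Its increments are linear in t − s only through the
  -- Lipschitz bound on w with coefficient ν, the small norm of N. All other errors are quadratic,
  -- so C₂, C₃ and C₄ disappear from the final bound.
  let Γ : ℝ → X := fun t => N t (w t) - ∫ s in (0 : ℝ)..t, M s (w s)
  have hΓ := norm_sub_le_of_quadratic (Γ := Γ) (T := T) (a := ν * m * B ^ (m - 1) * L)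
    (c := C₂ * B ^ m + Q) (fun s hs t ht hst => by
      have h1 : Γ t - Γ s = (N t (w t) - N t (w s)) + (N t - N s - (t - s) • M s) (w s) -
          ∫ r in s..t, (M r (w r) - M s (w s)) := by
        rw [intervalIntegral.integral_sub (hint s hs t ht) (by simp),
          intervalIntegral.integral_const,
          ← intervalIntegral.integral_interval_sub_left (hint 0 h0 t ht) (hint 0 h0 s hs)]
        simp only [Γ, sub_apply, smul_apply]
        abel
      have hts : |t - s| = t - s := abs_of_nonneg (sub_nonneg.2 hst)
      have h2 := norm_multilinear_sub_le (hN t) (hw t ht) (hw s hs)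
      have h3 := norm_multilinear_le (hNM s (t - s) (sub_nonneg.2 hst)) (hw s hs)
      rw [add_sub_cancel] at h3
      have h4 : ‖∫ r in s..t, (M r (w r) - M s (w s))‖ ≤ Q * (t - s) * |t - s| := by
        refine intervalIntegral.norm_integral_le_of_norm_le_const fun r hr => ?_
        rw [uIoc_of_le hst] at hr
        refine (hg s hs r ⟨hs.1.trans hr.1.le, hr.2.trans ht.2⟩).trans ?_
        rw [abs_of_nonneg (by linarith [hr.1])]
        gcongr
        exact hr.2
      have h5 := hL s hs t ht
      rw [hts] at h4 h5
      have hν : 0 ≤ ν := (norm_nonneg _).trans (hN 0)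
      have h6 := mul_le_mul_of_nonneg_left h5 (by positivity : 0 ≤ ν * m * B ^ (m - 1))
      rw [h1]
      refine (norm_sub_le _ _).trans ((add_le_add_left (norm_add_le _ _) _).trans ?_)
      nlinarith) hτ
  have h1 : ∫ s in (0 : ℝ)..τ, M s (w s) = N τ (w τ) - N 0 (w 0) - (Γ τ - Γ 0) := by
    simp only [Γ, intervalIntegral.integral_same]
    abel
  rw [h1]
  refine (norm_sub_le _ _).trans ((add_le_add_left (norm_sub_le _ _) _).trans ?_)
  have h2 := norm_multilinear_le (hN τ) (hw τ hτ)
  have h3 := norm_multilinear_le (hN 0) (hw 0 h0)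
  linarith

end Oscillation

end Wavepacket

namespace Wavepacket

open Filter Topology Nonlinearity

variable {d J : ℕ} {A : LinearPart d J} {B : Nonlinearity d J}

/-! ### The modal equation as an integral equation in `L¹` -/

namespace Nonlinearity

variable (B) in
/-- The susceptibility restricted to `k = k' + … + k^{(m)}`. -/
def chiSym (m : ℕ) : MSymbol d J m := fun x => B.χ m (∑ j, x j) x

variable (d) in
/-- The normalization factor of the `m`-th convolution. -/
def convConst (m : ℕ) : ℝ := ((2 * Real.pi) ^ ((m - 1) * d))⁻¹

theorem convConst_nonneg (m : ℕ) : 0 ≤ convConst d m := by unfold convConst; positivity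

theorem convConst_le_one (m : ℕ) : convConst d m ≤ 1 := by
  unfold convConst
  exact inv_le_one_of_one_le₀ (one_le_pow₀ (by linarith [Real.two_le_pi]))

theorem Admissible.exists_isSymbol (hB : B.Admissible A) (hA : A.Admissible) :
    ∃ C : ℝ, 0 ≤ C ∧ (∀ m ∈ B.M, ∀ (k : Wave d) (q : Fin m → Wave d), k ∉ A.bandCrossing →
      (∀ j, q j ∉ A.bandCrossing) → ‖B.χ m k q‖ ≤ C) ∧
      ∀ m ∈ B.M, IsSymbol (B.chiSym m) C := by
  obtain ⟨C, hC⟩ := hB.bounded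
  have hC' : ∀ m ∈ B.M, ∀ (k : Wave d) (q : Fin m → Wave d), k ∉ A.bandCrossing →
      (∀ j, q j ∉ A.bandCrossing) → ‖B.χ m k q‖ ≤ max C 0 :=
    fun m hm k q hk hq => (hC m hm k q hk hq).trans (le_max_left _ _)
  refine ⟨max C 0, le_max_right _ _, hC', fun m hm => ?_⟩
  have hm1 : 1 ≤ m := one_le_two.trans (hB.two_le m hm)
  have hae : ∀ᵐ x : Fin m → Wave d, x ∈ {x : Fin m → Wave d |
      ∑ j, x j ∉ A.bandCrossing ∧ ∀ j, x j ∉ A.bandCrossing} :=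
    (ae_sum hm1 hA.ae_notMem).and (ae_all_iff.2 fun j => ae_eval hA.ae_notMem j)
  refine ⟨?_, le_max_right _ _, hae.mono fun x hx => hC' m hm _ _ hx.1 hx.2⟩
  have hopen : IsOpen {x : Fin m → Wave d |
      ∑ j, x j ∉ A.bandCrossing ∧ ∀ j, x j ∉ A.bandCrossing} := by
    rw [ofPred_and, ofPred_forall]
    exact (hA.isOpen.preimage (by fun_prop)).inter
      (isOpen_iInter_of_finite fun j => hA.isOpen.preimage (by fun_prop))
  have hcont : ContinuousOn (B.chiSym m) {x : Fin m → Wave d |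
      ∑ j, x j ∉ A.bandCrossing ∧ ∀ j, x j ∉ A.bandCrossing} :=
    (hB.smooth m hm).continuousOn.comp (f := fun x : Fin m → Wave d => (∑ j, x j, x))
      (by fun_prop) fun x hx => hx
  have := hcont.aestronglyMeasurable (μ := volume) hopen.measurableSet
  rwa [Measure.restrict_eq_self_of_ae_mem hae] at this

end Nonlinearity

variable (A) in
/-- The propagator as an operator on `L¹`. -/
def propOp (t : ℝ) : AmpL1 d J →L[ℝ] AmpL1 d J := mulOp (A.propagator t)

theorem norm_propOp (hA : A.Admissible) (t : ℝ) (u : AmpL1 d J) : ‖propOp A t u‖ = ‖u‖ := by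
  rw [propOp, norm_mulOp_eq (hA.isMultiplier_propagator t), L1.norm_eq_integral_norm]
  simp_rw [hA.norm_propagator_apply]

/-- Dominated convergence, since the propagator is isometric at each k. L may be unbounded in k, so
continuity in t is only strong, not in operator norm. -/
theorem continuous_propOp_apply (hA : A.Admissible) (u : AmpL1 d J) :
    Continuous fun t => propOp A t u := by
  refine continuous_iff_continuousAt.2 fun t₀ => ?_
  rw [ContinuousAt, tendsto_iff_norm_sub_tendsto_zero]
  have h1 : ∀ t, ‖propOp A t u - propOp A t₀ u‖ =
      ∫ k, ‖A.propagator t k (u k) - A.propagator t₀ k (u k)‖ := fun t => by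
    rw [L1.norm_eq_integral_norm]
    refine integral_congr_ae ?_
    filter_upwards [Lp.coeFn_sub (propOp A t u) (propOp A t₀ u),
      mulOp_coe (hA.isMultiplier_propagator t) u,
      mulOp_coe (hA.isMultiplier_propagator t₀) u] with k h1 h2 h3
    rw [h1, Pi.sub_apply, propOp, propOp, h2, h3]
  simp_rw [h1]
  have h2 : ContinuousAt (fun t => ∫ k, ‖A.propagator t k (u k) - A.propagator t₀ k (u k)‖) t₀ := by
    refine continuousAt_of_dominated (bound := fun k => ‖u k‖ + ‖u k‖) ?_ ?_ ?_ ?_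
    · refine .of_forall fun t => ?_
      exact (((hA.isMultiplier_propagator t).isL1Bounded.integrable _
        (L1.integrable_coeFn u)).sub ((hA.isMultiplier_propagator t₀).isL1Bounded.integrable _
        (L1.integrable_coeFn u))).norm.1
    · refine .of_forall fun t => .of_forall fun k => ?_
      rw [norm_norm]
      refine (norm_sub_le _ _).trans ?_
      rw [hA.norm_propagator_apply, hA.norm_propagator_apply]
    · exact (L1.integrable_coeFn u).norm.add (L1.integrable_coeFn u).norm
    · refine .of_forall fun k => ?_
      have := (A.continuous_propagator k).clm_apply (continuous_const (y := u k))
      exact (this.sub continuous_const).norm.continuousAt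
  have h3 := h2.tendsto
  simpa using h3

theorem ContinuousOn.propOp (hA : A.Admissible) {S : Set ℝ} {φ : ℝ → ℝ} (hφ : Continuous φ)
    {w : ℝ → AmpL1 d J} (hw : ContinuousOn w S) :
    ContinuousOn (fun s => propOp A (φ s) (w s)) S := by
  intro s₀ hs₀
  rw [ContinuousWithinAt, tendsto_iff_norm_sub_tendsto_zero]
  have h1 : Tendsto (fun s => ‖w s - w s₀‖) (𝓝[S] s₀) (𝓝 0) :=
    tendsto_iff_norm_sub_tendsto_zero.1 (hw s₀ hs₀)
  have h2 : Tendsto (fun s => ‖Wavepacket.propOp A (φ s) (w s₀) -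
      Wavepacket.propOp A (φ s₀) (w s₀)‖) (𝓝[S] s₀) (𝓝 0) :=
    (tendsto_iff_norm_sub_tendsto_zero.1
      (((continuous_propOp_apply hA (w s₀)).comp hφ).tendsto s₀)).mono_left nhdsWithin_le_nhds
  have h3 := h1.add h2
  rw [add_zero] at h3
  refine squeeze_zero (fun _ => norm_nonneg _) (fun s => ?_) h3
  rw [← norm_propOp hA (φ s) (w s - w s₀), map_sub]
  exact norm_sub_le_norm_sub_add_norm_sub _ _ _

variable (A B) in
/-- The nonlinearity in the slow variables. -/
def forceOp (t : ℝ) (u : AmpL1 d J) : AmpL1 d J :=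
  ∑ m ∈ B.M, convConst d m • propOp A (-t) (symOp (B.chiSym m) fun _ => propOp A t u)

/-- This identifies the concrete integrals of the definition of a solution with a Lipschitz map on
L¹, on which the Banach space arguments run. -/
theorem slowForce_ae_eq (hA : A.Admissible) (hB : B.Admissible A) (ϱ τ : ℝ) (u : AmpL1 d J) :
    (forceOp A B (τ / ϱ) u : Wave d → Amp J) =ᵐ[volume] slowForce A B ϱ τ u := by
  obtain ⟨C, -, -, hC⟩ := hB.exists_isSymbol hA
  have h1 : ∀ m ∈ B.M, symOp (B.chiSym m) (fun _ => propOp A (τ / ϱ) u) =ᵐ[volume]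
      fiberIntegral (tens (B.chiSym m)
        fun _ k => A.propagator (τ / ϱ) k (u k)) := fun m hm => by
    have hm1 : 1 ≤ m := one_le_two.trans (hB.two_le m hm)
    exact (symOp_coe hm1 (hC m hm) _).trans (fiberIntegral_congr hm1 (tens_congr fun j =>
      mulOp_coe (hA.isMultiplier_propagator _) u))
  have h2 : ∀ᵐ k, ∀ m ∈ B.M,
      (convConst d m • propOp A (-(τ / ϱ)) (symOp (B.chiSym m) fun _ => propOp A (τ / ϱ) u) :
        AmpL1 d J) k = convConst d m • A.propagator (-(τ / ϱ)) k
        (fiberIntegral (tens (B.chiSym m) fun _ k => A.propagator (τ / ϱ) k (u k)) k) := by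
    refine (ae_ball_iff B.M.countable_toSet).2 fun m hm => ?_
    filter_upwards [h1 m hm, mulOp_coe (hA.isMultiplier_propagator (-(τ / ϱ)))
      (symOp (B.chiSym m) fun _ => propOp A (τ / ϱ) u), Lp.coeFn_smul (convConst d m)
      (propOp A (-(τ / ϱ)) (symOp (B.chiSym m) fun _ => propOp A (τ / ϱ) u))] with k h3 h4 h5
    rw [h5, Pi.smul_apply, propOp, h4, h3]
  filter_upwards [h2, Lp.coeFn_finsetSum B.M fun m => (convConst d m •
    propOp A (-(τ / ϱ)) (symOp (B.chiSym m) fun _ => propOp A (τ / ϱ) u) : AmpL1 d J)] with k h3 h4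
  rw [forceOp, h4, Finset.sum_apply, Finset.sum_congr rfl fun m hm => h3 m hm, slowForce,
    fourierOp, map_sum]
  refine Finset.sum_congr rfl fun m hm => ?_
  have hm1 : 1 ≤ m := one_le_two.trans (hB.two_le m hm)
  have h5 : fiberIntegral (tens (B.chiSym m) fun _ k => A.propagator (τ / ϱ) k (u k)) k =
      ∫ q : Fin (m - 1) → Wave d, B.χ m k (convVec m k q)
        (fun j => A.propagator (τ / ϱ) (convVec m k q j) (u (convVec m k q j))) := by
    unfold fiberIntegral tens chiSym
    simp_rw [sum_convVec hm1]
  rw [h5, ← Complex.coe_smul, ← Complex.coe_smul, map_smul]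
  rfl

/-- Lipschitz constant of the nonlinearity on the ball of radius `ρ`. -/
def lipConst (M : Finset ℕ) (C ρ : ℝ) : ℝ := ∑ m ∈ M, C * m * ρ ^ (m - 1)

theorem lipConst_nonneg (M : Finset ℕ) {C ρ : ℝ} (hC : 0 ≤ C) (hρ : 0 ≤ ρ) :
    0 ≤ lipConst M C ρ := Finset.sum_nonneg fun m _ => by positivity

theorem norm_forceOp_sub_le (hA : A.Admissible) (hB : B.Admissible A) {C ρ : ℝ}
    (hC : ∀ m ∈ B.M, IsSymbol (B.chiSym m) C) (t : ℝ) {u v : AmpL1 d J} (hu : ‖u‖ ≤ ρ)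
    (hv : ‖v‖ ≤ ρ) : ‖forceOp A B t u - forceOp A B t v‖ ≤ lipConst B.M C ρ * ‖u - v‖ := by
  have hρ : 0 ≤ ρ := (norm_nonneg _).trans hu
  rw [forceOp, forceOp, ← Finset.sum_sub_distrib, lipConst, Finset.sum_mul]
  refine (norm_sum_le _ _).trans (Finset.sum_le_sum fun m hm => ?_)
  have hm1 : 1 ≤ m := one_le_two.trans (hB.two_le m hm)
  have : Nonempty (Fin m) := ⟨⟨0, hm1⟩⟩
  have hC0 := (hC m hm).nonneg
  rw [← smul_sub, ← map_sub, norm_smul, norm_propOp hA, Real.norm_of_nonneg (convConst_nonneg m)]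
  have h1 := norm_multilinear_sub_le (norm_symOp_le hm1 (hC m hm)) (B := ρ)
    (x := fun _ => propOp A t u) (y := fun _ => propOp A t v)
    (by rw [pi_norm_const, norm_propOp hA]; exact hu)
    (by rw [pi_norm_const, norm_propOp hA]; exact hv)
  have h2 : ‖(fun _ : Fin m => propOp A t u) - fun _ => propOp A t v‖ = ‖u - v‖ := by
    rw [← norm_propOp hA t (u - v), map_sub]
    exact pi_norm_const (ι := Fin m) (propOp A t u - propOp A t v)
  rw [h2] at h1
  calc _ ≤ 1 * _ := mul_le_mul (convConst_le_one m) h1 (norm_nonneg _) zero_le_one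
    _ = _ := one_mul _

theorem forceOp_zero (hB : B.Admissible A) (t : ℝ) : forceOp A B t 0 = 0 := by
  rw [forceOp]
  refine Finset.sum_eq_zero fun m hm => ?_
  have hm1 : 1 ≤ m := one_le_two.trans (hB.two_le m hm)
  rw [ContinuousMultilinearMap.map_coord_zero _ ⟨0, hm1⟩ (map_zero _), map_zero, smul_zero]

theorem norm_forceOp_le (hA : A.Admissible) (hB : B.Admissible A) {C ρ : ℝ}
    (hC : ∀ m ∈ B.M, IsSymbol (B.chiSym m) C) (t : ℝ) {u : AmpL1 d J} (hu : ‖u‖ ≤ ρ) :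
    ‖forceOp A B t u‖ ≤ lipConst B.M C ρ * ‖u‖ := by
  have h := norm_forceOp_sub_le hA hB hC t hu (v := 0)
    (by rw [norm_zero]; exact (norm_nonneg _).trans hu)
  simpa [forceOp_zero hB] using h

theorem continuousOn_forceOp (hA : A.Admissible) {S : Set ℝ} {ϱ : ℝ}
    {w : ℝ → AmpL1 d J} (hw : ContinuousOn w S) :
    ContinuousOn (fun s => forceOp A B (s / ϱ) (w s)) S := by
  unfold forceOp
  refine continuousOn_finsetSum _ fun m _ =>
    (continuous_const_smul (convConst d m)).comp_continuousOn ?_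
  refine ContinuousOn.propOp hA (φ := fun s => -(s / ϱ)) (by fun_prop) ?_
  exact (symOp (B.chiSym m)).cont.comp_continuousOn
    (continuousOn_pi.2 fun _ => ContinuousOn.propOp hA (φ := fun s => s / ϱ) (by fun_prop) hw)

/-- The auxiliary integrand f is forced pointwise in τ to be `forceOp`, and its integrability
follows from the continuity of u. -/
theorem isSolution_iff (hA : A.Admissible) (hB : B.Admissible A) {ϱ T : ℝ} (hT : 0 ≤ T)
    {h : Wave d → Amp J} {u : ℝ → AmpL1 d J} :
    IsSolution A B ϱ T h u ↔ ContinuousOn u (Icc 0 T) ∧ u 0 =ᵐ[volume] h ∧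
      ∀ τ ∈ Icc 0 T, u τ = u 0 + ∫ s in (0 : ℝ)..τ, forceOp A B (s / ϱ) (u s) := by
  constructor
  · rintro ⟨hc, h0, f, hf, -, heq⟩
    refine ⟨hc, h0, fun τ hτ => ?_⟩
    rw [heq τ hτ]
    congr 1
    refine intervalIntegral.integral_congr fun s hs => ?_
    rw [uIcc_of_le hτ.1] at hs
    exact Lp.ext ((hf s ⟨hs.1, hs.2.trans hτ.2⟩).trans (slowForce_ae_eq hA hB ϱ s (u s)).symm)
  · rintro ⟨hc, h0, heq⟩
    refine ⟨hc, h0, fun s => forceOp A B (s / ϱ) (u s), fun τ _ => slowForce_ae_eq hA hB _ _ _,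
      ?_, heq⟩
    exact ((continuousOn_forceOp hA hc).mono (by rw [uIcc_of_le hT])).intervalIntegrable

/-- Stability of the modal equation with respect to residuals. -/
theorem norm_sub_le_of_residual (hA : A.Admissible) (hB : B.Admissible A) {C ρ ϱ T E : ℝ}
    (hC0 : 0 ≤ C) (hC : ∀ m ∈ B.M, IsSymbol (B.chiSym m) C) (hE : 0 ≤ E) {x₀ : AmpL1 d J}
    {u v : ℝ → AmpL1 d J} (hu : ContinuousOn u (Icc 0 T)) (hv : ContinuousOn v (Icc 0 T))
    (hub : ∀ s ∈ Icc 0 T, ‖u s‖ ≤ ρ) (hvb : ∀ s ∈ Icc 0 T, ‖v s‖ ≤ ρ)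
    (hueq : ∀ τ ∈ Icc 0 T, u τ = x₀ + ∫ s in (0 : ℝ)..τ, forceOp A B (s / ϱ) (u s))
    (hveq : ∀ τ ∈ Icc 0 T,
      ‖v τ - (x₀ + ∫ s in (0 : ℝ)..τ, forceOp A B (s / ϱ) (v s))‖ ≤ E) :
    ∀ τ ∈ Icc 0 T, ‖u τ - v τ‖ ≤ 2 * E * Real.exp (2 * (lipConst B.M C ρ + 1) * T) := by
  intro τ hτ
  have hρ : 0 ≤ ρ := (norm_nonneg _).trans (hub τ hτ)
  have hK := lipConst_nonneg B.M hC0 hρ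
  -- The added 1 keeps the Gronwall constant positive even when the Lipschitz constant vanishes.
  refine le_of_integral_inequality (D := fun s => ‖u s - v s‖) (by linarith) hE
    (hu.sub hv).norm (fun τ hτ => ?_) τ hτ
  have hi : ∀ w : ℝ → AmpL1 d J, ContinuousOn w (Icc 0 T) → IntervalIntegrable
      (fun s => forceOp A B (s / ϱ) (w s)) volume 0 τ := fun w hw =>
    ((continuousOn_forceOp hA hw).mono
      (by rw [uIcc_of_le hτ.1]; exact Icc_subset_Icc_right hτ.2)).intervalIntegrable
  have h1 : u τ - v τ = (∫ s in (0 : ℝ)..τ, (forceOp A B (s / ϱ) (u s) -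
      forceOp A B (s / ϱ) (v s))) -
      (v τ - (x₀ + ∫ s in (0 : ℝ)..τ, forceOp A B (s / ϱ) (v s))) := by
    rw [intervalIntegral.integral_sub (hi u hu) (hi v hv), hueq τ hτ]
    abel
  have h2 : ‖∫ s in (0 : ℝ)..τ, (forceOp A B (s / ϱ) (u s) - forceOp A B (s / ϱ) (v s))‖ ≤
      (lipConst B.M C ρ + 1) * ∫ s in (0 : ℝ)..τ, ‖u s - v s‖ := by
    rw [← intervalIntegral.integral_const_mul]
    refine intervalIntegral.norm_integral_le_of_norm_le hτ.1 (.of_forall fun s hs => ?_) ?_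
    · have hs' : s ∈ Icc 0 T := ⟨hs.1.le, hs.2.trans hτ.2⟩
      refine (norm_forceOp_sub_le hA hB hC _ (hub s hs') (hvb s hs')).trans ?_
      gcongr
      linarith
    · refine ContinuousOn.intervalIntegrable (((hu.sub hv).norm.const_mul _).mono ?_)
      rw [uIcc_of_le hτ.1]; exact Icc_subset_Icc_right hτ.2
  rw [h1]
  exact (norm_sub_le _ _).trans (by linarith [hveq τ hτ])

/-- Local existence, with an a priori bound. -/
theorem exists_isSolution (hA : A.Admissible) (hB : B.Admissible A) {C R ϱ T : ℝ}
    (hC0 : 0 ≤ C) (hC : ∀ m ∈ B.M, IsSymbol (B.chiSym m) C) (hT : 0 ≤ T)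
    (hTK : T * lipConst B.M C (2 * R) ≤ 1 / 2) {h : Wave d → Amp J} (hh : Integrable h)
    (hR : ∫ k, ‖h k‖ ≤ R) :
    ∃ u : ℝ → AmpL1 d J, IsSolution A B ϱ T h u ∧ ∀ s ∈ Icc 0 T, ‖u s‖ ≤ 2 * R := by
  have hx₀ : ‖hh.toL1 h‖ ≤ R := by rwa [norm_toL1_eq_integral]
  have hR0 : 0 ≤ R := (norm_nonneg _).trans hx₀
  have hK := lipConst_nonneg B.M hC0 (by linarith : 0 ≤ 2 * R)
  obtain ⟨u, hu, hub, hueq⟩ := exists_solution_of_invariant hT hK hTK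
    (fun s x => forceOp A B (s / ϱ) x) (hh.toL1 h) (ι := Unit)
    (fun _ => ContinuousLinearMap.id ℝ _) (fun _ => 2 * R) (fun _ => by simp; linarith)
    (fun _ => ⟨lipConst B.M C (2 * R) * (2 * R), by
      simp only [ContinuousLinearMap.id_apply]; nlinarith, fun s _ x hx => by
      have hx' : ‖x‖ ≤ 2 * R := hx ()
      simp only [ContinuousLinearMap.id_apply]
      refine (norm_forceOp_le hA hB hC _ hx').trans ?_
      gcongr⟩)
    (fun s _ x y hx hy => norm_forceOp_sub_le hA hB hC _ (hx ()) (hy ()))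
    (fun w hw => continuousOn_forceOp hA hw)
  have hu0 : u 0 = hh.toL1 h := by
    have := hueq 0 ⟨le_rfl, hT⟩
    simpa using this
  refine ⟨u, (isSolution_iff hA hB hT).2 ⟨hu, ?_, fun τ hτ => ?_⟩, fun s hs => hub s hs ()⟩
  · rw [hu0]; exact hh.coeFn_toL1
  · rw [hu0]; exact hueq τ hτ

theorem IsSolution.eqOn (hA : A.Admissible) (hB : B.Admissible A) {C ϱ T : ℝ}
    (hC0 : 0 ≤ C) (hC : ∀ m ∈ B.M, IsSymbol (B.chiSym m) C) (hT : 0 ≤ T)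
    {h : Wave d → Amp J} {u v : ℝ → AmpL1 d J} (hu : IsSolution A B ϱ T h u)
    (hv : IsSolution A B ϱ T h v) : EqOn u v (Icc 0 T) := by
  obtain ⟨huc, hu0, hueq⟩ := (isSolution_iff hA hB hT).1 hu
  obtain ⟨hvc, hv0, hveq⟩ := (isSolution_iff hA hB hT).1 hv
  obtain ⟨ρ₁, h1⟩ := isCompact_Icc.exists_bound_of_continuousOn huc
  obtain ⟨ρ₂, h2⟩ := isCompact_Icc.exists_bound_of_continuousOn hvc
  have h0 : u 0 = v 0 := Lp.ext (hu0.trans hv0.symm)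
  intro τ hτ
  -- Uniqueness is stability with zero residual, in a ball containing both compact trajectories; no
  -- smallness of T is required.
  have := norm_sub_le_of_residual hA hB hC0 hC (le_refl (0 : ℝ)) huc hvc
    (fun s hs => (h1 s hs).trans (le_max_left ρ₁ ρ₂))
    (fun s hs => (h2 s hs).trans (le_max_right ρ₁ ρ₂)) hueq
    (fun τ hτ => by rw [h0, ← hveq τ hτ, sub_self, norm_zero]) τ hτ
  rw [mul_zero, zero_mul] at this
  exact sub_eq_zero.1 (norm_le_zero_iff.1 this)

end Wavepacket

namespace Wavepacket

open Filter Topology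

variable {d J : ℕ}

/-! ### Weak gradients and translations in `L¹` -/

theorem integrable_comp_add_smul {F : Type*} [NormedAddCommGroup F] {g : Wave d → F}
    (hg : Integrable g) (y : Wave d) :
    Integrable (fun p : ℝ × Wave d => g (p.2 + p.1 • y))
      ((volume.restrict (Ioc (0 : ℝ) 1)).prod volume) := by
  have h1 : MeasurePreserving (fun p : ℝ × Wave d => (p.1, p.2 + p.1 • y))
      ((volume.restrict (Ioc (0 : ℝ) 1)).prod volume)
      ((volume.restrict (Ioc (0 : ℝ) 1)).prod volume) := by
    refine MeasurePreserving.skew_product (g := fun (t : ℝ) (k : Wave d) => k + t • y)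
      (MeasurePreserving.id _) (by fun_prop) ?_
    exact .of_forall fun t => (measurePreserving_add_right volume (t • y)).map_eq
  have h2 : Integrable (fun p : ℝ × Wave d => g p.2)
      ((volume.restrict (Ioc (0 : ℝ) 1)).prod volume) := hg.comp_snd _
  exact h1.integrable_comp_of_integrable h2

-- The fundamental theorem of calculus for F(t) = ∫ φ(k−ty) f(k) dk: the derivative falls on the
-- test function, and the weak gradient moves it back to f.
set_option maxHeartbeats 1000000 in
theorem HasWeakGradient.integral_smul_translate {f : Wave d → Amp J}
    {G : Wave d → Wave d →L[ℝ] Amp J} (h : HasWeakGradient f G) {φ : Wave d → ℝ}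
    (hφ : ContDiff ℝ ∞ φ) (hφc : HasCompactSupport φ) (y : Wave d) :
    ∫ k, φ k • (f (k + y) - f k) = ∫ t in (0 : ℝ)..1, ∫ k, φ k • G (k + t • y) y := by
  obtain ⟨hf, hG, hw⟩ := h
  have hφ1 : ContDiff ℝ 1 φ := hφ.of_le (by simp)
  obtain ⟨C, hC⟩ := hφc.exists_bound_of_continuous hφ.continuous
  obtain ⟨C', hC'⟩ := (hφc.fderiv (𝕜 := ℝ)).exists_bound_of_continuous
    (hφ1.continuous_fderiv (by simp))
  set F : ℝ → Amp J := fun t => ∫ k, φ (k - t • y) • f k with hF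
  have hsub : ∀ t : ℝ, ContDiff ℝ ∞ fun k : Wave d => φ (k - t • y) := fun t =>
    hφ.comp (contDiff_id.sub contDiff_const)
  have hsubc : ∀ t : ℝ, HasCompactSupport fun k : Wave d => φ (k - t • y) := fun t =>
    hφc.comp_homeomorph (Homeomorph.subRight (t • y))
  have hfd : ∀ (t : ℝ) (k : Wave d), fderiv ℝ (fun k : Wave d => φ (k - t • y)) k = fderiv ℝ φ (k - t • y) :=
    fun t k => by
      simp_rw [sub_eq_add_neg]
      exact fderiv_comp_add_right (𝕜 := ℝ) (f := φ) (x := k) (-(t • y))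
  have hderiv : ∀ t, HasDerivAt F (∫ k, φ k • G (k + t • y) y) t := by
    intro t
    have h1 := (hasDerivAt_integral_of_dominated_loc_of_deriv_le (μ := volume) (s := univ)
      (F := fun t k => φ (k - t • y) • f k)
      (F' := fun t k => -(fderiv ℝ φ (k - t • y) y • f k)) (x₀ := t)
      (bound := fun k => C' * ‖y‖ * ‖f k‖) univ_mem ?_ ?_ ?_ ?_ ?_ ?_).2
    · refine h1.congr_deriv ?_
      rw [integral_neg]
      have h2 := hw _ (hsub t) (hsubc t) y
      simp only [hfd] at h2
      rw [← h2]
      have h3 := integral_add_right_eq_self (μ := (volume : Measure (Wave d)))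
        (fun k => φ (k - t • y) • G k y) (t • y)
      rw [← h3]
      simp
    · exact .of_forall fun t => ((hsub t).continuous.aestronglyMeasurable).smul hf.1
    · refine (hf.norm.const_mul C).mono' (((hsub t).continuous.aestronglyMeasurable).smul hf.1) ?_
      refine .of_forall fun k => ?_
      rw [norm_smul]
      gcongr
      exact hC _
    · have hc : Continuous fun k => fderiv ℝ φ (k - t • y) y :=
        ((hφ1.continuous_fderiv (by simp)).comp (g := fderiv ℝ φ)
          (f := fun k : Wave d => k - t • y) (by fun_prop)).clm_apply continuous_const
      exact (hc.aestronglyMeasurable.smul hf.1).neg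
    · refine .of_forall fun k t _ => ?_
      rw [norm_neg, norm_smul]
      gcongr
      exact (fderiv ℝ φ (k - t • y)).le_of_opNorm_le (hC' _) y
    · exact hf.norm.const_mul _
    · refine .of_forall fun k t _ => ?_
      have h3 : HasDerivAt (fun t : ℝ => k - t • y) (-y) t := by
        simpa using ((hasDerivAt_id t).smul_const y).const_sub k
      have h4 := ((hφ1.differentiable (by simp)) (k - t • y)).hasFDerivAt.comp_hasDerivAt t h3
      have h5 := h4.smul_const (f k)
      simpa using h5
  have hint : IntervalIntegrable (fun t => ∫ k, φ k • G (k + t • y) y) volume 0 1 := by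
    rw [intervalIntegrable_iff_integrableOn_Ioc_of_le zero_le_one]
    have h1 : Integrable (fun p : ℝ × Wave d => φ p.2 • G (p.2 + p.1 • y) y)
        ((volume.restrict (Ioc (0 : ℝ) 1)).prod volume) := by
      have h2 := (ContinuousLinearMap.apply ℝ (Amp J) y).integrable_comp
        (integrable_comp_add_smul hG y)
      refine (h2.norm.const_mul C).mono'
        ((hφ.continuous.comp continuous_snd).aestronglyMeasurable.smul h2.1) ?_
      refine .of_forall fun p => ?_
      rw [norm_smul]
      exact mul_le_mul_of_nonneg_right (hC _) (norm_nonneg _)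
    exact h1.integral_prod_left
  rw [intervalIntegral.integral_eq_sub_of_hasDerivAt (fun t _ => hderiv t) hint]
  have h2 : F 1 = ∫ k, φ k • f (k + y) := by
    have h3 := integral_add_right_eq_self (μ := (volume : Measure (Wave d)))
      (fun k => φ (k - y) • f k) y
    simp only [hF, one_smul]
    rw [← h3]
    simp
  rw [h2]
  simp only [hF, zero_smul, sub_zero, smul_sub]
  have hi : ∀ g : Wave d → Amp J, Integrable g → Integrable fun k => φ k • g k := fun g hg => by
    refine (hg.norm.const_mul C).mono' (hφ.continuous.aestronglyMeasurable.smul hg.1) ?_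
    refine .of_forall fun k => ?_
    rw [norm_smul]
    gcongr
    exact hC _
  exact integral_sub (hi _ (hf.comp_add_right y)) (hi _ hf)

/-- Testing against all φ shows that f(·+y) − f is almost everywhere the integral of G(·+ty)y over 0
< t ≤ 1; Fubini then gives the bound. It converts the hypothesis on the data into the translation
estimate carried by the averaged system. -/
theorem HasWeakGradient.integral_norm_sub_le {f : Wave d → Amp J}
    {G : Wave d → Wave d →L[ℝ] Amp J} (h : HasWeakGradient f G) (y : Wave d) :
    ∫ k, ‖f (k + y) - f k‖ ≤ (∫ k, ‖G k‖) * ‖y‖ := by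
  have hf := h.1
  have hG := h.2.1
  have hGy : Integrable (fun p : ℝ × Wave d => G (p.2 + p.1 • y) y)
      ((volume.restrict (Ioc (0 : ℝ) 1)).prod volume) :=
    (ContinuousLinearMap.apply ℝ (Amp J) y).integrable_comp (integrable_comp_add_smul hG y)
  have hint : Integrable fun k => ∫ t in Ioc (0 : ℝ) 1, G (k + t • y) y :=
    hGy.integral_prod_right
  have hae : ∀ᵐ k, f (k + y) - f k = ∫ t in Ioc (0 : ℝ) 1, G (k + t • y) y := by
    refine ae_eq_of_integral_contDiff_smul_eq ((hf.comp_add_right y).sub hf).locallyIntegrable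
      hint.locallyIntegrable fun φ hφ hφc => ?_
    rw [h.integral_smul_translate hφ hφc, intervalIntegral.integral_of_le zero_le_one]
    obtain ⟨C, hC⟩ := hφc.exists_bound_of_continuous hφ.continuous
    have h1 : Integrable (fun p : ℝ × Wave d => φ p.2 • G (p.2 + p.1 • y) y)
        ((volume.restrict (Ioc (0 : ℝ) 1)).prod volume) := by
      refine (hGy.norm.const_mul C).mono'
        ((hφ.continuous.comp continuous_snd).aestronglyMeasurable.smul hGy.1) ?_
      refine .of_forall fun p => ?_
      rw [norm_smul]
      exact mul_le_mul_of_nonneg_right (hC _) (norm_nonneg _)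
    rw [integral_integral_swap h1]
    simp_rw [integral_smul]
  have hGn : Integrable (fun p : ℝ × Wave d => ‖G (p.2 + p.1 • y)‖ * ‖y‖)
      ((volume.restrict (Ioc (0 : ℝ) 1)).prod volume) :=
    (integrable_comp_add_smul hG y).norm.mul_const _
  calc ∫ k, ‖f (k + y) - f k‖ = ∫ k, ‖∫ t in Ioc (0 : ℝ) 1, G (k + t • y) y‖ :=
        integral_congr_ae (hae.mono fun k hk => by simp only [hk])
    _ ≤ ∫ k, ∫ t in Ioc (0 : ℝ) 1, ‖G (k + t • y)‖ * ‖y‖ := by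
        refine integral_mono_ae hint.norm hGn.integral_prod_right ?_
        filter_upwards [hGy.swap.prod_right_ae, hGn.swap.prod_right_ae] with k h1 h2
        refine (norm_integral_le_integral_norm _).trans ?_
        exact integral_mono h1.norm h2 fun t => (G (k + t • y)).le_opNorm y
    _ = ∫ t in Ioc (0 : ℝ) 1, ∫ k, ‖G (k + t • y)‖ * ‖y‖ :=
        (integral_integral_swap hGn).symm
    _ = ∫ t in Ioc (0 : ℝ) 1, (∫ k, ‖G k‖) * ‖y‖ := by
        refine integral_congr_ae (.of_forall fun t => ?_)
        simp only
        rw [integral_mul_const, integral_add_right_eq_self (fun k => ‖G k‖) (t • y)]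
    _ = (∫ k, ‖G k‖) * ‖y‖ := by simp

theorem hasWeakGradient_of_contDiff {f : Wave d → Amp J} (hf : ContDiff ℝ 1 f)
    (hi : Integrable f) (hi' : Integrable (fderiv ℝ f)) : HasWeakGradient f (fderiv ℝ f) := by
  refine ⟨hi, hi', fun φ hφ hφc e => ?_⟩
  have hφ1 : ContDiff ℝ 1 φ := hφ.of_le (by simp)
  obtain ⟨C, hC⟩ := hφc.exists_bound_of_continuous hφ.continuous
  have hce : Continuous fun k => fderiv ℝ φ k e :=
    (hφ1.continuous_fderiv (by simp)).clm_apply continuous_const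
  obtain ⟨C', hC'⟩ := (hφc.fderiv_apply (𝕜 := ℝ) e).exists_bound_of_continuous hce
  have hie : Integrable fun k => fderiv ℝ f k e :=
    (ContinuousLinearMap.apply ℝ (Amp J) e).integrable_comp hi'
  have hb : ∀ (g : Wave d → Amp J) (ψ : Wave d → ℝ) (c : ℝ), Integrable g → Continuous ψ →
      (∀ k, ‖ψ k‖ ≤ c) → Integrable fun k => ψ k • g k := fun g ψ c hg hψ hc => by
    refine (hg.norm.const_mul c).mono' (hψ.aestronglyMeasurable.smul hg.1) ?_
    refine .of_forall fun k => ?_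
    rw [norm_smul]
    gcongr
    exact hc _
  exact integral_bilinear_fderiv_right_eq_neg_left_of_integrable
    (B := ContinuousLinearMap.lsmul ℝ ℝ) (f := φ) (g := f) (v := e) (μ := volume)
    (hb _ _ _ hi hce hC') (hb _ _ _ hie hφ.continuous hC) (hb _ _ _ hi hφ.continuous hC)
    (fun k _ => hφ1.differentiable (by simp) k) (fun k _ => hf.differentiable (by simp) k)

theorem norm_le_sum_norm_apply (T : Wave d →L[ℝ] Amp J) :
    ‖T‖ ≤ ∑ i, ‖T (EuclideanSpace.single i 1)‖ := by
  refine T.opNorm_le_bound (Finset.sum_nonneg fun i _ => norm_nonneg _) fun v => ?_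
  have h1 : v = ∑ i, v i • EuclideanSpace.single i (1 : ℝ) := by
    have := (EuclideanSpace.basisFun (Fin d) ℝ).sum_repr v
    simpa using this.symm
  conv_lhs => rw [h1, map_sum]
  refine (norm_sum_le _ _).trans ?_
  rw [Finset.sum_mul]
  refine Finset.sum_le_sum fun i _ => ?_
  rw [map_smul, norm_smul, mul_comm]
  gcongr
  exact PiLp.norm_apply_le v i

/-- Fatou's lemma applied to difference quotients along each coordinate direction. The factor d
comes from bounding an operator norm by the sum over the basis vectors. -/
theorem integrable_fderiv_of_translate {g : Wave d → Amp J} {V η : ℝ} (hη : 0 < η)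
    (hV : 0 ≤ V) (hg : ContDiff ℝ 1 g) (hi : Integrable g)
    (h : ∀ y, ‖y‖ ≤ η → ∫ k, ‖g (k + y) - g k‖ ≤ V * ‖y‖) :
    Integrable (fderiv ℝ g) ∧ ∫ k, ‖fderiv ℝ g k‖ ≤ d * V := by
  have hcd : Continuous (fderiv ℝ g) := hg.continuous_fderiv (by simp)
  have key : ∀ e : Wave d, ‖e‖ = 1 → ∫⁻ k, ‖fderiv ℝ g k e‖ₑ ≤ ENNReal.ofReal V := by
    intro e he
    set ε : ℕ → ℝ := fun n => 1 / ((n : ℝ) + 1) with hε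
    have hε0 : ∀ n, 0 < ε n := fun n => by rw [hε]; positivity
    have hεlim : Tendsto ε atTop (𝓝[≠] 0) := by
      rw [tendsto_nhdsWithin_iff]
      exact ⟨tendsto_one_div_add_atTop_nhds_zero_nat, .of_forall fun n => (hε0 n).ne'⟩
    have hlim : ∀ k, Tendsto (fun n => ‖(ε n)⁻¹ • (g (k + ε n • e) - g k)‖ₑ) atTop
        (𝓝 ‖fderiv ℝ g k e‖ₑ) := fun k => by
      have h1 := ((hg.differentiable (by simp) k).hasFDerivAt.hasLineDerivAt e)
      have h2 := (hasDerivAt_iff_tendsto_slope_zero.1 h1).comp hεlim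
      have h3 := (continuous_enorm.tendsto _).comp h2
      simpa [Function.comp_def] using h3
    have hev : ∀ᶠ n in atTop, ∫⁻ k, ‖(ε n)⁻¹ • (g (k + ε n • e) - g k)‖ₑ ≤
        ENNReal.ofReal V := by
      have h0 := (tendsto_nhdsWithin_iff.1 hεlim).1.eventually (gt_mem_nhds hη)
      filter_upwards [h0] with n hn
      have hsm : ‖ε n • e‖ = ε n := by
        rw [norm_smul, he, mul_one, Real.norm_of_nonneg (hε0 n).le]
      have h1 := h (ε n • e) (by rw [hsm]; exact hn.le)
      have hint : Integrable fun k => (ε n)⁻¹ • (g (k + ε n • e) - g k) :=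
        ((hi.comp_add_right (ε n • e)).sub hi).smul (ε n)⁻¹
      rw [← ofReal_integral_norm_eq_lintegral_enorm hint]
      refine ENNReal.ofReal_le_ofReal ?_
      simp_rw [norm_smul]
      rw [integral_const_mul, Real.norm_of_nonneg (inv_nonneg.2 (hε0 n).le)]
      rw [hsm] at h1
      rw [inv_mul_le_iff₀ (hε0 n)]
      linarith
    calc ∫⁻ k, ‖fderiv ℝ g k e‖ₑ
        = ∫⁻ k, liminf (fun n => ‖(ε n)⁻¹ • (g (k + ε n • e) - g k)‖ₑ) atTop :=
          lintegral_congr fun k => (hlim k).liminf_eq.symm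
      _ ≤ liminf (fun n => ∫⁻ k, ‖(ε n)⁻¹ • (g (k + ε n • e) - g k)‖ₑ) atTop := by
          refine lintegral_liminf_le fun n => ?_
          have := hg.continuous
          exact Continuous.measurable (by fun_prop)
      _ ≤ ENNReal.ofReal V := liminf_le_of_frequently_le' hev.frequently
  have htot : ∫⁻ k, ‖fderiv ℝ g k‖ₑ ≤ ENNReal.ofReal (d * V) := by
    calc ∫⁻ k, ‖fderiv ℝ g k‖ₑ
        ≤ ∫⁻ k, ∑ i : Fin d, ‖fderiv ℝ g k (EuclideanSpace.single i 1)‖ₑ := by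
          refine lintegral_mono fun k => ?_
          have := ENNReal.ofReal_le_ofReal (norm_le_sum_norm_apply (fderiv ℝ g k))
          rw [ENNReal.ofReal_sum_of_nonneg fun i _ => norm_nonneg _] at this
          simpa only [ofReal_norm] using this
      _ = ∑ i : Fin d, ∫⁻ k, ‖fderiv ℝ g k (EuclideanSpace.single i 1)‖ₑ := by
          refine lintegral_finsetSum _ fun i _ => ?_
          exact (hcd.clm_apply continuous_const).enorm.measurable
      _ ≤ ∑ _i : Fin d, ENNReal.ofReal V := Finset.sum_le_sum fun i _ => key _ (by simp)
      _ = ENNReal.ofReal (d * V) := by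
          rw [Finset.sum_const, Finset.card_univ, Fintype.card_fin, nsmul_eq_mul,
            ENNReal.ofReal_mul (by positivity), ENNReal.ofReal_natCast]
  have hint : Integrable (fderiv ℝ g) :=
    ⟨hcd.aestronglyMeasurable, htot.trans_lt ENNReal.ofReal_lt_top⟩
  refine ⟨hint, ?_⟩
  rw [integral_norm_eq_lintegral_enorm hint.1]
  exact ENNReal.toReal_le_of_le_ofReal (by positivity) htot

/-- Mollification of a function which is Lipschitz continuous under translations in `L¹`. -/
theorem exists_mollification {f : Wave d → Amp J} (hf : Integrable f) {V η₀ : ℝ} (hV : 0 ≤ V)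
    (hη₀ : 0 < η₀) (h : ∀ y, ‖y‖ ≤ η₀ → ∫ k, ‖f (k + y) - f k‖ ≤ V * ‖y‖) {η : ℝ} (hη : 0 < η)
    (hηη : η ≤ η₀) :
    ∃ g : Wave d → Amp J, ContDiff ℝ 1 g ∧ Integrable g ∧ ∫ k, ‖g k - f k‖ ≤ V * η ∧
      ∫ k, ‖g k‖ ≤ ∫ k, ‖f k‖ ∧
      Integrable (fderiv ℝ g) ∧ ∫ k, ‖fderiv ℝ g k‖ ≤ d * V := by
  -- The outer radius η controls the approximation error; the inner radius η/2 plays no further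
  -- role.
  let b : ContDiffBump (0 : Wave d) := ⟨η / 2, η, by positivity, by linarith⟩
  set φ : Wave d → ℝ := b.normed volume with hφ
  have hφi : Integrable φ := b.integrable_normed
  have hφ1 : ∫ t, φ t = 1 := b.integral_normed
  have hφ0 : ∀ t, 0 ≤ φ t := b.nonneg_normed
  have hφs : ∀ t, φ t ≠ 0 → ‖t‖ ≤ η := fun t ht => by
    have : t ∈ Function.support φ := ht
    rw [hφ, b.support_normed_eq] at this
    exact (mem_ball_zero_iff.1 this).le
  set g : Wave d → Amp J := convolution φ f (ContinuousLinearMap.lsmul ℝ ℝ) volume with hg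
  have hgdef : ∀ k, g k = ∫ t, φ t • f (k - t) := fun k => rfl
  have hgc : ContDiff ℝ 1 g := b.hasCompactSupport_normed.contDiff_convolution_left _
    (n := 1) b.contDiff_normed hf.locallyIntegrable
  have hgi : Integrable g := hφi.integrable_convolution _ hf
  have hci : Integrable (fun p : Wave d × Wave d => φ p.2 • f (p.1 - p.2))
      (volume.prod volume) := hφi.convolution_integrand (ContinuousLinearMap.lsmul ℝ ℝ) hf
  -- A Minkowski inequality: averaging against the probability density φ, supported in ‖t‖ ≤ η, does
  -- not increase a uniform L¹ bound.
  have hmain : ∀ (F : Wave d → Amp J) (H : Wave d → Wave d → Amp J) (c : ℝ),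
      (∀ᵐ k, F k = ∫ t, φ t • H k t) →
      Integrable (fun p : Wave d × Wave d => φ p.2 • H p.1 p.2) (volume.prod volume) →
      (∀ t, ‖t‖ ≤ η → ∫ k, ‖H k t‖ ≤ c) → 0 ≤ c → ∫ k, ‖F k‖ ≤ c := by
    intro F H c hF hH hc hc0
    calc ∫ k, ‖F k‖ ≤ ∫ k, ∫ t, ‖φ t • H k t‖ := by
          refine integral_mono_of_nonneg (.of_forall fun _ => norm_nonneg _)
            hH.norm.integral_prod_left ?_
          filter_upwards [hF] with k hk
          rw [hk]
          exact norm_integral_le_integral_norm _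
      _ = ∫ t, ∫ k, ‖φ t • H k t‖ := integral_integral_swap hH.norm
      _ ≤ ∫ t, φ t * c := by
          refine integral_mono hH.norm.integral_prod_right (hφi.mul_const c) fun t => ?_
          simp only [norm_smul]
          rw [integral_const_mul, Real.norm_of_nonneg (hφ0 t)]
          by_cases ht : φ t = 0
          · simp [ht]
          · exact mul_le_mul_of_nonneg_left (hc t (hφs t ht)) (hφ0 t)
      _ = c := by rw [integral_mul_const, hφ1, one_mul]
  have hfi : Integrable (fun p : Wave d × Wave d => φ p.2 • f p.1) (volume.prod volume) :=
    (hφi.smul_prod hf).swap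
  have htrans : ∀ y, ‖y‖ ≤ η₀ → ∫ k, ‖g (k + y) - g k‖ ≤ V * ‖y‖ := by
    intro y hy
    have hci2 : Integrable (fun p : Wave d × Wave d => φ p.2 • f (p.1 + y - p.2))
        (volume.prod volume) := by
      have := hφi.convolution_integrand (ContinuousLinearMap.lsmul ℝ ℝ) (hf.comp_add_right y)
      refine this.congr (.of_forall fun p => ?_)
      simp [add_sub_right_comm]
    refine hmain _ (fun k t => f (k + y - t) - f (k - t)) _ ?_ ?_ (fun t _ => ?_) (by positivity)
    · filter_upwards [hci.prod_right_ae, hci2.prod_right_ae] with k h1 h2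
      rw [hgdef, hgdef, ← integral_sub h2 h1]
      simp_rw [smul_sub]
    · simp_rw [smul_sub]
      exact hci2.sub hci
    · have := integral_sub_right_eq_self (μ := (volume : Measure (Wave d)))
        (fun k => ‖f (k + y) - f k‖) t
      simp_rw [sub_add_eq_add_sub] at this
      rw [this]
      exact h y hy
  -- Averaging preserves the translation estimate, so the gradient bound does not degenerate as η →
  -- 0.
  obtain ⟨h1, h2⟩ := integrable_fderiv_of_translate hη₀ hV hgc hgi htrans
  refine ⟨g, hgc, hgi, ?_, ?_, h1, h2⟩
  · refine hmain _ (fun k t => f (k - t) - f k) _ ?_ ?_ (fun t ht => ?_) (by positivity)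
    · filter_upwards [hci.prod_right_ae, hfi.prod_right_ae] with k h1 h2
      simp_rw [smul_sub]
      rw [integral_sub h1 h2, hgdef, integral_smul_const, hφ1, one_smul]
    · simp_rw [smul_sub]
      exact hci.sub hfi
    · have := h (-t) (by rw [norm_neg]; exact ht.trans hηη)
      rw [norm_neg] at this
      simp_rw [← sub_eq_add_neg] at this
      exact this.trans (by gcongr)
  · refine hmain _ (fun k t => f (k - t)) _ (.of_forall hgdef) hci (fun t _ => ?_)
      (integral_nonneg fun _ => norm_nonneg _)
    exact (integral_sub_right_eq_self (fun k => ‖f k‖) t).le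

end Wavepacket

namespace Wavepacket

open Filter Topology

variable {d J m : ℕ}

/-! ### Oscillating symbols -/

theorem norm_exp_I_sub_one_sub_le (z : ℝ) :
    ‖Complex.exp (Complex.I * z) - 1 - Complex.I * z‖ ≤ 3 * z ^ 2 := by
  have hz : ‖Complex.I * (z : ℂ)‖ = |z| := by simp
  rcases le_or_gt |z| 1 with h | h
  · have := Complex.norm_exp_sub_one_sub_id_le (x := Complex.I * z) (by rwa [hz])
    rw [hz, sq_abs] at this
    nlinarith [sq_nonneg z]
  · have h1 : ‖Complex.exp (Complex.I * z) - 1 - Complex.I * z‖ ≤ 1 + 1 + |z| := by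
      refine (norm_sub_le _ _).trans (add_le_add ((norm_sub_le _ _).trans ?_) hz.le)
      rw [norm_exp_I_mul_ofReal, norm_one]
    have h2 : |z| ^ 2 = z ^ 2 := sq_abs z
    nlinarith

theorem norm_exp_I_sub_le (x y : ℝ) :
    ‖Complex.exp (Complex.I * x) - Complex.exp (Complex.I * y)‖ ≤ |x - y| := by
  have h1 : Complex.exp (Complex.I * x) - Complex.exp (Complex.I * y) =
      Complex.exp (Complex.I * y) * (Complex.exp (Complex.I * ((x - y : ℝ) : ℂ)) - 1) := by
    rw [mul_sub, ← Complex.exp_add, mul_one]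
    congr 2
    push_cast
    ring
  rw [h1, norm_mul, norm_exp_I_mul_ofReal, one_mul]
  exact Real.norm_exp_I_mul_ofReal_sub_one_le

theorem msmul_zero (c : ℂ) :
    c • (0 : ContinuousMultilinearMap ℂ (fun _ : Fin m => Amp J) (Amp J)) = 0 := by
  ext1 v
  exact smul_zero c

theorem msub_smul (c c' : ℂ) (S : ContinuousMultilinearMap ℂ (fun _ : Fin m => Amp J) (Amp J)) :
    c • S - c' • S = (c - c') • S :=
  (sub_smul c c' S).symm

theorem msmul_smul (c c' : ℂ) (S : ContinuousMultilinearMap ℂ (fun _ : Fin m => Amp J) (Amp J)) :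
    c • c' • S = (c * c') • S :=
  smul_smul c c' S

/-- The symbol `exp(i t φ) b`. -/
def oscSym (b : MSymbol d J m) (φ : (Fin m → Wave d) → ℝ) (t : ℝ) : MSymbol d J m :=
  fun x => Complex.exp (Complex.I * ((t * φ x : ℝ) : ℂ)) • b x

variable {b : MSymbol d J m} {φ : (Fin m → Wave d) → ℝ} {C Λ : ℝ}

theorem aestronglyMeasurable_exp_phase (hφ : AEStronglyMeasurable φ volume) (t : ℝ) :
    AEStronglyMeasurable (fun x => Complex.exp (Complex.I * ((t * φ x : ℝ) : ℂ))) volume := by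
  have hc : Continuous fun z : ℝ => Complex.exp (Complex.I * ((t * z : ℝ) : ℂ)) := by fun_prop
  exact hc.comp_aestronglyMeasurable hφ

theorem norm_oscSym (t : ℝ) (x : Fin m → Wave d) : ‖oscSym b φ t x‖ = ‖b x‖ := by
  rw [oscSym, norm_smul, norm_exp_I_mul_ofReal, one_mul]

theorem IsSymbol.osc (hb : IsSymbol b C) (hφ : AEStronglyMeasurable φ volume) (t : ℝ) :
    IsSymbol (oscSym b φ t) C :=
  hb.smul (aestronglyMeasurable_exp_phase hφ t)
    (hb.bound.mono fun x hx => (norm_oscSym (b := b) t x).trans_le hx) hb.nonneg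

/-- Because the phase is bounded where the symbol lives, localized interactions are Lipschitz in t
in operator norm, unlike the propagator itself. -/
theorem norm_symOp_oscSym_sub_le (hm : 1 ≤ m) (hb : IsSymbol b C)
    (hφ : AEStronglyMeasurable φ volume) (hΛ : ∀ x, b x ≠ 0 → |φ x| ≤ Λ) (hΛ0 : 0 ≤ Λ)
    (t t' : ℝ) :
    ‖symOp (oscSym b φ t) - symOp (oscSym b φ t')‖ ≤ C * Λ * |t - t'| := by
  rw [← symOp_sub hm (hb.osc hφ t) (hb.osc hφ t')]
  refine norm_symOp_le hm (((hb.osc hφ t).sub (hb.osc hφ t')).mono ?_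
    (by have := hb.nonneg; positivity))
  filter_upwards [hb.bound] with x hx
  by_cases h0 : b x = 0
  · rw [oscSym, oscSym, h0, msmul_zero, msmul_zero, sub_zero, norm_zero]
    have := hb.nonneg
    positivity
  rw [oscSym, oscSym, msub_smul, norm_smul]
  have h1 := norm_exp_I_sub_le (t * φ x) (t' * φ x)
  rw [← sub_mul, abs_mul] at h1
  have h2 : |t - t'| * |φ x| ≤ |t - t'| * Λ := by gcongr; exact hΛ x h0
  calc _ ≤ (|t - t'| * Λ) * C := mul_le_mul (h1.trans h2) hx (norm_nonneg _) (by positivity)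
    _ = _ := by ring

/-- Time averaging of a nonresonant term. -/
theorem norm_integral_oscSym_le (hm : 1 ≤ m) (hb : IsSymbol b C)
    (hφ : AEStronglyMeasurable φ volume) (hΛ : ∀ x, b x ≠ 0 → |φ x| ≤ Λ) (hΛ0 : 0 ≤ Λ) {c : ℝ}
    (hc0 : 0 < c) (hc : ∀ x, b x ≠ 0 → c ≤ |φ x|) {ϱ : ℝ} (hϱ : 0 < ϱ)
    {w : ℝ → Fin m → AmpL1 d J} {T B L : ℝ} (hL0 : 0 ≤ L)
    (hw : ∀ s ∈ Icc 0 T, ‖w s‖ ≤ B)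
    (hL : ∀ s ∈ Icc 0 T, ∀ t ∈ Icc 0 T, ‖w t - w s‖ ≤ L * |t - s|)
    {τ : ℝ} (hτ : τ ∈ Icc 0 T) :
    ‖∫ s in (0 : ℝ)..τ, symOp (oscSym b φ (s / ϱ)) (w s)‖ ≤
      ϱ * (C / c * (2 * B ^ m + m * B ^ (m - 1) * L * τ)) := by
  have hC := hb.nonneg
  -- The antiderivative in s of exp(isφ/ϱ). Dividing by φ is harmless: |φ| ≥ c where b ≠ 0, and
  -- elsewhere q is multiplied by zero. Its size ϱ/c is the gain of the averaging.
  let q : ℝ → (Fin m → Wave d) → ℂ := fun s x =>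
    (ϱ / (Complex.I * φ x)) * Complex.exp (Complex.I * ((s / ϱ * φ x : ℝ) : ℂ))
  have hqm : ∀ s, AEStronglyMeasurable (q s) volume := fun s => by
    refine AEMeasurable.aestronglyMeasurable ?_
    have h1 := (aestronglyMeasurable_exp_phase hφ (s / ϱ)).aemeasurable
    have h2 : AEMeasurable (fun x => (φ x : ℂ)) volume :=
      Complex.measurable_ofReal.comp_aemeasurable hφ.aemeasurable
    exact ((h2.const_mul Complex.I).const_div (ϱ : ℂ)).mul h1
  have hq : ∀ s x, b x ≠ 0 → ‖q s x‖ ≤ ϱ / c := fun s x hx => by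
    simp only [q]
    rw [norm_mul, norm_exp_I_mul_ofReal, mul_one, norm_div, norm_mul, Complex.norm_I, one_mul,
      Complex.norm_real, Complex.norm_real, Real.norm_of_nonneg hϱ.le, Real.norm_eq_abs]
    exact div_le_div_of_nonneg_left hϱ.le hc0 (hc x hx)
  have hN : ∀ s, IsSymbol (fun x => q s x • b x) (ϱ / c * C) := fun s =>
    hb.smul (hqm s) (by
      filter_upwards [hb.bound] with x hx
      by_cases h0 : b x = 0
      · rw [h0, msmul_zero, norm_zero]; positivity
      · rw [norm_smul]
        exact mul_le_mul (hq s x h0) hx (norm_nonneg _) (by positivity)) (by positivity)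
  have key := norm_integral_oscillating_le (M := fun s => symOp (oscSym b φ (s / ϱ)))
    (N := fun s => symOp (fun x => q s x • b x)) (w := w) (T := T) (ν := ϱ / c * C) (B := B)
    (L := L) (C₂ := 3 * Λ / ϱ * C) (C₃ := C * Λ / ϱ) (C₄ := C) hL0 (by positivity)
    hw hL (fun s => norm_symOp_le hm (hN s)) ?_ ?_ (fun s => norm_symOp_le hm (hb.osc hφ _)) hτ
  · refine key.trans (le_of_eq ?_)
    field_simp
  · intro s h hh
    have h1 : symOp (fun x => q (s + h) x • b x) - symOp (fun x => q s x • b x) -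
        h • symOp (oscSym b φ (s / ϱ)) =
        symOp (fun x => (q (s + h) x • b x - q s x • b x) -
          (((h : ℝ) : ℂ) • oscSym b φ (s / ϱ) x)) := by
      have hs : IsSymbol (fun x => ((h : ℝ) : ℂ) • oscSym b φ (s / ϱ) x) (h * C) :=
        (hb.osc hφ _).smul aestronglyMeasurable_const (by
          filter_upwards [(hb.osc hφ (s / ϱ)).bound] with x hx
          rw [norm_smul, Complex.norm_real, Real.norm_of_nonneg hh]
          gcongr) (by positivity)
      rw [symOp_sub hm ((hN (s + h)).sub (hN s)) hs, symOp_sub hm (hN (s + h)) (hN s)]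
      congr 1
      ext1 v
      rw [smul_apply]
      apply Lp.ext
      filter_upwards [Lp.coeFn_smul h (symOp (oscSym b φ (s / ϱ)) v), symOp_coe hm (hb.osc hφ _) v,
        symOp_coe hm hs v] with k h1 h2 h3
      rw [h1, h3, Pi.smul_apply, h2, fiberIntegral, fiberIntegral, ← integral_smul]
      simp only [tens, smul_apply, Complex.coe_smul]
    rw [h1]
    refine norm_symOp_le hm (IsSymbol.mono ((((hN (s + h)).sub (hN s)).sub
      ((hb.osc hφ _).smul (C' := h * C) aestronglyMeasurable_const ?_ (by positivity)))) ?_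
      (by positivity))
    · filter_upwards [(hb.osc hφ (s / ϱ)).bound] with x hx
      rw [norm_smul, Complex.norm_real, Real.norm_of_nonneg hh]
      gcongr
    · filter_upwards [hb.bound] with x hx
      by_cases h0 : b x = 0
      · rw [oscSym, h0, msmul_zero, msmul_zero, msmul_zero, msmul_zero, sub_zero, sub_zero, norm_zero]; positivity
      have hφ0 : φ x ≠ 0 := fun h => by have := hc x h0; rw [h, abs_zero] at this; linarith
      rw [oscSym, msub_smul, msmul_smul, msub_smul, norm_smul]
      have h2 : q (s + h) x - q s x - h * Complex.exp (Complex.I * ((s / ϱ * φ x : ℝ) : ℂ)) =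
          q s x * (Complex.exp (Complex.I * ((h / ϱ * φ x : ℝ) : ℂ)) - 1 -
            Complex.I * ((h / ϱ * φ x : ℝ) : ℂ)) := by
        have h3 : Complex.exp (Complex.I * (((s + h) / ϱ * φ x : ℝ) : ℂ)) =
            Complex.exp (Complex.I * ((s / ϱ * φ x : ℝ) : ℂ)) *
            Complex.exp (Complex.I * ((h / ϱ * φ x : ℝ) : ℂ)) := by
          rw [← Complex.exp_add]
          congr 1
          push_cast
          ring
        have hϱ' : (ϱ : ℂ) ≠ 0 := by exact_mod_cast hϱ.ne'
        have hφ' : (φ x : ℂ) ≠ 0 := by exact_mod_cast hφ0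
        simp only [q]
        rw [h3]
        push_cast
        field_simp
      rw [h2, norm_mul]
      have h4 := norm_exp_I_sub_one_sub_le (h / ϱ * φ x)
      have h5 : ‖q s x‖ = ϱ / |φ x| := by
        simp only [q]
        rw [norm_mul, norm_exp_I_mul_ofReal, mul_one, norm_div, norm_mul, Complex.norm_I, one_mul,
          Complex.norm_real, Complex.norm_real, Real.norm_of_nonneg hϱ.le, Real.norm_eq_abs]
      have h6 : ‖q s x‖ * (3 * (h / ϱ * φ x) ^ 2) = 3 * |φ x| / ϱ * h ^ 2 := by
        rw [h5, mul_pow, ← sq_abs (φ x)]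
        have : |φ x| ≠ 0 := abs_ne_zero.2 hφ0
        field_simp
      have h7 : 3 * |φ x| / ϱ * h ^ 2 ≤ 3 * Λ / ϱ * h ^ 2 := by
        gcongr
        exact hΛ x h0
      calc _ ≤ (3 * Λ / ϱ * h ^ 2) * C := mul_le_mul
            ((mul_le_mul_of_nonneg_left h4 (norm_nonneg _)).trans (h6.le.trans h7)) hx
            (norm_nonneg _) (by positivity)
        _ = _ := by ring
  · intro s t
    refine (norm_symOp_oscSym_sub_le hm hb hφ hΛ hΛ0 _ _).trans (le_of_eq ?_)
    rw [← sub_div, abs_div, abs_of_pos hϱ]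
    ring

end Wavepacket

namespace Wavepacket

open Filter Topology

variable {d J m N : ℕ}

/-! ### Localization functions -/

/-- The standard bump: `1` on `|k| ≤ 1`, `0` off `|k| < 2`. -/
def unitBump (d : ℕ) : ContDiffBump (0 : Wave d) := ⟨1, 2, one_pos, one_lt_two⟩

/-- A smooth function that is `1` on `|k - c| ≤ δ` and `0` off `|k - c| < 2δ`. -/
def bump (c : Wave d) (δ : ℝ) (k : Wave d) : ℝ := unitBump d (δ⁻¹ • (k - c))

variable {c : Wave d} {δ : ℝ} {k : Wave d}

theorem bump_nonneg : 0 ≤ bump c δ k := (unitBump d).nonneg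

theorem bump_le_one : bump c δ k ≤ 1 := (unitBump d).le_one

theorem bump_eq_one (hδ : 0 < δ) (h : ‖k - c‖ ≤ δ) : bump c δ k = 1 := by
  refine (unitBump d).one_of_mem_closedBall ?_
  rw [mem_closedBall_zero_iff, norm_smul, norm_inv, Real.norm_of_nonneg hδ.le]
  exact (inv_mul_le_one₀ hδ).2 h

theorem bump_eq_zero (hδ : 0 < δ) (h : 2 * δ ≤ ‖k - c‖) : bump c δ k = 0 := by
  refine (unitBump d).zero_of_le_dist ?_
  rw [dist_zero_right, norm_smul, norm_inv, Real.norm_of_nonneg hδ.le, ← div_eq_inv_mul,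
    le_div_iff₀ hδ]
  exact h

theorem norm_sub_lt_of_bump_ne_zero (hδ : 0 < δ) (h : bump c δ k ≠ 0) : ‖k - c‖ < 2 * δ := by
  by_contra! h'
  exact h (bump_eq_zero hδ h')

theorem contDiff_bump : ContDiff ℝ ∞ (bump c δ) :=
  (unitBump d).contDiff.comp (by fun_prop)

theorem exists_lipschitz_unitBump (d : ℕ) :
    ∃ K : ℝ, 0 ≤ K ∧ ∀ k k', |unitBump d k - unitBump d k'| ≤ K * ‖k - k'‖ := by
  obtain ⟨K, hK⟩ := ((unitBump d).contDiff (n := 1)).lipschitzWith_of_hasCompactSupport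
    (𝕂 := ℝ) (unitBump d).hasCompactSupport one_ne_zero
  exact ⟨K, K.2, fun k k' => by simpa [Real.dist_eq, dist_eq_norm] using hK.dist_le_mul k k'⟩

theorem abs_bump_sub_le {K : ℝ} (hK : ∀ k k', |unitBump d k - unitBump d k'| ≤ K * ‖k - k'‖)
    (hδ : 0 < δ) (k k' : Wave d) : |bump c δ k - bump c δ k'| ≤ K / δ * ‖k - k'‖ := by
  refine (hK _ _).trans (le_of_eq ?_)
  rw [← smul_sub, sub_sub_sub_cancel_right, norm_smul, norm_inv, Real.norm_of_nonneg hδ.le]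
  ring

/-! ### Centers and resonances -/

theorem sgn_mul_self (ζ : ℤˣ) : sgn ζ * sgn ζ = 1 := by
  rcases sgn_eq ζ with h | h <;> rw [h] <;> norm_num

theorem sgn_mul (ζ ζ' : ℤˣ) : sgn (ζ * ζ') = sgn ζ * sgn ζ' := by simp [sgn]

/-- The center `ζ k_{*l}` of the component with index `(ζ, l)`. -/
def ctr (S : Fin N → Fin J × Wave d) (θ : ℤˣ × Fin N) : Wave d := sgn θ.1 • (S θ.2).2

/-- The resonances that feed the component with index `θ`. -/
def Feeds (A : LinearPart d J) (S : Fin N → Fin J × Wave d) (lam : Fin m → ℤˣ × Fin N)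
    (θ : ℤˣ × Fin N) : Prop :=
  IsResonant A S θ.1 (S θ.2).1 lam ∧ kappa S lam = ctr S θ

variable {A : LinearPart d J} {B : Nonlinearity d J} {S : Fin N → Fin J × Wave d}

theorem ctr_notMem (hS : IsNKSpectrum A B.M S) (θ : ℤˣ × Fin N) : ctr S θ ∉ A.bandCrossing := by
  unfold ctr
  rcases sgn_eq θ.1 with h | h <;> rw [h]
  · rw [one_smul]; exact (hS.regular θ.2).1
  · rw [neg_one_smul]; exact (hS.regular θ.2).2

theorem kappa_notMem (hS : IsNKSpectrum A B.M S) (hm : m ∈ B.M) (lam : Fin m → ℤˣ × Fin N) :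
    kappa S lam ∉ A.bandCrossing := fun h =>
  (hS.output.subset (⟨⟨m, hm, lam, rfl⟩, h⟩ : _ ∈ outputK B.M S ∩ A.bandCrossing)).elim

theorem sgn_smul_kappa (ζ : ℤˣ) (lam : Fin m → ℤˣ × Fin N) :
    sgn ζ • kappa S lam = kappa S fun j => (ζ * (lam j).1, (lam j).2) := by
  simp only [kappa, Finset.smul_sum, smul_smul, sgn_mul]

theorem freq_sgn (hA : A.Admissible) {k : Wave d} (hk : k ∉ A.bandCrossing) (n : Fin J) (ζ : ℤˣ) :
    A.freq n ζ (sgn ζ • k) = sgn ζ * A.freq n 1 k := by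
  rcases Int.units_eq_one_or ζ with rfl | rfl
  · simp [sgn]
  · have := hA.symm k hk n 1
    simpa [sgn] using this

theorem kappa_eq_sum_delta (lam : Fin m → ℤˣ × Fin N) :
    kappa S lam = ∑ l, (delta lam l : ℝ) • (S l).2 := by
  simp only [delta, Int.cast_sum, Finset.sum_smul]
  rw [Finset.sum_comm, kappa]
  refine Finset.sum_congr rfl fun j _ => ?_
  rw [Finset.sum_eq_single (lam j).2]
  · simp [sgn]
  · intro l _ hl
    rw [if_neg hl.symm]
    simp
  · simp

/-- Every resonance feeds a unique component. -/
theorem exists_feeds (hU : UniversallyResonanceInvariant A B.M S)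
    (hm : m ∈ B.M) {lam : Fin m → ℤˣ × Fin N} {ζ : ℤˣ} {n : Fin J} (h : IsResonant A S ζ n lam) :
    ∃ l, S l = (n, sgn ζ • kappa S lam) := by
  have h1 : (n, sgn ζ • kappa S lam) ∈ range S ∪ resonantOutput A B.M S := by
    refine Or.inr ⟨⟨m, hm, _, sgn_smul_kappa ζ lam⟩, m, hm, ζ, lam, rfl, h⟩
  rwa [hU.1] at h1

theorem feeds_iff {lam : Fin m → ℤˣ × Fin N} {θ : ℤˣ × Fin N} :
    Feeds A S lam θ ↔ IsResonant A S θ.1 (S θ.2).1 lam ∧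
      S θ.2 = ((S θ.2).1, sgn θ.1 • kappa S lam) := by
  refine and_congr_right fun _ => ?_
  rw [ctr]
  constructor
  · intro h
    rw [h, smul_smul, sgn_mul_self, one_smul]
  · intro h
    have h2 := congrArg Prod.snd h
    simp only at h2
    rw [h2, smul_smul, sgn_mul_self, one_smul]

/-- The resonance is internal, hence universal: δ_I = ±1 for one index I and δ_l = 0 otherwise. Then
∑ζ^{(j)}k_{*l_j} = ζk_{*I}, and distinctness of the pairs gives I = l. As δ_I ≠ 0, some input
belongs to the packet l. -/
theorem Feeds.exists_index (hS : IsNKSpectrum A B.M S)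
    (hU : UniversallyResonanceInvariant A B.M S) (hm : m ∈ B.M) {lam : Fin m → ℤˣ × Fin N}
    {θ : ℤˣ × Fin N} (h : Feeds A S lam θ) : ∃ j, (lam j).2 = θ.2 := by
  rw [feeds_iff] at h
  obtain ⟨-, I, hI, hl, hn, hζ⟩ := (hU.2 m hm θ.1 _ lam).2 ⟨h.1, ⟨θ.2, h.2⟩⟩
  have hk : kappa S lam = sgn θ.1 • (S I).2 := by
    rw [kappa_eq_sum_delta, Finset.sum_eq_single I]
    · rw [← hζ, sgn]
    · intro l _ h'; rw [hl l h']; simp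
    · simp
  have hI2 : θ.2 = I := by
    apply hS.injective
    rw [h.2, hk, smul_smul, sgn_mul_self, one_smul, hn]
  by_contra! hne
  have : delta lam I = 0 := by
    refine Finset.sum_eq_zero fun j _ => ?_
    rw [if_neg]
    rw [← hI2]
    exact hne j
  omega

/-! ### The phase of an interaction -/

variable (A S) in
/-- The phase `ω_{n,ζ}(∑ k^{(j)}) - ∑ ω_{n_j,ζ_j}(k^{(j)})`. -/
def phase (lam : Fin m → ℤˣ × Fin N) (n : Fin J) (ζ : ℤˣ) (x : Fin m → Wave d) : ℝ :=
  A.freq n ζ (∑ j, x j) - ∑ j, A.freq (S (lam j).2).1 (lam j).1 (x j)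

/-- The symmetry ω_{n,ζ}(ζk) = ζω_n(k) turns the phase at the centres into minus the left side of
the resonance equation. The output spectrum avoiding σ_bc makes this legitimate at the output point.
-/
theorem phase_ctr (hA : A.Admissible) (hS : IsNKSpectrum A B.M S) (hm : m ∈ B.M)
    (lam : Fin m → ℤˣ × Fin N) (n : Fin J) (ζ : ℤˣ) :
    phase A S lam n ζ (fun j => ctr S (lam j)) = 0 ↔ IsResonant A S ζ n lam := by
  have h1 : A.freq n ζ (∑ j, ctr S (lam j)) = sgn ζ * A.freq n 1 (sgn ζ • kappa S lam) := by
    have h2 : sgn ζ • kappa S lam ∉ A.bandCrossing := by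
      rw [sgn_smul_kappa]; exact kappa_notMem hS hm _
    rw [← freq_sgn hA h2, smul_smul, sgn_mul_self, one_smul]
    rfl
  have h3 : ∀ j, A.freq (S (lam j).2).1 (lam j).1 (ctr S (lam j)) =
      sgn (lam j).1 * A.freq (S (lam j).2).1 1 (S (lam j).2).2 := fun j =>
    freq_sgn hA (hS.regular _).1 _ _
  rw [phase, IsResonant, h1]
  simp only [h3]
  constructor <;> intro h <;> linarith

theorem continuousAt_phase (hA : A.Admissible) (hS : IsNKSpectrum A B.M S) (hm : m ∈ B.M)
    (lam : Fin m → ℤˣ × Fin N) (n : Fin J) (ζ : ℤˣ) :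
    ContinuousAt (phase A S lam n ζ) (fun j => ctr S (lam j)) := by
  have hf : ∀ n ζ k, k ∉ A.bandCrossing → ContinuousAt (A.freq n ζ) k := fun n ζ k hk =>
    (hA.continuous_omega n ζ).continuousAt (hA.isOpen.mem_nhds hk)
  unfold phase
  refine ContinuousAt.sub ?_ (tendsto_finsetSum _ fun j _ => ?_)
  · exact ContinuousAt.comp (f := fun x : Fin m → Wave d => ∑ j, x j)
      (hf n ζ _ (kappa_notMem hS hm lam)) (by fun_prop)
  · exact ContinuousAt.comp (f := fun x : Fin m → Wave d => x j)
      (hf _ _ _ (ctr_notMem hS (lam j))) (continuous_apply j).continuousAt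

theorem aestronglyMeasurable_phase (hA : A.Admissible) (hm : 1 ≤ m)
    (lam : Fin m → ℤˣ × Fin N) (n : Fin J) (ζ : ℤˣ) :
    AEStronglyMeasurable (phase A S lam n ζ) volume := by
  have hf : ∀ n ζ, AEStronglyMeasurable (A.freq n ζ) volume := fun n ζ =>
    hA.aestronglyMeasurable (hA.continuous_omega n ζ)
  unfold phase
  refine AEStronglyMeasurable.sub ((hf n ζ).comp_quasiMeasurePreserving
    (quasiMeasurePreserving_sum hm)) ?_
  refine Finset.aestronglyMeasurable_fun_sum _ fun j _ => ?_
  exact (hf _ _).comp_quasiMeasurePreserving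
    (Measure.quasiMeasurePreserving_eval (fun _ : Fin m => (volume : Measure (Wave d))) j)

/-! ### The localization radius -/

/-- Properties of a radius that is small enough for all localizations. -/
structure IsLocalRadius (A : LinearPart d J) (B : Nonlinearity d J) (S : Fin N → Fin J × Wave d)
    (δ : ℝ) : Prop where
  pos : 0 < δ
  notMem : ∀ θ k, ‖k - ctr S θ‖ ≤ 6 * δ → k ∉ A.bandCrossing
  sum_notMem : ∀ m ∈ B.M, ∀ (lam : Fin m → ℤˣ × Fin N) k, ‖k - kappa S lam‖ ≤ m * 6 * δ →
    k ∉ A.bandCrossing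
  gap : ∀ m ∈ B.M, ∀ (lam : Fin m → ℤˣ × Fin N) (n : Fin J) (ζ : ℤˣ), ¬ IsResonant A S ζ n lam →
    ∀ x : Fin m → Wave d, (∀ j, ‖x j - ctr S (lam j)‖ ≤ 6 * δ) → δ ≤ |phase A S lam n ζ x|
  phase_le : ∀ m ∈ B.M, ∀ (lam : Fin m → ℤˣ × Fin N) (n : Fin J) (ζ : ℤˣ),
    ∀ x : Fin m → Wave d, (∀ j, ‖x j - ctr S (lam j)‖ ≤ 6 * δ) → |phase A S lam n ζ x| ≤ δ⁻¹
  taylor : ∀ θ k y, ‖k - ctr S θ‖ ≤ 6 * δ → ‖y‖ ≤ 6 * δ →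
    |A.freq (S θ.2).1 θ.1 (k + y) - A.freq (S θ.2).1 θ.1 k -
      inner ℝ (gradient (A.freq (S θ.2).1 1) (S θ.2).2) y| ≤
      δ⁻¹ * ‖y‖ * (‖k - ctr S θ‖ + ‖y‖)
  sep : ∀ θ θ', ctr S θ ≠ ctr S θ' → 12 * δ < ‖ctr S θ - ctr S θ'‖

theorem eventually_closedBall {E : Type*} [SeminormedAddCommGroup E] {p : E → Prop} {c : E}
    (h : ∀ᶠ k in 𝓝 c, p k) (a : ℝ) :
    ∀ᶠ δ in 𝓝[>] (0 : ℝ), ∀ k, ‖k - c‖ ≤ a * δ → p k := by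
  obtain ⟨r, hr, h⟩ := Metric.eventually_nhds_iff.1 h
  have h1 : ∀ᶠ δ in 𝓝[>] (0 : ℝ), a * δ < r := by
    have : Tendsto (fun δ : ℝ => a * δ) (𝓝[>] 0) (𝓝 (a * 0)) :=
      (tendsto_id.const_mul a).mono_left nhdsWithin_le_nhds
    exact this.eventually (gt_mem_nhds (by simpa using hr))
  filter_upwards [h1] with δ hδ k hk
  exact h (by rw [dist_eq_norm]; exact hk.trans_lt hδ)

/-- There are finitely many components, tuples and bands. The band-crossing, gap and phase
conditions follow from openness or continuity at the centres; Taylor and separation come from local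
constants and finite distances. All requirements therefore hold eventually as δ → 0⁺. -/
theorem exists_isLocalRadius (hA : A.Admissible) (hS : IsNKSpectrum A B.M S) :
    ∃ δ, IsLocalRadius A B S δ := by
  have hinv : ∀ C : ℝ, ∀ᶠ δ in 𝓝[>] (0 : ℝ), C ≤ δ⁻¹ := fun C =>
    tendsto_inv_nhdsGT_zero.eventually_ge_atTop C
  have hsmall : ∀ C : ℝ, 0 < C → ∀ a : ℝ, ∀ᶠ δ in 𝓝[>] (0 : ℝ), a * δ < C := fun C hC a => by
    have : Tendsto (fun δ : ℝ => a * δ) (𝓝[>] 0) (𝓝 (a * 0)) :=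
      (tendsto_id.const_mul a).mono_left nhdsWithin_le_nhds
    exact this.eventually (gt_mem_nhds (by simpa using hC))
  have e0 : ∀ᶠ δ in 𝓝[>] (0 : ℝ), 0 < δ := eventually_mem_nhdsWithin
  have e1 : ∀ᶠ δ in 𝓝[>] (0 : ℝ), ∀ θ k, ‖k - ctr S θ‖ ≤ 6 * δ → k ∉ A.bandCrossing :=
    eventually_all.2 fun θ => eventually_closedBall (hA.isOpen.mem_nhds (ctr_notMem hS θ)) 6
  have e2 : ∀ᶠ δ in 𝓝[>] (0 : ℝ), ∀ m ∈ B.M, ∀ (lam : Fin m → ℤˣ × Fin N) k,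
      ‖k - kappa S lam‖ ≤ m * 6 * δ → k ∉ A.bandCrossing :=
    (Filter.eventually_all_finset _).2 fun m hm => eventually_all.2 fun lam =>
      eventually_closedBall (hA.isOpen.mem_nhds (kappa_notMem hS hm lam)) _
  have e3 : ∀ᶠ δ in 𝓝[>] (0 : ℝ), ∀ m ∈ B.M, ∀ (lam : Fin m → ℤˣ × Fin N) (n : Fin J) (ζ : ℤˣ),
      ¬ IsResonant A S ζ n lam → ∀ x : Fin m → Wave d,
      (∀ j, ‖x j - ctr S (lam j)‖ ≤ 6 * δ) → δ ≤ |phase A S lam n ζ x| := by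
    refine (Filter.eventually_all_finset _).2 fun m hm => eventually_all.2 fun lam =>
      eventually_all.2 fun n => eventually_all.2 fun ζ => ?_
    by_cases hr : IsResonant A S ζ n lam
    · exact Eventually.of_forall fun δ h => absurd hr h
    have h0 : 0 < |phase A S lam n ζ (fun j => ctr S (lam j))| :=
      abs_pos.2 fun h => hr ((phase_ctr hA hS hm lam n ζ).1 h)
    have h1 := eventually_closedBall ((continuousAt_phase hA hS hm lam n ζ).abs.eventually
      (lt_mem_nhds (half_lt_self h0))) 6
    filter_upwards [h1, hsmall _ (half_pos h0) 1, e0] with δ hδ hs hp _ x hx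
    have := hδ x ((pi_norm_le_iff_of_nonneg (by positivity)).2 hx)
    linarith
  have e4 : ∀ᶠ δ in 𝓝[>] (0 : ℝ), ∀ m ∈ B.M, ∀ (lam : Fin m → ℤˣ × Fin N) (n : Fin J) (ζ : ℤˣ),
      ∀ x : Fin m → Wave d,
      (∀ j, ‖x j - ctr S (lam j)‖ ≤ 6 * δ) → |phase A S lam n ζ x| ≤ δ⁻¹ := by
    refine (Filter.eventually_all_finset _).2 fun m hm => eventually_all.2 fun lam =>
      eventually_all.2 fun n => eventually_all.2 fun ζ => ?_
    have h1 := eventually_closedBall ((continuousAt_phase hA hS hm lam n ζ).abs.eventually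
      (gt_mem_nhds (lt_add_one _))) 6
    filter_upwards [h1, hinv _, e0] with δ hδ hs hp x hx
    exact (hδ x ((pi_norm_le_iff_of_nonneg (by positivity)).2 hx)).le.trans hs
  have e5 : ∀ᶠ δ in 𝓝[>] (0 : ℝ), ∀ θ k y, ‖k - ctr S θ‖ ≤ 6 * δ → ‖y‖ ≤ 6 * δ →
      |A.freq (S θ.2).1 θ.1 (k + y) - A.freq (S θ.2).1 θ.1 k -
        inner ℝ (gradient (A.freq (S θ.2).1 1) (S θ.2).2) y| ≤
        δ⁻¹ * ‖y‖ * (‖k - ctr S θ‖ + ‖y‖) := by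
    refine eventually_all.2 fun θ => ?_
    obtain ⟨r, hr, C, -, h⟩ := hA.exists_freq_second_order (hS.regular θ.2).1 (S θ.2).1 θ.1
    filter_upwards [hinv C, hsmall r hr 6] with δ hC hδ k y hk hy
    refine (h k y (hk.trans hδ.le) (hy.trans hδ.le)).trans ?_
    exact mul_le_mul_of_nonneg_right (mul_le_mul_of_nonneg_right hC (norm_nonneg _))
      (by positivity)
  have e6 : ∀ᶠ δ in 𝓝[>] (0 : ℝ), ∀ θ θ', ctr S θ ≠ ctr S θ' →
      12 * δ < ‖ctr S θ - ctr S θ'‖ := by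
    refine eventually_all.2 fun θ => eventually_all.2 fun θ' => ?_
    by_cases h : ctr S θ = ctr S θ'
    · exact Eventually.of_forall fun δ h' => absurd h h'
    · filter_upwards [hsmall _ (norm_pos_iff.2 (sub_ne_zero.2 h)) 12] with δ hδ _
      exact hδ
  obtain ⟨δ, h0, h1, h2, h3, h4, h5, h6⟩ :=
    (e0.and (e1.and (e2.and (e3.and (e4.and (e5.and e6)))))).exists
  exact ⟨δ, h0, h1, h2, h3, h4, h5, h6⟩

end Wavepacket

namespace Wavepacket

open Filter Topology Nonlinearity

variable {d J m N : ℕ} {A : LinearPart d J} {B : Nonlinearity d J} {S : Fin N → Fin J × Wave d}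
  {δ C : ℝ}

/-! ### Localized interaction symbols -/

theorem mzero_smul (T : ContinuousMultilinearMap ℂ (fun _ : Fin m => Amp J) (Amp J)) :
    (0 : ℂ) • T = 0 := by
  ext1 v
  exact zero_smul ℂ (T v)

theorem msmul_sub_smul (c c' : ℂ)
    (T T' : ContinuousMultilinearMap ℂ (fun _ : Fin m => Amp J) (Amp J)) :
    c • T - c' • T' = (c - c') • T + c' • (T - T') := by
  ext1 v
  change c • T v - c' • T' v = (c - c') • T v + c' • (T v - T' v)
  module

theorem msmul_sub_smul' (c c' : ℂ)
    (T T' : ContinuousMultilinearMap ℂ (fun _ : Fin m => Amp J) (Amp J)) :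
    c • T - c' • T' = (c - c') • T' + c • (T - T') := by
  ext1 v
  change c • T v - c' • T' v = (c - c') • T' v + c • (T v - T' v)
  module

theorem mcomp_zero (p : Amp J →L[ℂ] Amp J) :
    p.compContinuousMultilinearMap
      (0 : ContinuousMultilinearMap ℂ (fun _ : Fin m => Amp J) (Amp J)) = 0 := by
  ext1 v
  exact map_zero p

theorem mcomp_smul (p : Amp J →L[ℂ] Amp J) (c : ℂ)
    (T : ContinuousMultilinearMap ℂ (fun _ : Fin m => Amp J) (Amp J)) :
    p.compContinuousMultilinearMap (c • T) = c • p.compContinuousMultilinearMap T := by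
  ext1 v
  exact map_smul p c (T v)

theorem msmul_comp_range {p : Amp J →L[ℂ] Amp J} (hp : ∀ v, p (p v) = p v) (c c' : ℂ)
    (T : ContinuousMultilinearMap ℂ (fun _ : Fin m => Amp J) (Amp J)) :
    p.compContinuousMultilinearMap (c • c' • p.compContinuousMultilinearMap T) =
      c • c' • p.compContinuousMultilinearMap T := by
  rw [mcomp_smul, mcomp_smul]
  congr 2
  ext1 v
  exact hp (T v)

variable (A B S δ) in
/-- The part of the interaction symbol that acts on waves near the centers of `lam` and has values
in the band `(n, ζ)`. -/
def bandSym (lam : Fin m → ℤˣ × Fin N) (n : Fin J) (ζ : ℤˣ) : MSymbol d J m := fun x =>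
  ((convConst d m * ∏ j, bump (ctr S (lam j)) (2 * δ) (x j) : ℝ) : ℂ) •
    (A.projL n ζ (∑ j, x j)).compContinuousMultilinearMap (B.chiSym m x)

theorem bandSym_support (hδ : IsLocalRadius A B S δ) {lam : Fin m → ℤˣ × Fin N} {n : Fin J}
    {ζ : ℤˣ} {x : Fin m → Wave d} (h : bandSym A B S δ lam n ζ x ≠ 0) (j : Fin m) :
    ‖x j - ctr S (lam j)‖ < 4 * δ := by
  have h1 : bump (ctr S (lam j)) (2 * δ) (x j) ≠ 0 := fun h0 => h (by
    rw [bandSym, Finset.prod_eq_zero (Finset.mem_univ j) h0, mul_zero, Complex.ofReal_zero,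
      mzero_smul])
  have := norm_sub_lt_of_bump_ne_zero (by have := hδ.pos; positivity) h1
  linarith

theorem sum_add_single (x : Fin m → Wave d) (j : Fin m) (y : Wave d) :
    ∑ i, (x + Pi.single j y : Fin m → Wave d) i = ∑ i, x i + y := by
  simp only [Pi.add_apply, Finset.sum_add_distrib]
  rw [Fintype.sum_pi_single']

theorem norm_sum_sub_kappa_le (lam : Fin m → ℤˣ × Fin N) (x : Fin m → Wave d) :
    ‖∑ j, x j - kappa S lam‖ ≤ ∑ j, ‖x j - ctr S (lam j)‖ := by
  have : ∑ j, x j - kappa S lam = ∑ j, (x j - ctr S (lam j)) := by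
    rw [Finset.sum_sub_distrib]; rfl
  rw [this]
  exact norm_sum_le _ _

theorem IsLocalRadius.sum_notMem' (hδ : IsLocalRadius A B S δ) (hm : m ∈ B.M)
    {lam : Fin m → ℤˣ × Fin N} {x : Fin m → Wave d}
    (hx : ∀ j, ‖x j - ctr S (lam j)‖ ≤ 6 * δ) : ∑ j, x j ∉ A.bandCrossing := by
  refine hδ.sum_notMem m hm lam _ ((norm_sum_sub_kappa_le lam x).trans ?_)
  refine (Finset.sum_le_sum fun j _ => hx j).trans (le_of_eq ?_)
  simp [mul_assoc]

theorem norm_bandSym_le (hA : A.Admissible) (hδ : IsLocalRadius A B S δ) (hC0 : 0 ≤ C)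
    (hC : ∀ m ∈ B.M, ∀ (k : Wave d) (q : Fin m → Wave d), k ∉ A.bandCrossing →
      (∀ j, q j ∉ A.bandCrossing) → ‖B.χ m k q‖ ≤ C) (hm : m ∈ B.M)
    (lam : Fin m → ℤˣ × Fin N) (n : Fin J) (ζ : ℤˣ) (x : Fin m → Wave d) :
    ‖bandSym A B S δ lam n ζ x‖ ≤ C := by
  by_cases h : bandSym A B S δ lam n ζ x = 0
  · rwa [h, norm_zero]
  have hx : ∀ j, ‖x j - ctr S (lam j)‖ ≤ 6 * δ := fun j => by
    have := bandSym_support hδ h j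
    have := hδ.pos
    linarith
  have hs := hδ.sum_notMem' hm hx
  rw [bandSym, norm_smul]
  have h1 : ‖((convConst d m * ∏ j, bump (ctr S (lam j)) (2 * δ) (x j) : ℝ) : ℂ)‖ ≤ 1 := by
    have h2 : 0 ≤ ∏ j, bump (ctr S (lam j)) (2 * δ) (x j) :=
      Finset.prod_nonneg fun j _ => bump_nonneg
    have h3 : ∏ j, bump (ctr S (lam j)) (2 * δ) (x j) ≤ 1 :=
      Finset.prod_le_one (fun j _ => bump_nonneg) fun j _ => bump_le_one
    rw [Complex.norm_real, Real.norm_of_nonneg (mul_nonneg (convConst_nonneg m) h2)]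
    exact mul_le_one₀ (convConst_le_one m) h2 h3
  have h2 : ‖(A.projL n ζ (∑ j, x j)).compContinuousMultilinearMap (B.chiSym m x)‖ ≤ 1 * C :=
    (ContinuousLinearMap.norm_compContinuousMultilinearMap_le _ _).trans
      (mul_le_mul (hA.norm_projL_le hs n ζ) (hC m hm _ _ hs fun j => hδ.notMem _ _ (hx j))
        (norm_nonneg _) zero_le_one)
  calc _ ≤ 1 * (1 * C) := mul_le_mul h1 h2 (norm_nonneg _) zero_le_one
    _ = C := by ring

/-- The cutoffs vanish beyond 4δ, while χ and the projection are smooth as long as all inputs stay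
within 6δ; the two regions overlap. -/
theorem contDiff_bandSym (hA : A.Admissible) (hB : B.Admissible A) (hδ : IsLocalRadius A B S δ)
    (hm : m ∈ B.M) (lam : Fin m → ℤˣ × Fin N) (n : Fin J) (ζ : ℤˣ) :
    ContDiff ℝ ∞ (bandSym A B S δ lam n ζ) := by
  have hδ0 := hδ.pos
  rw [contDiff_iff_contDiffAt]
  intro x
  by_cases hx : ∀ j, ‖x j - ctr S (lam j)‖ ≤ 6 * δ
  · have hs := hδ.sum_notMem' hm hx
    have h1 : ContDiffAt ℝ ∞ (fun x : Fin m → Wave d =>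
        (((convConst d m * ∏ j, bump (ctr S (lam j)) (2 * δ) (x j) : ℝ) : ℂ))) x := by
      refine ContDiff.contDiffAt (Complex.ofRealCLM.contDiff.comp (contDiff_const.mul ?_))
      exact contDiff_prod fun j _ => contDiff_bump.comp (contDiff_apply _ _ j)
    have h2 : ContDiffAt ℝ ∞ (fun x : Fin m → Wave d => A.projL n ζ (∑ j, x j)) x :=
      ContDiffAt.comp (f := fun x : Fin m → Wave d => ∑ j, x j) x
        ((hA.contDiffOn_projL n ζ).contDiffAt (hA.isOpen.mem_nhds hs))
        (ContDiff.contDiffAt (ContDiff.sum fun j _ => contDiff_apply _ _ j))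
    have h3 : ContDiffAt ℝ ∞ (B.chiSym m) x := by
      have hopen : IsOpen {q : Wave d × (Fin m → Wave d) |
          q.1 ∉ A.bandCrossing ∧ ∀ j, q.2 j ∉ A.bandCrossing} := by
        rw [ofPred_and, ofPred_forall]
        exact (hA.isOpen.preimage (by fun_prop)).inter
          (isOpen_iInter_of_finite fun j => hA.isOpen.preimage (t := A.bandCrossingᶜ)
            (f := fun q : Wave d × (Fin m → Wave d) => q.2 j)
            ((continuous_apply j).comp continuous_snd))
      exact ContDiffAt.comp (f := fun x : Fin m → Wave d => (∑ j, x j, x)) x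
        ((hB.smooth m hm).contDiffAt (hopen.mem_nhds ⟨hs, fun j => hδ.notMem _ _ (hx j)⟩))
        ((ContDiff.sum fun j _ => contDiff_apply _ _ j).prodMk contDiff_id).contDiffAt
    have hbil : ContDiff ℝ ∞ fun p : (Amp J →L[ℂ] Amp J) ×
        (ContinuousMultilinearMap ℂ (fun _ : Fin m => Amp J) (Amp J)) =>
        p.1.compContinuousMultilinearMap p.2 :=
      ((ContinuousLinearMap.compContinuousMultilinearMapL ℂ (fun _ : Fin m => Amp J) (Amp J)
        (Amp J)).isBoundedBilinearMap.contDiff (n := ∞)).restrict_scalars ℝ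
    exact h1.smul (hbil.contDiffAt.comp x (h2.prodMk h3))
  · push Not at hx
    obtain ⟨j, hj⟩ := hx
    have h1 : ∀ᶠ y : Fin m → Wave d in 𝓝 x, 4 * δ < ‖y j - ctr S (lam j)‖ := by
      have : Continuous fun y : Fin m → Wave d => ‖y j - ctr S (lam j)‖ :=
        ((continuous_apply j).sub continuous_const).norm
      exact this.continuousAt.eventually (lt_mem_nhds (by linarith))
    have h2 : bandSym A B S δ lam n ζ =ᶠ[𝓝 x] fun _ => 0 := by
      filter_upwards [h1] with y hy
      by_contra h
      exact absurd (bandSym_support hδ h j) (by linarith)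
    exact contDiffAt_const.congr_of_eventuallyEq h2

theorem exists_lipschitz_bandSym (hA : A.Admissible) (hB : B.Admissible A)
    (hδ : IsLocalRadius A B S δ) (hm : m ∈ B.M) (lam : Fin m → ℤˣ × Fin N) (n : Fin J) (ζ : ℤˣ) :
    ∃ K : ℝ, 0 ≤ K ∧ ∀ x y, ‖bandSym A B S δ lam n ζ x - bandSym A B S δ lam n ζ y‖ ≤
      K * ‖x - y‖ := by
  have hc : HasCompactSupport (bandSym A B S δ lam n ζ) := by
    refine HasCompactSupport.intro
      (isCompact_closedBall (fun j => ctr S (lam j)) (6 * δ)) fun x hx => ?_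
    by_contra h
    refine hx ?_
    rw [Metric.mem_closedBall, dist_eq_norm]
    refine (pi_norm_le_iff_of_nonneg (by have := hδ.pos; positivity)).2 fun j => ?_
    have := bandSym_support hδ h j
    have := hδ.pos
    change ‖x j - ctr S (lam j)‖ ≤ _
    linarith
  obtain ⟨K, hK⟩ := (contDiff_bandSym hA hB hδ hm lam n ζ).lipschitzWith_of_hasCompactSupport
    hc (by simp)
  exact ⟨K, K.2, fun x y => by simpa [dist_eq_norm] using hK.dist_le_mul x y⟩

theorem isSymbol_bandSym (hA : A.Admissible) (hB : B.Admissible A) (hδ : IsLocalRadius A B S δ)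
    (hC0 : 0 ≤ C)
    (hC : ∀ m ∈ B.M, ∀ (k : Wave d) (q : Fin m → Wave d), k ∉ A.bandCrossing →
      (∀ j, q j ∉ A.bandCrossing) → ‖B.χ m k q‖ ≤ C) (hm : m ∈ B.M)
    (lam : Fin m → ℤˣ × Fin N) (n : Fin J) (ζ : ℤˣ) : IsSymbol (bandSym A B S δ lam n ζ) C :=
  ⟨(contDiff_bandSym hA hB hδ hm lam n ζ).continuous.aestronglyMeasurable, hC0,
    ae_of_all _ fun x => norm_bandSym_le hA hδ hC0 hC hm lam n ζ x⟩

/-! ### The symbols of the averaged system -/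

open Classical in
variable (A B S δ) in
/-- The part of the interaction symbol kept in the averaged equation for the component `θ`. -/
def resSym (lam : Fin m → ℤˣ × Fin N) (θ : ℤˣ × Fin N) : MSymbol d J m := fun x =>
  if Feeds A S lam θ then
    ((bump (ctr S θ) δ (∑ j, x j) : ℝ) : ℂ) • bandSym A B S δ lam (S θ.2).1 θ.1 x
  else 0

theorem resSym_support (hδ : IsLocalRadius A B S δ) {lam : Fin m → ℤˣ × Fin N}
    {θ : ℤˣ × Fin N} {x : Fin m → Wave d} (h : resSym A B S δ lam θ x ≠ 0) :
    Feeds A S lam θ ∧ (∀ j, ‖x j - ctr S (lam j)‖ < 4 * δ) ∧ ‖∑ j, x j - ctr S θ‖ < 2 * δ := by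
  unfold resSym at h
  split_ifs at h with hF
  · refine ⟨hF, bandSym_support hδ (n := (S θ.2).1) (ζ := θ.1) fun h0 => h ?_,
      norm_sub_lt_of_bump_ne_zero hδ.pos fun h0 => h ?_⟩
    · rw [h0, msmul_zero]
    · rw [h0, Complex.ofReal_zero, mzero_smul]
  · exact absurd rfl h

theorem norm_resSym_le_bandSym (lam : Fin m → ℤˣ × Fin N) (θ : ℤˣ × Fin N) (x : Fin m → Wave d) :
    ‖resSym A B S δ lam θ x‖ ≤ ‖bandSym A B S δ lam (S θ.2).1 θ.1 x‖ := by
  unfold resSym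
  split_ifs
  · rw [norm_smul, Complex.norm_real, Real.norm_of_nonneg bump_nonneg]
    exact mul_le_of_le_one_left (norm_nonneg _) bump_le_one
  · rw [norm_zero]; positivity

theorem continuous_resSym (hA : A.Admissible) (hB : B.Admissible A) (hδ : IsLocalRadius A B S δ)
    (hm : m ∈ B.M) (lam : Fin m → ℤˣ × Fin N) (θ : ℤˣ × Fin N) :
    Continuous (resSym A B S δ lam θ) := by
  unfold resSym
  split_ifs
  · exact Continuous.smul (M := ℂ) (f := fun x : Fin m → Wave d =>
      ((bump (ctr S θ) δ (∑ j, x j) : ℝ) : ℂ))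
      (Complex.continuous_ofReal.comp (contDiff_bump.continuous.comp (by fun_prop)))
      (contDiff_bandSym hA hB hδ hm lam _ _).continuous
  · exact continuous_const

theorem isSymbol_resSym (hA : A.Admissible) (hB : B.Admissible A) (hδ : IsLocalRadius A B S δ)
    (hC0 : 0 ≤ C)
    (hC : ∀ m ∈ B.M, ∀ (k : Wave d) (q : Fin m → Wave d), k ∉ A.bandCrossing →
      (∀ j, q j ∉ A.bandCrossing) → ‖B.χ m k q‖ ≤ C) (hm : m ∈ B.M)
    (lam : Fin m → ℤˣ × Fin N) (θ : ℤˣ × Fin N) : IsSymbol (resSym A B S δ lam θ) C :=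
  ⟨(continuous_resSym hA hB hδ hm lam θ).aestronglyMeasurable, hC0,
    ae_of_all _ fun x => (norm_resSym_le_bandSym lam θ x).trans
      (norm_bandSym_le hA hδ hC0 hC hm lam _ _ x)⟩

/-- The output projection is already part of the symbol and is idempotent. Hence polarization is
preserved exactly by the averaged flow, rather than up to an error. -/
theorem resSym_range (hA : A.Admissible) (hδ : IsLocalRadius A B S δ)
    (lam : Fin m → ℤˣ × Fin N) (θ : ℤˣ × Fin N) (x : Fin m → Wave d) :
    (A.projL (S θ.2).1 θ.1 (∑ j, x j)).compContinuousMultilinearMap (resSym A B S δ lam θ x) =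
      resSym A B S δ lam θ x := by
  by_cases h : resSym A B S δ lam θ x = 0
  · rw [h, mcomp_zero]
  obtain ⟨hF, hx, hs⟩ := resSym_support hδ h
  have hδ0 := hδ.pos
  have h1 : ∑ j, x j ∉ A.bandCrossing := hδ.notMem θ _ (by linarith)
  have h2 : resSym A B S δ lam θ x =
      ((bump (ctr S θ) δ (∑ j, x j) : ℝ) : ℂ) • bandSym A B S δ lam (S θ.2).1 θ.1 x := if_pos hF
  rw [h2, bandSym, msmul_comp_range fun v => by
    rw [hA.projL_projL h1 ((S θ.2).1, θ.1) ((S θ.2).1, θ.1), if_pos rfl]]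

theorem exists_lipschitz_resSym (hA : A.Admissible) (hB : B.Admissible A)
    (hδ : IsLocalRadius A B S δ) (hC0 : 0 ≤ C)
    (hC : ∀ m ∈ B.M, ∀ (k : Wave d) (q : Fin m → Wave d), k ∉ A.bandCrossing →
      (∀ j, q j ∉ A.bandCrossing) → ‖B.χ m k q‖ ≤ C) (hm : m ∈ B.M)
    (lam : Fin m → ℤˣ × Fin N) (θ : ℤˣ × Fin N) :
    ∃ K : ℝ, 0 ≤ K ∧ ∀ (x : Fin m → Wave d) (j : Fin m) (y : Wave d),
      ‖resSym A B S δ lam θ (x + Pi.single j y) - resSym A B S δ lam θ x‖ ≤ K * ‖y‖ := by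
  obtain ⟨K₁, hK₁, h1⟩ := exists_lipschitz_bandSym hA hB hδ hm lam (S θ.2).1 θ.1
  obtain ⟨K₂, hK₂, h2⟩ := exists_lipschitz_unitBump d
  have hδ0 := hδ.pos
  refine ⟨K₂ / δ * C + K₁, by positivity, fun x j y => ?_⟩
  by_cases hF : Feeds A S lam θ
  · have hr : ∀ x, resSym A B S δ lam θ x =
        ((bump (ctr S θ) δ (∑ j, x j) : ℝ) : ℂ) • bandSym A B S δ lam (S θ.2).1 θ.1 x :=
      fun x => if_pos hF
    have hb : ‖bandSym A B S δ lam (S θ.2).1 θ.1 (x + Pi.single j y) -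
        bandSym A B S δ lam (S θ.2).1 θ.1 x‖ ≤ K₁ * ‖y‖ := by
      refine (h1 _ _).trans (le_of_eq ?_)
      rw [add_sub_cancel_left, Pi.norm_single]
    have hp : |bump (ctr S θ) δ (∑ i, (x + Pi.single j y : Fin m → Wave d) i) -
        bump (ctr S θ) δ (∑ i, x i)| ≤ K₂ / δ * ‖y‖ := by
      refine (abs_bump_sub_le h2 hδ0 _ _).trans (le_of_eq ?_)
      rw [sum_add_single, add_sub_cancel_left]
    rw [hr, hr, msmul_sub_smul, ← Complex.ofReal_sub]
    refine (norm_add_le _ _).trans ?_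
    rw [norm_smul, norm_smul, Complex.norm_real, Complex.norm_real, Real.norm_eq_abs,
      Real.norm_of_nonneg bump_nonneg]
    have h5 := mul_le_mul hp (norm_bandSym_le hA hδ hC0 hC hm lam (S θ.2).1 θ.1
      (x + Pi.single j y)) (norm_nonneg _) (by positivity)
    have h6 := mul_le_mul (bump_le_one (c := ctr S θ) (δ := δ) (k := ∑ j, x j)) hb
      (norm_nonneg _) zero_le_one
    linarith
  · have hr : ∀ x, resSym A B S δ lam θ x = 0 := fun x => if_neg hF
    rw [hr, hr, sub_zero, norm_zero]; positivity

/-- Shifting x_j by y also shifts ∑x_j by y. Since input j and the output belong to the same packet,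
both frequencies change by the same ∇ω_{n_l}(k_{*l})·y to first order, even if their signs differ,
and these terms cancel in the phase. Two Taylor remainders are left, hence the factor 2. -/
theorem phase_shift_le (hδ : IsLocalRadius A B S δ)
    {lam : Fin m → ℤˣ × Fin N} {θ : ℤˣ × Fin N} {j : Fin m} (hj : (lam j).2 = θ.2)
    (hF : Feeds A S lam θ) {x : Fin m → Wave d} (hx : ‖x j - ctr S (lam j)‖ ≤ 6 * δ)
    (hs : ‖∑ j, x j - ctr S θ‖ ≤ 6 * δ) {y : Wave d} (hy : ‖y‖ ≤ 6 * δ) :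
    |phase A S lam (S θ.2).1 θ.1 (x + Pi.single j y) - phase A S lam (S θ.2).1 θ.1 x| ≤
      2 * δ⁻¹ * ‖y‖ * (∑ j, ‖x j - ctr S (lam j)‖ + ‖y‖) := by
  have hδ0 := hδ.pos
  have h1 := hδ.taylor θ _ y hs hy
  have h2 := hδ.taylor (lam j) _ y hx hy
  rw [hj] at h2
  have h3 := sum_add_single x j y
  have h4 : ∑ i, A.freq (S (lam i).2).1 (lam i).1 ((x + Pi.single j y : Fin m → Wave d) i) -
      ∑ i, A.freq (S (lam i).2).1 (lam i).1 (x i) =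
      A.freq (S θ.2).1 (lam j).1 (x j + y) - A.freq (S θ.2).1 (lam j).1 (x j) := by
    rw [← Finset.sum_sub_distrib, Finset.sum_eq_single j, hj]
    · simp
    · intro i _ hi
      simp [Pi.single_eq_of_ne hi]
    · simp
  have h5 : ‖∑ j, x j - ctr S θ‖ ≤ ∑ j, ‖x j - ctr S (lam j)‖ := by
    rw [← hF.2]; exact norm_sum_sub_kappa_le lam x
  have h6 : ‖x j - ctr S (lam j)‖ ≤ ∑ j, ‖x j - ctr S (lam j)‖ :=
    Finset.single_le_sum (f := fun j => ‖x j - ctr S (lam j)‖) (fun _ _ => norm_nonneg _)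
      (Finset.mem_univ j)
  have h7 : δ⁻¹ * ‖y‖ * (‖∑ j, x j - ctr S θ‖ + ‖y‖) ≤
      δ⁻¹ * ‖y‖ * (∑ j, ‖x j - ctr S (lam j)‖ + ‖y‖) := by gcongr
  have h8 : δ⁻¹ * ‖y‖ * (‖x j - ctr S (lam j)‖ + ‖y‖) ≤
      δ⁻¹ * ‖y‖ * (∑ j, ‖x j - ctr S (lam j)‖ + ‖y‖) := by gcongr
  rw [phase, phase, h3]
  rw [abs_le] at *
  constructor <;> linarith [h1.1, h1.2, h2.1, h2.2]

/-- Shifting the variable of an incoming wave of the same group changes the averaged symbol by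
little. -/
theorem exists_shift_resSym (hA : A.Admissible) (hB : B.Admissible A)
    (hδ : IsLocalRadius A B S δ) (hC0 : 0 ≤ C)
    (hC : ∀ m ∈ B.M, ∀ (k : Wave d) (q : Fin m → Wave d), k ∉ A.bandCrossing →
      (∀ j, q j ∉ A.bandCrossing) → ‖B.χ m k q‖ ≤ C) (hm : m ∈ B.M)
    (lam : Fin m → ℤˣ × Fin N) (θ : ℤˣ × Fin N) :
    ∃ K : ℝ, 0 ≤ K ∧ ∀ j, (lam j).2 = θ.2 → ∀ t x y, ‖y‖ ≤ δ →
      ‖oscSym (resSym A B S δ lam θ) (phase A S lam (S θ.2).1 θ.1) t (x + Pi.single j y) -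
        oscSym (resSym A B S δ lam θ) (phase A S lam (S θ.2).1 θ.1) t x‖ ≤
      K * ‖y‖ * (1 + |t| * (∑ j, ‖x j - ctr S (lam j)‖ + ‖y‖)) ∧
      ((∃ i, 5 * δ < ‖x i - ctr S (lam i)‖) →
        oscSym (resSym A B S δ lam θ) (phase A S lam (S θ.2).1 θ.1) t (x + Pi.single j y) -
        oscSym (resSym A B S δ lam θ) (phase A S lam (S θ.2).1 θ.1) t x = 0) := by
  obtain ⟨K, hK0, hK⟩ := exists_lipschitz_resSym hA hB hδ hC0 hC hm lam θ
  have hδ0 := hδ.pos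
  refine ⟨K + 2 * δ⁻¹ * C, by positivity, fun j hj t x y hy => ⟨?_, ?_⟩⟩
  · set b := resSym A B S δ lam θ
    set φ := phase A S lam (S θ.2).1 θ.1
    set x' := x + Pi.single j y
    have hsplit : oscSym b φ t x' - oscSym b φ t x =
        (Complex.exp (Complex.I * ((t * φ x' : ℝ) : ℂ)) -
          Complex.exp (Complex.I * ((t * φ x : ℝ) : ℂ))) • b x +
        Complex.exp (Complex.I * ((t * φ x' : ℝ) : ℂ)) • (b x' - b x) := by
      exact msmul_sub_smul' _ _ _ _
    have h1 : ‖Complex.exp (Complex.I * ((t * φ x' : ℝ) : ℂ)) • (b x' - b x)‖ ≤ K * ‖y‖ := by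
      rw [norm_smul, norm_exp_I_mul_ofReal, one_mul]
      exact hK x j y
    have h2 : ‖(Complex.exp (Complex.I * ((t * φ x' : ℝ) : ℂ)) -
          Complex.exp (Complex.I * ((t * φ x : ℝ) : ℂ))) • b x‖ ≤
        |t| * (2 * δ⁻¹ * ‖y‖ * (∑ j, ‖x j - ctr S (lam j)‖ + ‖y‖)) * C := by
      by_cases h0 : b x = 0
      · rw [h0, msmul_zero, norm_zero]; positivity
      obtain ⟨hF, hx, hs⟩ := resSym_support hδ h0
      rw [norm_smul]
      refine mul_le_mul ((norm_exp_I_sub_le _ _).trans ?_)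
        ((norm_resSym_le_bandSym lam θ x).trans (norm_bandSym_le hA hδ hC0 hC hm lam _ _ x))
        (norm_nonneg _) (by positivity)
      rw [← mul_sub, abs_mul]
      refine mul_le_mul_of_nonneg_left ?_ (abs_nonneg t)
      exact phase_shift_le hδ hj hF (by linarith [hx j]) (by linarith) (by linarith)
    rw [hsplit]
    refine (norm_add_le _ _).trans ((add_le_add h2 h1).trans ?_)
    have h3 : 0 ≤ K * ‖y‖ * (|t| * (∑ j, ‖x j - ctr S (lam j)‖ + ‖y‖)) := by positivity
    have h4 : 0 ≤ 2 * δ⁻¹ * C * ‖y‖ := by positivity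
    linarith
  -- The supports have radius 4δ and the shift at most δ, so both symbols vanish when an input is
  -- beyond 5δ. The remaining inputs lie where the weights are not saturated.
  · rintro ⟨i, hi⟩
    have h1 : resSym A B S δ lam θ x = 0 := by
      by_contra h
      have := (resSym_support hδ h).2.1 i
      linarith
    have h2 : resSym A B S δ lam θ (x + Pi.single j y) = 0 := by
      by_contra h
      have h3 := (resSym_support hδ h).2.1 i
      have h4 : ‖(Pi.single j y : Fin m → Wave d) i‖ ≤ δ := by
        refine (norm_le_pi_norm _ i).trans ?_
        rwa [Pi.norm_single]
      have h5 : ‖x i - ctr S (lam i)‖ ≤ ‖(x + Pi.single j y : Fin m → Wave d) i - ctr S (lam i)‖ +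
          ‖(Pi.single j y : Fin m → Wave d) i‖ := by
        have h6 : x i - ctr S (lam i) = ((x + Pi.single j y : Fin m → Wave d) i - ctr S (lam i)) -
          (Pi.single j y : Fin m → Wave d) i := by
          rw [Pi.add_apply]; abel
        rw [h6]
        exact norm_sub_le _ _
      linarith
    rw [oscSym, oscSym, h1, h2, msmul_zero, msmul_zero, sub_zero]

end Wavepacket

namespace Wavepacket

open Filter Topology Nonlinearity

variable {d J m N : ℕ} {A : LinearPart d J} {B : Nonlinearity d J} {S : Fin N → Fin J × Wave d}
  {δ C : ℝ}

/-! ### Exponential weights -/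

/-- The weight `exp(min(|k - c|, 6δ) / b)`. -/
def weight (δ b : ℝ) (c k : Wave d) : ℝ := Real.exp (min ‖k - c‖ (6 * δ) / b)

variable {b : ℝ} {c k : Wave d}

theorem weight_pos : 0 < weight δ b c k := Real.exp_pos _

theorem one_le_weight (hδ : 0 < δ) (hb : 0 < b) : 1 ≤ weight δ b c k :=
  Real.one_le_exp (by positivity)

theorem weight_le_exp (hb : 0 < b) {r : ℝ} (h : ‖k - c‖ ≤ r) : weight δ b c k ≤ Real.exp (r / b) := by
  unfold weight
  gcongr
  exact (min_le_left _ _).trans h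

theorem weight_eq (h : ‖k - c‖ ≤ 6 * δ) : weight δ b c k = Real.exp (‖k - c‖ / b) := by
  rw [weight, min_eq_left h]

variable (J) in
theorem isMultiplier_weight (hb : 0 < b) (c : Wave d) :
    IsMultiplier (scal (J := J) fun k => (weight δ b c k : ℂ)) (Real.exp (6 * δ / b)) := by
  refine isMultiplier_scal (Continuous.aestronglyMeasurable ?_) (ae_of_all _ fun k => ?_)
  · refine Complex.continuous_ofReal.comp (Real.continuous_exp.comp ?_)
    exact ((continuous_norm.comp (continuous_id.sub continuous_const)).min
      continuous_const).div_const b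
  · rw [Complex.norm_real, Real.norm_of_nonneg weight_pos.le]
    unfold weight
    gcongr
    exact min_le_right _ _

/-- Multiplication by the weight. -/
def weightOp (δ b : ℝ) (c : Wave d) : AmpL1 d J →L[ℝ] AmpL1 d J :=
  mulOp (scal fun k => (weight δ b c k : ℂ))

theorem norm_weightOp (hb : 0 < b) (c : Wave d) (f : AmpL1 d J) :
    ‖weightOp δ b c f‖ = ∫ k, weight δ b c k * ‖f k‖ := by
  rw [weightOp, norm_mulOp_eq (isMultiplier_weight J hb c)]
  simp only [scal_apply, norm_smul, Complex.norm_real, Real.norm_of_nonneg weight_pos.le]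

theorem integrable_weight (hb : 0 < b) (c : Wave d) (f : AmpL1 d J) :
    Integrable fun k => weight δ b c k * ‖f k‖ := by
  have h := ((L1.integrable_coeFn (weightOp δ b c f)).congr
    (mulOp_coe (isMultiplier_weight J hb c) f)).norm
  simpa only [scal_apply, norm_smul, Complex.norm_real, Real.norm_of_nonneg weight_pos.le] using h

theorem norm_le_weightOp (hδ : 0 < δ) (hb : 0 < b) (c : Wave d) (f : AmpL1 d J) :
    ‖f‖ ≤ ‖weightOp δ b c f‖ := by
  rw [norm_weightOp hb, L1.norm_eq_integral_norm]
  refine integral_mono (L1.integrable_coeFn f).norm (integrable_weight hb c f) fun k => ?_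
  exact le_mul_of_one_le_left (norm_nonneg _) (one_le_weight hδ hb)

/-- Below the saturation distance 6δ a product of weights is the exponential of the sum of
distances. Saturation serves only to make the weight a bounded multiplier. -/
theorem prod_weight_eq (lam : Fin m → ℤˣ × Fin N) {x : Fin m → Wave d}
    (hx : ∀ j, ‖x j - ctr S (lam j)‖ ≤ 6 * δ) :
    ∏ j, weight δ b (ctr S (lam j)) (x j) = Real.exp ((∑ j, ‖x j - ctr S (lam j)‖) / b) := by
  rw [Finset.sum_div, Real.exp_sum]
  exact Finset.prod_congr rfl fun j _ => weight_eq (hx j)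

/-! ### The averaged system -/

variable (A B S δ) in
/-- The symbols of the averaged system, at the fast time `t`. -/
def avgSym (lam : Fin m → ℤˣ × Fin N) (θ : ℤˣ × Fin N) (t : ℝ) : MSymbol d J m :=
  oscSym (resSym A B S δ lam θ) (phase A S lam (S θ.2).1 θ.1) t

variable (A B S δ) in
/-- The right-hand side of the averaged system. -/
def avgForce (t : ℝ) (w : ℤˣ × Fin N → AmpL1 d J) (θ : ℤˣ × Fin N) : AmpL1 d J :=
  ∑ m ∈ B.M, ∑ lam : Fin m → ℤˣ × Fin N, symOp (avgSym A B S δ lam θ t) fun j => w (lam j)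

theorem norm_avgSym (lam : Fin m → ℤˣ × Fin N) (θ : ℤˣ × Fin N) (t : ℝ) (x : Fin m → Wave d) :
    ‖avgSym A B S δ lam θ t x‖ = ‖resSym A B S δ lam θ x‖ := norm_oscSym t x

theorem avgSym_eq_zero {lam : Fin m → ℤˣ × Fin N} {θ : ℤˣ × Fin N} {t : ℝ} {x : Fin m → Wave d}
    (h : resSym A B S δ lam θ x = 0) : avgSym A B S δ lam θ t x = 0 := by
  rw [avgSym, oscSym, h, msmul_zero]

theorem isSymbol_avgSym (hA : A.Admissible) (hB : B.Admissible A) (hδ : IsLocalRadius A B S δ)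
    (hC0 : 0 ≤ C)
    (hC : ∀ m ∈ B.M, ∀ (k : Wave d) (q : Fin m → Wave d), k ∉ A.bandCrossing →
      (∀ j, q j ∉ A.bandCrossing) → ‖B.χ m k q‖ ≤ C) (hm : m ∈ B.M)
    (lam : Fin m → ℤˣ × Fin N) (θ : ℤˣ × Fin N) (t : ℝ) :
    IsSymbol (avgSym A B S δ lam θ t) C :=
  (isSymbol_resSym hA hB hδ hC0 hC hm lam θ).osc
    (aestronglyMeasurable_phase hA (one_le_two.trans (hB.two_le m hm)) _ _ _) t

theorem avgSym_support (hδ : IsLocalRadius A B S δ) {lam : Fin m → ℤˣ × Fin N}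
    {θ : ℤˣ × Fin N} {t : ℝ} {x : Fin m → Wave d} (h : avgSym A B S δ lam θ t x ≠ 0) :
    Feeds A S lam θ ∧ (∀ j, ‖x j - ctr S (lam j)‖ < 4 * δ) ∧ ‖∑ j, x j - ctr S θ‖ < 2 * δ :=
  resSym_support hδ fun h0 => h (avgSym_eq_zero h0)

theorem norm_avgSym_le (hA : A.Admissible) (hδ : IsLocalRadius A B S δ)
    (hC0 : 0 ≤ C)
    (hC : ∀ m ∈ B.M, ∀ (k : Wave d) (q : Fin m → Wave d), k ∉ A.bandCrossing →
      (∀ j, q j ∉ A.bandCrossing) → ‖B.χ m k q‖ ≤ C) (hm : m ∈ B.M)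
    (lam : Fin m → ℤˣ × Fin N) (θ : ℤˣ × Fin N) (t : ℝ) (x : Fin m → Wave d) :
    ‖avgSym A B S δ lam θ t x‖ ≤ C := by
  rw [norm_avgSym]
  exact (norm_resSym_le_bandSym lam θ x).trans (norm_bandSym_le hA hδ hC0 hC hm lam _ _ x)

/-- The number of `m`-tuples of components. -/
theorem card_tuples (N m : ℕ) : (Finset.univ : Finset (Fin m → ℤˣ × Fin N)).card = (2 * N) ^ m := by
  simp [Fintype.card_pi]

theorem norm_sum_tuples_le {M : Finset ℕ} {F : (m : ℕ) → (Fin m → ℤˣ × Fin N) → AmpL1 d J}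
    {c : ℕ → ℝ} (h : ∀ m ∈ M, ∀ lam, ‖F m lam‖ ≤ c m) :
    ‖∑ m ∈ M, ∑ lam, F m lam‖ ≤ ∑ m ∈ M, (2 * N : ℝ) ^ m * c m := by
  refine (norm_sum_le _ _).trans (Finset.sum_le_sum fun m hm => ?_)
  refine (norm_sum_le _ _).trans ((Finset.sum_le_sum fun lam _ => h m hm lam).trans (le_of_eq ?_))
  rw [Finset.sum_const, card_tuples, nsmul_eq_mul]
  push_cast
  rfl

/-- The Lipschitz constant of the averaged system. -/
def avgLip (M : Finset ℕ) (N : ℕ) (C ρ : ℝ) : ℝ := ∑ m ∈ M, (2 * N : ℝ) ^ m * (C * m * ρ ^ (m - 1))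

theorem avgLip_nonneg (M : Finset ℕ) (N : ℕ) {C ρ : ℝ} (hC : 0 ≤ C) (hρ : 0 ≤ ρ) :
    0 ≤ avgLip M N C ρ := Finset.sum_nonneg fun m _ => by positivity

theorem norm_comp_le (w : ℤˣ × Fin N → AmpL1 d J) (lam : Fin m → ℤˣ × Fin N) :
    ‖fun j => w (lam j)‖ ≤ ‖w‖ :=
  (pi_norm_le_iff_of_nonneg (norm_nonneg _)).2 fun j => norm_le_pi_norm w (lam j)

theorem norm_avgForce_sub_le (hA : A.Admissible) (hB : B.Admissible A)
    (hδ : IsLocalRadius A B S δ) (hC0 : 0 ≤ C)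
    (hC : ∀ m ∈ B.M, ∀ (k : Wave d) (q : Fin m → Wave d), k ∉ A.bandCrossing →
      (∀ j, q j ∉ A.bandCrossing) → ‖B.χ m k q‖ ≤ C) (t : ℝ)
    {w w' : ℤˣ × Fin N → AmpL1 d J} {ρ : ℝ} (hρ : 0 ≤ ρ) (hw : ‖w‖ ≤ ρ) (hw' : ‖w'‖ ≤ ρ) :
    ‖avgForce A B S δ t w - avgForce A B S δ t w'‖ ≤ avgLip B.M N C ρ * ‖w - w'‖ := by
  refine (pi_norm_le_iff_of_nonneg (mul_nonneg (avgLip_nonneg _ _ hC0 hρ) (norm_nonneg _))).2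
    fun θ => ?_
  change ‖avgForce A B S δ t w θ - avgForce A B S δ t w' θ‖ ≤ _
  simp only [avgForce, ← Finset.sum_sub_distrib]
  refine (norm_sum_tuples_le (c := fun m => C * m * ρ ^ (m - 1) * ‖w - w'‖)
    fun m hm lam => ?_).trans (le_of_eq ?_)
  · have hs := isSymbol_avgSym hA hB hδ hC0 hC hm lam θ t
    refine (norm_multilinear_sub_le (norm_symOp_le (one_le_two.trans (hB.two_le m hm)) hs)
      ((norm_comp_le w lam).trans hw) ((norm_comp_le w' lam).trans hw')).trans ?_
    exact mul_le_mul_of_nonneg_left (norm_comp_le (w - w') lam) (by positivity)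
  · rw [avgLip, Finset.sum_mul]
    exact Finset.sum_congr rfl fun m _ => by ring

theorem continuousOn_symOp_oscSym (hm : 1 ≤ m) {a : MSymbol d J m} (ha : IsSymbol a C)
    {φ : (Fin m → Wave d) → ℝ} (hφ : AEStronglyMeasurable φ volume) {Λ : ℝ}
    (hΛ : ∀ x, a x ≠ 0 → |φ x| ≤ Λ) (hΛ0 : 0 ≤ Λ) (ϱ : ℝ) {w : ℝ → Fin m → AmpL1 d J} {s : Set ℝ}
    (hw : ContinuousOn w s) : ContinuousOn (fun t => symOp (oscSym a φ (t / ϱ)) (w t)) s := by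
  have hC0 := ha.nonneg
  have h1 : Continuous fun t : ℝ => symOp (oscSym a φ (t / ϱ)) := by
    have h2 : LipschitzWith (Real.toNNReal (C * Λ)) fun t : ℝ => symOp (oscSym a φ t) := by
      refine LipschitzWith.of_dist_le_mul fun t t' => ?_
      rw [dist_eq_norm, Real.dist_eq, Real.coe_toNNReal _ (by positivity)]
      exact norm_symOp_oscSym_sub_le hm ha hφ hΛ hΛ0 t t'
    exact h2.continuous.comp (continuous_id.div_const ϱ)
  exact ContinuousOn.eval h1.continuousOn hw

theorem continuousOn_avgForce (hA : A.Admissible) (hB : B.Admissible A)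
    (hδ : IsLocalRadius A B S δ) (hC0 : 0 ≤ C)
    (hC : ∀ m ∈ B.M, ∀ (k : Wave d) (q : Fin m → Wave d), k ∉ A.bandCrossing →
      (∀ j, q j ∉ A.bandCrossing) → ‖B.χ m k q‖ ≤ C) {ϱ : ℝ}
    {w : ℝ → ℤˣ × Fin N → AmpL1 d J} {s : Set ℝ} (hw : ContinuousOn w s) :
    ContinuousOn (fun t => avgForce A B S δ (t / ϱ) (w t)) s := by
  refine continuousOn_pi.2 fun θ => ?_
  refine continuousOn_finsetSum _ fun m hm => continuousOn_finsetSum _ fun lam _ => ?_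
  have hm1 := one_le_two.trans (hB.two_le m hm)
  refine continuousOn_symOp_oscSym hm1 (isSymbol_resSym hA hB hδ hC0 hC hm lam θ)
    (aestronglyMeasurable_phase hA hm1 _ _ _) (Λ := δ⁻¹) (fun x hx => ?_)
    (inv_nonneg.2 hδ.pos.le) _
    (continuousOn_pi.2 fun j => (continuous_apply (lam j)).comp_continuousOn hw)
  refine hδ.phase_le m hm lam _ _ x fun j => ?_
  have := (resSym_support hδ hx).2.1 j
  have := hδ.pos
  linarith

/-- For a feeding tuple the output centre is the sum of the input centres, so the triangle
inequality bounds the output weight by the product of the input weights. The resulting bound is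
independent of b and of t, and so is the lifetime. -/
theorem norm_weightOp_avgForce_le (hA : A.Admissible) (hB : B.Admissible A)
    (hδ : IsLocalRadius A B S δ) (hC0 : 0 ≤ C)
    (hC : ∀ m ∈ B.M, ∀ (k : Wave d) (q : Fin m → Wave d), k ∉ A.bandCrossing →
      (∀ j, q j ∉ A.bandCrossing) → ‖B.χ m k q‖ ≤ C) (hb : 0 < b) (t : ℝ)
    {w : ℤˣ × Fin N → AmpL1 d J} {ρ : ℝ} (hw : ∀ θ, ‖weightOp δ b (ctr S θ) (w θ)‖ ≤ ρ)
    (θ : ℤˣ × Fin N) :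
    ‖weightOp δ b (ctr S θ) (avgForce A B S δ t w θ)‖ ≤
      ∑ m ∈ B.M, (2 * N : ℝ) ^ m * (C * ρ ^ m) := by
  have hδ0 := hδ.pos
  simp only [avgForce, map_sum]
  refine norm_sum_tuples_le fun m hm lam => ?_
  have hm1 := one_le_two.trans (hB.two_le m hm)
  have hs := isSymbol_avgSym hA hB hδ hC0 hC hm lam θ t
  have hW := isMultiplier_weight (δ := δ) J hb (ctr S θ)
  rw [weightOp, mulOp_symOp hm1 hs hW (Real.exp_pos _).le]
  refine (norm_symOp_apply_le hm1 (hs.comp_left hm1 hW (Real.exp_pos _).le) (C' := C)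
    (f := fun j k => weight δ b (ctr S (lam j)) k * ‖w (lam j) k‖) _
    (fun j => integrable_weight hb _ _) (ae_of_all _ fun x => ?_)).trans ?_
  · simp only [tens, Finset.prod_mul_distrib]
    by_cases h : avgSym A B S δ lam θ t x = 0
    · rw [h, mcomp_zero]
      have : 0 ≤ ∏ j, weight δ b (ctr S (lam j)) (x j) := Finset.prod_nonneg fun _ _ => weight_pos.le
      change ‖(0 : Amp J)‖ ≤ _
      rw [norm_zero]
      positivity
    obtain ⟨hF, hx, hsum⟩ := avgSym_support hδ h
    change ‖scal _ _ (avgSym A B S δ lam θ t x fun j => w (lam j) (x j))‖ ≤ _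
    rw [scal_apply, norm_smul, Complex.norm_real, Real.norm_of_nonneg weight_pos.le]
    have h1 : weight δ b (ctr S θ) (∑ j, x j) ≤ ∏ j, weight δ b (ctr S (lam j)) (x j) := by
      rw [prod_weight_eq lam fun j => by linarith [hx j]]
      refine weight_le_exp hb ?_
      rw [← hF.2]
      exact norm_sum_sub_kappa_le lam x
    have h2 : ‖avgSym A B S δ lam θ t x fun j => w (lam j) (x j)‖ ≤ C * ∏ j, ‖w (lam j) (x j)‖ :=
      (ContinuousMultilinearMap.le_opNorm _ _).trans (mul_le_mul_of_nonneg_right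
        (norm_avgSym_le hA hδ hC0 hC hm lam θ t x) (by positivity))
    calc _ ≤ (∏ j, weight δ b (ctr S (lam j)) (x j)) * (C * ∏ j, ‖w (lam j) (x j)‖) :=
          mul_le_mul h1 h2 (norm_nonneg _) (Finset.prod_nonneg fun _ _ => weight_pos.le)
      _ = _ := by ring
  · refine mul_le_mul_of_nonneg_left ?_ hC0
    calc _ ≤ ∏ _j : Fin m, ρ := Finset.prod_le_prod (fun j _ => integral_nonneg fun k =>
          mul_nonneg weight_pos.le (norm_nonneg _)) fun j _ => by
            rw [← norm_weightOp hb]; exact hw (lam j)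
      _ = ρ ^ m := by simp

/-! ### Localization and polarization of the components -/

variable (A S δ) in
/-- The multiplier that localizes near the center of `θ` and projects onto its band. -/
def bandProj (θ : ℤˣ × Fin N) (k : Wave d) : Amp J →L[ℂ] Amp J :=
  ((bump (ctr S θ) (2 * δ) k : ℝ) : ℂ) • A.projL (S θ.2).1 θ.1 k

theorem isMultiplier_bandProj (hA : A.Admissible) (θ : ℤˣ × Fin N) :
    IsMultiplier (bandProj A S δ θ) 1 := by
  refine ⟨hA.aestronglyMeasurable ?_, ?_⟩
  · exact ContinuousOn.smul (Complex.continuous_ofReal.comp contDiff_bump.continuous).continuousOn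
      (hA.contDiffOn_projL _ _).continuousOn
  · filter_upwards [hA.ae_notMem] with k hk
    rw [bandProj, norm_smul, Complex.norm_real, Real.norm_of_nonneg bump_nonneg]
    exact mul_le_one₀ bump_le_one (norm_nonneg _) (hA.norm_projL_le hk _ _)

/-- The output cutoff in `resSym` keeps ∑x_j within 2δ of the centre, exactly where the bump of
`bandProj` equals 1; the projection acts trivially by `resSym_range`. -/
theorem bandProj_avgForce (hA : A.Admissible) (hB : B.Admissible A)
    (hδ : IsLocalRadius A B S δ) (hC0 : 0 ≤ C)
    (hC : ∀ m ∈ B.M, ∀ (k : Wave d) (q : Fin m → Wave d), k ∉ A.bandCrossing →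
      (∀ j, q j ∉ A.bandCrossing) → ‖B.χ m k q‖ ≤ C) (t : ℝ)
    (w : ℤˣ × Fin N → AmpL1 d J) (θ : ℤˣ × Fin N) :
    mulOp (bandProj A S δ θ) (avgForce A B S δ t w θ) = avgForce A B S δ t w θ := by
  have hδ0 := hδ.pos
  simp only [avgForce, map_sum]
  refine Finset.sum_congr rfl fun m hm => Finset.sum_congr rfl fun lam _ => ?_
  have hm1 := one_le_two.trans (hB.two_le m hm)
  rw [mulOp_symOp hm1 (isSymbol_avgSym hA hB hδ hC0 hC hm lam θ t) (isMultiplier_bandProj hA θ)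
    zero_le_one]
  congr 2
  funext x
  by_cases h : resSym A B S δ lam θ x = 0
  · rw [avgSym_eq_zero h, mcomp_zero]
  rw [bandProj, bump_eq_one (by positivity) (resSym_support hδ h).2.2.le, Complex.ofReal_one,
    one_smul, avgSym, oscSym, mcomp_smul, resSym_range hA hδ]

/-! ### Twisted translations of the averaged force -/

theorem exists_uniform {ι : Type*} [Finite ι] {p : ι → ℝ → Prop}
    (hmono : ∀ i K K', K ≤ K' → p i K → p i K') (h : ∀ i, ∃ K, 0 ≤ K ∧ p i K) :
    ∃ K, 0 ≤ K ∧ ∀ i, p i K := by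
  have := Fintype.ofFinite ι
  choose K hK0 hK using h
  exact ⟨∑ i, K i, Finset.sum_nonneg fun i _ => hK0 i, fun i =>
    hmono i _ _ (Finset.single_le_sum (fun i _ => hK0 i) (Finset.mem_univ i)) (hK i)⟩

/-- The polynomial factor ∑‖x_j−c_j‖ of the shift estimate is absorbed by the weights at the cost of
one factor b. This converts the large time t into t·b, the quantity controlled by β²/ϱ ≤ C. -/
theorem exists_shift_avgSym (hA : A.Admissible) (hB : B.Admissible A)
    (hδ : IsLocalRadius A B S δ) (hC0 : 0 ≤ C)
    (hC : ∀ m ∈ B.M, ∀ (k : Wave d) (q : Fin m → Wave d), k ∉ A.bandCrossing →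
      (∀ j, q j ∉ A.bandCrossing) → ‖B.χ m k q‖ ≤ C) :
    ∃ K : ℝ, 0 ≤ K ∧ ∀ m ∈ B.M, ∀ (lam : Fin m → ℤˣ × Fin N) (θ : ℤˣ × Fin N) (j : Fin m),
      (lam j).2 = θ.2 → ∀ b t x y, 0 < b → ‖y‖ ≤ δ → ‖y‖ ≤ b →
      ‖avgSym A B S δ lam θ t (x + Pi.single j y) - avgSym A B S δ lam θ t x‖ ≤
        K * ‖y‖ * (1 + |t| * b) * ∏ j, weight δ b (ctr S (lam j)) (x j) := by
  have key := exists_uniform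
    (ι := Σ m : B.M, (Fin (m : ℕ) → ℤˣ × Fin N) × (ℤˣ × Fin N))
    (p := fun i K => ∀ j, (i.2.1 j).2 = i.2.2.2 → ∀ b t x y, 0 < b → ‖y‖ ≤ δ → ‖y‖ ≤ b →
      ‖avgSym A B S δ i.2.1 i.2.2 t (x + Pi.single j y) - avgSym A B S δ i.2.1 i.2.2 t x‖ ≤
        K * ‖y‖ * (1 + |t| * b) * ∏ j, weight δ b (ctr S (i.2.1 j)) (x j)) ?_ ?_
  · obtain ⟨K, hK0, hK⟩ := key
    exact ⟨K, hK0, fun m hm lam θ => hK ⟨⟨m, hm⟩, lam, θ⟩⟩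
  · intro i K K' hKK h j hj b t x y hb hy hyb
    refine (h j hj b t x y hb hy hyb).trans ?_
    have : 0 ≤ ∏ j, weight δ b (ctr S (i.2.1 j)) (x j) :=
      Finset.prod_nonneg fun _ _ => weight_pos.le
    gcongr
  · rintro ⟨⟨m, hm⟩, lam, θ⟩
    have hδ0 := hδ.pos
    obtain ⟨K, hK0, hK⟩ := exists_shift_resSym hA hB hδ hC0 hC hm lam θ
    refine ⟨K, hK0, fun j hj b t x y hb hy hyb => ?_⟩
    have hp : 0 ≤ ∏ j, weight δ b (ctr S (lam j)) (x j) :=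
      Finset.prod_nonneg fun _ _ => weight_pos.le
    obtain ⟨h1, h2⟩ := hK j hj t x y hy
    by_cases hx : ∃ i, 5 * δ < ‖x i - ctr S (lam i)‖
    · refine (norm_le_zero_iff.2 (h2 hx)).trans ?_
      exact mul_nonneg (by positivity) hp
    push Not at hx
    refine h1.trans ?_
    rw [mul_assoc (K * ‖y‖)]
    refine mul_le_mul_of_nonneg_left ?_ (by positivity)
    change _ ≤ (1 + |t| * b) * ∏ j, weight δ b (ctr S (lam j)) (x j)
    rw [prod_weight_eq lam fun j => by linarith [hx j]]
    set D := ∑ j, ‖x j - ctr S (lam j)‖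
    have hD : 0 ≤ D := Finset.sum_nonneg fun _ _ => norm_nonneg _
    have h3 := Real.add_one_le_exp (D / b)
    -- Uses ‖y‖ ≤ b and z + 1 ≤ exp z with z = D/b.
    have h4 : D + ‖y‖ ≤ b * Real.exp (D / b) := by
      calc D + ‖y‖ ≤ b * (D / b + 1) := by field_simp; linarith
        _ ≤ _ := by gcongr
    have h5 : 1 ≤ Real.exp (D / b) := Real.one_le_exp (by positivity)
    have h6 := mul_le_mul_of_nonneg_left h4 (abs_nonneg t)
    linarith

theorem symOp_zero_of_forall (hm : 1 ≤ m) {a : MSymbol d J m} (h : ∀ x, a x = 0)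
    (w : Fin m → AmpL1 d J) : symOp a w = 0 := by
  have hs : IsSymbol a 0 := by
    have : a = fun _ => 0 := funext h
    rw [this]
    exact ⟨aestronglyMeasurable_const, le_rfl, ae_of_all _ fun _ => norm_zero.le⟩
  have := norm_symOp_apply_le_prod hm hs w
  rw [zero_mul] at this
  exact norm_le_zero_iff.1 this

/-- Output and input j belong to the same packet and so carry the same position; the other inputs
are not translated. The first term is the translation of input j, without a factor m since one slot
moves; the second is the change of the symbol. -/
theorem norm_twistOp_avgForce_sub_le (hA : A.Admissible) (hB : B.Admissible A)
    (hS : IsNKSpectrum A B.M S) (hU : UniversallyResonanceInvariant A B.M S)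
    (hδ : IsLocalRadius A B S δ) (hC0 : 0 ≤ C)
    (hC : ∀ m ∈ B.M, ∀ (k : Wave d) (q : Fin m → Wave d), k ∉ A.bandCrossing →
      (∀ j, q j ∉ A.bandCrossing) → ‖B.χ m k q‖ ≤ C) {K : ℝ} (hK0 : 0 ≤ K)
    (hK : ∀ m ∈ B.M, ∀ (lam : Fin m → ℤˣ × Fin N) (θ : ℤˣ × Fin N) (j : Fin m),
      (lam j).2 = θ.2 → ∀ b t x y, 0 < b → ‖y‖ ≤ δ → ‖y‖ ≤ b →
      ‖avgSym A B S δ lam θ t (x + Pi.single j y) - avgSym A B S δ lam θ t x‖ ≤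
        K * ‖y‖ * (1 + |t| * b) * ∏ j, weight δ b (ctr S (lam j)) (x j))
    (hb : 0 < b) (hbδ : b ≤ δ) (t : ℝ) (r : Fin N → Wave d)
    {w : ℤˣ × Fin N → AmpL1 d J} {ρ V : ℝ} (hρ : 0 ≤ ρ) (hV : 0 ≤ V)
    (hw : ∀ θ, ‖weightOp δ b (ctr S θ) (w θ)‖ ≤ ρ) {y : Wave d} (hy : ‖y‖ ≤ b)
    (hwV : ∀ θ, ‖twistOp (r θ.2) y (w θ) - w θ‖ ≤ V * ‖y‖) (θ : ℤˣ × Fin N) :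
    ‖twistOp (r θ.2) y (avgForce A B S δ t w θ) - avgForce A B S δ t w θ‖ ≤
      ∑ m ∈ B.M, (2 * N : ℝ) ^ m *
        (C * ρ ^ (m - 1) * V * ‖y‖ + K * (1 + |t| * b) * ρ ^ m * ‖y‖) := by
  have hδ0 := hδ.pos
  simp only [avgForce, map_sum, ← Finset.sum_sub_distrib]
  refine norm_sum_tuples_le fun m hm lam => ?_
  have hm1 := one_le_two.trans (hB.two_le m hm)
  have hs := isSymbol_avgSym hA hB hδ hC0 hC hm lam θ t
  by_cases hF : Feeds A S lam θ
  swap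
  · have h0 : ∀ x, avgSym A B S δ lam θ t x = 0 := fun x => by
      by_contra h
      exact hF (avgSym_support hδ h).1
    rw [symOp_zero_of_forall hm1 h0, map_zero, sub_zero, norm_zero]
    positivity
  obtain ⟨j, hj⟩ := hF.exists_index hS hU hm
  have hss := hs.shift j y
  set v : Fin m → AmpL1 d J := fun j => w (lam j) with hv
  have hvρ : ∀ i, ‖v i‖ ≤ ρ := fun i => (norm_le_weightOp hδ0 hb (ctr S (lam i)) _).trans (hw (lam i))
  -- Linearity in slot j separates the translation of the wave from the translation of the symbol.
  have hupd : symOp (shiftSym (avgSym A B S δ lam θ t) j y)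
      (Function.update v j (twistOp (r θ.2) y (v j))) =
      symOp (shiftSym (avgSym A B S δ lam θ t) j y)
        (Function.update v j (twistOp (r θ.2) y (v j) - v j)) +
      symOp (shiftSym (avgSym A B S δ lam θ t) j y) v := by
    rw [ContinuousMultilinearMap.map_update_sub, Function.update_eq_self, sub_add_cancel]
  rw [twistOp_symOp hm1 hs (r θ.2) y j, hupd, add_sub_assoc]
  refine (norm_add_le _ _).trans (add_le_add ?_ ?_)
  · refine (norm_symOp_apply_le_prod hm1 hss _).trans ?_
    rw [mul_assoc, mul_assoc]
    refine mul_le_mul_of_nonneg_left ?_ hC0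
    rw [← Finset.mul_prod_erase Finset.univ _ (Finset.mem_univ j), Function.update_self, mul_comm]
    refine mul_le_mul ?_ ?_ (norm_nonneg _) (by positivity)
    · calc _ ≤ ∏ _i ∈ Finset.univ.erase j, ρ := by
            refine Finset.prod_le_prod (fun _ _ => norm_nonneg _) fun i hi => ?_
            rw [Function.update_of_ne (Finset.ne_of_mem_erase hi)]
            exact hvρ i
        _ = ρ ^ (m - 1) := by
            rw [Finset.prod_const, Finset.card_erase_of_mem (Finset.mem_univ j)]; simp
    · rw [hv, ← hj]
      exact hwV (lam j)
  · have hsub : symOp (shiftSym (avgSym A B S δ lam θ t) j y) v - symOp (avgSym A B S δ lam θ t) v =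
        symOp (fun x => shiftSym (avgSym A B S δ lam θ t) j y x - avgSym A B S δ lam θ t x) v := by
      rw [symOp_sub hm1 hss hs]; rfl
    rw [hsub]
    refine (norm_symOp_apply_le hm1 (hss.sub hs) (C' := K * ‖y‖ * (1 + |t| * b))
      (f := fun j k => weight δ b (ctr S (lam j)) k * ‖w (lam j) k‖) _
      (fun j => integrable_weight hb _ _) (ae_of_all _ fun x => ?_)).trans ?_
    · rw [Finset.prod_mul_distrib, ← mul_assoc]
      refine (norm_tens_le _ _).trans ?_
      exact mul_le_mul_of_nonneg_right (hK m hm lam θ j hj b t x y hb (hy.trans hbδ) hy)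
        (by positivity)
    · have h1 : ∏ j, ∫ k, weight δ b (ctr S (lam j)) k * ‖w (lam j) k‖ ≤ ρ ^ m := by
        calc _ ≤ ∏ _j : Fin m, ρ := Finset.prod_le_prod (fun j _ => integral_nonneg fun k =>
              mul_nonneg weight_pos.le (norm_nonneg _)) fun j _ => by
                rw [← norm_weightOp hb]; exact hw (lam j)
          _ = ρ ^ m := by simp
      calc _ ≤ K * ‖y‖ * (1 + |t| * b) * ρ ^ m := mul_le_mul_of_nonneg_left h1 (by positivity)
        _ = _ := by ring

end Wavepacket

namespace Wavepacket

open Filter Topology Nonlinearity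

variable {d J m N : ℕ} {A : LinearPart d J} {B : Nonlinearity d J} {S : Fin N → Fin J × Wave d}
  {δ C b : ℝ}

/-! ### Solution of the averaged system -/

/-- A solution of the averaged system with its a priori bounds. -/
structure IsAveragedSolution (A : LinearPart d J) (B : Nonlinearity d J)
    (S : Fin N → Fin J × Wave d) (δ C b ϱ T ρ V : ℝ) (r : Fin N → Wave d)
    (h : ℤˣ × Fin N → AmpL1 d J) (w : ℝ → ℤˣ × Fin N → AmpL1 d J) : Prop where
  cont : ContinuousOn w (Icc 0 T)
  weight_le : ∀ s ∈ Icc 0 T, ∀ θ, ‖weightOp δ b (ctr S θ) (w s θ)‖ ≤ ρ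
  range : ∀ s ∈ Icc 0 T, ∀ θ, mulOp (bandProj A S δ θ) (w s θ) = w s θ
  twist_le : ∀ s ∈ Icc 0 T, ∀ θ, ∀ y : Wave d, ‖y‖ ≤ b →
    ‖twistOp (r θ.2) y (w s θ) - w s θ‖ ≤ V * ‖y‖
  lipschitz : ∀ s ∈ Icc 0 T, ∀ t ∈ Icc 0 T,
    ‖w t - w s‖ ≤ (∑ m ∈ B.M, (2 * N : ℝ) ^ m * (C * ρ ^ m)) * |t - s|
  eq : ∀ τ ∈ Icc 0 T, w τ = h + ∫ s in (0 : ℝ)..τ, avgForce A B S δ (s / ϱ) (w s)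

theorem sum_tuples_le (hB : B.Admissible A) (hC0 : 0 ≤ C) {ρ : ℝ} (hρ : 0 ≤ ρ) :
    ∑ m ∈ B.M, (2 * N : ℝ) ^ m * (C * ρ ^ (m - 1)) ≤ avgLip B.M N C ρ := by
  refine Finset.sum_le_sum fun m hm => ?_
  have h1 : (1 : ℝ) ≤ m := by exact_mod_cast one_le_two.trans (hB.two_le m hm)
  have : C * ρ ^ (m - 1) ≤ C * m * ρ ^ (m - 1) := by
    rw [mul_assoc]
    exact mul_le_mul_of_nonneg_left (le_mul_of_one_le_left (by positivity) h1) hC0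
  gcongr

theorem sum_tuples_pow (hB : B.Admissible A) (ρ : ℝ) :
    ∑ m ∈ B.M, (2 * N : ℝ) ^ m * (C * ρ ^ m) =
      ρ * ∑ m ∈ B.M, (2 * N : ℝ) ^ m * (C * ρ ^ (m - 1)) := by
  rw [Finset.mul_sum]
  refine Finset.sum_congr rfl fun m hm => ?_
  have h1 : 1 ≤ m := one_le_two.trans (hB.two_le m hm)
  obtain ⟨n, rfl⟩ := Nat.exists_eq_add_of_le' h1
  rw [Nat.add_sub_cancel, pow_succ ρ n]
  ring

/-- One Picard iteration with all constraints imposed at once. The data use half of ρ and the force,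
integrated over [0, T], at most the other half. For translations the force contributes T·Q·V ≤ V/2
plus a source term, so V is twice the initial constant plus the integrated source. -/
theorem exists_averagedSolution (hA : A.Admissible) (hB : B.Admissible A)
    (hS : IsNKSpectrum A B.M S) (hU : UniversallyResonanceInvariant A B.M S)
    (hδ : IsLocalRadius A B S δ) (hC0 : 0 ≤ C)
    (hC : ∀ m ∈ B.M, ∀ (k : Wave d) (q : Fin m → Wave d), k ∉ A.bandCrossing →
      (∀ j, q j ∉ A.bandCrossing) → ‖B.χ m k q‖ ≤ C) {K : ℝ} (hK0 : 0 ≤ K)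
    (hK : ∀ m ∈ B.M, ∀ (lam : Fin m → ℤˣ × Fin N) (θ : ℤˣ × Fin N) (j : Fin m),
      (lam j).2 = θ.2 → ∀ b t x y, 0 < b → ‖y‖ ≤ δ → ‖y‖ ≤ b →
      ‖avgSym A B S δ lam θ t (x + Pi.single j y) - avgSym A B S δ lam θ t x‖ ≤
        K * ‖y‖ * (1 + |t| * b) * ∏ j, weight δ b (ctr S (lam j)) (x j))
    (hb : 0 < b) (hbδ : b ≤ δ) {ρ ϱ T V₀ : ℝ} (hρ : 0 ≤ ρ) (hϱ : 0 < ϱ) (hT : 0 ≤ T)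
    (hTρ : T * avgLip B.M N C ρ ≤ 1 / 2) (hV₀ : 0 ≤ V₀) (r : Fin N → Wave d)
    {h : ℤˣ × Fin N → AmpL1 d J} (hw : ∀ θ, ‖weightOp δ b (ctr S θ) (h θ)‖ ≤ ρ / 2)
    (hr : ∀ θ, mulOp (bandProj A S δ θ) (h θ) = h θ)
    (hV : ∀ θ, ∀ y : Wave d, ‖y‖ ≤ b → ‖twistOp (r θ.2) y (h θ) - h θ‖ ≤ V₀ * ‖y‖) :
    ∃ w, IsAveragedSolution A B S δ C b ϱ T ρ
      (2 * (V₀ + T * ((1 + T / ϱ * b) * ∑ m ∈ B.M, (2 * N : ℝ) ^ m * (K * ρ ^ m)))) r h w := by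
  have hδ0 := hδ.pos
  set KK := ∑ m ∈ B.M, (2 * N : ℝ) ^ m * (K * ρ ^ m) with hKK
  have hKK0 : 0 ≤ KK := Finset.sum_nonneg fun m _ => by positivity
  set V := 2 * (V₀ + T * ((1 + T / ϱ * b) * KK)) with hVdef
  have hV0 : 0 ≤ V := by positivity
  set Q := ∑ m ∈ B.M, (2 * N : ℝ) ^ m * (C * ρ ^ (m - 1)) with hQ
  have hQ0 : 0 ≤ Q := Finset.sum_nonneg fun m _ => by positivity
  have hTQ : T * Q ≤ 1 / 2 := (mul_le_mul_of_nonneg_left (sum_tuples_le hB hC0 hρ) hT).trans hTρ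
  let pr : (θ : ℤˣ × Fin N) → (ℤˣ × Fin N → AmpL1 d J) →L[ℝ] AmpL1 d J := fun θ =>
    ContinuousLinearMap.proj θ
  -- Three families of constraints: weighted norms, polarization (bound 0, so a closed subspace),
  -- and one translation estimate for each y with ‖y‖ ≤ b.
  let ι := (ℤˣ × Fin N) ⊕ (ℤˣ × Fin N) ⊕ ((ℤˣ × Fin N) × {y : Wave d // ‖y‖ ≤ b})
  let L : ι → (ℤˣ × Fin N → AmpL1 d J) →L[ℝ] AmpL1 d J := fun i => match i with
    | .inl θ => (weightOp δ b (ctr S θ)).comp (pr θ)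
    | .inr (.inl θ) => (mulOp (bandProj A S δ θ)).comp (pr θ) - pr θ
    | .inr (.inr p) => (twistOp (r p.1.2) p.2).comp (pr p.1) - pr p.1
  let c : ι → ℝ := fun i => match i with
    | .inl _ => ρ
    | .inr (.inl _) => 0
    | .inr (.inr p) => V * ‖(p.2 : Wave d)‖
  have hbound : ∀ x : ℤˣ × Fin N → AmpL1 d J, (∀ i, ‖L i x‖ ≤ c i) → ‖x‖ ≤ ρ := fun x hx =>
    (pi_norm_le_iff_of_nonneg hρ).2 fun θ =>
      (norm_le_weightOp hδ0 hb (ctr S θ) (x θ)).trans (hx (.inl θ))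
  have hVV : V₀ + T * ((1 + T / ϱ * b) * KK) = V / 2 := by rw [hVdef]; ring
  have key := exists_solution_of_invariant hT (avgLip_nonneg B.M N hC0 hρ) hTρ
    (fun s => avgForce A B S δ (s / ϱ)) h L c ?_ ?_ ?_ ?_
  · obtain ⟨w, hwc, hwb, hwe⟩ := key
    have hforce : ∀ s ∈ Icc 0 T, ‖avgForce A B S δ (s / ϱ) (w s)‖ ≤
        ∑ m ∈ B.M, (2 * N : ℝ) ^ m * (C * ρ ^ m) := fun s hs =>
      (pi_norm_le_iff_of_nonneg (Finset.sum_nonneg fun m _ => by positivity)).2 fun θ =>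
        (norm_le_weightOp hδ0 hb (ctr S θ) _).trans
          (norm_weightOp_avgForce_le hA hB hδ hC0 hC hb (s / ϱ) (fun θ => hwb s hs (.inl θ)) θ)
    refine ⟨w, hwc, fun s hs θ => hwb s hs (.inl θ), fun s hs θ => ?_,
      fun s hs θ y hy => hwb s hs (.inr (.inr (θ, ⟨y, hy⟩))), fun s hs t ht => ?_, hwe⟩
    · exact sub_eq_zero.1 (norm_le_zero_iff.1 (hwb s hs (.inr (.inl θ))))
    · have hint : ∀ τ ∈ Icc 0 T, IntervalIntegrable (fun s => avgForce A B S δ (s / ϱ) (w s))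
          volume 0 τ := fun τ hτ => by
        refine ContinuousOn.intervalIntegrable ?_
        rw [uIcc_of_le hτ.1]
        exact (continuousOn_avgForce hA hB hδ hC0 hC hwc).mono (Icc_subset_Icc_right hτ.2)
      rw [hwe t ht, hwe s hs, add_sub_add_left_eq_sub,
        intervalIntegral.integral_interval_sub_left (hint t ht) (hint s hs)]
      refine intervalIntegral.norm_integral_le_of_norm_le_const fun x hx => hforce x ?_
      have := uIoc_subset_uIcc hx
      exact (uIcc_subset_Icc hs ht) this
  · rintro (θ | θ | ⟨θ, y, hy⟩)
    · exact (hw θ).trans (by linarith)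
    · exact (norm_le_zero_iff.2 (sub_eq_zero.2 (hr θ)))
    · refine (hV θ y hy).trans (mul_le_mul_of_nonneg_right ?_ (norm_nonneg _))
      have : 0 ≤ T * ((1 + T / ϱ * b) * KK) := by positivity
      linarith
  · rintro (θ | θ | ⟨θ, y, hy⟩)
    · refine ⟨∑ m ∈ B.M, (2 * N : ℝ) ^ m * (C * ρ ^ m), ?_, fun s hs x hx => ?_⟩
      · have h1 := hw θ
        change ‖weightOp δ b (ctr S θ) (h θ)‖ + _ ≤ ρ
        rw [sum_tuples_pow hB]
        have h2 := mul_le_mul_of_nonneg_left hTQ hρ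
        linarith
      · exact norm_weightOp_avgForce_le hA hB hδ hC0 hC hb (s / ϱ) (fun θ => hx (.inl θ)) θ
    · refine ⟨0, ?_, fun s hs x hx => ?_⟩
      · rw [mul_zero, add_zero]
        exact (norm_le_zero_iff.2 (sub_eq_zero.2 (hr θ)))
      · exact (norm_le_zero_iff.2 (sub_eq_zero.2
          (bandProj_avgForce hA hB hδ hC0 hC (s / ϱ) x θ)))
    · refine ⟨(Q * V + (1 + T / ϱ * b) * KK) * ‖y‖, ?_, fun s hs x hx => ?_⟩
      · have h1 := hV θ y hy
        change ‖twistOp (r θ.2) y (h θ) - h θ‖ + _ ≤ V * ‖y‖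
        have h2 : T * (Q * V) ≤ V / 2 := by
          have := mul_le_mul_of_nonneg_right hTQ hV0
          linarith
        have h3 : V₀ + T * (Q * V + (1 + T / ϱ * b) * KK) ≤ V := by linarith
        have h4 := mul_le_mul_of_nonneg_right h3 (norm_nonneg y)
        linarith
      · have hs1 : |s / ϱ| * b ≤ T / ϱ * b := by
          have := hs.1
          have := hs.2
          rw [abs_of_nonneg (by positivity)]
          gcongr
        refine (norm_twistOp_avgForce_sub_le hA hB hS hU hδ hC0 hC hK0 hK hb hbδ (s / ϱ) r hρ hV0
          (fun θ => hx (.inl θ)) hy (fun θ => hx (.inr (.inr (θ, ⟨y, hy⟩)))) θ).trans ?_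
        calc _ ≤ ∑ m ∈ B.M, (2 * N : ℝ) ^ m *
            (C * ρ ^ (m - 1) * V * ‖y‖ + K * (1 + T / ϱ * b) * ρ ^ m * ‖y‖) := by gcongr
          _ = _ := by
            rw [hQ, hKK, Finset.sum_mul, Finset.mul_sum, ← Finset.sum_add_distrib, Finset.sum_mul]
            exact Finset.sum_congr rfl fun m _ => by ring
  · intro s hs x y hx hy
    exact norm_avgForce_sub_le hA hB hδ hC0 hC (s / ϱ) hρ (hbound x hx) (hbound y hy)
  · intro w hw
    exact continuousOn_avgForce hA hB hδ hC0 hC hw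

/-! ### Decomposition of the exact force -/

theorem symOp_ofReal_smul (hm : 1 ≤ m) {a : MSymbol d J m} (ha : IsSymbol a C) {c : ℝ} (hc : 0 ≤ c)
    (w : Fin m → AmpL1 d J) : symOp (fun x => (c : ℂ) • a x) w = c • symOp a w := by
  have hs : IsSymbol (fun x => (c : ℂ) • a x) (c * C) :=
    ha.smul aestronglyMeasurable_const (by
      filter_upwards [ha.bound] with x hx
      rw [norm_smul, Complex.norm_real, Real.norm_of_nonneg hc]
      gcongr) (mul_nonneg hc ha.nonneg)
  apply Lp.ext
  filter_upwards [Lp.coeFn_smul c (symOp a w), symOp_coe hm ha w, symOp_coe hm hs w] with k h1 h2 h3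
  rw [h1, h3, Pi.smul_apply, h2, fiberIntegral, fiberIntegral, ← integral_smul]
  rfl

/-- A fixed vector of ψΠ is in the range of Π, hence is fixed by Π and then by ψ. This allows
cutoffs to be inserted in front of a component at no cost. -/
theorem bandProj_fixed (hA : A.Admissible) {θ : ℤˣ × Fin N} {k : Wave d}
    (hk : k ∉ A.bandCrossing) {v : Amp J} (h : bandProj A S δ θ k v = v) :
    A.projL (S θ.2).1 θ.1 k v = v ∧ ((bump (ctr S θ) (2 * δ) k : ℝ) : ℂ) • v = v := by
  set p := A.projL (S θ.2).1 θ.1 k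
  have hpp : p (p v) = p v := by
    have := hA.projL_projL hk ((S θ.2).1, θ.1) ((S θ.2).1, θ.1) v
    rwa [if_pos rfl] at this
  change ((bump (ctr S θ) (2 * δ) k : ℝ) : ℂ) • p v = v at h
  have h1 : p v = v := by
    conv_rhs => rw [← h]
    conv_lhs => rw [← h]
    rw [map_smul, hpp]
  exact ⟨h1, by rwa [h1] at h⟩

/-- On polarized inputs the propagators are scalar phases, and the output is expanded in the
eigenbasis at ∑x_j. The scalars combine into exp(itφ), one oscillating symbol per output band. -/
theorem propOp_symOp_chi (hA : A.Admissible) (hB : B.Admissible A) (hδ : IsLocalRadius A B S δ)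
    (hC0 : 0 ≤ C)
    (hC : ∀ m ∈ B.M, ∀ (k : Wave d) (q : Fin m → Wave d), k ∉ A.bandCrossing →
      (∀ j, q j ∉ A.bandCrossing) → ‖B.χ m k q‖ ≤ C)
    (hχ : ∀ m ∈ B.M, IsSymbol (B.chiSym m) C) (hm : m ∈ B.M) (t : ℝ)
    {w : ℤˣ × Fin N → AmpL1 d J} (hw : ∀ θ, mulOp (bandProj A S δ θ) (w θ) = w θ)
    (lam : Fin m → ℤˣ × Fin N) :
    convConst d m • propOp A (-t) (symOp (B.chiSym m) fun j => propOp A t (w (lam j))) =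
      ∑ i : Fin J × ℤˣ, symOp (oscSym (bandSym A B S δ lam i.1 i.2) (phase A S lam i.1 i.2) t)
        fun j => w (lam j) := by
  have hm1 := one_le_two.trans (hB.two_le m hm)
  have hP := hA.isMultiplier_propagator (-t)
  have hP' := hA.isMultiplier_propagator t
  have hsym := (hχ m hm).comp_left hm1 hP zero_le_one
  have hsym' : IsSymbol (fun x => ((convConst d m : ℝ) : ℂ) •
      (A.propagator (-t) (∑ j, x j)).compContinuousMultilinearMap (B.chiSym m x))
      (convConst d m * (1 * C)) := hsym.smul aestronglyMeasurable_const (by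
    filter_upwards [hsym.bound] with x hx
    rw [norm_smul, Complex.norm_real, Real.norm_of_nonneg (convConst_nonneg m)]
    exact mul_le_mul_of_nonneg_left hx (convConst_nonneg m))
      (mul_nonneg (convConst_nonneg m) (by linarith))
  rw [propOp, mulOp_symOp hm1 (hχ m hm) hP zero_le_one, ← symOp_ofReal_smul hm1 hsym
    (convConst_nonneg m)]
  refine symOp_eq_sum hm1 hsym' _ Finset.univ
    (fun i : Fin J × ℤˣ => oscSym (bandSym A B S δ lam i.1 i.2) (phase A S lam i.1 i.2) t)
    (C' := fun _ => C) (fun i _ => (isSymbol_bandSym hA hB hδ hC0 hC hm lam i.1 i.2).osc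
      (aestronglyMeasurable_phase hA hm1 _ _ _) t) (fun _ j => w (lam j)) ?_
  have h1 : ∀ᵐ x : Fin m → Wave d, ∀ j, propOp A t (w (lam j)) (x j) =
      A.propagator t (x j) (w (lam j) (x j)) :=
    ae_all_iff.2 fun j => ae_eval (mulOp_coe hP' (w (lam j))) j
  have h2 : ∀ᵐ x : Fin m → Wave d, ∀ j, bandProj A S δ (lam j) (x j) (w (lam j) (x j)) =
      w (lam j) (x j) :=
    ae_all_iff.2 fun j => ae_eval (by
      have := mulOp_coe (isMultiplier_bandProj (δ := δ) (S := S) hA (lam j)) (w (lam j))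
      rw [hw] at this
      exact this.symm) j
  filter_upwards [h1, h2, ae_sum hm1 hA.ae_notMem,
    ae_all_iff.2 fun j => ae_eval hA.ae_notMem j] with x h1 h2 hs hx
  -- The bump is inserted through ψw = w, so the full symbol may be replaced by the localized one
  -- exactly.
  have h3 : ∀ j, propOp A t (w (lam j)) (x j) =
      (Complex.exp (Complex.I * ((-(t * A.freq (S (lam j).2).1 (lam j).1 (x j)) : ℝ) : ℂ)) *
        ((bump (ctr S (lam j)) (2 * δ) (x j) : ℝ) : ℂ)) • w (lam j) (x j) := fun j => by
    obtain ⟨h4, h5⟩ := bandProj_fixed hA (hx j) (h2 j)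
    rw [h1 j, mul_smul, h5]
    conv_lhs => rw [← h4, LinearPart.projL_apply, hA.propagator_proj (hx j)]
    rw [← LinearPart.projL_apply, h4]
  simp only [tens, h3]
  change ((convConst d m : ℝ) : ℂ) • A.propagator (-t) (∑ j, x j) (B.chiSym m x _) = _
  rw [ContinuousMultilinearMap.map_smul_univ, map_smul, hA.propagator_apply hs, Finset.smul_sum,
    Finset.smul_sum]
  refine Finset.sum_congr rfl fun i _ => ?_
  change _ = Complex.exp (Complex.I * ((t * phase A S lam i.1 i.2 x : ℝ) : ℂ)) •
    ((convConst d m * ∏ j, bump (ctr S (lam j)) (2 * δ) (x j) : ℝ) : ℂ) •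
    A.projL i.1 i.2 (∑ j, x j) (B.chiSym m x fun j => w (lam j) (x j))
  rw [Finset.prod_mul_distrib, ← Complex.exp_sum, LinearPart.projL_apply, smul_smul, smul_smul,
    smul_smul]
  congr 1
  have h6 : Complex.exp (Complex.I * ((t * phase A S lam i.1 i.2 x : ℝ) : ℂ)) =
      Complex.exp (∑ j, Complex.I *
        ((-(t * A.freq (S (lam j).2).1 (lam j).1 (x j)) : ℝ) : ℂ)) *
      Complex.exp (Complex.I * ((-(-t * A.freq i.1 i.2 (∑ j, x j)) : ℝ) : ℂ)) := by
    rw [← Complex.exp_add, ← Finset.mul_sum, ← mul_add, phase, ← Complex.ofReal_sum,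
      ← Complex.ofReal_add]
    congr 3
    rw [Finset.sum_neg_distrib, ← Finset.mul_sum]
    ring
  rw [h6, Complex.ofReal_mul, Complex.ofReal_prod]
  ring

theorem forceOp_sum (hA : A.Admissible) (hB : B.Admissible A) (hδ : IsLocalRadius A B S δ)
    (hC0 : 0 ≤ C)
    (hC : ∀ m ∈ B.M, ∀ (k : Wave d) (q : Fin m → Wave d), k ∉ A.bandCrossing →
      (∀ j, q j ∉ A.bandCrossing) → ‖B.χ m k q‖ ≤ C)
    (hχ : ∀ m ∈ B.M, IsSymbol (B.chiSym m) C) (t : ℝ)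
    {w : ℤˣ × Fin N → AmpL1 d J} (hw : ∀ θ, mulOp (bandProj A S δ θ) (w θ) = w θ) :
    forceOp A B t (∑ θ, w θ) = ∑ m ∈ B.M, ∑ lam : Fin m → ℤˣ × Fin N, ∑ i : Fin J × ℤˣ,
      symOp (oscSym (bandSym A B S δ lam i.1 i.2) (phase A S lam i.1 i.2) t)
        fun j => w (lam j) := by
  unfold forceOp
  refine Finset.sum_congr rfl fun m hm => ?_
  rw [map_sum, ContinuousMultilinearMap.map_sum, map_sum, Finset.smul_sum]
  exact Finset.sum_congr rfl fun lam _ => propOp_symOp_chi hA hB hδ hC0 hC hχ hm t hw lam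

end Wavepacket

namespace Wavepacket

open Filter Topology Nonlinearity

variable {d J m N : ℕ} {A : LinearPart d J} {B : Nonlinearity d J} {S : Fin N → Fin J × Wave d}
  {δ C b : ℝ}

/-! ### The residual of the averaged solution -/

-- Resonance invariance makes θ ↦ (n_l, ζ) a bijection from the components fed by λ onto its
-- resonant output bands: existence is R(S) = S, and injectivity is distinctness of the pairs. No
-- resonant term of the exact force is lost or counted twice.
open Classical in
theorem sum_feeds {E : Type*} [AddCommMonoid E] (hS : IsNKSpectrum A B.M S)
    (hU : UniversallyResonanceInvariant A B.M S) (hm : m ∈ B.M) (lam : Fin m → ℤˣ × Fin N)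
    (g : Fin J × ℤˣ → E) :
    ∑ θ : ℤˣ × Fin N, (if Feeds A S lam θ then g ((S θ.2).1, θ.1) else 0) =
      ∑ i : Fin J × ℤˣ, if IsResonant A S i.2 i.1 lam then g i else 0 := by
  simp only [← Finset.sum_filter]
  refine Finset.sum_bij (fun θ _ => ((S θ.2).1, θ.1)) ?_ ?_ ?_ fun _ _ => rfl
  · intro θ hθ
    rw [Finset.mem_filter] at hθ ⊢
    exact ⟨Finset.mem_univ _, hθ.2.1⟩
  · intro θ hθ θ' hθ' h
    rw [Finset.mem_filter, feeds_iff] at hθ hθ'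
    have h1 := congrArg Prod.fst h
    have h2 := congrArg Prod.snd h
    simp only at h1 h2
    refine Prod.ext h2 (hS.injective ?_)
    rw [hθ.2.2, hθ'.2.2, h1, h2]
  · intro i hi
    rw [Finset.mem_filter] at hi
    obtain ⟨l, hl⟩ := exists_feeds hU hm hi.2
    have hl1 : (S l).1 = i.1 := by rw [hl]
    refine ⟨(i.2, l), ?_, Prod.ext hl1 rfl⟩
    rw [Finset.mem_filter, feeds_iff]
    refine ⟨Finset.mem_univ _, ?_, ?_⟩
    · simp only [hl1]; exact hi.2
    · simp only [hl1]; exact hl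

theorem bandSym_phase_le (hδ : IsLocalRadius A B S δ) (hm : m ∈ B.M) {lam : Fin m → ℤˣ × Fin N}
    {n : Fin J} {ζ : ℤˣ} {x : Fin m → Wave d} (h : bandSym A B S δ lam n ζ x ≠ 0) :
    |phase A S lam n ζ x| ≤ δ⁻¹ := by
  refine hδ.phase_le m hm lam _ _ x fun j => ?_
  have := bandSym_support hδ h j
  have := hδ.pos
  linarith

/-- The symbols differ only by the output cutoff, that is where ∑x_j is at least δ from the centre.
There the distances of the inputs sum to at least δ, and the weights supply exp(−δ/b). -/
theorem norm_symOp_avgSym_sub_le (hA : A.Admissible) (hB : B.Admissible A)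
    (hδ : IsLocalRadius A B S δ) (hC0 : 0 ≤ C)
    (hC : ∀ m ∈ B.M, ∀ (k : Wave d) (q : Fin m → Wave d), k ∉ A.bandCrossing →
      (∀ j, q j ∉ A.bandCrossing) → ‖B.χ m k q‖ ≤ C) (hb : 0 < b) (t : ℝ) {ρ : ℝ}
    {w : ℤˣ × Fin N → AmpL1 d J} (hw : ∀ θ, ‖weightOp δ b (ctr S θ) (w θ)‖ ≤ ρ) (hm : m ∈ B.M)
    {lam : Fin m → ℤˣ × Fin N} {θ : ℤˣ × Fin N} (hF : Feeds A S lam θ) :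
    ‖(symOp (avgSym A B S δ lam θ t) fun j => w (lam j)) -
      symOp (oscSym (bandSym A B S δ lam (S θ.2).1 θ.1) (phase A S lam (S θ.2).1 θ.1) t)
        fun j => w (lam j)‖ ≤ C * Real.exp (-(δ / b)) * ρ ^ m := by
  have hδ0 := hδ.pos
  have hm1 := one_le_two.trans (hB.two_le m hm)
  have hs := isSymbol_avgSym hA hB hδ hC0 hC hm lam θ t
  have hs' := (isSymbol_bandSym hA hB hδ hC0 hC hm lam (S θ.2).1 θ.1).osc
      (aestronglyMeasurable_phase (S := S) hA hm1 lam (S θ.2).1 θ.1) t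
  rw [← sub_apply, ← symOp_sub hm1 hs hs']
  refine (norm_symOp_apply_le hm1 (hs.sub hs') (C' := C * Real.exp (-(δ / b)))
      (f := fun j k => weight δ b (ctr S (lam j)) k * ‖w (lam j) k‖) _
      (fun j => integrable_weight hb _ _) (ae_of_all _ fun x => ?_)).trans ?_
  · rw [Finset.prod_mul_distrib, ← mul_assoc]
    refine (norm_tens_le _ _).trans (mul_le_mul_of_nonneg_right ?_ (by positivity))
    have hp : 0 ≤ ∏ j, weight δ b (ctr S (lam j)) (x j) :=
      Finset.prod_nonneg fun _ _ => weight_pos.le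
    have hr : resSym A B S δ lam θ x =
        ((bump (ctr S θ) δ (∑ j, x j) : ℝ) : ℂ) • bandSym A B S δ lam (S θ.2).1 θ.1 x := if_pos hF
    rw [avgSym, oscSym, oscSym, hr, msmul_smul, msub_smul, norm_smul]
    have h1 : Complex.exp (Complex.I * ((t * phase A S lam (S θ.2).1 θ.1 x : ℝ) : ℂ)) *
        ((bump (ctr S θ) δ (∑ j, x j) : ℝ) : ℂ) -
        Complex.exp (Complex.I * ((t * phase A S lam (S θ.2).1 θ.1 x : ℝ) : ℂ)) =
        Complex.exp (Complex.I * ((t * phase A S lam (S θ.2).1 θ.1 x : ℝ) : ℂ)) *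
        ((bump (ctr S θ) δ (∑ j, x j) - 1 : ℝ) : ℂ) := by push_cast; ring
    rw [h1, norm_mul, norm_exp_I_mul_ofReal, one_mul, Complex.norm_real, Real.norm_eq_abs]
    by_cases h0 : bandSym A B S δ lam (S θ.2).1 θ.1 x = 0
    · rw [h0, norm_zero, mul_zero]; positivity
    by_cases hκ : ‖∑ j, x j - ctr S θ‖ ≤ δ
    · rw [bump_eq_one hδ0 hκ, sub_self, abs_zero, zero_mul]; positivity
    push Not at hκ
    have hx := bandSym_support hδ h0
    have h2 : |bump (ctr S θ) δ (∑ j, x j) - 1| ≤ 1 := by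
      rw [abs_le]
      constructor <;>
        linarith [bump_nonneg (c := ctr S θ) (δ := δ) (k := ∑ j, x j),
          bump_le_one (c := ctr S θ) (δ := δ) (k := ∑ j, x j)]
    have h3 : 1 ≤ Real.exp (-(δ / b)) * ∏ j, weight δ b (ctr S (lam j)) (x j) := by
      rw [prod_weight_eq lam fun j => by linarith [hx j], ← Real.exp_add]
      refine Real.one_le_exp ?_
      have h4 : δ ≤ ∑ j, ‖x j - ctr S (lam j)‖ := by
        refine hκ.le.trans ?_
        rw [← hF.2]
        exact norm_sum_sub_kappa_le lam x
      have h5 : δ / b ≤ (∑ j, ‖x j - ctr S (lam j)‖) / b := by gcongr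
      linarith
    calc _ ≤ 1 * C := mul_le_mul h2 (norm_bandSym_le hA hδ hC0 hC hm lam _ _ x) (norm_nonneg _)
          zero_le_one
      _ = C * 1 := by ring
      _ ≤ C * (Real.exp (-(δ / b)) * ∏ j, weight δ b (ctr S (lam j)) (x j)) := by gcongr
      _ = _ := by ring
  · refine mul_le_mul_of_nonneg_left ?_ (by positivity)
    calc _ ≤ ∏ _j : Fin m, ρ := Finset.prod_le_prod (fun j _ => integral_nonneg fun k =>
          mul_nonneg weight_pos.le (norm_nonneg _)) fun j _ => by
            rw [← norm_weightOp hb]; exact hw (lam j)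
      _ = ρ ^ m := by simp

/-- The averaged force minus the exact one consists of output-cutoff errors, exponentially small at
each time, and of nonresonant terms, small only after integration in time. This is why the time
integral is estimated as a whole. -/
theorem IsAveragedSolution.norm_residual_le (hA : A.Admissible) (hB : B.Admissible A)
    (hS : IsNKSpectrum A B.M S) (hU : UniversallyResonanceInvariant A B.M S)
    (hδ : IsLocalRadius A B S δ) (hC0 : 0 ≤ C)
    (hC : ∀ m ∈ B.M, ∀ (k : Wave d) (q : Fin m → Wave d), k ∉ A.bandCrossing →
      (∀ j, q j ∉ A.bandCrossing) → ‖B.χ m k q‖ ≤ C)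
    (hχ : ∀ m ∈ B.M, IsSymbol (B.chiSym m) C) (hb : 0 < b) {ρ ϱ T V : ℝ} (hρ : 0 ≤ ρ) (hϱ : 0 < ϱ)
    {r : Fin N → Wave d} {h : ℤˣ × Fin N → AmpL1 d J} {w : ℝ → ℤˣ × Fin N → AmpL1 d J}
    (hw : IsAveragedSolution A B S δ C b ϱ T ρ V r h w) {τ : ℝ} (hτ : τ ∈ Icc 0 T) :
    ‖∫ s in (0 : ℝ)..τ, (∑ θ, avgForce A B S δ (s / ϱ) (w s) θ -
        forceOp A B (s / ϱ) (∑ θ, w s θ))‖ ≤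
      ∑ m ∈ B.M, (2 * N : ℝ) ^ m * ((2 * N) * (C * Real.exp (-(δ / b)) * ρ ^ m * T) +
        (2 * J) * (ϱ * (C / δ * (2 * ρ ^ m +
          m * ρ ^ (m - 1) * (∑ m ∈ B.M, (2 * N : ℝ) ^ m * (C * ρ ^ m)) * T)))) := by
  classical
  have hδ0 := hδ.pos
  have hT : 0 ≤ T := hτ.1.trans hτ.2
  set L := ∑ m ∈ B.M, (2 * N : ℝ) ^ m * (C * ρ ^ m) with hL
  have hL0 : 0 ≤ L := Finset.sum_nonneg fun m _ => by positivity
  let G : (m : ℕ) → (Fin m → ℤˣ × Fin N) → Fin J × ℤˣ → ℝ → AmpL1 d J := fun m lam i s =>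
    symOp (oscSym (bandSym A B S δ lam i.1 i.2) (phase A S lam i.1 i.2) (s / ϱ))
      fun j => w s (lam j)
  -- P collects the cutoff errors of the resonant terms, Q the nonresonant terms.
  let P : (m : ℕ) → (Fin m → ℤˣ × Fin N) → ℤˣ × Fin N → ℝ → AmpL1 d J := fun m lam θ s =>
    if Feeds A S lam θ then (symOp (avgSym A B S δ lam θ (s / ϱ)) fun j => w s (lam j)) -
      G m lam ((S θ.2).1, θ.1) s else 0
  let Q : (m : ℕ) → (Fin m → ℤˣ × Fin N) → Fin J × ℤˣ → ℝ → AmpL1 d J := fun m lam i s =>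
    if IsResonant A S i.2 i.1 lam then 0 else G m lam i s
  have hsplit : ∀ s ∈ Icc 0 T, ∑ θ, avgForce A B S δ (s / ϱ) (w s) θ -
      forceOp A B (s / ϱ) (∑ θ, w s θ) =
      ∑ m ∈ B.M, ∑ lam, (∑ θ, P m lam θ s - ∑ i, Q m lam i s) := by
    intro s hs
    rw [forceOp_sum hA hB hδ hC0 hC hχ (s / ϱ) (hw.range s hs)]
    simp only [avgForce]
    rw [Finset.sum_comm, ← Finset.sum_sub_distrib]
    refine Finset.sum_congr rfl fun m hm => ?_
    have hm1 := one_le_two.trans (hB.two_le m hm)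
    rw [Finset.sum_comm, ← Finset.sum_sub_distrib]
    refine Finset.sum_congr rfl fun lam _ => ?_
    have h1 : ∀ θ, (symOp (avgSym A B S δ lam θ (s / ϱ)) fun j => w s (lam j)) =
        P m lam θ s + if Feeds A S lam θ then G m lam ((S θ.2).1, θ.1) s else 0 := by
      intro θ
      by_cases hF : Feeds A S lam θ
      · simp only [P, if_pos hF, sub_add_cancel]
      · simp only [P, if_neg hF, add_zero]
        refine symOp_zero_of_forall hm1 (fun x => ?_) _
        by_contra h
        exact hF (avgSym_support hδ h).1
    have h2 : ∀ i, G m lam i s = (if IsResonant A S i.2 i.1 lam then G m lam i s else 0) +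
        Q m lam i s := by
      intro i
      by_cases hR : IsResonant A S i.2 i.1 lam
      · simp only [Q, if_pos hR, add_zero]
      · simp only [Q, if_neg hR, zero_add]
    rw [Finset.sum_congr rfl fun θ _ => h1 θ, Finset.sum_add_distrib,
      sum_feeds hS hU hm lam fun i => G m lam i s]
    change _ - ∑ i, G m lam i s = _
    rw [Finset.sum_congr rfl fun i _ => h2 i, Finset.sum_add_distrib]
    abel
  have hwc : ∀ m, ∀ lam : Fin m → ℤˣ × Fin N, ContinuousOn (fun s j => w s (lam j)) (Icc 0 T) :=
    fun m lam => continuousOn_pi.2 fun j => (continuous_apply (lam j)).comp_continuousOn hw.cont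
  have hGc : ∀ m ∈ B.M, ∀ lam i, ContinuousOn (G m lam i) (Icc 0 T) := fun m hm lam i => by
    have hm1 := one_le_two.trans (hB.two_le m hm)
    exact continuousOn_symOp_oscSym hm1 (isSymbol_bandSym hA hB hδ hC0 hC hm lam i.1 i.2)
      (aestronglyMeasurable_phase hA hm1 _ _ _) (fun x hx => bandSym_phase_le hδ hm hx)
      (inv_nonneg.2 hδ0.le) _ (hwc m lam)
  have hPc : ∀ m ∈ B.M, ∀ lam θ, ContinuousOn (P m lam θ) (Icc 0 T) := fun m hm lam θ => by
    have hm1 := one_le_two.trans (hB.two_le m hm)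
    by_cases hF : Feeds A S lam θ
    · simp only [P, if_pos hF]
      refine ContinuousOn.sub ?_ (hGc m hm lam _)
      exact continuousOn_symOp_oscSym hm1 (isSymbol_resSym hA hB hδ hC0 hC hm lam θ)
        (aestronglyMeasurable_phase hA hm1 _ _ _) (fun x hx => bandSym_phase_le hδ hm
          (n := (S θ.2).1) (ζ := θ.1) fun h0 => hx (norm_le_zero_iff.1
            ((norm_resSym_le_bandSym lam θ x).trans (by rw [h0, norm_zero]))))
        (inv_nonneg.2 hδ0.le) _ (hwc m lam)
    · simp only [P, if_neg hF]
      exact continuousOn_const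
  have hQc : ∀ m ∈ B.M, ∀ lam i, ContinuousOn (Q m lam i) (Icc 0 T) := fun m hm lam i => by
    by_cases hR : IsResonant A S i.2 i.1 lam
    · simp only [Q, if_pos hR]; exact continuousOn_const
    · simp only [Q, if_neg hR]; exact hGc m hm lam i
  have hi : ∀ {f : ℝ → AmpL1 d J}, ContinuousOn f (Icc 0 T) → IntervalIntegrable f volume 0 τ :=
    fun hf => by
      refine ContinuousOn.intervalIntegrable ?_
      rw [uIcc_of_le hτ.1]
      exact hf.mono (Icc_subset_Icc_right hτ.2)
  have hPi : ∀ m ∈ B.M, ∀ lam θ, ‖∫ s in (0 : ℝ)..τ, P m lam θ s‖ ≤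
      C * Real.exp (-(δ / b)) * ρ ^ m * T := fun m hm lam θ => by
    refine (intervalIntegral.norm_integral_le_of_norm_le_const (C := C * Real.exp (-(δ / b)) * ρ ^ m)
      fun s hs => ?_).trans ?_
    · rw [uIoc_of_le hτ.1] at hs
      have hs' : s ∈ Icc 0 T := ⟨hs.1.le, hs.2.trans hτ.2⟩
      by_cases hF : Feeds A S lam θ
      · simp only [P, if_pos hF]
        exact norm_symOp_avgSym_sub_le hA hB hδ hC0 hC hb (s / ϱ) (hw.weight_le s hs') hm hF
      · simp only [P, if_neg hF, norm_zero]
        positivity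
    · rw [sub_zero, abs_of_nonneg hτ.1]
      exact mul_le_mul_of_nonneg_left hτ.2 (by positivity)
  have hwρ : ∀ s ∈ Icc 0 T, ‖w s‖ ≤ ρ := fun s hs => (pi_norm_le_iff_of_nonneg hρ).2 fun θ =>
    (norm_le_weightOp hδ0 hb (ctr S θ) (w s θ)).trans (hw.weight_le s hs θ)
  have hQi : ∀ m ∈ B.M, ∀ lam i, ‖∫ s in (0 : ℝ)..τ, Q m lam i s‖ ≤
      ϱ * (C / δ * (2 * ρ ^ m + m * ρ ^ (m - 1) * L * T)) := fun m hm lam i => by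
    have hm1 := one_le_two.trans (hB.two_le m hm)
    by_cases hR : IsResonant A S i.2 i.1 lam
    · simp only [Q, if_pos hR, intervalIntegral.integral_zero, norm_zero]
      positivity
    · simp only [Q, if_neg hR, G]
      refine (norm_integral_oscSym_le hm1 (isSymbol_bandSym hA hB hδ hC0 hC hm lam i.1 i.2)
        (aestronglyMeasurable_phase hA hm1 _ _ _) (fun x hx => bandSym_phase_le hδ hm hx)
        (inv_nonneg.2 hδ0.le) hδ0 (fun x hx => hδ.gap m hm lam _ _ hR x fun j => ?_) hϱ hL0
        (w := fun s j => w s (lam j)) (B := ρ) (L := L)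
        (fun s hs => (norm_comp_le (w s) lam).trans (hwρ s hs))
        (fun s hs t ht => (norm_comp_le (w t - w s) lam).trans (hw.lipschitz s hs t ht)) hτ).trans ?_
      · have := bandSym_support hδ hx j
        linarith
      · have := hτ.2
        gcongr
  have hint : ∫ s in (0 : ℝ)..τ, (∑ θ, avgForce A B S δ (s / ϱ) (w s) θ -
        forceOp A B (s / ϱ) (∑ θ, w s θ)) = ∑ m ∈ B.M, ∑ lam,
        ((∑ θ, ∫ s in (0 : ℝ)..τ, P m lam θ s) - ∑ i, ∫ s in (0 : ℝ)..τ, Q m lam i s) := by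
    rw [intervalIntegral.integral_congr (g := fun s => ∑ m ∈ B.M, ∑ lam,
      (∑ θ, P m lam θ s - ∑ i, Q m lam i s)) fun s hs => by
        rw [uIcc_of_le hτ.1] at hs
        exact hsplit s ⟨hs.1, hs.2.trans hτ.2⟩]
    have c1 : ∀ m ∈ B.M, ∀ lam, ContinuousOn (fun s => ∑ θ, P m lam θ s) (Icc 0 T) :=
      fun m hm lam => continuousOn_finsetSum _ fun θ _ => hPc m hm lam θ
    have c2 : ∀ m ∈ B.M, ∀ lam, ContinuousOn (fun s => ∑ i, Q m lam i s) (Icc 0 T) :=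
      fun m hm lam => continuousOn_finsetSum _ fun i _ => hQc m hm lam i
    have c3 : ∀ m ∈ B.M, ∀ lam, ContinuousOn (fun s => ∑ θ, P m lam θ s - ∑ i, Q m lam i s)
      (Icc 0 T) := fun m hm lam => (c1 m hm lam).sub (c2 m hm lam)
    rw [intervalIntegral.integral_finsetSum fun m hm => hi (continuousOn_finsetSum _ fun lam _ =>
      c3 m hm lam)]
    refine Finset.sum_congr rfl fun m hm => ?_
    rw [intervalIntegral.integral_finsetSum fun lam _ => hi (c3 m hm lam)]
    refine Finset.sum_congr rfl fun lam _ => ?_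
    rw [intervalIntegral.integral_sub (hi (c1 m hm lam)) (hi (c2 m hm lam)),
      intervalIntegral.integral_finsetSum fun θ _ => hi (hPc m hm lam θ),
      intervalIntegral.integral_finsetSum fun i _ => hi (hQc m hm lam i)]
  rw [hint]
  refine norm_sum_tuples_le fun m hm lam => ?_
  refine (norm_sub_le _ _).trans (add_le_add ?_ ?_)
  · refine (norm_sum_le _ _).trans ((Finset.sum_le_sum fun θ _ => hPi m hm lam θ).trans
      (le_of_eq ?_))
    rw [Finset.sum_const, nsmul_eq_mul]
    simp
  · refine (norm_sum_le _ _).trans ((Finset.sum_le_sum fun i _ => hQi m hm lam i).trans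
      (le_of_eq ?_))
    rw [Finset.sum_const, nsmul_eq_mul]
    simp [mul_comm]

end Wavepacket

namespace Wavepacket

open Filter Topology Nonlinearity

variable {d J m N : ℕ} {A : LinearPart d J} {B : Nonlinearity d J} {S : Fin N → Fin J × Wave d}
  {δ C b : ℝ} {Ψ : Wave d → ℝ}

/-! ### The components of the initial data -/

theorem projL_projL_self (hA : A.Admissible) {k : Wave d} (hk : k ∉ A.bandCrossing) (n : Fin J)
    (ζ : ℤˣ) (v : Amp J) : A.projL n ζ k (A.projL n ζ k v) = A.projL n ζ k v := by
  have := hA.projL_projL hk (n, ζ) (n, ζ) v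
  rwa [if_pos rfl] at this

theorem polarized_of_cutoff (hA : A.Admissible) (hΨ : IsCutoff Ψ) (hb : 0 < b) {c k : Wave d}
    (hk : k ∉ A.bandCrossing) {n : Fin J} {ζ : ℤˣ} {v : Amp J}
    (h : v = cutoff Ψ (b / 2) c k • A.proj n ζ k v) (hv : v ≠ 0) :
    ‖k - c‖ ≤ b / 2 ∧ A.projL n ζ k v = v := by
  rw [← LinearPart.projL_apply] at h
  constructor
  · by_contra! h'
    refine hv ?_
    rw [h, cutoff, hΨ.eq_zero, zero_smul]
    rw [norm_smul, norm_inv, Real.norm_of_nonneg (by positivity), ← div_eq_inv_mul,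
      one_le_div (by positivity)]
    exact h'.le
  · have h2 : A.projL n ζ k v = cutoff Ψ (b / 2) c k • A.projL n ζ k v := by
      conv_lhs => rw [h]
      rw [ContinuousLinearMap.map_smul_of_tower, projL_projL_self hA hk]
    rw [h2, ← h]

/-- The components of the initial data are polarized and localized. -/
theorem bandProj_toL1 (hA : A.Admissible) (hδ : IsLocalRadius A B S δ) (hb : 0 < b) (hbδ : b ≤ δ)
    {θ : ℤˣ × Fin N} {f : Wave d → Amp J} (hf : Integrable f)
    (h : ∀ᵐ k, f k ≠ 0 → ‖k - ctr S θ‖ ≤ b / 2 ∧ A.projL (S θ.2).1 θ.1 k (f k) = f k) :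
    mulOp (bandProj A S δ θ) (hf.toL1 f) = hf.toL1 f := by
  have hδ0 := hδ.pos
  apply Lp.ext
  filter_upwards [mulOp_coe (isMultiplier_bandProj (δ := δ) (S := S) hA θ) (hf.toL1 f),
    hf.coeFn_toL1, h] with k h1 h2 h3
  rw [h1, h2]
  by_cases h0 : f k = 0
  · rw [h0, map_zero]
  obtain ⟨h4, h5⟩ := h3 h0
  change ((bump (ctr S θ) (2 * δ) k : ℝ) : ℂ) • A.projL (S θ.2).1 θ.1 k (f k) = f k
  rw [h5, bump_eq_one (by positivity) (by linarith), Complex.ofReal_one, one_smul]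

theorem norm_weightOp_toL1_le (hb : 0 < b) {c : Wave d} {f : Wave d → Amp J} (hf : Integrable f)
    (h : ∀ᵐ k, f k ≠ 0 → ‖k - c‖ ≤ b / 2) :
    ‖weightOp δ b c (hf.toL1 f)‖ ≤ 2 * ∫ k, ‖f k‖ := by
  rw [norm_weightOp hb, ← integral_const_mul]
  refine integral_mono_ae (integrable_weight hb c _) (hf.norm.const_mul 2) ?_
  filter_upwards [hf.coeFn_toL1, h] with k h1 h2
  simp only [h1]
  by_cases h0 : f k = 0
  · rw [h0, norm_zero, mul_zero, mul_zero]
  refine mul_le_mul_of_nonneg_right ?_ (norm_nonneg _)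
  refine (weight_le_exp hb (h2 h0)).trans ?_
  have h3 : b / 2 / b = 1 / 2 := by field_simp
  rw [h3]
  -- On the support of the data the weight is at most exp(1/2), which is below 2 since e < 4.
  have h4 : Real.exp (1 / 2) ^ 2 = Real.exp 1 := by rw [← Real.exp_nat_mul]; norm_num
  nlinarith [Real.exp_one_lt_d9, Real.exp_pos (1 / 2)]

theorem norm_twistOp_sub_eq (r y : Wave d) (w : AmpL1 d J) :
    ‖twistOp r y w - w‖ = ∫ k, ‖Complex.exp (Complex.I * (inner ℝ r (k + y) : ℝ)) • w (k + y) -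
      Complex.exp (Complex.I * (inner ℝ r k : ℝ)) • w k‖ := by
  rw [L1.norm_eq_integral_norm]
  refine integral_congr_ae ?_
  filter_upwards [Lp.coeFn_sub (twistOp r y w) w, twistOp_coe r y w] with k h1 h2
  rw [h1, Pi.sub_apply, h2, twist]
  have h5 : Complex.exp (Complex.I * (inner ℝ r (k + y) : ℝ)) • w (k + y) -
      Complex.exp (Complex.I * (inner ℝ r k : ℝ)) • w k =
      Complex.exp (Complex.I * (inner ℝ r k : ℝ)) •
        (Complex.exp (Complex.I * (inner ℝ r y : ℝ)) • w (k + y) - w k) := by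
    rw [inner_add_right, Complex.ofReal_add, mul_add, Complex.exp_add, smul_sub, smul_smul]
  rw [h5, norm_smul, norm_exp_I_mul_ofReal, one_mul]

theorem norm_twistOp_toL1_sub_le {r : Wave d} {f : Wave d → Amp J} (hf : Integrable f volume)
    {G : Wave d → Wave d →L[ℝ] Amp J}
    (hG : HasWeakGradient (fun k => Complex.exp (Complex.I * (inner ℝ r k : ℝ)) • f k) G)
    (y : Wave d) : ‖twistOp r y (hf.toL1 f) - hf.toL1 f‖ ≤ (∫ k, ‖G k‖) * ‖y‖ := by
  rw [norm_twistOp_sub_eq]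
  refine le_trans (le_of_eq (integral_congr_ae ?_)) (hG.integral_norm_sub_le y)
  filter_upwards [hf.coeFn_toL1, ae_comp_add_right hf.coeFn_toL1 y] with k h3 h4
  rw [h3, h4]

/-- A component is recovered from the sum by its own projection. The others either have a distant
centre and vanish at k, or share the centre and lie in a different, orthogonal band, by distinctness
of the pairs. It bounds both the initial components and the final packets by their sums. -/
theorem norm_component_le (hA : A.Admissible) (hS : IsNKSpectrum A B.M S)
    (hδ : IsLocalRadius A B S δ) (hbδ : b ≤ δ)
    {f : ℤˣ × Fin N → Wave d → Amp J} {k : Wave d} (hk : k ∉ A.bandCrossing)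
    (h : ∀ θ, f θ k ≠ 0 → ‖k - ctr S θ‖ ≤ b / 2 ∧ A.projL (S θ.2).1 θ.1 k (f θ k) = f θ k)
    (θ : ℤˣ × Fin N) : ‖f θ k‖ ≤ ‖∑ θ, f θ k‖ := by
  by_cases h0 : f θ k = 0
  · rw [h0, norm_zero]; positivity
  have hδ0 := hδ.pos
  have h1 : A.projL (S θ.2).1 θ.1 k (∑ θ, f θ k) = f θ k := by
    rw [map_sum, Finset.sum_eq_single θ]
    · exact (h θ h0).2
    · intro θ' _ hne
      by_cases h0' : f θ' k = 0
      · rw [h0', map_zero]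
      have hc : ctr S θ = ctr S θ' := by
        by_contra hne'
        have h2 := hδ.sep θ θ' hne'
        have h3 : ‖ctr S θ - ctr S θ'‖ ≤ ‖k - ctr S θ'‖ + ‖k - ctr S θ‖ := by
          have : ctr S θ - ctr S θ' = (k - ctr S θ') - (k - ctr S θ) := by abel
          rw [this]
          exact norm_sub_le _ _
        linarith [(h θ h0).1, (h θ' h0').1]
      rw [← (h θ' h0').2, hA.projL_projL hk ((S θ.2).1, θ.1) ((S θ'.2).1, θ'.1), if_neg]
      intro heq
      have e1 := congrArg Prod.fst heq
      have e2 := congrArg Prod.snd heq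
      simp only at e1 e2
      refine hne (Prod.ext e2.symm (hS.injective (Prod.ext e1.symm ?_)))
      rw [ctr, ctr, e2] at hc
      have := congrArg (fun v => sgn θ'.1 • v) hc
      simp only [smul_smul, sgn_mul_self, one_smul] at this
      exact this.symm
    · simp
  calc ‖f θ k‖ = ‖A.projL (S θ.2).1 θ.1 k (∑ θ, f θ k)‖ := by rw [h1]
    _ ≤ 1 * ‖∑ θ, f θ k‖ := ContinuousLinearMap.le_of_opNorm_le _ (hA.norm_projL_le hk _ _) _
    _ = _ := one_mul _

/-! ### The final wavepackets -/

theorem clm_zero_smul (T : Amp J →L[ℂ] Amp J) : (0 : ℂ) • T = 0 := by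
  ext1 v
  exact zero_smul ℂ (T v)

theorem eventually_lt_norm_sub {c k : Wave d} {a : ℝ} (h : a < ‖k - c‖) :
    ∀ᶠ y in 𝓝 k, a < ‖y - c‖ :=
  (show Continuous fun y : Wave d => ‖y - c‖ by fun_prop).continuousAt.eventually (lt_mem_nhds h)

theorem contDiff_bandProj (hA : A.Admissible) (hδ : IsLocalRadius A B S δ) (θ : ℤˣ × Fin N) :
    ContDiff ℝ ∞ (bandProj A S δ θ) := by
  have hδ0 := hδ.pos
  rw [contDiff_iff_contDiffAt]
  intro k
  by_cases hk : ‖k - ctr S θ‖ ≤ 6 * δ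
  · exact ContDiffAt.smul (𝕜 := ℝ)
      (f := fun k => ((bump (ctr S θ) (2 * δ) k : ℝ) : ℂ))
      (Complex.ofRealCLM.contDiff.comp contDiff_bump).contDiffAt
      ((hA.contDiffOn_projL _ _).contDiffAt (hA.isOpen.mem_nhds (hδ.notMem θ k hk)))
  · push Not at hk
    have h1 : ∀ᶠ y in 𝓝 k, 4 * δ < ‖y - ctr S θ‖ := eventually_lt_norm_sub (by linarith)
    refine (contDiffAt_const (c := 0)).congr_of_eventuallyEq ?_
    filter_upwards [h1] with y hy
    rw [bandProj, bump_eq_zero (by positivity) (by linarith), Complex.ofReal_zero, clm_zero_smul]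

theorem exists_lipschitz_bandProj (hA : A.Admissible) (hδ : IsLocalRadius A B S δ)
    (θ : ℤˣ × Fin N) :
    ∃ K : ℝ, 0 ≤ K ∧ ∀ x y, ‖bandProj A S δ θ x - bandProj A S δ θ y‖ ≤ K * ‖x - y‖ := by
  have hδ0 := hδ.pos
  have hc : HasCompactSupport (bandProj A S δ θ) := by
    refine HasCompactSupport.intro (isCompact_closedBall (ctr S θ) (4 * δ)) fun x hx => ?_
    rw [Metric.mem_closedBall, dist_eq_norm, not_le] at hx
    rw [bandProj, bump_eq_zero (by positivity) (by linarith), Complex.ofReal_zero, clm_zero_smul]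
  obtain ⟨K, hK⟩ := (contDiff_bandProj hA hδ θ).lipschitzWith_of_hasCompactSupport hc (by simp)
  exact ⟨K, K.2, fun x y => by simpa [dist_eq_norm] using hK.dist_le_mul x y⟩

theorem norm_bandProj_le (hA : A.Admissible) (hδ : IsLocalRadius A B S δ) (θ : ℤˣ × Fin N)
    (k : Wave d) : ‖bandProj A S δ θ k‖ ≤ 1 := by
  have hδ0 := hδ.pos
  rw [bandProj, norm_smul, Complex.norm_real, Real.norm_of_nonneg bump_nonneg]
  by_cases hk : ‖k - ctr S θ‖ ≤ 6 * δ
  · exact mul_le_one₀ bump_le_one (norm_nonneg _) (hA.norm_projL_le (hδ.notMem θ k hk) _ _)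
  · push Not at hk
    rw [bump_eq_zero (by positivity) (by linarith), zero_mul]
    exact zero_le_one

variable (A S δ) in
/-- The modulated localized projection `exp(i t (∇ω·k - ω(k))) ψ(k) Π(k)`. -/
def packetMul (a t : ℝ) (θ : ℤˣ × Fin N) (k : Wave d) : Amp J →L[ℂ] Amp J :=
  (((bump (ctr S θ) a k : ℝ) : ℂ) * Complex.exp (Complex.I *
    ((t * (inner ℝ (gradient (A.freq (S θ.2).1 1) (S θ.2).2) k - A.freq (S θ.2).1 θ.1 k) : ℝ) : ℂ)))
    • bandProj A S δ θ k

theorem norm_packetMul_le (hA : A.Admissible) (hδ : IsLocalRadius A B S δ) (a t : ℝ)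
    (θ : ℤˣ × Fin N) (k : Wave d) : ‖packetMul A S δ a t θ k‖ ≤ 1 := by
  rw [packetMul, norm_smul, norm_mul, norm_exp_I_mul_ofReal, mul_one, Complex.norm_real,
    Real.norm_of_nonneg bump_nonneg]
  exact mul_le_one₀ bump_le_one (norm_nonneg _) (norm_bandProj_le hA hδ θ k)

theorem contDiff_packetMul (hA : A.Admissible) (hδ : IsLocalRadius A B S δ) {a : ℝ} (ha : 0 < a)
    (haδ : a ≤ δ) (t : ℝ) (θ : ℤˣ × Fin N) : ContDiff ℝ ∞ (packetMul A S δ a t θ) := by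
  have hδ0 := hδ.pos
  rw [contDiff_iff_contDiffAt]
  intro k
  by_cases hk : ‖k - ctr S θ‖ ≤ 6 * δ
  · have h0 : ContDiffAt ℝ ∞ (fun k : Wave d => ((bump (ctr S θ) a k : ℝ) : ℂ)) k :=
      (Complex.ofRealCLM.contDiff.comp contDiff_bump).contDiffAt
    refine ContDiffAt.smul (𝕜 := ℝ) (h0.mul ?_) (contDiff_bandProj hA hδ θ).contDiffAt
    · have h1 : ContDiffAt ℝ ∞ (A.freq (S θ.2).1 θ.1) k :=
        hA.contDiffAt_freq (hδ.notMem θ k hk) _ _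
      have h2 : ContDiffAt ℝ ∞ (fun k : Wave d =>
          t * (inner ℝ (gradient (A.freq (S θ.2).1 1) (S θ.2).2) k - A.freq (S θ.2).1 θ.1 k)) k :=
        contDiffAt_const.mul ((contDiffAt_const.inner ℝ contDiffAt_id).sub h1)
      exact ContDiffAt.cexp (contDiffAt_const.mul (Complex.ofRealCLM.contDiff.contDiffAt.comp k h2))
  · push Not at hk
    have h1 : ∀ᶠ y in 𝓝 k, 4 * δ < ‖y - ctr S θ‖ := eventually_lt_norm_sub (by linarith)
    refine (contDiffAt_const (c := 0)).congr_of_eventuallyEq ?_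
    filter_upwards [h1] with y hy
    rw [packetMul, bump_eq_zero ha (by linarith), Complex.ofReal_zero, zero_mul, clm_zero_smul]

/-- The three terms come from the cutoff at scale a, the phase, and the localized projection. The
velocity at the centre has been subtracted from the phase, so its derivative is O(|t|a) on the
support instead of O(|t|). -/
theorem norm_fderiv_packetMul_le (hA : A.Admissible) (hδ : IsLocalRadius A B S δ) {a : ℝ}
    (ha : 0 < a) (haδ : a ≤ δ) (t : ℝ) (θ : ℤˣ × Fin N) {K K' : ℝ} (hK0 : 0 ≤ K) (hK0' : 0 ≤ K')
    (hK : ∀ k k', |unitBump d k - unitBump d k'| ≤ K * ‖k - k'‖)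
    (hK' : ∀ x y, ‖bandProj A S δ θ x - bandProj A S δ θ y‖ ≤ K' * ‖x - y‖) (k : Wave d) :
    ‖fderiv ℝ (packetMul A S δ a t θ) k‖ ≤ K / a + |t| * (δ⁻¹ * (3 * a)) + K' := by
  have hδ0 := hδ.pos
  refine norm_fderiv_le_of_lip' ℝ (by positivity) ?_
  filter_upwards [Metric.closedBall_mem_nhds k ha] with x hx
  rw [Metric.mem_closedBall, dist_eq_norm] at hx
  set v := gradient (A.freq (S θ.2).1 1) (S θ.2).2
  set α : Wave d → ℝ := fun k => inner ℝ v k - A.freq (S θ.2).1 θ.1 k with hα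
  set e : Wave d → ℂ := fun k => Complex.exp (Complex.I * ((t * α k : ℝ) : ℂ)) with he
  have hen : ∀ k, ‖e k‖ = 1 := fun k => norm_exp_I_mul_ofReal _
  have hsplit : packetMul A S δ a t θ x - packetMul A S δ a t θ k =
      (((bump (ctr S θ) a x - bump (ctr S θ) a k : ℝ) : ℂ) * e x) • bandProj A S δ θ x +
      (((bump (ctr S θ) a k : ℝ) : ℂ) * (e x - e k)) • bandProj A S δ θ x +
      (((bump (ctr S θ) a k : ℝ) : ℂ) * e k) • (bandProj A S δ θ x - bandProj A S δ θ k) := by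
    simp only [packetMul, he, hα]
    push_cast
    module
  have h1 : ‖(((bump (ctr S θ) a x - bump (ctr S θ) a k : ℝ) : ℂ) * e x) • bandProj A S δ θ x‖ ≤
      K / a * ‖x - k‖ := by
    rw [norm_smul, norm_mul, hen, mul_one, Complex.norm_real, Real.norm_eq_abs]
    exact (mul_le_of_le_one_right (abs_nonneg _) (norm_bandProj_le hA hδ θ x)).trans
      (abs_bump_sub_le hK ha x k)
  have h3 : ‖(((bump (ctr S θ) a k : ℝ) : ℂ) * e k) • (bandProj A S δ θ x - bandProj A S δ θ k)‖ ≤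
      K' * ‖x - k‖ := by
    rw [norm_smul, norm_mul, hen, mul_one, Complex.norm_real, Real.norm_of_nonneg bump_nonneg]
    exact (mul_le_of_le_one_left (norm_nonneg _) bump_le_one).trans (hK' x k)
  have h2 : ‖(((bump (ctr S θ) a k : ℝ) : ℂ) * (e x - e k)) • bandProj A S δ θ x‖ ≤
      |t| * (δ⁻¹ * (3 * a)) * ‖x - k‖ := by
    by_cases h0 : bump (ctr S θ) a k = 0
    · rw [h0, Complex.ofReal_zero, zero_mul, clm_zero_smul, norm_zero]; positivity
    have hk := norm_sub_lt_of_bump_ne_zero ha h0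
    rw [norm_smul, norm_mul, Complex.norm_real, Real.norm_of_nonneg bump_nonneg]
    refine (mul_le_of_le_one_right (by have := bump_nonneg (c := ctr S θ) (δ := a) (k := k)
                                       positivity) (norm_bandProj_le hA hδ θ x)).trans ?_
    refine (mul_le_of_le_one_left (norm_nonneg _) bump_le_one).trans ?_
    refine (norm_exp_I_sub_le _ _).trans ?_
    rw [← mul_sub, abs_mul, mul_assoc]
    refine mul_le_mul_of_nonneg_left ?_ (abs_nonneg t)
    have h4 := hδ.taylor θ k (x - k) (by linarith) (by linarith)
    rw [add_sub_cancel] at h4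
    -- The increment of the phase is exactly the Taylor remainder, with distance to the centre below
    -- 2a and step at most a.
    have h5 : α x - α k = -(A.freq (S θ.2).1 θ.1 x - A.freq (S θ.2).1 θ.1 k - inner ℝ v (x - k)) := by
      simp only [hα, inner_sub_right]
      ring
    rw [h5, abs_neg]
    refine h4.trans ?_
    calc _ ≤ δ⁻¹ * ‖x - k‖ * (2 * a + a) := by gcongr
      _ = _ := by ring
  rw [hsplit]
  refine (norm_add₃_le).trans ?_
  linarith

variable (J) in
/-- Application of a complex linear map, as a real bilinear map. -/
def applyL : (Amp J →L[ℂ] Amp J) →L[ℝ] Amp J →L[ℝ] Amp J :=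
  ContinuousLinearMap.restrictScalarsL ℂ (Amp J) (Amp J) ℝ ℝ

theorem norm_fderiv_apply_le {M : Wave d → Amp J →L[ℂ] Amp J} {g : Wave d → Amp J} {K : ℝ}
    (hM : ContDiff ℝ 1 M) (hg : ContDiff ℝ 1 g) (hM1 : ∀ k, ‖M k‖ ≤ 1)
    (hMK : ∀ k, ‖fderiv ℝ M k‖ ≤ K) (k : Wave d) :
    ‖fderiv ℝ (fun k => M k (g k)) k‖ ≤ ‖fderiv ℝ g k‖ + K * ‖g k‖ := by
  have h := (applyL J).hasFDerivAt_of_bilinear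
    (hM.differentiable one_ne_zero k).hasFDerivAt (hg.differentiable one_ne_zero k).hasFDerivAt
  have h' : HasFDerivAt (fun k => M k (g k)) _ k := h
  rw [h'.fderiv]
  have hK0 : 0 ≤ K := (norm_nonneg (fderiv ℝ M k)).trans (hMK k)
  refine ContinuousLinearMap.opNorm_le_bound _ (by positivity) fun y => ?_
  change ‖M k (fderiv ℝ g k y) + (fderiv ℝ M k y) (g k)‖ ≤ _
  refine (norm_add_le _ _).trans ?_
  have h1 : ‖M k (fderiv ℝ g k y)‖ ≤ 1 * (‖fderiv ℝ g k‖ * ‖y‖) :=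
    (ContinuousLinearMap.le_opNorm _ _).trans (mul_le_mul (hM1 k)
      (ContinuousLinearMap.le_opNorm _ _) (norm_nonneg _) zero_le_one)
  have h2 : ‖(fderiv ℝ M k y) (g k)‖ ≤ K * ‖y‖ * ‖g k‖ :=
    (ContinuousLinearMap.le_opNorm _ _).trans (mul_le_mul_of_nonneg_right
      (ContinuousLinearMap.le_of_opNorm_le _ (hMK k) y) (norm_nonneg _))
  linarith

end Wavepacket

namespace Wavepacket

open Filter Topology Nonlinearity

variable {d J m N : ℕ} {A : LinearPart d J} {B : Nonlinearity d J} {S : Fin N → Fin J × Wave d}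
  {δ C b : ℝ} {Ψ : Wave d → ℝ}

/-! ### Regularized packets at the moving positions -/

theorem exp_neg_mul_exp (z : ℂ) : Complex.exp (-z) * Complex.exp z = 1 := by
  rw [← Complex.exp_add, neg_add_cancel, Complex.exp_zero]

theorem norm_exp_neg_I (x : ℝ) : ‖Complex.exp (-(Complex.I * (x : ℂ)))‖ = 1 := by
  rw [Complex.exp_neg, norm_inv, norm_exp_I_mul_ofReal, inv_one]

variable (A S δ) in
/-- The function `exp(-i t ω(k)) ψ(k) Π(k) exp(-i r·k) g(k)`. -/
def packet (a t : ℝ) (θ : ℤˣ × Fin N) (r : Wave d) (g : Wave d → Amp J) (k : Wave d) : Amp J :=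
  Complex.exp (-(Complex.I *
    (inner ℝ (r + t • gradient (A.freq (S θ.2).1 1) (S θ.2).2) k : ℝ))) •
    packetMul A S δ a t θ k (g k)

theorem packetMul_apply (a t : ℝ) (θ : ℤˣ × Fin N) (k : Wave d) (x : Amp J) :
    packetMul A S δ a t θ k x = (((bump (ctr S θ) a k : ℝ) : ℂ) * Complex.exp (Complex.I *
      ((t * (inner ℝ (gradient (A.freq (S θ.2).1 1) (S θ.2).2) k - A.freq (S θ.2).1 θ.1 k) : ℝ) : ℂ)))
      • bandProj A S δ θ k x := rfl

theorem bandProj_apply (θ : ℤˣ × Fin N) (k : Wave d) (x : Amp J) :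
    bandProj A S δ θ k x = ((bump (ctr S θ) (2 * δ) k : ℝ) : ℂ) • A.projL (S θ.2).1 θ.1 k x := rfl

theorem projL_bandProj (hA : A.Admissible) {k : Wave d} (hk : k ∉ A.bandCrossing)
    (θ : ℤˣ × Fin N) (x : Amp J) :
    A.projL (S θ.2).1 θ.1 k (bandProj A S δ θ k x) = bandProj A S δ θ k x := by
  rw [bandProj_apply, map_smul, projL_projL_self hA hk]

theorem packet_polarized (hA : A.Admissible) (hΨ : IsCutoff Ψ) {a : ℝ} (ha : 0 < a) (t : ℝ)
    (θ : ℤˣ × Fin N) (r : Wave d) (g : Wave d → Amp J) {k : Wave d} (hk : k ∉ A.bandCrossing) :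
    packet A S δ a t θ r g k = cutoff Ψ (8 * a / 2) (ctr S θ) k •
      A.proj (S θ.2).1 θ.1 k (packet A S δ a t θ r g k) := by
  rw [← LinearPart.projL_apply]
  by_cases h0 : bump (ctr S θ) a k = 0
  · have : packet A S δ a t θ r g k = 0 := by
      rw [packet, packetMul_apply, h0, Complex.ofReal_zero, zero_mul, zero_smul, smul_zero]
    rw [this, map_zero, smul_zero]
  have h1 := norm_sub_lt_of_bump_ne_zero ha h0
  -- The packet lives in ‖k − c‖ < 2a, and a cutoff of scale 8a/2 = 4a equals 1 up to distance 2a.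
  have h2 : cutoff Ψ (8 * a / 2) (ctr S θ) k = 1 := by
    refine hΨ.eq_one _ ?_
    rw [norm_smul, norm_inv, Real.norm_of_nonneg (by positivity), ← div_eq_inv_mul,
      div_le_iff₀ (by positivity)]
    linarith
  rw [h2, one_smul, packet, packetMul_apply, map_smul, map_smul, projL_bandProj hA hk]

/-- On a polarized vector the propagator is a scalar, so up to a unimodular factor the difference is
the mollification error plus the tail removed by the cutoff. Beyond distance a the weight is at
least exp(a/b), which pays for the tail. -/
theorem norm_packet_sub_le (hA : A.Admissible) (hδ : IsLocalRadius A B S δ)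
    (θ : ℤˣ × Fin N) (hb : 0 < b) {a : ℝ} (ha : 0 < a) (haδ : a ≤ δ) (t : ℝ) (r : Wave d)
    (g : Wave d → Amp J) {k : Wave d} (hk : k ∉ A.bandCrossing) {x : Amp J}
    (hx : bandProj A S δ θ k x = x) :
    ‖packet A S δ a t θ r g k - A.propagator t k x‖ ≤
      ‖g k - Complex.exp (Complex.I * (inner ℝ r k : ℝ)) • x‖ +
        Real.exp (-(a / b)) * (weight δ b (ctr S θ) k * ‖x‖) := by
  have hδ0 := hδ.pos
  set v := gradient (A.freq (S θ.2).1 1) (S θ.2).2 with hv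
  obtain ⟨h1, h2⟩ := bandProj_fixed hA hk hx
  have h3 : A.propagator t k x = Complex.exp (Complex.I *
      ((-(t * A.freq (S θ.2).1 θ.1 k) : ℝ) : ℂ)) • x := by
    conv_lhs => rw [← h1, LinearPart.projL_apply, hA.propagator_proj hk]
    rw [← LinearPart.projL_apply, h1]
  set ψ := bump (ctr S θ) a k with hψ
  set y := Complex.exp (Complex.I * (inner ℝ r k : ℝ)) • x with hy
  have hyn : ‖y‖ = ‖x‖ := by rw [hy, norm_smul, norm_exp_I_mul_ofReal, one_mul]
  have hFk : bandProj A S δ θ k y = y := by rw [hy, map_smul, hx]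
  have hxy : x = Complex.exp (-(Complex.I * (inner ℝ r k : ℝ))) • y := by
    rw [hy, smul_smul, exp_neg_mul_exp, one_smul]
  have hphase : Complex.exp (-(Complex.I * (inner ℝ (r + t • v) k : ℝ))) *
      Complex.exp (Complex.I * ((t * (inner ℝ v k - A.freq (S θ.2).1 θ.1 k) : ℝ) : ℂ)) =
      Complex.exp (Complex.I * ((-(t * A.freq (S θ.2).1 θ.1 k) : ℝ) : ℂ)) *
      Complex.exp (-(Complex.I * (inner ℝ r k : ℝ))) := by
    rw [← Complex.exp_add, ← Complex.exp_add, inner_add_left, real_inner_smul_left]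
    congr 1
    push_cast
    ring
  have h4 : packet A S δ a t θ r g k - A.propagator t k x =
      (Complex.exp (Complex.I * ((-(t * A.freq (S θ.2).1 θ.1 k) : ℝ) : ℂ)) *
      Complex.exp (-(Complex.I * (inner ℝ r k : ℝ)))) •
      ((ψ : ℂ) • bandProj A S δ θ k (g k - y) + ((ψ - 1 : ℝ) : ℂ) • y) := by
    have e1 : packet A S δ a t θ r g k = (ψ : ℂ) •
        (Complex.exp (-(Complex.I * (inner ℝ (r + t • v) k : ℝ))) *
        Complex.exp (Complex.I * ((t * (inner ℝ v k - A.freq (S θ.2).1 θ.1 k) : ℝ) : ℂ))) •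
        bandProj A S δ θ k (g k) := by
      rw [packet, packetMul_apply, smul_smul, smul_smul]
      congr 1
      ring
    have e2 : A.propagator t k x =
        (Complex.exp (Complex.I * ((-(t * A.freq (S θ.2).1 θ.1 k) : ℝ) : ℂ)) *
        Complex.exp (-(Complex.I * (inner ℝ r k : ℝ)))) • y := by
      rw [h3, mul_smul, ← hxy]
    rw [e1, e2, hphase, map_sub, hFk]
    generalize bandProj A S δ θ k (g k) = z
    push_cast
    module
  rw [h4, norm_smul, norm_mul, norm_exp_I_mul_ofReal, norm_exp_neg_I, mul_one, one_mul]
  refine (norm_add_le _ _).trans (add_le_add ?_ ?_)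
  · rw [norm_smul, Complex.norm_real, Real.norm_of_nonneg bump_nonneg]
    exact (mul_le_of_le_one_left (norm_nonneg _) bump_le_one).trans
      ((ContinuousLinearMap.le_of_opNorm_le _ (norm_bandProj_le hA hδ θ k) _).trans
        (one_mul _).le)
  · rw [norm_smul, hyn, ← mul_assoc, Complex.norm_real, Real.norm_eq_abs]
    refine mul_le_mul_of_nonneg_right ?_ (norm_nonneg _)
    by_cases hka : ‖k - ctr S θ‖ ≤ a
    · rw [hψ, bump_eq_one ha hka, sub_self, abs_zero]
      exact mul_nonneg (Real.exp_pos _).le weight_pos.le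
    push Not at hka
    have h5 : |ψ - 1| ≤ 1 := by
      rw [abs_le]
      constructor <;> linarith [bump_nonneg (c := ctr S θ) (δ := a) (k := k),
        bump_le_one (c := ctr S θ) (δ := a) (k := k)]
    refine h5.trans ?_
    rw [weight, ← Real.exp_add]
    refine Real.one_le_exp ?_
    have h6 : a / b ≤ min ‖k - ctr S θ‖ (6 * δ) / b := by
      gcongr
      exact le_min hka.le (by linarith)
    linarith

/-- Regularization of a component of the averaged solution to a wavepacket at the shifted
position. -/
theorem exists_packet (hA : A.Admissible) (hδ : IsLocalRadius A B S δ) (hΨ : IsCutoff Ψ)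
    (θ : ℤˣ × Fin N) {K K' : ℝ} (hK0 : 0 ≤ K) (hK0' : 0 ≤ K')
    (hK : ∀ k k' : Wave d, |unitBump d k - unitBump d k'| ≤ K * ‖k - k'‖)
    (hK' : ∀ x y, ‖bandProj A S δ θ x - bandProj A S δ θ y‖ ≤ K' * ‖x - y‖) (hb : 0 < b)
    {a : ℝ} (ha : 0 < a) (haδ : a ≤ δ) (t : ℝ) (r : Wave d) {w : AmpL1 d J} {ρ V : ℝ}
    (hw : ‖weightOp δ b (ctr S θ) w‖ ≤ ρ) (hr : mulOp (bandProj A S δ θ) w = w) (hV0 : 0 ≤ V)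
    (hV : ∀ y : Wave d, ‖y‖ ≤ b → ‖twistOp r y w - w‖ ≤ V * ‖y‖) {η : ℝ} (hη : 0 < η)
    (hηb : η ≤ b) :
    ∃ f : Wave d → Amp J, Integrable f ∧
      (∀ᵐ k, f k = cutoff Ψ (8 * a / 2) (ctr S θ) k • A.proj (S θ.2).1 θ.1 k (f k)) ∧
      (∃ G : Wave d → Wave d →L[ℝ] Amp J, HasWeakGradient (fun k => Complex.exp (Complex.I *
          (inner ℝ (r + t • gradient (A.freq (S θ.2).1 1) (S θ.2).2) k : ℝ)) • f k) G ∧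
        ∫ k, ‖G k‖ ≤ d * V + (K / a + |t| * (δ⁻¹ * (3 * a)) + K') * ρ) ∧
      ∫ k, ‖f k - A.propagator t k (w k)‖ ≤ V * η + Real.exp (-(a / b)) * ρ := by
  have hδ0 := hδ.pos
  set v := gradient (A.freq (S θ.2).1 1) (S θ.2).2 with hv
  set F : Wave d → Amp J := fun k => Complex.exp (Complex.I * (inner ℝ r k : ℝ)) • w k with hF
  have hFn : ∀ k, ‖F k‖ = ‖w k‖ := fun k => by
    rw [hF]; simp only; rw [norm_smul, norm_exp_I_mul_ofReal, one_mul]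
  have hexp : ∀ p : Wave d, Continuous fun k : Wave d =>
      Complex.exp (Complex.I * (inner ℝ p k : ℝ)) := fun p => by fun_prop
  have hFi : Integrable F := by
    refine (L1.integrable_coeFn w).mono
      ((hexp r).aestronglyMeasurable.smul (L1.integrable_coeFn w).1) (ae_of_all _ fun k => ?_)
    rw [hFn]
  -- The function exp(ir·k)w is mollified before the smooth factors are applied. Without the
  -- position phase the gradient of w would depend on r.
  obtain ⟨g, hg1, hgi, hgF, hgn, hg'i, hg'⟩ := exists_mollification hFi hV0 hb
    (fun y hy => (norm_twistOp_sub_eq r y w).symm.trans_le (hV y hy)) hη hηb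
  set M := packetMul A S δ a t θ with hM
  have hM1 : ContDiff ℝ 1 M := (contDiff_packetMul hA hδ ha haδ t θ).of_le (by simp)
  have hMn : ∀ k, ‖M k‖ ≤ 1 := norm_packetMul_le hA hδ a t θ
  set L := K / a + |t| * (δ⁻¹ * (3 * a)) + K' with hL
  have hL0 : 0 ≤ L := by positivity
  have hML : ∀ k, ‖fderiv ℝ M k‖ ≤ L :=
    norm_fderiv_packetMul_le hA hδ ha haδ t θ hK0 hK0' hK hK'
  have hMg1 : ContDiff ℝ 1 fun k => M k (g k) := by
    have h1 : ContDiff ℝ 1 fun k => applyL J (M k) := (applyL J).contDiff.comp hM1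
    exact h1.clm_apply hg1
  have hMgi : Integrable fun k => M k (g k) :=
    hgi.mono hMg1.continuous.aestronglyMeasurable (ae_of_all _ fun k =>
      (ContinuousLinearMap.le_of_opNorm_le _ (hMn k) _).trans (one_mul _).le)
  have hder := norm_fderiv_apply_le hM1 hg1 hMn hML
  have hdi : Integrable fun k => ‖fderiv ℝ g k‖ + L * ‖g k‖ :=
    hg'i.norm.add (hgi.norm.const_mul L)
  have hMg'i : Integrable (fderiv ℝ fun k => M k (g k)) :=
    hdi.mono' (hMg1.continuous_fderiv one_ne_zero).aestronglyMeasurable (ae_of_all _ hder)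
  set f : Wave d → Amp J := packet A S δ a t θ r g with hf
  have hfM : ∀ k, f k = Complex.exp (-(Complex.I * (inner ℝ (r + t • v) k : ℝ))) • M k (g k) :=
    fun k => rfl
  have hfc : Continuous f :=
    (show Continuous fun k : Wave d => Complex.exp (-(Complex.I * (inner ℝ (r + t • v) k : ℝ))) by
      fun_prop).smul hMg1.continuous
  have hfi : Integrable f := hMgi.mono hfc.aestronglyMeasurable (ae_of_all _ fun k => by
    rw [hfM, norm_smul, norm_exp_neg_I, one_mul])
  have hwb := mulOp_coe (isMultiplier_bandProj (δ := δ) (S := S) hA θ) w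
  rw [hr] at hwb
  refine ⟨f, hfi, hA.ae_notMem.mono fun k hk => packet_polarized hA hΨ ha t θ r g hk,
    ⟨fderiv ℝ fun k => M k (g k), ?_, ?_⟩, ?_⟩
  -- Multiplication by the exponential of the new position cancels the prefactor of `packet` and
  -- leaves a C¹ function.
  · have : (fun k => Complex.exp (Complex.I * (inner ℝ (r + t • v) k : ℝ)) • f k) =
        fun k => M k (g k) := by
      funext k
      rw [hfM, smul_smul, mul_comm (Complex.exp (Complex.I * _)), exp_neg_mul_exp, one_smul]
    rw [this]
    exact hasWeakGradient_of_contDiff hMg1 hMgi hMg'i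
  · refine (integral_mono hMg'i.norm hdi hder).trans ?_
    rw [integral_add hg'i.norm (hgi.norm.const_mul L), integral_const_mul]
    refine add_le_add hg' (mul_le_mul_of_nonneg_left (hgn.trans ?_) hL0)
    simp only [hFn]
    rw [← L1.norm_eq_integral_norm]
    exact (norm_le_weightOp hδ0 hb (ctr S θ) w).trans hw
  · have hiw := integrable_weight (δ := δ) hb (ctr S θ) w
    have hb1 : ∀ᵐ k, ‖f k - A.propagator t k (w k)‖ ≤
        ‖g k - F k‖ + Real.exp (-(a / b)) * (weight δ b (ctr S θ) k * ‖w k‖) := by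
      filter_upwards [hA.ae_notMem, hwb] with k hk hwk
      exact norm_packet_sub_le hA hδ θ hb ha haδ t r g hk hwk.symm
    have hgFi : Integrable fun k => ‖g k - F k‖ := (hgi.sub hFi).norm
    have hfp : Integrable fun k => ‖g k - F k‖ +
        Real.exp (-(a / b)) * (weight δ b (ctr S θ) k * ‖w k‖) :=
      hgFi.add (hiw.const_mul _)
    refine (integral_mono_of_nonneg (ae_of_all _ fun k => norm_nonneg _) hfp hb1).trans ?_
    rw [integral_add hgFi (hiw.const_mul _), integral_const_mul, ← norm_weightOp hb]
    gcongr

end Wavepacket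

namespace Wavepacket

open Filter Topology Nonlinearity

variable {d J m N : ℕ} {A : LinearPart d J} {B : Nonlinearity d J} {S : Fin N → Fin J × Wave d}
  {δ C b : ℝ} {Ψ : Wave d → ℝ}

/-! ### Approximation of the solution -/

/-- The bound for the residual of the averaged solution in the modal equation. -/
def residualBound (M : Finset ℕ) (J N : ℕ) (δ C b ϱ T ρ : ℝ) : ℝ :=
  ∑ m ∈ M, (2 * N : ℝ) ^ m * ((2 * N) * (C * Real.exp (-(δ / b)) * ρ ^ m * T) +
    (2 * J) * (ϱ * (C / δ * (2 * ρ ^ m +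
      m * ρ ^ (m - 1) * (∑ m ∈ M, (2 * N : ℝ) ^ m * (C * ρ ^ m)) * T))))

theorem residualBound_nonneg (M : Finset ℕ) (J N : ℕ) {ϱ T ρ : ℝ} (hδ : 0 < δ) (hC : 0 ≤ C)
    (hϱ : 0 ≤ ϱ) (hT : 0 ≤ T) (hρ : 0 ≤ ρ) : 0 ≤ residualBound M J N δ C b ϱ T ρ := by
  have : 0 ≤ ∑ m ∈ M, (2 * N : ℝ) ^ m * (C * ρ ^ m) := Finset.sum_nonneg fun m _ => by positivity
  exact Finset.sum_nonneg fun m _ => by positivity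

/-- A sum of averaged components approximates the solution of the modal equation. -/
theorem IsAveragedSolution.norm_sub_le (hA : A.Admissible) (hB : B.Admissible A)
    (hS : IsNKSpectrum A B.M S) (hU : UniversallyResonanceInvariant A B.M S)
    (hδ : IsLocalRadius A B S δ) (hC0 : 0 ≤ C)
    (hC : ∀ m ∈ B.M, ∀ (k : Wave d) (q : Fin m → Wave d), k ∉ A.bandCrossing →
      (∀ j, q j ∉ A.bandCrossing) → ‖B.χ m k q‖ ≤ C)
    (hχ : ∀ m ∈ B.M, IsSymbol (B.chiSym m) C) (hb : 0 < b) {R ϱ T V E : ℝ} (hR : 0 ≤ R)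
    (hϱ : 0 < ϱ) {r : Fin N → Wave d} {h : ℤˣ × Fin N → AmpL1 d J}
    {w : ℝ → ℤˣ × Fin N → AmpL1 d J} (hw : IsAveragedSolution A B S δ C b ϱ T (8 * R) V r h w)
    {x₀ : AmpL1 d J} (hE : ‖∑ θ, h θ - x₀‖ ≤ E) {u : ℝ → AmpL1 d J}
    (hu : ContinuousOn u (Icc 0 T)) (hub : ∀ s ∈ Icc 0 T, ‖u s‖ ≤ 2 * R)
    (hueq : ∀ τ ∈ Icc 0 T, u τ = x₀ + ∫ s in (0 : ℝ)..τ, forceOp A B (s / ϱ) (u s))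
    {τ : ℝ} (hτ : τ ∈ Icc 0 T) :
    ‖u τ - ∑ θ, w τ θ‖ ≤ 2 * (E + residualBound B.M J N δ C b ϱ T (8 * R)) *
      Real.exp (2 * (lipConst B.M C ((16 * N + 2) * R) + 1) * T) := by
  have hδ0 := hδ.pos
  have hT : 0 ≤ T := hτ.1.trans hτ.2
  have hE0 : 0 ≤ E := (norm_nonneg _).trans hE
  have hwθ : ∀ θ, ContinuousOn (fun s => w s θ) (Icc 0 T) := fun θ =>
    (continuous_apply θ).comp_continuousOn hw.cont
  have hvc : ContinuousOn (fun s => ∑ θ, w s θ) (Icc 0 T) :=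
    continuousOn_finsetSum _ fun θ _ => hwθ θ
  -- The common radius (16N + 2)R allows 2R for u and 8R for each of the 2N components.
  refine norm_sub_le_of_residual hA hB hC0 hχ
    (add_nonneg hE0 (residualBound_nonneg B.M J N hδ0 hC0 hϱ.le hT (by positivity))) hu hvc
    (fun s hs => (hub s hs).trans ?_) (fun s hs => ?_) hueq (fun τ hτ => ?_) τ hτ
  · have : (0 : ℝ) ≤ N * R := by positivity
    nlinarith
  · refine (norm_sum_le _ _).trans ((Finset.sum_le_sum fun θ _ =>
      (norm_le_weightOp hδ0 hb (ctr S θ) (w s θ)).trans (hw.weight_le s hs θ)).trans ?_)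
    rw [Finset.sum_const, nsmul_eq_mul, Finset.card_univ]
    simp only [Fintype.card_prod, Fintype.card_units_int, Fintype.card_fin]
    push_cast
    linarith
  · have hsub : uIcc 0 τ ⊆ Icc 0 T := by
      rw [uIcc_of_le hτ.1]; exact Icc_subset_Icc_right hτ.2
    have hac := (continuousOn_avgForce hA hB hδ hC0 hC (ϱ := ϱ) hw.cont).mono hsub
    have haθ : ∀ θ, ContinuousOn (fun s => avgForce A B S δ (s / ϱ) (w s) θ) (uIcc 0 τ) :=
      fun θ => (continuous_apply θ).comp_continuousOn hac
    have hai : ∀ θ, IntervalIntegrable (fun s => avgForce A B S δ (s / ϱ) (w s) θ) volume 0 τ :=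
      fun θ => (haθ θ).intervalIntegrable
    have hsi : IntervalIntegrable (fun s => ∑ θ, avgForce A B S δ (s / ϱ) (w s) θ) volume 0 τ :=
      (continuousOn_finsetSum _ fun θ _ => haθ θ).intervalIntegrable
    have hfi : IntervalIntegrable (fun s => forceOp A B (s / ϱ) (∑ θ, w s θ)) volume 0 τ :=
      ((continuousOn_forceOp hA hvc).mono hsub).intervalIntegrable
    have hsum : ∑ θ, w τ θ = (∑ θ, h θ) +
        ∫ s in (0 : ℝ)..τ, ∑ θ, avgForce A B S δ (s / ϱ) (w s) θ := by
      rw [intervalIntegral.integral_finsetSum fun θ _ => hai θ, ← Finset.sum_add_distrib]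
      refine Finset.sum_congr rfl fun θ _ => ?_
      have h1 := congrFun (hw.eq τ hτ) θ
      rw [h1, Pi.add_apply]
      congr 1
      exact ((ContinuousLinearMap.proj (R := ℝ) (φ := fun _ : ℤˣ × Fin N => AmpL1 d J)
        θ).intervalIntegral_comp_comm hac.intervalIntegrable).symm
    have hres := hw.norm_residual_le hA hB hS hU hδ hC0 hC hχ hb (by positivity) hϱ hτ
    rw [intervalIntegral.integral_sub hsi hfi] at hres
    have : ∑ θ, w τ θ - (x₀ + ∫ s in (0 : ℝ)..τ, forceOp A B (s / ϱ) (∑ θ, w s θ)) =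
        (∑ θ, h θ - x₀) + ((∫ s in (0 : ℝ)..τ, ∑ θ, avgForce A B S δ (s / ϱ) (w s) θ) -
          ∫ s in (0 : ℝ)..τ, forceOp A B (s / ϱ) (∑ θ, w s θ)) := by
      rw [hsum]; abel
    rw [this]
    exact (norm_add_le _ _).trans (add_le_add hE hres)

/-- For fixed `β`, the solution is close to a sum of wavepackets at the moving positions. -/
theorem exists_packets (hA : A.Admissible) (hB : B.Admissible A)
    (hS : IsNKSpectrum A B.M S) (hU : UniversallyResonanceInvariant A B.M S)
    (hδ : IsLocalRadius A B S δ) (hC0 : 0 ≤ C)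
    (hC : ∀ m ∈ B.M, ∀ (k : Wave d) (q : Fin m → Wave d), k ∉ A.bandCrossing →
      (∀ j, q j ∉ A.bandCrossing) → ‖B.χ m k q‖ ≤ C)
    (hχ : ∀ m ∈ B.M, IsSymbol (B.chiSym m) C) {K : ℝ} (hK0 : 0 ≤ K)
    (hK : ∀ m ∈ B.M, ∀ (lam : Fin m → ℤˣ × Fin N) (θ : ℤˣ × Fin N) (j : Fin m),
      (lam j).2 = θ.2 → ∀ b t x y, 0 < b → ‖y‖ ≤ δ → ‖y‖ ≤ b →
      ‖avgSym A B S δ lam θ t (x + Pi.single j y) - avgSym A B S δ lam θ t x‖ ≤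
        K * ‖y‖ * (1 + |t| * b) * ∏ j, weight δ b (ctr S (lam j)) (x j))
    {Ku Kp : ℝ} (hKu0 : 0 ≤ Ku) (hKp0 : 0 ≤ Kp)
    (hKu : ∀ k k' : Wave d, |unitBump d k - unitBump d k'| ≤ Ku * ‖k - k'‖)
    (hKp : ∀ θ x y, ‖bandProj A S δ θ x - bandProj A S δ θ y‖ ≤ Kp * ‖x - y‖)
    (hΨ : IsCutoff Ψ) (hb : 0 < b) (hbδ : b ≤ δ) {a : ℝ} (ha : 0 < a) (haδ : a ≤ δ)
    {R ϱ T V₀ V : ℝ} (hR : 0 ≤ R) (hϱ : 0 < ϱ) (hT : 0 ≤ T)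
    (hT₁ : T * avgLip B.M N C (8 * R) ≤ 1 / 2) (hT₂ : T * lipConst B.M C (2 * R) ≤ 1 / 2)
    (hV₀ : 0 ≤ V₀)
    (hV : V = 2 * (V₀ + T * ((1 + T / ϱ * b) * ∑ m ∈ B.M, (2 * N : ℝ) ^ m * (K * (8 * R) ^ m))))
    {h : Wave d → Amp J} (hh : Integrable h) (hhR : ∫ k, ‖h k‖ ≤ R) (r : Fin N → Wave d)
    {hc : ℤˣ × Fin N → Wave d → Amp J} (hci : ∀ θ, Integrable (hc θ))
    (hcp : ∀ θ, ∀ᵐ k, hc θ k = cutoff Ψ (b / 2) (ctr S θ) k • A.proj (S θ.2).1 θ.1 k (hc θ k))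
    {G : ℤˣ × Fin N → Wave d → Wave d →L[ℝ] Amp J}
    (hG : ∀ θ, HasWeakGradient
      (fun k => Complex.exp (Complex.I * (inner ℝ (r θ.2) k : ℝ)) • hc θ k) (G θ))
    (hGV : ∀ θ, ∫ k, ‖G θ k‖ ≤ V₀) {E : ℝ} (hER : E ≤ R)
    (hE : ∫ k, ‖h k - ∑ θ, hc θ k‖ ≤ E) {u : ℝ → AmpL1 d J}
    (hu : IsSolution A B ϱ T h u) {τ : ℝ} (hτ : τ ∈ Icc 0 T) {η : ℝ} (hη : 0 < η) (hηb : η ≤ b) :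
    ∃ f : ℤˣ × Fin N → Wave d → Amp J, (∀ θ, Integrable (f θ) ∧
      (∀ᵐ k, f θ k = cutoff Ψ (8 * a / 2) (ctr S θ) k • A.proj (S θ.2).1 θ.1 k (f θ k)) ∧
      ∃ G : Wave d → Wave d →L[ℝ] Amp J, HasWeakGradient (fun k => Complex.exp (Complex.I *
          (inner ℝ (r θ.2 + (τ / ϱ) • gradient (A.freq (S θ.2).1 1) (S θ.2).2) k : ℝ)) • f θ k) G ∧
        ∫ k, ‖G k‖ ≤ d * V + (Ku / a + T / ϱ * (δ⁻¹ * (3 * a)) + Kp) * (8 * R)) ∧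
      Integrable (fun k => A.propagator (τ / ϱ) k (u τ k)) ∧
      ∫ k, ‖A.propagator (τ / ϱ) k (u τ k)‖ ≤ 2 * R ∧
      ∫ k, ‖A.propagator (τ / ϱ) k (u τ k) - ∑ θ, f θ k‖ ≤
        2 * (E + residualBound B.M J N δ C b ϱ T (8 * R)) *
          Real.exp (2 * (lipConst B.M C ((16 * N + 2) * R) + 1) * T) +
        2 * N * (V * η + Real.exp (-(a / b)) * (8 * R)) := by
  have hδ0 := hδ.pos
  have hpol : ∀ θ, ∀ᵐ k, hc θ k ≠ 0 →
      ‖k - ctr S θ‖ ≤ b / 2 ∧ A.projL (S θ.2).1 θ.1 k (hc θ k) = hc θ k := fun θ => by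
    filter_upwards [hA.ae_notMem, hcp θ] with k hk h1 h0
    exact polarized_of_cutoff hA hΨ hb hk h1 h0
  have hsi : Integrable fun k => ∑ θ, hc θ k := integrable_finsetSum _ fun θ _ => hci θ
  have hs2 : ∫ k, ‖∑ θ, hc θ k‖ ≤ 2 * R := by
    have : ∫ k, ‖∑ θ, hc θ k‖ ≤ ∫ k, (‖h k‖ + ‖h k - ∑ θ, hc θ k‖) := by
      refine integral_mono hsi.norm (hh.norm.add (hh.sub hsi).norm) fun k => ?_
      exact norm_le_insert _ _
    have hhs : Integrable fun k => ‖h k - ∑ θ, hc θ k‖ := (hh.sub hsi).norm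
    rw [integral_add hh.norm hhs] at this
    linarith
  have hc2 : ∀ θ, ∫ k, ‖hc θ k‖ ≤ 2 * R := fun θ => by
    refine le_trans (integral_mono_ae (hci θ).norm hsi.norm ?_) hs2
    filter_upwards [hA.ae_notMem, ae_all_iff.2 hpol] with k hk h1
    exact norm_component_le hA hS hδ hbδ hk h1 θ
  set H : ℤˣ × Fin N → AmpL1 d J := fun θ => (hci θ).toL1 (hc θ) with hH
  -- The radius is 8R: each component has norm at most 2R because E ≤ R, the weight at most doubles
  -- it, and 4R is half of 8R.
  obtain ⟨w, hw⟩ := exists_averagedSolution hA hB hS hU hδ hC0 hC hK0 hK hb hbδ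
    (by positivity : 0 ≤ 8 * R) hϱ hT hT₁ hV₀ r (h := H)
    (fun θ => (norm_weightOp_toL1_le hb (hci θ) ((hpol θ).mono fun k hk h0 => (hk h0).1)).trans
      (by linarith [hc2 θ]))
    (fun θ => bandProj_toL1 hA hδ hb hbδ (hci θ) (hpol θ))
    (fun θ y _ => (norm_twistOp_toL1_sub_le (hci θ) (hG θ) y).trans
      (mul_le_mul_of_nonneg_right (hGV θ) (norm_nonneg _)))
  rw [← hV] at hw
  have hV0 : 0 ≤ V := by
    have : 0 ≤ ∑ m ∈ B.M, (2 * N : ℝ) ^ m * (K * (8 * R) ^ m) :=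
      Finset.sum_nonneg fun m _ => by positivity
    rw [hV]; positivity
  -- The given solution inherits the a priori bound 2R from the constructed one by uniqueness.
  obtain ⟨u', hu', hub'⟩ := exists_isSolution hA hB (ϱ := ϱ) hC0 hχ hT hT₂ hh hhR
  have huu := IsSolution.eqOn hA hB hC0 hχ hT hu hu'
  have hub : ∀ s ∈ Icc 0 T, ‖u s‖ ≤ 2 * R := fun s hs => by rw [huu hs]; exact hub' s hs
  obtain ⟨huc, hu0, hueq⟩ := (isSolution_iff hA hB hT).1 hu
  have hE' : ‖∑ θ, H θ - u 0‖ ≤ E := by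
    rw [norm_sub_rev, L1.norm_eq_integral_norm]
    refine le_trans (le_of_eq (integral_congr_ae ?_)) hE
    have hHc : ∀ᵐ k, ∀ θ, H θ k = hc θ k := ae_all_iff.2 fun θ => (hci θ).coeFn_toL1
    filter_upwards [Lp.coeFn_sub (u 0) (∑ θ, H θ), hu0, Lp.coeFn_finsetSum Finset.univ H,
      hHc] with k h1 h2 h3 h4
    rw [h1, Pi.sub_apply, h2, h3, Finset.sum_apply]
    simp only [h4]
  have happ := hw.norm_sub_le hA hB hS hU hδ hC0 hC hχ hb hR hϱ hE' huc hub hueq hτ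
  have hpk := fun θ => exists_packet hA hδ hΨ θ hKu0 hKp0 hKu (hKp θ) hb ha haδ (τ / ϱ) (r θ.2)
    (hw.weight_le τ hτ θ) (hw.range τ hτ θ) hV0 (hw.twist_le τ hτ θ) hη hηb
  choose f hfi hfp hfG hfw using hpk
  have hUc := mulOp_coe (hA.isMultiplier_propagator (τ / ϱ)) (u τ)
  have hUi : Integrable (fun k => A.propagator (τ / ϱ) k (u τ k)) :=
    (L1.integrable_coeFn (propOp A (τ / ϱ) (u τ))).congr hUc
  refine ⟨f, fun θ => ⟨hfi θ, hfp θ, ?_⟩, hUi, ?_, ?_⟩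
  · obtain ⟨G, hG1, hG2⟩ := hfG θ
    refine ⟨G, hG1, hG2.trans ?_⟩
    have : |τ / ϱ| ≤ T / ϱ := by
      rw [abs_of_nonneg (div_nonneg hτ.1 hϱ.le)]
      exact div_le_div_of_nonneg_right hτ.2 hϱ.le
    gcongr
  · have h1 : ∫ k, ‖A.propagator (τ / ϱ) k (u τ k)‖ = ‖propOp A (τ / ϱ) (u τ)‖ := by
      rw [L1.norm_eq_integral_norm]
      exact integral_congr_ae (hUc.mono fun k hk => (congrArg norm hk).symm)
    rw [h1, norm_propOp hA]
    exact hub τ hτ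
  · have hPi : ∀ θ, Integrable (fun k => A.propagator (τ / ϱ) k (w τ θ k)) := fun θ =>
      (L1.integrable_coeFn (propOp A (τ / ϱ) (w τ θ))).congr
        (mulOp_coe (hA.isMultiplier_propagator (τ / ϱ)) (w τ θ))
    have hdi : Integrable (fun k => ‖(u τ - ∑ θ, w τ θ : AmpL1 d J) k‖) :=
      (L1.integrable_coeFn _).norm
    have hsi' : Integrable fun k => ∑ θ, ‖f θ k - A.propagator (τ / ϱ) k (w τ θ k)‖ :=
      integrable_finsetSum _ fun θ _ => ((hfi θ).sub (hPi θ)).norm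
    have hmono : ∫ k, ‖A.propagator (τ / ϱ) k (u τ k) - ∑ θ, f θ k‖ ≤
        ∫ k, (‖(u τ - ∑ θ, w τ θ : AmpL1 d J) k‖ +
          ∑ θ, ‖f θ k - A.propagator (τ / ϱ) k (w τ θ k)‖) := by
      refine integral_mono_ae (hUi.sub (integrable_finsetSum _ fun θ _ => hfi θ)).norm
        (hdi.add hsi') ?_
      filter_upwards [Lp.coeFn_sub (u τ) (∑ θ, w τ θ), Lp.coeFn_finsetSum Finset.univ (w τ)]
        with k h1 h2
      rw [h1, Pi.sub_apply, h2, Finset.sum_apply]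
      -- The propagator is isometric, so the averaging error and the regularization errors add.
      have : A.propagator (τ / ϱ) k (u τ k) - ∑ θ, f θ k =
          A.propagator (τ / ϱ) k (u τ k - ∑ θ, w τ θ k) -
            ∑ θ, (f θ k - A.propagator (τ / ϱ) k (w τ θ k)) := by
        rw [Finset.sum_sub_distrib, map_sub, map_sum]; abel
      rw [this]
      refine (norm_sub_le _ _).trans (add_le_add ?_ (norm_sum_le _ _))
      rw [hA.norm_propagator_apply]
    refine hmono.trans ?_
    rw [integral_add hdi hsi', ← L1.norm_eq_integral_norm]
    refine add_le_add happ ?_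
    have hfP : ∀ θ, Integrable fun k => ‖f θ k - A.propagator (τ / ϱ) k (w τ θ k)‖ :=
      fun θ => ((hfi θ).sub (hPi θ)).norm
    rw [integral_finsetSum _ fun θ _ => hfP θ]
    refine (Finset.sum_le_sum fun θ _ => hfw θ).trans (le_of_eq ?_)
    rw [Finset.sum_const, nsmul_eq_mul, Finset.card_univ]
    simp only [Fintype.card_prod, Fintype.card_units_int, Fintype.card_fin]
    push_cast
    ring

end Wavepacket

namespace Wavepacket

open Filter Topology Nonlinearity

variable {d J m N : ℕ} {A : LinearPart d J} {B : Nonlinearity d J} {S : Fin N → Fin J × Wave d}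
  {δ C b : ℝ} {Ψ : Wave d → ℝ}

/-! ### Powers of the small parameter -/

theorem exists_rpow_le {p c : ℝ} (hp : 0 < p) (hc : 0 < c) :
    ∃ β₀ > (0 : ℝ), ∀ β ∈ Ioo 0 β₀, β ^ p ≤ c := by
  refine ⟨c ^ p⁻¹, Real.rpow_pos_of_pos hc _, fun β hβ => ?_⟩
  calc β ^ p ≤ (c ^ p⁻¹) ^ p := Real.rpow_le_rpow hβ.1.le hβ.2.le hp.le
    _ = c := Real.rpow_inv_rpow hc.le hp.ne'

theorem exists_exp_neg_le {c p : ℝ} (hc : 0 < c) (hp : 0 < p) (s : ℝ) :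
    ∃ C : ℝ, 0 ≤ C ∧ ∀ β : ℝ, 0 < β → β ≤ 1 → Real.exp (-(c * β ^ (-p))) ≤ C * β ^ s := by
  -- The n-th term of the exponential series yields the power β^(pn), and n ≥ s/p makes it at least
  -- as small as β^s.
  obtain ⟨n, hn⟩ := exists_nat_ge (s / p)
  refine ⟨n.factorial / c ^ n, by positivity, fun β hβ hβ1 => ?_⟩
  have hx : 0 < c * β ^ (-p) := mul_pos hc (Real.rpow_pos_of_pos hβ _)
  have h1 := Real.pow_div_factorial_le_exp _ hx.le n
  have h2 : (c * β ^ (-p)) ^ n = c ^ n * (β ^ (p * n))⁻¹ := by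
    rw [mul_pow, ← Real.rpow_natCast (β ^ (-p)), ← Real.rpow_mul hβ.le, ← Real.rpow_neg hβ.le]
    congr 2; ring
  have h3 : β ^ (p * n) ≤ β ^ s :=
    Real.rpow_le_rpow_of_exponent_ge hβ hβ1 (by rw [div_le_iff₀ hp] at hn; linarith)
  have h4 : 0 < β ^ (p * n) := Real.rpow_pos_of_pos hβ _
  calc Real.exp (-(c * β ^ (-p))) = (Real.exp (c * β ^ (-p)))⁻¹ := Real.exp_neg _
    _ ≤ ((c * β ^ (-p)) ^ n / n.factorial)⁻¹ := inv_anti₀ (by positivity) h1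
    _ = n.factorial / c ^ n * β ^ (p * n) := by
      rw [h2]; field_simp
    _ ≤ _ := by gcongr

theorem exists_residualBound_eq (M : Finset ℕ) (J N : ℕ) (hδ : 0 < δ) (hC : 0 ≤ C) {T ρ : ℝ}
    (hT : 0 ≤ T) (hρ : 0 ≤ ρ) :
    ∃ X Y : ℝ, 0 ≤ X ∧ 0 ≤ Y ∧ ∀ b ϱ,
      residualBound M J N δ C b ϱ T ρ = X * Real.exp (-(δ / b)) + Y * ϱ := by
  have : 0 ≤ ∑ m ∈ M, (2 * N : ℝ) ^ m * (C * ρ ^ m) := Finset.sum_nonneg fun m _ => by positivity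
  refine ⟨∑ m ∈ M, (2 * N : ℝ) ^ m * ((2 * N) * (C * ρ ^ m * T)),
    ∑ m ∈ M, (2 * N : ℝ) ^ m * ((2 * J) * (C / δ * (2 * ρ ^ m +
      m * ρ ^ (m - 1) * (∑ m ∈ M, (2 * N : ℝ) ^ m * (C * ρ ^ m)) * T))),
    Finset.sum_nonneg fun m _ => by positivity, Finset.sum_nonneg fun m _ => by positivity,
    fun b ϱ => ?_⟩
  rw [residualBound, Finset.sum_mul, Finset.sum_mul, ← Finset.sum_add_distrib]
  exact Finset.sum_congr rfl fun m _ => by ring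

/-- The remainder is of order `β ^ min s s₀`. -/
theorem exists_error_le (M : Finset ℕ) (J N : ℕ) (hδ : 0 < δ) (hC : 0 ≤ C) {T ρ D ε ε' s s₀ C₀ : ℝ}
    (hT : 0 ≤ T) (hρ : 0 ≤ ρ) (hD : 0 ≤ D) (hε' : ε < ε') (hε1 : ε' < 1) (Λ : ℝ) :
    ∃ CE : ℝ, 0 ≤ CE ∧ ∀ β ϱ η V : ℝ, 0 < β → β ≤ 1 → ϱ ≤ C₀ * β ^ s₀ → 0 ≤ V →
      η ≤ β ^ min s s₀ / (V + 1) →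
      2 * (D * β ^ s + residualBound M J N δ C (β ^ (1 - ε)) ϱ T ρ) * Real.exp Λ +
        2 * N * (V * η + Real.exp (-(β ^ (1 - ε') / 8 / β ^ (1 - ε))) * ρ) ≤
          CE * β ^ min s s₀ := by
  obtain ⟨X, Y, hX, hY, hres⟩ := exists_residualBound_eq (C := C) M J N hδ hC hT hρ
  obtain ⟨c₁, hc₁, h₁⟩ := exists_exp_neg_le hδ (by linarith : 0 < 1 - ε) (min s s₀)
  obtain ⟨c₂, hc₂, h₂⟩ := exists_exp_neg_le (by norm_num : (0 : ℝ) < 1 / 8)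
    (by linarith : 0 < ε' - ε) (min s s₀)
  refine ⟨2 * (D + (X * c₁ + Y * |C₀|)) * Real.exp Λ + 2 * N * (1 + c₂ * ρ), by positivity,
    fun β ϱ η V hβ hβ1 hϱ hV hη => ?_⟩
  set Q := β ^ min s s₀ with hQ
  have hQ0 : 0 < Q := Real.rpow_pos_of_pos hβ _
  have e1 : β ^ s ≤ Q := Real.rpow_le_rpow_of_exponent_ge hβ hβ1 (min_le_left _ _)
  have e2 : ϱ ≤ |C₀| * Q := hϱ.trans (mul_le_mul (le_abs_self _)
    (Real.rpow_le_rpow_of_exponent_ge hβ hβ1 (min_le_right _ _))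
    (Real.rpow_pos_of_pos hβ _).le (abs_nonneg _))
  have e3 : Real.exp (-(δ / β ^ (1 - ε))) ≤ c₁ * Q := by
    have := h₁ β hβ hβ1
    rwa [Real.rpow_neg hβ.le, ← div_eq_mul_inv] at this
  -- Here ε < ε' is indispensable: a/b = β^{-(ε'-ε)}/8 tends to infinity.
  have e4 : Real.exp (-(β ^ (1 - ε') / 8 / β ^ (1 - ε))) ≤ c₂ * Q := by
    have := h₂ β hβ hβ1
    have h5 : β ^ (-(ε' - ε)) = β ^ (1 - ε') / β ^ (1 - ε) := by
      rw [← Real.rpow_sub hβ]; congr 1; ring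
    rw [h5] at this
    convert this using 3
    ring
  have e5 : V * η ≤ Q := by
    calc V * η ≤ V * (Q / (V + 1)) := mul_le_mul_of_nonneg_left hη hV
      _ = Q * (V / (V + 1)) := by ring
      _ ≤ Q * 1 := by
        refine mul_le_mul_of_nonneg_left ?_ hQ0.le
        rw [div_le_one (by positivity)]; linarith
      _ = Q := mul_one Q
  rw [hres]
  calc _ ≤ 2 * (D * Q + (X * (c₁ * Q) + Y * (|C₀| * Q))) * Real.exp Λ +
        2 * N * (Q + c₂ * Q * ρ) := by gcongr
    _ = _ := by ring

/-- The gradients are of order `β ^ (-1 - ε')`. -/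
theorem exists_gradient_le {T ρ D ε ε' CC KK Ku Kp : ℝ} (d : ℕ) (hδ : 0 < δ) (hT : 0 ≤ T)
    (hρ : 0 ≤ ρ) (hD : 0 ≤ D) (hCC : 0 ≤ CC) (hKK : 0 ≤ KK) (hKu : 0 ≤ Ku) (hKp : 0 ≤ Kp)
    (hε : 0 < ε) (hε' : ε < ε') :
    ∃ CG : ℝ, ∀ β ϱ : ℝ, 0 < β → β ≤ 1 → 0 < ϱ → β ^ 2 / ϱ ≤ CC →
      d * (2 * (D * β ^ (-1 - ε) + T * ((1 + T / ϱ * β ^ (1 - ε)) * KK))) +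
        (Ku / (β ^ (1 - ε') / 8) + T / ϱ * (δ⁻¹ * (3 * (β ^ (1 - ε') / 8))) + Kp) * ρ ≤
      CG * β ^ (-1 - ε') := by
  refine ⟨d * (2 * (D + T * ((1 + T * CC) * KK))) +
    (8 * Ku + T * CC * (δ⁻¹ * 3 / 8) + Kp) * ρ, fun β ϱ hβ hβ1 hϱ hC => ?_⟩
  set x := β ^ (-1 - ε') with hx
  have hmono : ∀ {p : ℝ}, -1 - ε' ≤ p → β ^ p ≤ x := fun hp =>
    Real.rpow_le_rpow_of_exponent_ge hβ hβ1 hp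
  have hx0 : 0 < x := Real.rpow_pos_of_pos hβ _
  have hx1 : 1 ≤ x := by rw [← Real.rpow_zero β]; exact hmono (by linarith)
  have hinv : 1 / ϱ ≤ CC * β ^ (-2 : ℝ) := by
    have h2 : β ^ (-2 : ℝ) = (β ^ 2)⁻¹ := by
      rw [Real.rpow_neg hβ.le]; norm_cast
    rw [h2, ← div_eq_mul_inv, le_div_iff₀ (by positivity)]
    calc 1 / ϱ * β ^ 2 = β ^ 2 / ϱ := by ring
      _ ≤ CC := hC
  -- Every occurrence of 1/ϱ comes with a power β^(1-p), p ≤ ε', and β²/ϱ ≤ CC turns the product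
  -- into O(β^{-1-p}).
  have hpow : ∀ {p : ℝ}, p ≤ ε' → 1 / ϱ * β ^ (1 - p) ≤ CC * x := fun {p} hp => by
    calc 1 / ϱ * β ^ (1 - p) ≤ CC * β ^ (-2 : ℝ) * β ^ (1 - p) :=
          mul_le_mul_of_nonneg_right hinv (Real.rpow_pos_of_pos hβ _).le
      _ = CC * β ^ (-1 - p) := by
          rw [mul_assoc, ← Real.rpow_add hβ]; congr 2; ring
      _ ≤ CC * x := mul_le_mul_of_nonneg_left (hmono (by linarith)) hCC
  have e1 : β ^ (-1 - ε) ≤ x := hmono (by linarith)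
  have e2 : T / ϱ * β ^ (1 - ε) ≤ T * (CC * x) := by
    calc T / ϱ * β ^ (1 - ε) = T * (1 / ϱ * β ^ (1 - ε)) := by ring
      _ ≤ _ := mul_le_mul_of_nonneg_left (hpow hε'.le) hT
  have e3 : T / ϱ * (δ⁻¹ * (3 * (β ^ (1 - ε') / 8))) ≤ T * (CC * x) * (δ⁻¹ * 3 / 8) := by
    calc T / ϱ * (δ⁻¹ * (3 * (β ^ (1 - ε') / 8))) =
          T * (1 / ϱ * β ^ (1 - ε')) * (δ⁻¹ * 3 / 8) := by ring
      _ ≤ _ := mul_le_mul_of_nonneg_right (mul_le_mul_of_nonneg_left (hpow le_rfl) hT)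
          (by positivity)
  have e4 : Ku / (β ^ (1 - ε') / 8) ≤ 8 * Ku * x := by
    have : Ku / (β ^ (1 - ε') / 8) = 8 * Ku * β ^ (-(1 - ε')) := by
      rw [Real.rpow_neg hβ.le]
      field_simp
    rw [this]
    exact mul_le_mul_of_nonneg_left (hmono (by linarith)) (by positivity)
  calc _ ≤ d * (2 * (D * x + T * ((x + T * (CC * x)) * KK))) +
        (8 * Ku * x + T * (CC * x) * (δ⁻¹ * 3 / 8) + Kp * x) * ρ := by
        gcongr
        exact le_mul_of_one_le_right hKp hx1
    _ = _ := by ring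

/-! ### Assembly -/

/-- The total remainder must be distributed among the N packets; each receives an equal share, which
requires N > 0. -/
theorem IsMultiParticleWavepacket.of_components {P : Type} {ε q : ℝ} (hN : 0 < N) (hq : 0 ≤ q)
    {pos : Fin N → ℝ → P → Wave d} {U : ℝ → P → Wave d → Amp J} {β₂ CF CG CE : ℝ} (hβ₂ : 0 < β₂)
    (hβ1 : β₂ ≤ 1) (hCE : 0 ≤ CE)
    (H : ∀ β ∈ Ioo 0 β₂, ∀ p, ∃ f : ℤˣ × Fin N → Wave d → Amp J, (∀ θ, Integrable (f θ) ∧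
      ∫ k, ‖f θ k‖ ≤ CF ∧
      (∀ᵐ k, f θ k = cutoff Ψ (β ^ (1 - ε) / 2) (ctr S θ) k • A.proj (S θ.2).1 θ.1 k (f θ k)) ∧
      ∃ G : Wave d → Wave d →L[ℝ] Amp J, HasWeakGradient (fun k => Complex.exp (Complex.I *
          (inner ℝ (pos θ.2 β p) k : ℝ)) • f θ k) G ∧ ∫ k, ‖G k‖ ≤ CG * β ^ (-1 - ε)) ∧
      Integrable (U β p) ∧ ∫ k, ‖U β p k - ∑ θ, f θ k‖ ≤ CE * β ^ q) :
    IsMultiParticleWavepacket A Ψ ε q S pos U := by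
  choose! f hf hU hE using H
  have hN0 : (N : ℝ) ≠ 0 := by exact_mod_cast hN.ne'
  have hN1 : (N : ℝ)⁻¹ ≤ 1 := inv_le_one_of_one_le₀ (by exact_mod_cast hN)
  let D : ℝ → P → Wave d → Amp J := fun β p k => (N : ℝ)⁻¹ • (U β p k - ∑ θ, f β p θ k)
  have hDi : ∀ β ∈ Ioo 0 β₂, ∀ p, Integrable (D β p) := fun β hβ p =>
    ((hU β hβ p).sub (integrable_finsetSum _ fun θ _ => (hf β hβ p θ).1)).smul (N : ℝ)⁻¹
  have hDn : ∀ β ∈ Ioo 0 β₂, ∀ p, ∫ k, ‖D β p k‖ ≤ CE * β ^ q := fun β hβ p => by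
    have h1 : ∫ k, ‖D β p k‖ = (N : ℝ)⁻¹ * ∫ k, ‖U β p k - ∑ θ, f β p θ k‖ := by
      rw [← integral_const_mul]
      refine integral_congr_ae (ae_of_all _ fun k => ?_)
      simp only [D]
      rw [norm_smul, Real.norm_of_nonneg (by positivity)]
    rw [h1]
    exact (mul_le_of_le_one_left (integral_nonneg fun _ => norm_nonneg _) hN1).trans (hE β hβ p)
  refine ⟨fun l β p k => f β p (-1, l) k + f β p (1, l) k + D β p k, fun l => ?_, β₂, hβ₂,
    fun β hβ p => ae_of_all _ fun k => ?_⟩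
  · refine ⟨β₂, hβ₂, CF + CF + CE, CE, CG, fun ζ β p => f β p (ζ, l), D, fun β hβ p => ?_⟩
    have hm := (hf β hβ p (-1, l)).1
    have hp := (hf β hβ p (1, l)).1
    have hD := hDi β hβ p
    refine ⟨(hm.add hp).add hD, ?_, ae_of_all _ fun k => rfl,
      fun ζ => ⟨(hf β hβ p (ζ, l)).1, (hf β hβ p (ζ, l)).2.2.1⟩, hD, hDn β hβ p,
      fun ζ => (hf β hβ p (ζ, l)).2.2.2⟩
    have hmp : Integrable fun k => ‖f β p (-1, l) k‖ + ‖f β p (1, l) k‖ := hm.norm.add hp.norm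
    have h1 : ∫ k, ‖f β p (-1, l) k + f β p (1, l) k + D β p k‖ ≤
        ∫ k, (‖f β p (-1, l) k‖ + ‖f β p (1, l) k‖ + ‖D β p k‖) :=
      integral_mono ((hm.add hp).add hD).norm (hmp.add hD.norm) fun k => norm_add₃_le
    refine h1.trans ?_
    rw [integral_add hmp hD.norm, integral_add hm.norm hp.norm]
    have h2 : CE * β ^ q ≤ CE := mul_le_of_le_one_right hCE
      (Real.rpow_le_one hβ.1.le (hβ.2.le.trans hβ1) hq)
    linarith [(hf β hβ p (-1, l)).2.1, (hf β hβ p (1, l)).2.1, hDn β hβ p]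
  · have h1 : ∑ θ, f β p θ k = ∑ l, (f β p (-1, l) k + f β p (1, l) k) := by
      rw [Fintype.sum_prod_type_right]
      refine Finset.sum_congr rfl fun l _ => ?_
      rw [UnitsInt.univ, Finset.sum_pair (by decide), add_comm]
    rw [Finset.sum_add_distrib, ← h1, Finset.sum_const, Finset.card_univ, Fintype.card_fin]
    simp only [D]
    rw [← Nat.cast_smul_eq_nsmul ℝ, smul_smul, mul_inv_cancel₀ hN0, one_smul]
    abel

end Wavepacket

namespace Wavepacket

open Filter Topology Nonlinearity

variable {d J m N : ℕ} {A : LinearPart d J} {B : Nonlinearity d J} {S : Fin N → Fin J × Wave d}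
  {δ C b : ℝ} {Ψ : Wave d → ℝ}

theorem exists_common_pos {ι : Type*} [Finite ι] (b : ι → ℝ) (hb : ∀ i, 0 < b i) :
    ∃ β > (0 : ℝ), ∀ i, β ≤ b i := by
  cases isEmpty_or_nonempty ι
  · exact ⟨1, one_pos, fun i => isEmptyElim i⟩
  · obtain ⟨i, hi⟩ := Finite.exists_min b
    exact ⟨b i, hb i, hi⟩

/-- The components of a multi-particle wavepacket, with common constants. -/
theorem IsMultiParticleWavepacket.exists_components {P : Type} {ε s : ℝ}
    {pos : Fin N → ℝ → P → Wave d} {h : ℝ → P → Wave d → Amp J}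
    (hh : IsMultiParticleWavepacket A Ψ ε s S pos h) :
    ∃ β₀ > (0 : ℝ), ∃ D V : ℝ, 0 ≤ D ∧ 0 ≤ V ∧ ∀ β ∈ Ioo 0 β₀, ∀ p, Integrable (h β p) ∧
      ∃ hc : ℤˣ × Fin N → Wave d → Amp J, (∀ θ, Integrable (hc θ) ∧
        (∀ᵐ k, hc θ k =
          cutoff Ψ (β ^ (1 - ε) / 2) (ctr S θ) k • A.proj (S θ.2).1 θ.1 k (hc θ k)) ∧
        ∃ G : Wave d → Wave d →L[ℝ] Amp J, HasWeakGradient (fun k => Complex.exp (Complex.I *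
          (inner ℝ (pos θ.2 β p) k : ℝ)) • hc θ k) G ∧ ∫ k, ‖G k‖ ≤ V * β ^ (-1 - ε)) ∧
        ∫ k, ‖h β p k - ∑ θ, hc θ k‖ ≤ D * β ^ s := by
  obtain ⟨hl, hpart, β₁, hβ₁, hsum⟩ := hh
  choose b hb C C' C₁ hc D hspec using hpart
  obtain ⟨β₂, hβ₂, hb₂⟩ := exists_common_pos b hb
  refine ⟨min β₁ β₂, lt_min hβ₁ hβ₂, ∑ l, |C' l|, ∑ l, |C₁ l|,
    Finset.sum_nonneg fun _ _ => abs_nonneg _, Finset.sum_nonneg fun _ _ => abs_nonneg _,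
    fun β hβ p => ?_⟩
  have hβl : ∀ l, β ∈ Ioo 0 (b l) := fun l =>
    ⟨hβ.1, hβ.2.trans_le ((min_le_right _ _).trans (hb₂ l))⟩
  have hpow : ∀ q : ℝ, 0 ≤ β ^ q := fun q => (Real.rpow_pos_of_pos hβ.1 q).le
  choose hi hn hdec hpol hDi hDn hloc using fun l => hspec l β (hβl l) p
  have hs := hsum β ⟨hβ.1, hβ.2.trans_le (min_le_left _ _)⟩ p
  refine ⟨(integrable_finsetSum _ fun l _ => hi l).congr (hs.mono fun k hk => hk.symm),
    fun θ => hc θ.2 θ.1 β p, fun θ => ⟨(hpol θ.2 θ.1).1, (hpol θ.2 θ.1).2, ?_⟩, ?_⟩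
  · obtain ⟨G, hG, hG'⟩ := hloc θ.2 θ.1
    refine ⟨G, hG, hG'.trans (mul_le_mul_of_nonneg_right ((le_abs_self _).trans ?_) (hpow _))⟩
    exact Finset.single_le_sum (f := fun l => |C₁ l|) (fun _ _ => abs_nonneg _)
      (Finset.mem_univ θ.2)
  · have h1 : ∫ k, ‖h β p k - ∑ θ : ℤˣ × Fin N, hc θ.2 θ.1 β p k‖ ≤
        ∫ k, ∑ l, ‖D l β p k‖ := by
      refine integral_mono_of_nonneg (ae_of_all _ fun _ => norm_nonneg _)
        (integrable_finsetSum _ fun l _ => (hDi l).norm) ?_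
      filter_upwards [hs, ae_all_iff.2 hdec] with k hk hd
      have h2 : ∑ θ : ℤˣ × Fin N, hc θ.2 θ.1 β p k =
          ∑ l, (hc l (-1) β p k + hc l 1 β p k) := by
        rw [Fintype.sum_prod_type_right]
        refine Finset.sum_congr rfl fun l _ => ?_
        rw [UnitsInt.univ, Finset.sum_pair (by decide), add_comm]
      rw [hk, h2, ← Finset.sum_sub_distrib]
      refine (norm_sum_le _ _).trans (Finset.sum_le_sum fun l _ => le_of_eq ?_)
      rw [hd l, add_sub_cancel_left]
    refine h1.trans ?_
    rw [integral_finsetSum _ fun l _ => (hDi l).norm, Finset.sum_mul]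
    exact Finset.sum_le_sum fun l _ =>
      (hDn l).trans (mul_le_mul_of_nonneg_right (le_abs_self _) (hpow _))

/-- The solution is, uniformly in `β`, a sum of wavepackets at the moving positions. -/
theorem exists_packets_uniform (hA : A.Admissible) (hB : B.Admissible A)
    (hS : IsNKSpectrum A B.M S) (hU : UniversallyResonanceInvariant A B.M S) (hC0 : 0 ≤ C)
    (hC : ∀ m ∈ B.M, ∀ (k : Wave d) (q : Fin m → Wave d), k ∉ A.bandCrossing →
      (∀ j, q j ∉ A.bandCrossing) → ‖B.χ m k q‖ ≤ C)
    (hχ : ∀ m ∈ B.M, IsSymbol (B.chiSym m) C) (hΨ : IsCutoff Ψ)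
    {R T ε ε' s s₀ C₀ CC β₁ : ℝ} (hR : 0 < R) (hT : 0 ≤ T)
    (hT₁ : T * avgLip B.M N C (8 * R) ≤ 1 / 2) (hT₂ : T * lipConst B.M C (2 * R) ≤ 1 / 2)
    (hε : 0 < ε) (hε' : ε < ε') (hε1 : ε' < 1) (hs : 0 < s) (hs₀ : 0 < s₀) {ϱ : ℝ → ℝ}
    (hϱ : ∀ β : ℝ, 0 < β → β ≤ 1 / 2 →
      0 < ϱ β ∧ ϱ β ≤ 1 / 2 ∧ ϱ β ≤ C₀ * β ^ s₀ ∧ β ^ 2 / ϱ β ≤ CC)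
    {h : ℝ → (Fin N → Wave d) → Wave d → Amp J}
    (hh : IsMultiParticleWavepacket A Ψ ε s S (fun l _ r => r l) h) (hβ₁ : 0 < β₁)
    (hhR : ∀ β ∈ Ioo 0 β₁, ∀ r, ∫ k, ‖h β r k‖ ≤ R) :
    ∃ β₂ > (0 : ℝ), β₂ ≤ 1 ∧ ∃ CF CG CE : ℝ, 0 ≤ CE ∧ ∀ β ∈ Ioo 0 β₂, ∀ r,
      ∀ u : ℝ → AmpL1 d J, IsSolution A B (ϱ β) T (h β r) u → ∀ τ ∈ Icc 0 T,
      ∃ f : ℤˣ × Fin N → Wave d → Amp J, (∀ θ, Integrable (f θ) ∧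
        ∫ k, ‖f θ k‖ ≤ CF ∧
        (∀ᵐ k, f θ k =
          cutoff Ψ (β ^ (1 - ε') / 2) (ctr S θ) k • A.proj (S θ.2).1 θ.1 k (f θ k)) ∧
        ∃ G : Wave d → Wave d →L[ℝ] Amp J, HasWeakGradient (fun k => Complex.exp (Complex.I *
          (inner ℝ (r θ.2 + (τ / ϱ β) • gradient (A.freq (S θ.2).1 1) (S θ.2).2) k : ℝ)) • f θ k)
            G ∧ ∫ k, ‖G k‖ ≤ CG * β ^ (-1 - ε')) ∧
        Integrable (fun k => A.propagator (τ / ϱ β) k (u τ k)) ∧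
        ∫ k, ‖A.propagator (τ / ϱ β) k (u τ k) - ∑ θ, f θ k‖ ≤ CE * β ^ min s s₀ := by
  obtain ⟨δ, hδ⟩ := exists_isLocalRadius hA hS
  have hδ0 := hδ.pos
  obtain ⟨K, hK0, hK⟩ := exists_shift_avgSym hA hB hδ hC0 hC
  obtain ⟨Ku, hKu0, hKu⟩ := exists_lipschitz_unitBump d
  obtain ⟨Kp, hKp0, hKp⟩ := exists_uniform
    (p := fun (θ : ℤˣ × Fin N) K => ∀ x y,
      ‖bandProj A S δ θ x - bandProj A S δ θ y‖ ≤ K * ‖x - y‖)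
    (fun θ K K' hKK h x y => (h x y).trans (mul_le_mul_of_nonneg_right hKK (norm_nonneg _)))
    (exists_lipschitz_bandProj hA hδ)
  obtain ⟨β₀, hβ₀, D, V₀, hD, hV₀, hcomp⟩ := hh.exists_components
  set KK := ∑ m ∈ B.M, (2 * N : ℝ) ^ m * (K * (8 * R) ^ m) with hKK
  have hKK0 : 0 ≤ KK := Finset.sum_nonneg fun m _ => by positivity
  have hCC : 0 ≤ CC := by
    have h1 := hϱ (1 / 2) (by norm_num) le_rfl
    have h2 := h1.1
    exact le_trans (by positivity) h1.2.2.2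
  obtain ⟨CE, hCE0, hCE⟩ := exists_error_le (C := C) (s := s) (s₀ := s₀) (C₀ := C₀) B.M J N hδ0
    hC0 hT (by positivity : 0 ≤ 8 * R) hD hε' hε1
    (2 * (lipConst B.M C ((16 * N + 2) * R) + 1) * T)
  obtain ⟨CG, hCG⟩ := exists_gradient_le d hδ0 hT (by positivity : 0 ≤ 8 * R) hV₀ hCC hKK0 hKu0
    hKp0 hε hε'
  obtain ⟨γ₁, hγ₁, hb₁⟩ := exists_rpow_le (by linarith : 0 < 1 - ε) hδ0
  obtain ⟨γ₂, hγ₂, hb₂⟩ := exists_rpow_le (by linarith : 0 < 1 - ε') hδ0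
  obtain ⟨γ₃, hγ₃, hb₃⟩ := exists_rpow_le hs (by positivity : 0 < R / (D + 1))
  obtain ⟨β₂, hβ₂, hmin⟩ := exists_common_pos ![β₀, β₁, γ₁, γ₂, γ₃, 1 / 2]
    (by intro i; fin_cases i <;> simp [hβ₀, hβ₁, hγ₁, hγ₂, hγ₃])
  have m0 : β₂ ≤ β₀ := hmin 0
  have m1 : β₂ ≤ β₁ := hmin 1
  have m2 : β₂ ≤ γ₁ := hmin 2
  have m3 : β₂ ≤ γ₂ := hmin 3
  have m4 : β₂ ≤ γ₃ := hmin 4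
  have m5 : β₂ ≤ 1 / 2 := hmin 5
  refine ⟨β₂, hβ₂, by linarith, 2 * R + CE, CG, CE, hCE0, fun β hβ r u hu τ hτ => ?_⟩
  have hβ0 := hβ.1
  have hβ1 : β ≤ 1 := by linarith [hβ.2]
  obtain ⟨hϱ0, -, hϱ1, hϱ2⟩ := hϱ β hβ0 (by linarith [hβ.2])
  obtain ⟨hhi, hc, hcs, hE⟩ := hcomp β ⟨hβ0, hβ.2.trans_le m0⟩ r
  choose hci hcp G hG hGV using hcs
  have hb0 : 0 < β ^ (1 - ε) := Real.rpow_pos_of_pos hβ0 _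
  have ha0 : 0 < β ^ (1 - ε') := Real.rpow_pos_of_pos hβ0 _
  have hbδ := hb₁ β ⟨hβ0, hβ.2.trans_le m2⟩
  have haδ := hb₂ β ⟨hβ0, hβ.2.trans_le m3⟩
  have hER : D * β ^ s ≤ R := by
    have h1 := hb₃ β ⟨hβ0, hβ.2.trans_le m4⟩
    calc D * β ^ s ≤ (D + 1) * (R / (D + 1)) := by
          refine mul_le_mul (by linarith) h1 (Real.rpow_pos_of_pos hβ0 _).le (by linarith)
      _ = R := by field_simp
  set V := 2 * (V₀ * β ^ (-1 - ε) + T * ((1 + T / ϱ β * β ^ (1 - ε)) * KK)) with hV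
  have hpow0 : 0 < β ^ (-1 - ε) := Real.rpow_pos_of_pos hβ0 _
  have hV0 : 0 ≤ V := by positivity
  have hQ0 : 0 < β ^ min s s₀ := Real.rpow_pos_of_pos hβ0 _
  -- The mollification length η is at most b, where translations are controlled, and so small that
  -- Vη ≤ β^min(s,s₀) although V grows as β → 0. The scale a = β^(1-ε')/8 makes the cutoff 8a/2 the
  -- required one.
  obtain ⟨f, hf, hUi, hUn, hUf⟩ := exists_packets hA hB hS hU hδ hC0 hC hχ hK0 hK hKu0 hKp0 hKu
    hKp hΨ hb0 hbδ (by positivity : 0 < β ^ (1 - ε') / 8) (by linarith) hR.le hϱ0 hT hT₁ hT₂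
    (by positivity) hV hhi (hhR β ⟨hβ0, hβ.2.trans_le m1⟩ r) r hci hcp hG hGV hER hE hu hτ
    (η := min (β ^ (1 - ε)) (β ^ min s s₀ / (V + 1))) (lt_min hb0 (by positivity))
    (min_le_left _ _)
  have h8 : 8 * (β ^ (1 - ε') / 8) / 2 = β ^ (1 - ε') / 2 := by ring
  rw [h8] at hf
  have herr := hUf.trans (hCE β (ϱ β) _ V hβ0 hβ1 hϱ1 hV0 (min_le_right _ _))
  have hsi : Integrable fun k => ∑ θ, f θ k := integrable_finsetSum _ fun θ _ => (hf θ).1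
  have hsn : ∫ k, ‖∑ θ, f θ k‖ ≤ 2 * R + CE := by
    have hdi : Integrable fun k => ‖A.propagator (τ / ϱ β) k (u τ k) - ∑ θ, f θ k‖ :=
      (hUi.sub hsi).norm
    have : ∫ k, ‖∑ θ, f θ k‖ ≤ ∫ k, (‖A.propagator (τ / ϱ β) k (u τ k)‖ +
        ‖A.propagator (τ / ϱ β) k (u τ k) - ∑ θ, f θ k‖) :=
      integral_mono hsi.norm (hUi.norm.add hdi) fun k => norm_le_insert _ _
    rw [integral_add hUi.norm hdi] at this
    have h1 : CE * β ^ min s s₀ ≤ CE := mul_le_of_le_one_right hCE0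
      (Real.rpow_le_one hβ0.le hβ1 (lt_min hs hs₀).le)
    linarith
  refine ⟨f, fun θ => ⟨(hf θ).1, ?_, (hf θ).2.1, ?_⟩, hUi, herr⟩
  · refine le_trans (integral_mono_ae (hf θ).1.norm hsi.norm ?_) hsn
    filter_upwards [hA.ae_notMem, ae_all_iff.2 fun θ => (hf θ).2.1] with k hk h1
    exact norm_component_le hA hS hδ haδ hk
      (fun θ h0 => polarized_of_cutoff hA hΨ ha0 hk (h1 θ) h0) θ
  · obtain ⟨G, hG, hGn⟩ := (hf θ).2.2
    exact ⟨G, hG, hGn.trans (hCG β (ϱ β) hβ0 hβ1 hϱ0 hϱ2)⟩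

/-- Zero data give the zero solution. -/
theorem IsSolution.eq_zero (hA : A.Admissible) (hB : B.Admissible A) (hC0 : 0 ≤ C)
    (hχ : ∀ m ∈ B.M, IsSymbol (B.chiSym m) C) {ϱ T : ℝ} {h : Wave d → Amp J}
    {u : ℝ → AmpL1 d J} (hu : IsSolution A B ϱ T h u) (hh : h =ᵐ[volume] 0) {τ : ℝ}
    (hτ : τ ∈ Icc 0 T) : u τ = 0 := by
  have hT : 0 ≤ T := hτ.1.trans hτ.2
  have h0 : IsSolution A B ϱ T h (fun _ => (0 : AmpL1 d J)) :=
    (isSolution_iff hA hB hT).2 ⟨continuousOn_const, (Lp.coeFn_zero _ _ _).trans hh.symm,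
      fun τ _ => by simp [forceOp_zero hB]⟩
  exact hu.eqOn hA hB hC0 hχ hT h0 hτ

end Wavepacket

end

/-! ### The theorem -/

theorem mainTheorem3 (d J : ℕ) (hd : 1 ≤ d)
    (A : Wavepacket.LinearPart d J) (hA : A.Admissible)
    (B : Wavepacket.Nonlinearity d J) (hB : B.Admissible A)
    (N : ℕ) (R : ℝ) (hR : 0 < R) :
    ∃ T > (0 : ℝ),
      ∀ (S : Fin N → Fin J × Wavepacket.Wave d), Wavepacket.IsNKSpectrum A B.M S →
      Wavepacket.UniversallyResonanceInvariant A B.M S →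
      ∀ (Ψ : Wavepacket.Wave d → ℝ), Wavepacket.IsCutoff Ψ →
      ∀ (ε s s₀ C₀ C : ℝ), 0 < ε → ε < 1 → 0 < s → 0 < s₀ →
      ∀ (ρ : ℝ → ℝ),
      (∀ β : ℝ, 0 < β → β ≤ 1 / 2 →
        0 < ρ β ∧ ρ β ≤ 1 / 2 ∧ ρ β ≤ C₀ * β ^ s₀ ∧ β ^ 2 / ρ β ≤ C) →
      ∀ (h : ℝ → (Fin N → Wavepacket.Wave d) → Wavepacket.Wave d → Wavepacket.Amp J),
      Wavepacket.IsMultiParticleWavepacket A Ψ ε s S (fun l _ r => r l) h →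
      (∃ β₁ > (0 : ℝ), ∀ β ∈ Set.Ioo 0 β₁, ∀ r, ∫ k, ‖h β r k‖ ≤ R) →
      -- the solution exists and is unique on `[0, T]`
      (∃ β₂ > (0 : ℝ), ∀ β ∈ Set.Ioo 0 β₂, ∀ r,
        ∃ u, Wavepacket.IsSolution A B (ρ β) T (h β r) u ∧
          ∀ u', Wavepacket.IsSolution A B (ρ β) T (h β r) u' → Set.EqOn u' u (Set.Icc 0 T)) ∧
      -- the solution is a multi-particle wavepacket with moving positions
      ∀ (u : ℝ → (Fin N → Wavepacket.Wave d) → ℝ →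
          (Wavepacket.Wave d →₁[MeasureTheory.volume] Wavepacket.Amp J)),
        (∃ β₂ > (0 : ℝ), ∀ β ∈ Set.Ioo 0 β₂, ∀ r,
          Wavepacket.IsSolution A B (ρ β) T (h β r) (u β r)) →
        ∀ τ ∈ Set.Icc 0 T, ∀ ε' : ℝ, ε < ε' → ε' < 1 →
          Wavepacket.IsMultiParticleWavepacket A Ψ ε' (min s s₀) S
            (fun l β r => r l + (τ / ρ β) • gradient (A.freq (S l).1 1) (S l).2)
            (fun β r k => A.propagator (τ / ρ β) k (u β r τ k)) := by
  obtain ⟨K, hK0, hK, hχ⟩ := hB.exists_isSymbol hA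
  have h1 := Wavepacket.avgLip_nonneg B.M N hK0 (by positivity : 0 ≤ 8 * R)
  have h2 := Wavepacket.lipConst_nonneg B.M hK0 (by positivity : 0 ≤ 2 * R)
  set a := Wavepacket.avgLip B.M N K (8 * R)
  set l := Wavepacket.lipConst B.M K (2 * R)
  -- One lifetime for both contractions: the exact equation on the ball of radius 2R and the
  -- averaged system on that of radius 8R. No constant depending on S enters.
  set T := 1 / (2 * (a + l + 1)) with hTdef
  have hT : 0 < T := by positivity
  have hTs : T * (a + l + 1) = 1 / 2 := by rw [hTdef]; field_simp
  have hT₁ : T * a ≤ 1 / 2 := by nlinarith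
  have hT₂ : T * l ≤ 1 / 2 := by nlinarith
  refine ⟨T, hT, fun S hS hU Ψ hΨ ε s s₀ C₀ C hε hε1 hs hs₀ ρ hρ h hh hhR => ⟨?_, ?_⟩⟩
  · obtain ⟨β₁, hβ₁, hhR⟩ := hhR
    obtain ⟨β₀, hβ₀, D, V, -, -, hcomp⟩ := hh.exists_components
    refine ⟨min β₀ β₁, lt_min hβ₀ hβ₁, fun β hβ r => ?_⟩
    obtain ⟨u, hu, -⟩ := Wavepacket.exists_isSolution hA hB (ϱ := ρ β) hK0 hχ hT.le hT₂
      (hcomp β ⟨hβ.1, hβ.2.trans_le (min_le_left _ _)⟩ r).1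
      (hhR β ⟨hβ.1, hβ.2.trans_le (min_le_right _ _)⟩ r)
    exact ⟨u, hu, fun u' hu' => hu'.eqOn hA hB hK0 hχ hT.le hu⟩
  · rintro u ⟨β₂, hβ₂, hu⟩ τ hτ ε' hε' hε1'
    -- For N = 0 there is no packet to carry a remainder, but the datum is then an empty sum, so the
    -- solution vanishes.
    rcases Nat.eq_zero_or_pos N with rfl | hN
    · obtain ⟨hl, -, β₃, hβ₃, hsum⟩ := hh
      refine ⟨fun l => l.elim0, fun l => l.elim0, min β₂ β₃, lt_min hβ₂ hβ₃, fun β hβ r => ?_⟩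
      have h0 : h β r =ᵐ[MeasureTheory.volume] 0 := by
        filter_upwards [hsum β ⟨hβ.1, hβ.2.trans_le (min_le_right _ _)⟩ r] with k hk
        rw [hk, Finset.univ_eq_empty, Finset.sum_empty, Pi.zero_apply]
      have hu0 := (hu β ⟨hβ.1, hβ.2.trans_le (min_le_left _ _)⟩ r).eq_zero hA hB hK0 hχ h0 hτ
      filter_upwards [MeasureTheory.Lp.coeFn_zero (Wavepacket.Amp J) 1
        (MeasureTheory.volume : MeasureTheory.Measure (Wavepacket.Wave d))] with k hk
      simp only [hu0, hk, Pi.zero_apply, map_zero, Finset.univ_eq_empty, Finset.sum_empty]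
    · obtain ⟨β₁, hβ₁, hhR⟩ := hhR
      obtain ⟨β₃, hβ₃, hβ31, CF, CG, CE, hCE, H⟩ := Wavepacket.exists_packets_uniform hA hB hS hU hK0 hK hχ
        hΨ hR hT.le hT₁ hT₂ hε hε' hε1' hs hs₀ hρ hh hβ₁ hhR
      refine Wavepacket.IsMultiParticleWavepacket.of_components (CF := CF) (CG := CG) hN
        (lt_min hs hs₀).le (lt_min hβ₂ hβ₃)
        ((min_le_right _ _).trans hβ31) hCE fun β hβ r => ?_
      exact H β ⟨hβ.1, hβ.2.trans_le (min_le_right _ _)⟩ r (u β r)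
        (hu β ⟨hβ.1, hβ.2.trans_le (min_le_left _ _)⟩ r) τ hτ
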